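/- **Conventions.** Let $\Bbbk$ be a field and let $\mathcal T$ be a small dg-enhanced $\Bbbk$-linear triangulated category, i.e. a small pretriangulated dg category over $\Bbbk$ (its homotopy category $H^0(\mathcal T)$ has a zero object and is closed under shifts and cones). Let $\mathbf D(\mathcal T)$ be the derived category of right dg modules over $\mathcal T$, and let $\mathbf D^{\mathrm{fd}}(\mathcal T)\subset \mathbf D(\mathcal T)$ be the full subcategory of homologically finite-dimensional modules, i.e. of those $M$ such that $\bigoplus_i H^i(M(t))$ is finite-dimensional for every $t\in\mathcal T$. It is again an (essentially small) dg-enhanced triangulated category, with dg enhancement given by the K-projective homologically finite-dimensional dg modules. A (dg-enhanced) functor $\varphi\colon \mathcal T_1\to\mathcal T_2$ induces $\varphi^!\colon \mathbf D^{\mathrm{fd}}(\mathcal T_2)\to \mathbf D^{\mathrm{fd}}(\mathcal T_1)$, $\varphi^!(M)=M\circ\varphi$. The category $\mathcal T$ is *reflexive* if the coevaluation functor $$\mathrm{coev}_{\mathcal T}\colon \mathcal T\to \mathbf D^{\mathrm{fd}}(\mathbf D^{\mathrm{fd}}(\mathcal T)),\qquad t\mapsto \bigl(M\mapsto M(t)^\vee\bigr),$$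 is an equivalence. Let $\mathrm{LAdm}(\mathcal T)$ (resp. $\mathrm{RAdm}(\mathcal T)$) be the set of strictly full triangulated subcategories $\mathcal A$ of $\mathcal T$ whose embedding functor $\iota$ has a left adjoint $\pi_L$ (resp. a right adjoint $\pi_R$); such an $\mathcal A$ carries the induced dg enhancement, and its adjoint the induced dg enhancement. We think of an element as a triple (subcategory, embedding functor, adjoint functor). **Theorem.** Let $\mathcal T$ be a reflexive small dg-enhanced triangulated category. 1. If $(\mathcal A,\iota,\pi_L)$ is a left admissible subcategory of $\mathcal T$, then $\pi_L^!\colon \mathbf D^{\mathrm{fd}}(\mathcal A)\to\mathbf D^{\mathrm{fd}}(\mathcal T)$ is fully faithful with right adjoint $\iota^!$, its essential image is right admissible, and $$\mathrm{LAdm}(\mathcal T)\to \mathrm{RAdm}(\mathbf D^{\mathrm{fd}}(\mathcal T)),\qquad (\mathcal A,\iota,\pi_L)\mapsto(\mathbf D^{\mathrm{fd}}(\mathcal A),\pi_L^!,\iota^!)$$ is a bijection. 2. If $(\mathcal A,\iota,\pi_R)$ is a right admissible subcategory of $\mathcal T$, then $\pi_R^!\colon \mathbf D^{\mathrm{fd}}(\mathcal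 A)\to\mathbf D^{\mathrm{fd}}(\mathcal T)$ is fully faithful with left adjoint $\iota^!$, its essential image is left admissible, and $$\mathrm{RAdm}(\mathcal T)\to \mathrm{LAdm}(\mathbf D^{\mathrm{fd}}(\mathcal T)),\qquad (\mathcal A,\iota,\pi_R)\mapsto(\mathbf D^{\mathrm{fd}}(\mathcal A),\pi_R^!,\iota^!)$$ is a bijection. 3. Every left or right admissible subcategory $\mathcal A\subset\mathcal T$ is itself reflexive. -/

import Mathlib

open CategoryTheory

universe x w v u v' u'

set_option linter.checkUnivs false

/-- A differential graded category over a field `k`, with cohomological grading. The composition is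
written in diagrammatic order: `comp h f g` is `g ∘ f`. -/
structure DGCat (k : Type w) [Field k] where
  /-- the objects -/
  Obj : Type u
  /-- the complexes of morphisms -/
  Hom : Obj → Obj → CochainComplex (ModuleCat.{v} k) ℤ
  /-- the composition of `f : X ⟶ Y` of degree `m` and `g : Y ⟶ Z` of degree `n` -/
  comp {X Y Z : Obj} {m n p : ℤ} (h : m + n = p) :
    (Hom X Y).X m →ₗ[k] (Hom Y Z).X n →ₗ[k] (Hom X Z).X p
  /-- the identities -/
  ident (X : Obj) : (Hom X X).X 0
  ident_comp {X Y : Obj} {n : ℤ} (h : 0 + n = n) (f : (Hom X Y).X n) : comp h (ident X) f = f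
  comp_ident {X Y : Obj} {n : ℤ} (h : n + 0 = n) (f : (Hom X Y).X n) : comp h f (ident Y) = f
  assoc {X Y Z W : Obj} {m n l a b p : ℤ} (h₁ : m + n = a) (h₂ : n + l = b) (h₃ : a + l = p)
    (h₄ : m + b = p) (f : (Hom X Y).X m) (g : (Hom Y Z).X n) (e : (Hom Z W).X l) :
    comp h₃ (comp h₁ f g) e = comp h₄ f (comp h₂ g e)
  /-- the Leibniz rule `d (g ∘ f) = dg ∘ f + (-1)^|g| g ∘ df` -/
  d_comp {X Y Z : Obj} {m n p m' n' p' : ℤ} (h : m + n = p) (hm : m + 1 = m') (hn : n + 1 = n')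
    (hp : p + 1 = p') (f : (Hom X Y).X m) (g : (Hom Y Z).X n) :
    ((Hom X Z).d p p').hom (comp h f g) =
      comp (show m + n' = p' by omega) f (((Hom Y Z).d n n').hom g) +
        n.negOnePow • comp (show m' + n = p' by omega) (((Hom X Y).d m m').hom f) g

/-- A dg functor. -/
structure DGFunctor {k : Type w} [Field k] (S : DGCat.{w, v, u} k) (T : DGCat.{w, v', u'} k) where
  /-- the action on objects -/
  obj : S.Obj → T.Obj
  /-- the action on morphisms of degree `n` -/
  map {X Y : S.Obj} (n : ℤ) : (S.Hom X Y).X n →ₗ[k] (T.Hom (obj X) (obj Y)).X n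
  map_ident (X : S.Obj) : map 0 (S.ident X) = T.ident (obj X)
  map_comp {X Y Z : S.Obj} {m n p : ℤ} (h : m + n = p) (f : (S.Hom X Y).X m)
    (g : (S.Hom Y Z).X n) : map p (S.comp h f g) = T.comp h (map m f) (map n g)
  map_d {X Y : S.Obj} (n n' : ℤ) (h : n + 1 = n') (f : (S.Hom X Y).X n) :
    map n' (((S.Hom X Y).d n n').hom f) = ((T.Hom (obj X) (obj Y)).d n n').hom (map n f)

noncomputable section

variable {k : Type w} [Field k]

namespace DGCat

variable (T : DGCat.{w, v, u} k)

lemma d_ident (X : T.Obj) : ((T.Hom X X).d 0 1).hom (T.ident X) = 0 := by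
  have h := T.d_comp (add_zero 0) (zero_add 1) (zero_add 1) (zero_add 1) (T.ident X) (T.ident X)
  rw [T.ident_comp, T.ident_comp, T.comp_ident] at h
  simpa using h

/-- The full dg subcategory on the objects satisfying `P`. -/
@[simps]
def full (P : T.Obj → Prop) : DGCat.{w, v, u} k where
  Obj := {X : T.Obj // P X}
  Hom X Y := T.Hom X.1 Y.1
  comp h := T.comp h
  ident X := T.ident X.1
  ident_comp h f := T.ident_comp h f
  comp_ident h f := T.comp_ident h f
  assoc h₁ h₂ h₃ h₄ f g e := T.assoc h₁ h₂ h₃ h₄ f g e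
  d_comp h h₁ h₂ h₃ f g := T.d_comp h h₁ h₂ h₃ f g

/-- The embedding of a full dg subcategory. -/
@[simps]
def incl (P : T.Obj → Prop) : DGFunctor (T.full P) T where
  obj X := X.1
  map _ := LinearMap.id
  map_ident _ := rfl
  map_comp _ _ _ := rfl
  map_d _ _ _ _ := rfl

/-- The category `Z⁰ T`: same objects as `T`, closed morphisms of degree `0`. -/
@[ext]
structure Z0 where
  /-- the underlying object -/
  obj : T.Obj

instance : Category.{v} T.Z0 where
  Hom X Y := {f : (T.Hom X.obj Y.obj).X 0 // ((T.Hom X.obj Y.obj).d 0 1).hom f = 0}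
  id X := ⟨T.ident X.obj, T.d_ident X.obj⟩
  comp {X Y Z} f g := ⟨T.comp (add_zero 0) f.1 g.1, by
    rw [T.d_comp (add_zero 0) (zero_add 1) (zero_add 1) (zero_add 1) f.1 g.1, f.2, g.2]
    simp⟩
  id_comp f := Subtype.ext (T.ident_comp _ f.1)
  comp_id f := Subtype.ext (T.comp_ident _ f.1)
  assoc f g h := Subtype.ext (T.assoc _ _ _ _ f.1 g.1 h.1)

/-- Two closed morphisms of degree `0` are homotopic if their difference is exact. -/
def homotopic : HomRel T.Z0 := fun X Y f g =>
  ∃ h : (T.Hom X.obj Y.obj).X (-1), ((T.Hom X.obj Y.obj).d (-1) 0).hom h = f.1 - g.1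

instance : Congruence T.homotopic where
  equivalence := by
    refine ⟨fun f => ⟨0, by simp⟩, ?_, ?_⟩
    · rintro f g ⟨h, e⟩
      exact ⟨-h, by simp [e]⟩
    · rintro f g i ⟨h, e⟩ ⟨h', e'⟩
      exact ⟨h + h', by simp [e, e']⟩
  comp_left {X Y Z} f g g' := by
    rintro ⟨h, e⟩
    refine ⟨T.comp (zero_add (-1)) f.1 h, ?_⟩
    rw [T.d_comp (zero_add (-1)) (zero_add 1) (neg_add_cancel 1) (neg_add_cancel 1), f.2, e]
    simp
    rfl
  comp_right {X Y Z} f f' g := by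
    rintro ⟨h, e⟩
    refine ⟨T.comp (add_zero (-1)) h g.1, ?_⟩
    rw [T.d_comp (add_zero (-1)) (neg_add_cancel 1) (zero_add 1) (neg_add_cancel 1), g.2, e]
    simp
    rfl

/-- The homotopy category `H⁰ T`. -/
abbrev H0 := CategoryTheory.Quotient T.homotopic

/-- An object of `T`, seen as an object of `H⁰ T`. -/
abbrev toH0 (X : T.Obj) : T.H0 := (CategoryTheory.Quotient.functor T.homotopic).obj ⟨X⟩

/-- The class in `H⁰ T` of a closed morphism of degree `0`. -/
abbrev homH0 {X Y : T.Obj} (f : (T.Hom X Y).X 0) (hf : ((T.Hom X Y).d 0 1).hom f = 0) :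
    T.toH0 X ⟶ T.toH0 Y :=
  (CategoryTheory.Quotient.functor T.homotopic).map (X := ⟨X⟩) (Y := ⟨Y⟩) ⟨f, hf⟩

end DGCat

/-- The functor `Z⁰ F : Z⁰ S ⥤ Z⁰ T` induced by a dg functor. -/
@[simps]
def DGFunctor.toZ0 {S : DGCat.{w, v, u} k} {T : DGCat.{w, v', u'} k} (F : DGFunctor S T) :
    S.Z0 ⥤ T.Z0 where
  obj X := ⟨F.obj X.obj⟩
  map {X Y} f := ⟨F.map 0 f.1, by rw [← F.map_d 0 1 (zero_add 1), f.2, map_zero]⟩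
  map_id X := Subtype.ext (F.map_ident X.obj)
  map_comp f g := Subtype.ext (F.map_comp _ f.1 g.1)

/-- The functor `H⁰ F : H⁰ S ⥤ H⁰ T` induced by a dg functor. -/
def DGFunctor.toH0 {S : DGCat.{w, v, u} k} {T : DGCat.{w, v', u'} k} (F : DGFunctor S T) :
    S.H0 ⥤ T.H0 :=
  CategoryTheory.Quotient.lift S.homotopic (F.toZ0 ⋙ CategoryTheory.Quotient.functor T.homotopic) (by
    rintro X Y f g ⟨h, e⟩
    refine CategoryTheory.Quotient.sound _ ⟨F.map (-1) h, ?_⟩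
    exact (F.map_d (-1) 0 (neg_add_cancel 1) h).symm.trans (by rw [e, map_sub]; rfl))

/-- A right dg module over `T`. The element `act h y f` is `y · f`, for `y ∈ M(t)` of degree `m` and
`f : s ⟶ t` of degree `n`. -/
structure DGMod (T : DGCat.{w, v, u} k) where
  /-- the value at an object -/
  obj : T.Obj → CochainComplex (ModuleCat.{x} k) ℤ
  /-- the right action of the morphisms of `T` -/
  act {s t : T.Obj} {m n p : ℤ} (h : m + n = p) :
    (obj t).X m →ₗ[k] (T.Hom s t).X n →ₗ[k] (obj s).X p
  act_ident {t : T.Obj} {m : ℤ} (h : m + 0 = m) (y : (obj t).X m) : act h y (T.ident t) = y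
  act_act {r s t : T.Obj} {m n l a b p : ℤ} (h₁ : m + n = a) (h₂ : a + l = p) (h₃ : l + n = b)
    (h₄ : m + b = p) (y : (obj t).X m) (g : (T.Hom s t).X n) (f : (T.Hom r s).X l) :
    act h₂ (act h₁ y g) f = act h₄ y (T.comp h₃ f g)
  /-- the Leibniz rule `d (y · f) = dy · f + (-1)^|y| y · df` -/
  d_act {s t : T.Obj} {m n p m' n' p' : ℤ} (h : m + n = p) (hm : m + 1 = m') (hn : n + 1 = n')
    (hp : p + 1 = p') (y : (obj t).X m) (f : (T.Hom s t).X n) :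
    ((obj s).d p p').hom (act h y f) =
      act (show m' + n = p' by omega) (((obj t).d m m').hom y) f +
        m.negOnePow • act (show m + n' = p' by omega) y (((T.Hom s t).d n n').hom f)

namespace DGMod

open CochainComplex.HomComplex

variable {T : DGCat.{w, v, u} k}

/-- The morphisms of degree `n` of dg modules: the families of cochains of degree `n` which commute
with the action of `T`. -/
def homSubmodule (M N : DGMod.{x} T) (n : ℤ) :
    Submodule k (∀ t, Cochain (M.obj t) (N.obj t) n) where
  carrier := {φ | ∀ ⦃s t : T.Obj⦄ ⦃m l p m' p' : ℤ⦄ (h : m + l = p) (hm : m + n = m')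
    (hp : p + n = p') (y : (M.obj t).X m) (f : (T.Hom s t).X l),
    ((φ s).v p p' hp).hom (M.act h y f) =
      N.act (show m' + l = p' by omega) (((φ t).v m m' hm).hom y) f}
  add_mem' {φ ψ} hφ hψ s t m l p m' p' h hm hp y f := by
    simp [hφ h hm hp y f, hψ h hm hp y f]
  zero_mem' s t m l p m' p' h hm hp y f := by simp
  smul_mem' c φ hφ s t m l p m' p' h hm hp y f := by
    simp [hφ h hm hp y f]

lemma δ_mem (M N : DGMod.{x} T) (n n' : ℤ) (φ : ∀ t, Cochain (M.obj t) (N.obj t) n)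
    (hφ : φ ∈ homSubmodule M N n) :
    (fun t => δ n n' (φ t)) ∈ homSubmodule M N n' := by
  by_cases hn : n + 1 = n'
  · intro s t m l p m' p' h hm hp y f
    have h₁ : m + n = m' - 1 := by omega
    have h₂ : p + n = p' - 1 := by omega
    have h₃ : m' - 1 + 1 = m' := by omega
    have h₄ : p' - 1 + 1 = p' := by omega
    have h₅ : ((m' - 1).negOnePow : ℤ) = -((n'.negOnePow : ℤ) * (m.negOnePow : ℤ)) := by
      rw [← h₁, ← hn, Int.negOnePow_succ, Int.negOnePow_add]
      simp [mul_comm]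
    rw [δ_v n n' hn _ p p' hp (p' - 1) (p + 1) rfl rfl,
      δ_v n n' hn _ m m' hm (m' - 1) (m + 1) rfl rfl]
    simp only [ModuleCat.hom_add, ModuleCat.hom_comp, LinearMap.add_apply, LinearMap.comp_apply,
      map_add, Units.smul_def, map_zsmul, LinearMap.smul_apply, ModuleCat.hom_zsmul]
    rw [hφ h h₁ h₂, N.d_act (by omega) h₃ rfl h₄, M.d_act h rfl rfl rfl, map_add, smul_add,
      hφ (m' := m') (by omega) (by omega) (by omega), Units.smul_def, Units.smul_def, map_zsmul,
      hφ (by omega) h₁ (by omega), smul_smul, h₅, neg_smul]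
    abel
  · have : (fun t => δ n n' (φ t)) = 0 := funext fun t => δ_shape n n' hn (φ t)
    rw [this]
    exact Submodule.zero_mem _

/-- The complex of morphisms between two dg modules. -/
def homComplex (M N : DGMod.{x} T) : CochainComplex (ModuleCat.{max u x} k) ℤ where
  X n := ModuleCat.of k (homSubmodule M N n)
  d n n' := ModuleCat.ofHom
    { toFun := fun φ => ⟨fun t => δ n n' (φ.1 t), δ_mem M N n n' φ.1 φ.2⟩
      map_add' := fun φ ψ => by ext t : 2; simp
      map_smul' := fun c φ => by ext t : 2; simp }
  shape n n' h := by
    ext φ : 2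
    exact Subtype.ext (funext fun t => δ_shape n n' h (φ.1 t))
  d_comp_d' n n' n'' _ _ := by
    ext φ : 2
    exact Subtype.ext (funext fun t => δ_δ n n' n'' (φ.1 t))

/-- The composition of morphisms of dg modules. -/
def homComp (L M N : DGMod.{x} T) {m n p : ℤ} (h : m + n = p) :
    homSubmodule L M m →ₗ[k] homSubmodule M N n →ₗ[k] homSubmodule L N p :=
  LinearMap.mk₂ k
    (fun φ ψ => ⟨fun t => (φ.1 t).comp (ψ.1 t) h, by
      intro s t a l b a' b' h' ha hb y f
      rw [Cochain.comp_v _ _ h b (b + m) b' rfl (by omega),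
        Cochain.comp_v _ _ h a (a + m) a' rfl (by omega)]
      simp only [ModuleCat.hom_comp, LinearMap.comp_apply]
      rw [φ.2 h' rfl rfl y f, ψ.2]⟩)
    (fun φ φ' ψ => by ext t : 2; simp)
    (fun c φ ψ => by ext t : 2; simp)
    (fun φ ψ ψ' => by ext t : 2; simp)
    (fun c φ ψ => by ext t : 2; simp)

/-- The identity morphism of a dg module. -/
def homIdent (M : DGMod.{x} T) : homSubmodule M M 0 :=
  ⟨fun t => Cochain.ofHom (𝟙 (M.obj t)), by
    intro s t m l p m' p' h hm hp y f
    obtain rfl : m = m' := by omega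
    obtain rfl : p = p' := by omega
    simp⟩

end DGMod

/-- The dg category of right dg modules over `T`, with values in the universe `x`. -/
@[simps]
def DGCat.dgMod (T : DGCat.{w, v, u} k) : DGCat.{w, max u x, max u v w (x + 1)} k where
  Obj := DGMod.{x} T
  Hom M N := DGMod.homComplex M N
  comp {L M N m n p} h := DGMod.homComp L M N h
  ident M := DGMod.homIdent M
  ident_comp {M N n} h φ := Subtype.ext (funext fun t =>
    CochainComplex.HomComplex.Cochain.id_comp _)
  comp_ident {M N n} h φ := Subtype.ext (funext fun t =>
    CochainComplex.HomComplex.Cochain.comp_id _)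
  assoc {L M N P m n l a b p} h₁ h₂ h₃ h₄ φ ψ θ := Subtype.ext (funext fun t =>
    CochainComplex.HomComplex.Cochain.comp_assoc _ _ _ h₁ h₂ (by omega))
  d_comp {L M N m n p m' n' p'} h h₁ h₂ h₃ φ ψ := Subtype.ext (funext fun t =>
    CochainComplex.HomComplex.δ_comp _ _ h m' n' p' h₃ h₁ h₂)

namespace DGMod

open CochainComplex.HomComplex

variable (T : DGCat.{w, v, u} k)

/-- The evaluation at `t` of dg modules and closed morphisms of degree `0`. -/
@[simps]
def evalZ0 (t : T.Obj) : (T.dgMod.{x}).Z0 ⥤ CochainComplex (ModuleCat.{x} k) ℤ where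
  obj M := M.obj.obj t
  map φ := Cocycle.homOf (Cocycle.mk (φ.1.1 t) 1 (zero_add 1)
    (congrFun (congrArg Subtype.val φ.2) t))
  map_id M := by
    ext n : 1
    exact Cochain.ofHom_v (𝟙 (M.obj.obj t)) n
  map_comp φ ψ := by
    ext n : 1
    exact Cochain.comp_zero_cochain_v (φ.1.1 t) (ψ.1.1 t) n n (add_zero n)

/-- The evaluation at `t`, from the homotopy category of dg modules to the homotopy category of
complexes. -/
def evalH0 (t : T.Obj) :
    (T.dgMod.{x}).H0 ⥤ HomotopyCategory (ModuleCat.{x} k) (ComplexShape.up ℤ) :=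
  CategoryTheory.Quotient.lift _ (evalZ0 T t ⋙ HomotopyCategory.quotient _ _) (by
    rintro M N φ ψ ⟨h, e⟩
    refine HomotopyCategory.eq_of_homotopy _ _ ((Cochain.equivHomotopy _ _).symm ⟨h.1 t, ?_⟩)
    have e' : δ (-1) 0 (h.1 t) = φ.1.1 t - ψ.1.1 t := congrFun (congrArg Subtype.val e) t
    have h₁ : Cochain.ofHom ((evalZ0 T t).map φ) = φ.1.1 t :=
      Cocycle.cochain_ofHom_homOf_eq_coe _
    have h₂ : Cochain.ofHom ((evalZ0 T t).map ψ) = ψ.1.1 t :=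
      Cocycle.cochain_ofHom_homOf_eq_coe _
    exact h₁.trans ((sub_add_cancel _ _).symm.trans (congrArg₂ (· + ·) e'.symm h₂.symm)))

/-- A dg module is homologically finite-dimensional if the total cohomology of each of its values
is finite-dimensional. -/
def IsFd {T : DGCat.{w, v, u} k} (M : DGMod.{x} T) : Prop :=
  ∀ t, (∀ n, Module.Finite k ((M.obj t).homology n)) ∧
    {n | ¬ Limits.IsZero ((M.obj t).homology n)}.Finite

/-- A dg module `P` is K-projective if all morphism complexes from `P` to acyclic dg modules are
acyclic. -/
def IsKProj {T : DGCat.{w, v, u} k} (P : DGMod.{x} T) : Prop :=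
  ∀ N : DGMod.{x} T, (∀ t, (N.obj t).Acyclic) → (homComplex P N).Acyclic

end DGMod

namespace DGCat

section

variable (T : DGCat.{w, v, u} k)

/-- The quasi-isomorphisms of the homotopy category of dg modules. -/
def qis : MorphismProperty (T.dgMod.{x}).H0 := fun _ _ φ =>
  ∀ t, HomotopyCategory.quasiIso (ModuleCat.{x} k) (ComplexShape.up ℤ) ((DGMod.evalH0 T t).map φ)

/-- The derived category `D(T)` of right dg modules over `T`. -/
abbrev Der := (qis.{x} T).Localization

/-- The localization functor. -/
abbrev toDer : (T.dgMod.{x}).H0 ⥤ Der.{x} T := (qis.{x} T).Q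

/-- The objects of `D(T)` given by homologically finite-dimensional dg modules. -/
def isFd : ObjectProperty (Der.{x} T) := fun X =>
  ∃ M : DGMod.{x} T, M.IsFd ∧ Nonempty ((toDer.{x} T).obj (T.dgMod.toH0 M) ≅ X)

/-- The full subcategory `Dᶠᵈ(T)` of `D(T)`. -/
abbrev DerFd := (isFd.{x} T).FullSubcategory

/-- The small dg category `Dᶠᵈ(T)`: the standard dg enhancement, whose objects are the homologically
finite-dimensional K-projective right dg modules. -/
abbrev dgFd : DGCat.{w, max u x, max u v w (x + 1)} k :=
  (T.dgMod.{x}).full fun M => M.IsFd ∧ M.IsKProj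

/-- The comparison functor from the homotopy category of the dg category `Dᶠᵈ(T)`. -/
def fdToDer : (dgFd.{x} T).H0 ⥤ DerFd.{x} T :=
  (isFd.{x} T).lift ((T.dgMod.incl _).toH0 ⋙ toDer.{x} T) fun M =>
    ⟨M.as.obj.1, M.as.obj.2.1, ⟨Iso.refl _⟩⟩

end

end DGCat

namespace DGFunctor

variable {S : DGCat.{w, v, u} k} {T : DGCat.{w, v', u'} k} (F : DGFunctor S T)

/-- The restriction of a dg module along a dg functor: `Res(F)(M)(s) = M(F s)`. -/
@[simps]
def resObj (M : DGMod.{x} T) : DGMod.{x} S where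
  obj s := M.obj (F.obj s)
  act {s t m n p} h := (M.act h).compl₂ (F.map n)
  act_ident h y := by simp [F.map_ident, M.act_ident]
  act_act h₁ h₂ h₃ h₄ y g f := by simp [F.map_comp, M.act_act h₁ h₂ h₃ h₄]
  d_act h hm hn hp y f := by simp [M.d_act h hm hn hp, F.map_d _ _ hn]

/-- The restriction along a dg functor, as a dg functor between dg categories of dg modules. -/
@[simps]
def res : DGFunctor (T.dgMod.{x}) (S.dgMod.{x}) where
  obj M := F.resObj M
  map {M N} n :=
    { toFun := fun (φ : DGMod.homSubmodule M N n) =>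
        (⟨fun s => φ.1 (F.obj s), fun _ _ _ _ _ _ _ h hm hp y f => φ.2 h hm hp y (F.map _ f)⟩ :
          DGMod.homSubmodule (F.resObj M) (F.resObj N) n)
      map_add' := fun _ _ => rfl
      map_smul' := fun _ _ => rfl }
  map_ident _ := rfl
  map_comp _ _ _ := rfl
  map_d _ _ _ _ := rfl

lemma res_qis {M N : (T.dgMod.{x}).H0} (φ : M ⟶ N) (hφ : DGCat.qis.{x} T φ) :
    DGCat.qis.{x} S ((res.{x} F).toH0.map φ) := by
  intro s
  obtain ⟨φ, rfl⟩ := (CategoryTheory.Quotient.functor _).map_surjective φ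
  exact hφ (F.obj s)

/-- The restriction functor `Res(F) : D(T) ⥤ D(S)`. -/
def resDer : DGCat.Der.{x} T ⥤ DGCat.Der.{x} S :=
  Localization.lift ((res.{x} F).toH0 ⋙ DGCat.toDer.{x} S)
    (fun _ _ φ hφ => Localization.inverts (DGCat.toDer.{x} S) (DGCat.qis.{x} S) _
      (F.res_qis φ hφ))
    (DGCat.toDer.{x} T)

/-- The restriction functor `F^! : Dᶠᵈ(T) ⥤ Dᶠᵈ(S)`. -/
def shriek : DGCat.DerFd.{x} T ⥤ DGCat.DerFd.{x} S :=
  (DGCat.isFd.{x} S).lift ((DGCat.isFd.{x} T).ι ⋙ resDer.{x} F) (by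
    rintro ⟨X, M, hM, ⟨e⟩⟩
    refine ⟨F.resObj M, fun s => hM (F.obj s), ⟨?_⟩⟩
    exact ((Localization.fac ((res.{x} F).toH0 ⋙ DGCat.toDer.{x} S) _
      (DGCat.toDer.{x} T)).app (T.dgMod.toH0 M)).symm ≪≫ (resDer.{x} F).mapIso e)

end DGFunctor

lemma exists_dual_homology_injective {V : Type v} [AddCommGroup V] [Module k V]
    (S : ShortComplex (ModuleCat.{x} k)) (S' : ShortComplex (ModuleCat.{u} k))
    (e : S'.X₂ →ₗ[k] (S.X₂ →ₗ[k] V))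
    (h₁ : ∀ ξ, S'.g.hom ξ = 0 → ∀ a, e ξ (S.f.hom a) = 0)
    (h₂ : ∀ ξ, ∀ η : S.X₃ →ₗ[k] V, e ξ = η.comp S.g.hom → ∃ ζ, S'.f.hom ζ = ξ)
    (h₃ : ∀ ζ b, S.g.hom b = 0 → e (S'.f.hom ζ) b = 0) :
    ∃ φ : S'.homology →ₗ[k] (S.homology →ₗ[k] V), Function.Injective φ := by
  let R := LinearMap.range S.moduleCatToCycles
  let R' := LinearMap.range S'.moduleCatToCycles
  let φ₁ : LinearMap.ker S'.g.hom →ₗ[k] ((LinearMap.ker S.g.hom ⧸ R) →ₗ[k] V) :=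
    { toFun := fun ξ => R.liftQ ((e ξ.1).comp (LinearMap.ker S.g.hom).subtype) (by
        rintro _ ⟨a, rfl⟩
        exact h₁ ξ.1 ξ.2 a)
      map_add' := fun ξ ξ' => by ext; simp
      map_smul' := fun c ξ => by ext; simp }
  have hφ₁ : LinearMap.ker φ₁ = R' := by
    apply le_antisymm
    · intro ξ hξ
      have hz : ∀ z : LinearMap.ker S.g.hom, e ξ.1 z.1 = 0 := fun z =>
        congrArg (fun f => f (R.mkQ z)) (LinearMap.mem_ker.1 hξ)
      obtain ⟨s, hs⟩ := S.g.hom.rangeRestrict.exists_rightInverse_of_surjective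
        S.g.hom.range_rangeRestrict
      obtain ⟨η, hη⟩ := ((e ξ.1).comp s).exists_extend
      obtain ⟨ζ, hζ⟩ := h₂ ξ.1 η (by
        ext b
        have hb := congrArg (fun f => f (S.g.hom.rangeRestrict b)) hη
        have hsb := congrArg (fun f => (f (S.g.hom.rangeRestrict b)).1) hs
        have hz' := hz ⟨b - s (S.g.hom.rangeRestrict b), by
          simpa [sub_eq_zero] using hsb.symm⟩
        simp only [map_sub, sub_eq_zero] at hz'
        exact hz'.trans hb.symm)
      exact ⟨ζ, Subtype.ext hζ⟩
    · rintro _ ⟨ζ, rfl⟩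
      refine LinearMap.mem_ker.2 (R.linearMap_qext ?_)
      ext z
      exact h₃ ζ z.1 z.2
  let φ₂ : (LinearMap.ker S'.g.hom ⧸ R') →ₗ[k] ((LinearMap.ker S.g.hom ⧸ R) →ₗ[k] V) :=
    R'.liftQ φ₁ hφ₁.ge
  have hφ₂ : Function.Injective φ₂ :=
    LinearMap.ker_eq_bot.1 (Submodule.ker_liftQ_eq_bot _ _ _ hφ₁.le)
  let i : S.homology ≃ₗ[k] (LinearMap.ker S.g.hom ⧸ R) := S.moduleCatHomologyIso.toLinearEquiv
  let i' : S'.homology ≃ₗ[k] (LinearMap.ker S'.g.hom ⧸ R') := S'.moduleCatHomologyIso.toLinearEquiv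
  refine ⟨(LinearMap.lcomp k V i.toLinearMap).comp (φ₂.comp i'.toLinearMap), ?_⟩
  intro a b hab
  refine i'.injective (hφ₂ (LinearMap.ext fun c => ?_))
  simpa using congrArg (fun f => f (i.symm c)) hab

/-- The dual `K^∨` of a complex of vector spaces: `(K^∨)ⁿ` is the dual of `K⁻ⁿ` (with values in a
copy of `k` in a larger universe), and `d ξ = (-1)^(|ξ| + 1) ξ ∘ d`. -/
@[simps]
def dualComplex (K : CochainComplex (ModuleCat.{x} k) ℤ) :
    CochainComplex (ModuleCat.{max w (x + 1)} k) ℤ where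
  X n := ModuleCat.of k (K.X (-n) →ₗ[k] ULift.{x + 1} k)
  d n n' := ModuleCat.ofHom
    ((n + 1).negOnePow • LinearMap.lcomp k (ULift.{x + 1} k) (K.d (-n') (-n)).hom)
  shape n n' h := by
    have h' : ¬ (ComplexShape.up ℤ).Rel (-n') (-n) := by
      simp only [ComplexShape.up_Rel] at h ⊢
      omega
    have h'' : (K.d (-n') (-n)).hom = 0 := by rw [K.shape _ _ h']; rfl
    ext ξ : 2
    rw [h'']
    refine LinearMap.ext fun b => ?_
    change ((n + 1).negOnePow • ξ.comp (0 : K.X (-n') →ₗ[k] K.X (-n))) b = 0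
    rw [LinearMap.comp_zero, smul_zero, LinearMap.zero_apply]
  d_comp_d' n n' n'' _ _ := by
    have h : (K.d (-n') (-n)).hom ∘ₗ (K.d (-n'') (-n')).hom = 0 := by
      rw [← ModuleCat.hom_comp, K.d_comp_d]; rfl
    ext ξ : 2
    simp only [ModuleCat.hom_comp, ModuleCat.hom_ofHom, LinearMap.comp_apply, Units.smul_def,
      LinearMap.smul_apply, map_zsmul, LinearMap.lcomp_apply', LinearMap.comp_assoc]
    rw [h]
    simp

lemma dualComplex_homology (K : CochainComplex (ModuleCat.{x} k) ℤ) (n : ℤ) :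
    ∃ φ : (dualComplex K).homology n →ₗ[k] (K.homology (-n) →ₗ[k] ULift.{x + 1} k),
      Function.Injective φ := by
  have i₁ : (dualComplex K).homology n ≅ ((dualComplex K).sc' (n - 1) n (n + 1)).homology :=
    ShortComplex.homologyMapIso ((dualComplex K).isoSc' (n - 1) n (n + 1) (by simp) (by simp))
  have i₂ : K.homology (-n) ≅ (K.sc' (-(n + 1)) (-n) (-(n - 1))).homology :=
    ShortComplex.homologyMapIso (K.isoSc' (-(n + 1)) (-n) (-(n - 1))
      (by simp; omega) (by simp; omega))
  obtain ⟨φ, hφ⟩ := exists_dual_homology_injective (V := ULift.{x + 1} k)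
    (K.sc' (-(n + 1)) (-n) (-(n - 1))) ((dualComplex K).sc' (n - 1) n (n + 1))
    LinearMap.id
    (fun (ξ : K.X (-n) →ₗ[k] ULift.{x + 1} k) hξ a => by
      have h : (n + 1).negOnePow • (ξ.comp (K.d (-(n + 1)) (-n)).hom) = 0 := hξ
      rw [smul_eq_zero_iff_eq] at h
      exact congrArg (fun f => f a) h)
    (fun (ξ : K.X (-n) →ₗ[k] ULift.{x + 1} k) (η : K.X (-(n - 1)) →ₗ[k] ULift.{x + 1} k) hη => ⟨((n - 1) + 1).negOnePow • η, by
      change (n - 1 + 1).negOnePow •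
        (((n - 1) + 1).negOnePow • η).comp (K.d (-n) (-(n - 1))).hom = ξ
      rw [Units.smul_def, Units.smul_def, LinearMap.smul_comp, smul_smul]
      rw [← Units.val_mul, Int.units_mul_self, Units.val_one, one_smul]
      exact hη.symm⟩)
    (fun (ζ : K.X (-(n - 1)) →ₗ[k] ULift.{x + 1} k) (b : K.X (-n)) hb => by
      change ((n - 1 + 1).negOnePow • ζ.comp (K.d (-n) (-(n - 1))).hom) b = 0
      have hb' : (K.d (-n) (-(n - 1))).hom b = 0 := hb
      rw [Units.smul_def, LinearMap.smul_apply, LinearMap.comp_apply, hb', map_zero, smul_zero])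
  refine ⟨(LinearMap.lcomp k _ i₂.toLinearEquiv.toLinearMap).comp
    (φ.comp i₁.toLinearEquiv.toLinearMap), fun a b hab => ?_⟩
  refine i₁.toLinearEquiv.injective (hφ (LinearMap.ext fun c => ?_))
  simpa using congrArg (fun f => f (i₂.toLinearEquiv.symm c)) hab

namespace DGCat

variable (T : DGCat.{w, v, u} k)

/-- The dg module `M ↦ M(t)^∨` over `Dᶠᵈ(T)`; a morphism `φ : M ⟶ N` acts by `ξ ↦ ξ ∘ φ(t)`. -/
@[simps]
def coevObj (t : T.Obj) : DGMod.{max w (x + 1)} (dgFd.{x} T) where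
  obj M := dualComplex (M.1.obj t)
  act {M N m n p} h := LinearMap.mk₂ k
    (fun (ξ : (N.1.obj t).X (-m) →ₗ[k] ULift.{x + 1} k)
      (φ : DGMod.homSubmodule M.1 N.1 n) =>
        (ξ.comp ((φ.1 t).v (-p) (-m) (by omega)).hom : (M.1.obj t).X (-p) →ₗ[k] ULift.{x + 1} k))
    (fun ξ ξ' φ => LinearMap.add_comp _ _ _) (fun c ξ φ => LinearMap.smul_comp _ _ _)
    (fun ξ φ φ' => LinearMap.comp_add _ _ _) (fun c ξ φ => LinearMap.comp_smul _ _ _)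
  act_ident := fun {M m} h (ξ : (M.1.obj t).X (-m) →ₗ[k] ULift.{x + 1} k) => by
    refine LinearMap.ext fun (y : (M.1.obj t).X (-m)) => ?_
    change ξ (((CochainComplex.HomComplex.Cochain.ofHom (𝟙 (M.1.obj t))).v (-m) (-m) (add_zero _)).hom y) = ξ y
    rw [CochainComplex.HomComplex.Cochain.ofHom_v]
    rfl
  act_act := fun {L M N m n l a b p} h₁ h₂ h₃ h₄ (ξ : (N.1.obj t).X (-m) →ₗ[k] ULift.{x + 1} k)
      (ψ : DGMod.homSubmodule M.1 N.1 n) (φ : DGMod.homSubmodule L.1 M.1 l) => by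
    refine LinearMap.ext fun (y : (L.1.obj t).X (-p)) => ?_
    change ξ (((ψ.1 t).v (-a) (-m) _).hom (((φ.1 t).v (-p) (-a) _).hom y)) =
      ξ ((((φ.1 t).comp (ψ.1 t) h₃).v (-p) (-m) _).hom y)
    rw [CochainComplex.HomComplex.Cochain.comp_v _ _ h₃ (-p) (-a) (-m) (by omega) (by omega)]
    rfl
  d_act := fun {M N m n p m' n' p'} h hm hn hp (ξ : (N.1.obj t).X (-m) →ₗ[k] ULift.{x + 1} k)
      (φ : DGMod.homSubmodule M.1 N.1 n) => by
    refine LinearMap.ext fun (y : (M.1.obj t).X (-p')) => ?_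
    change ((p + 1).negOnePow : ℤ) • ξ (((φ.1 t).v (-p) (-m) _).hom
        (((M.1.obj t).d (-p') (-p)).hom y)) =
      ((m + 1).negOnePow : ℤ) • ξ (((N.1.obj t).d (-m') (-m)).hom
        (((φ.1 t).v (-p') (-m') _).hom y)) +
      (m.negOnePow : ℤ) • ξ (((CochainComplex.HomComplex.δ n n' (φ.1 t)).v (-p') (-m) _).hom y)
    rw [CochainComplex.HomComplex.δ_v n n' hn _ (-p') (-m) (by omega) (-m') (-p) (by omega)
      (by omega)]
    simp only [ModuleCat.hom_add, ModuleCat.hom_comp, LinearMap.add_apply, LinearMap.comp_apply,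
      map_add, Units.smul_def, map_zsmul, LinearMap.smul_apply, ModuleCat.hom_zsmul, smul_add,
      smul_smul]
    have h₁ : ((p + 1).negOnePow : ℤ) = (m.negOnePow : ℤ) * (n'.negOnePow : ℤ) := by
      rw [← h, ← hn, add_assoc, Int.negOnePow_add m (n + 1), Units.val_mul]
    rw [h₁, Int.negOnePow_succ m, Units.val_neg, neg_smul, neg_add_cancel_left]

/-- The transposed action of a morphism of `T` on duals: for `f : s ⟶ t` of degree `n`, this is
`ξ ↦ (y ↦ (-1)ⁿ ξ (y · f))`. -/
def coevMap {s t : T.Obj} (n : ℤ) :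
    (T.Hom s t).X n →ₗ[k] DGMod.homSubmodule (coevObj.{x} T s) (coevObj.{x} T t) n where
  toFun f := ⟨fun M => CochainComplex.HomComplex.Cochain.mk fun m p hp =>
    ModuleCat.ofHom ((n.negOnePow : ℤ) • LinearMap.lcomp k (ULift.{x + 1} k)
      ((M.1.act (show -p + n = -m by omega)).flip f)), by
    intro M N m l p m' p' h hm hp (ξ : (N.1.obj s).X (-m) →ₗ[k] ULift.{x + 1} k)
      (φ : DGMod.homSubmodule M.1 N.1 l)
    refine LinearMap.ext fun (y : (M.1.obj t).X (-p')) => ?_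
    change (n.negOnePow : ℤ) • ξ (((φ.1 s).v (-p) (-m) _).hom (M.1.act _ y f)) =
      (n.negOnePow : ℤ) • ξ (N.1.act _ (((φ.1 t).v (-p') (-m') _).hom y) f)
    rw [φ.2 (show -p' + n = -p by omega) (show -p' + l = -m' by omega) (by omega)]⟩
  map_add' f g := by
    refine Subtype.ext (funext fun M => ?_)
    ext m p hp : 2
    refine LinearMap.ext fun (ξ : (M.1.obj s).X (-m) →ₗ[k] ULift.{x + 1} k) => ?_
    refine LinearMap.ext fun (y : (M.1.obj t).X (-p)) => ?_
    change (n.negOnePow : ℤ) • ξ (M.1.act (show -p + n = -m by omega) y (f + g)) =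
      (n.negOnePow : ℤ) • ξ (M.1.act (show -p + n = -m by omega) y f) +
      (n.negOnePow : ℤ) • ξ (M.1.act (show -p + n = -m by omega) y g)
    rw [map_add, map_add, smul_add]
  map_smul' c f := by
    refine Subtype.ext (funext fun M => ?_)
    ext m p hp : 2
    refine LinearMap.ext fun (ξ : (M.1.obj s).X (-m) →ₗ[k] ULift.{x + 1} k) => ?_
    refine LinearMap.ext fun (y : (M.1.obj t).X (-p)) => ?_
    change (n.negOnePow : ℤ) • ξ (M.1.act (show -p + n = -m by omega) y (c • f)) =
      c • (n.negOnePow : ℤ) • ξ (M.1.act (show -p + n = -m by omega) y f)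
    rw [map_smul, map_smul, smul_comm]

/-- The coevaluation dg functor `T → dgMod (Dᶠᵈ(T))`, `t ↦ (M ↦ M(t)^∨)`. -/
def coev : DGFunctor T ((dgFd.{x} T).dgMod.{max w (x + 1)}) where
  obj t := coevObj.{x} T t
  map {s t} n := coevMap.{x} T n
  map_ident t := by
    refine Subtype.ext (funext fun M => ?_)
    ext m : 2
    refine LinearMap.ext fun (ξ : (M.1.obj t).X (-m) →ₗ[k] ULift.{x + 1} k) => ?_
    refine LinearMap.ext fun (y : (M.1.obj t).X (-m)) => ?_
    have h₁ : ((DGMod.homIdent (coevObj.{x} T t)).1 M).v m m (add_zero m) =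
      𝟙 ((dualComplex (M.1.obj t)).X m) := CochainComplex.HomComplex.Cochain.ofHom_v _ _
    refine Eq.trans ?_ (congrArg (fun f => (f.hom ξ : (M.1.obj t).X (-m) →ₗ[k] _) y) h₁).symm
    change ((0 : ℤ).negOnePow : ℤ) • ξ (M.1.act (show -m + 0 = -m by omega) y (T.ident t)) = ξ y
    rw [M.1.act_ident]
    simp
  map_comp {r s t m n p} h f g := by
    refine Subtype.ext (funext fun M => ?_)
    ext a b hab : 2
    refine LinearMap.ext fun (ξ : (M.1.obj r).X (-a) →ₗ[k] ULift.{x + 1} k) => ?_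
    refine LinearMap.ext fun (y : (M.1.obj t).X (-b)) => ?_
    have h₁ := CochainComplex.HomComplex.Cochain.comp_v ((coevMap.{x} T m f).1 M)
      ((coevMap.{x} T n g).1 M) h a (a + m) b rfl (by omega)
    refine Eq.trans ?_ (congrArg (fun f => (f.hom ξ : (M.1.obj t).X (-b) →ₗ[k] _) y) h₁).symm
    change (p.negOnePow : ℤ) • ξ (M.1.act (show -b + p = -a by omega) y (T.comp h f g)) =
      (n.negOnePow : ℤ) • (m.negOnePow : ℤ) • ξ (M.1.act (show -(a + m) + m = -a by omega)
        (M.1.act (show -b + n = -(a + m) by omega) y g) f)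
    have h₂ : (p.negOnePow : ℤ) = (n.negOnePow : ℤ) * (m.negOnePow : ℤ) := by
      rw [← h, Int.negOnePow_add, Units.val_mul, mul_comm]
    rw [M.1.act_act _ _ h (by omega), smul_smul, h₂]
  map_d {s t} n n' h f := by
    refine Subtype.ext (funext fun M => ?_)
    ext a b hab : 2
    refine LinearMap.ext fun (ξ : (M.1.obj s).X (-a) →ₗ[k] ULift.{x + 1} k) => ?_
    refine LinearMap.ext fun (y : (M.1.obj t).X (-b)) => ?_
    have h₁ := CochainComplex.HomComplex.δ_v n n' h ((coevMap.{x} T n f).1 M) a b hab (b - 1)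
      (a + 1) rfl rfl
    refine Eq.trans ?_ (congrArg (fun f => (f.hom ξ : (M.1.obj t).X (-b) →ₗ[k] _) y) h₁).symm
    change (n'.negOnePow : ℤ) • ξ (M.1.act (show -b + n' = -a by omega) y
        (((T.Hom s t).d n n').hom f)) =
      ((b - 1 + 1).negOnePow : ℤ) • (n.negOnePow : ℤ) • ξ (M.1.act
        (show -(b - 1) + n = -a by omega) (((M.1.obj t).d (-b) (-(b - 1))).hom y) f) +
      (n'.negOnePow : ℤ) • (n.negOnePow : ℤ) • ((a + 1).negOnePow : ℤ) •
        ξ (((M.1.obj s).d (-(a + 1)) (-a)).hom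
          (M.1.act (show -b + n = -(a + 1) by omega) y f))
    rw [M.1.d_act (show -b + n = -(a + 1) by omega) (show -b + 1 = -(b - 1) by omega) h (by omega)]
    simp only [Units.smul_def, map_add, map_zsmul, smul_add, smul_smul, Int.negOnePow_neg]
    have h₂ : ((b - 1 + 1).negOnePow : ℤ) * (n.negOnePow : ℤ) =
        -((n'.negOnePow : ℤ) * (n.negOnePow : ℤ) * ((a + 1).negOnePow : ℤ)) := by
      rw [sub_add_cancel, ← hab, Int.negOnePow_add, Int.negOnePow_succ, Units.val_mul, Units.val_neg]
      ring
    have h₃ : (n'.negOnePow : ℤ) * (n.negOnePow : ℤ) * ((a + 1).negOnePow : ℤ) *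
        (b.negOnePow : ℤ) = (n'.negOnePow : ℤ) := by
      rw [← hab, ← h, ← Units.val_mul, ← Units.val_mul, ← Units.val_mul, ← Int.negOnePow_add,
        ← Int.negOnePow_add, ← Int.negOnePow_add, Units.val_inj, Int.negOnePow_eq_iff]
      exact ⟨a + n + 1, by ring⟩
    simp only [mul_assoc] at h₂ h₃
    rw [h₂, h₃, neg_smul, neg_add_cancel_left]

/-- The coevaluation functor `H⁰ T ⥤ Dᶠᵈ(Dᶠᵈ(T))`. -/
def coevFd : T.H0 ⥤ DerFd.{max w (x + 1)} (dgFd.{x} T) :=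
  (isFd.{max w (x + 1)} (dgFd.{x} T)).lift ((coev.{x} T).toH0 ⋙ toDer _) (by
    rintro ⟨⟨t⟩⟩
    refine ⟨coevObj.{x} T t, fun M => ⟨fun n => ?_, ?_⟩, ⟨Iso.refl _⟩⟩
    · obtain ⟨φ, hφ⟩ := dualComplex_homology (M.1.obj t) n
      have := (M.2.1 t).1 (-n)
      exact Module.Finite.of_injective φ hφ
    · refine ((M.2.1 t).2.preimage (f := fun n : ℤ => -n) neg_injective.injOn).subset ?_
      intro n hn hn'
      obtain ⟨φ, hφ⟩ := dualComplex_homology (M.1.obj t) n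
      have h₁ : Subsingleton ((M.1.obj t).homology (-n)) := ModuleCat.subsingleton_of_isZero hn'
      have h₂ : Subsingleton ((dualComplex (M.1.obj t)).homology n) := hφ.subsingleton
      exact hn (@ModuleCat.isZero_of_subsingleton _ _ _ h₂))

/-- `Y` is the shift `X[n]`. -/
def IsShift (n : ℤ) (X Y : T.Obj) : Prop :=
  ∃ (f : (T.Hom Y X).X n) (g : (T.Hom X Y).X (-n)),
    ((T.Hom Y X).d n (n + 1)).hom f = 0 ∧ ((T.Hom X Y).d (-n) (-n + 1)).hom g = 0 ∧
    (∃ h : (T.Hom Y Y).X (-1),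
      ((T.Hom Y Y).d (-1) 0).hom h = T.comp (add_neg_cancel n) f g - T.ident Y) ∧
    (∃ h : (T.Hom X X).X (-1),
      ((T.Hom X X).d (-1) 0).hom h = T.comp (neg_add_cancel n) g f - T.ident X)

/-- `Z` is a cone of the closed morphism `f : X ⟶ Y` of degree `0`: there is a closed element
`(q, r)` of degree `0` of the value at `Z` of the cone of `Hom(-, X) ⟶ Hom(-, Y)`, such that the
induced morphism from `Hom(-, Z)` to this cone is a quasi-isomorphism (i.e. surjective and injective
in cohomology). Here the cone at `W` is `Hom(W, X)ⁿ⁺¹ × Hom(W, Y)ⁿ` in degree `n`, with differential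
`(a, b) ↦ (-da, f ∘ a + db)`. -/
def IsCone {X Y : T.Obj} (f : (T.Hom X Y).X 0) (Z : T.Obj) : Prop :=
  ∃ (q : (T.Hom Z X).X 1) (r : (T.Hom Z Y).X 0),
    ((T.Hom Z X).d 1 2).hom q = 0 ∧
    T.comp (add_zero 1) q f + ((T.Hom Z Y).d 0 1).hom r = 0 ∧
    ∀ (W : T.Obj) (n : ℤ),
      (∀ (a : (T.Hom W X).X (n + 1)) (b : (T.Hom W Y).X n),
        ((T.Hom W X).d (n + 1) (n + 2)).hom a = 0 →
        T.comp (add_zero (n + 1)) a f + ((T.Hom W Y).d n (n + 1)).hom b = 0 →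
        ∃ (y : (T.Hom W Z).X n) (a' : (T.Hom W X).X n) (b' : (T.Hom W Y).X (n - 1)),
          ((T.Hom W Z).d n (n + 1)).hom y = 0 ∧
          T.comp rfl y q - a = -((T.Hom W X).d n (n + 1)).hom a' ∧
          T.comp (add_zero n) y r - b =
            T.comp (add_zero n) a' f + ((T.Hom W Y).d (n - 1) n).hom b') ∧
      (∀ (y : (T.Hom W Z).X n) (a' : (T.Hom W X).X n) (b' : (T.Hom W Y).X (n - 1)),
        ((T.Hom W Z).d n (n + 1)).hom y = 0 →
        T.comp rfl y q = -((T.Hom W X).d n (n + 1)).hom a' →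
        T.comp (add_zero n) y r =
          T.comp (add_zero n) a' f + ((T.Hom W Y).d (n - 1) n).hom b' →
        ∃ z : (T.Hom W Z).X (n - 1), ((T.Hom W Z).d (n - 1) n).hom z = y)

/-- A dg category is pretriangulated (a dg-enhanced triangulated category) if its homotopy category
has a zero object and is closed under shifts and cones. -/
structure IsPretriangulated : Prop where
  exists_zero : ∃ X : T.Obj, Limits.IsZero (T.toH0 X)
  exists_shift (n : ℤ) (X : T.Obj) : ∃ Y, T.IsShift n X Y
  exists_cone {X Y : T.Obj} (f : (T.Hom X Y).X 0) (hf : ((T.Hom X Y).d 0 1).hom f = 0) :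
    ∃ Z, T.IsCone f Z

/-- A small dg-enhanced triangulated category `T` is reflexive if the coevaluation
`T → Dᶠᵈ(Dᶠᵈ(T))` is an equivalence. -/
structure IsReflexive : Prop where
  isPretriangulated : T.IsPretriangulated
  isEquivalence_coev : (coevFd.{max u v w} T).IsEquivalence

variable {T} in
/-- A strictly full triangulated subcategory of `H⁰ T`. -/
structure IsTriangulatedSubcategory (A : ObjectProperty T.H0) : Prop where
  isClosedUnderIsomorphisms : A.IsClosedUnderIsomorphisms
  zero (X : T.Obj) (hX : Limits.IsZero (T.toH0 X)) : A (T.toH0 X)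
  shift (n : ℤ) (X Y : T.Obj) (h : T.IsShift n X Y) (hX : A (T.toH0 X)) : A (T.toH0 Y)
  cone {X Y : T.Obj} (f : (T.Hom X Y).X 0) (hf : ((T.Hom X Y).d 0 1).hom f = 0) (Z : T.Obj)
    (h : T.IsCone f Z) (hX : A (T.toH0 X)) (hY : A (T.toH0 Y)) : A (T.toH0 Z)

/-- The set of left admissible subcategories: the strictly full triangulated subcategories whose
embedding functor has a left adjoint. -/
def LAdm : Set (ObjectProperty T.H0) :=
  {A | IsTriangulatedSubcategory A ∧ A.ι.IsRightAdjoint}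

/-- The set of right admissible subcategories: the strictly full triangulated subcategories whose
embedding functor has a right adjoint. -/
def RAdm : Set (ObjectProperty T.H0) :=
  {A | IsTriangulatedSubcategory A ∧ A.ι.IsLeftAdjoint}

/-- The closed morphisms of degree `0` of `T`. -/
structure Arrow where
  /-- the source -/
  src : T.Obj
  /-- the target -/
  tgt : T.Obj
  /-- the morphism -/
  hom : (T.Hom src tgt).X 0
  closed : ((T.Hom src tgt).d 0 1).hom hom = 0

namespace Arrow

variable {T}

/-- A morphism of degree `n` from `f : s ⟶ t` to `f' : s' ⟶ t'` in the dg category of arrows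
consists of `u : s ⟶ s'` and `v : t ⟶ t'` of degree `n`, and `h : s ⟶ t'` of degree `n - 1`. -/
abbrev HomX (f f' : T.Arrow) (n : ℤ) : Type v :=
  (T.Hom f.src f'.src).X n × (T.Hom f.tgt f'.tgt).X n × (T.Hom f.src f'.tgt).X (n - 1)

/-- The differential `(u, v, h) ↦ (du, dv, dh + (-1)ⁿ (f' ∘ u - v ∘ f))`. -/
def homD (f f' : T.Arrow) (n n' : ℤ) (hn : n + 1 = n') : HomX f f' n →ₗ[k] HomX f f' n' where
  toFun φ := (((T.Hom f.src f'.src).d n n').hom φ.1, ((T.Hom f.tgt f'.tgt).d n n').hom φ.2.1,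
    ((T.Hom f.src f'.tgt).d (n - 1) (n' - 1)).hom φ.2.2 + n.negOnePow •
      (T.comp (show n + 0 = n' - 1 by omega) φ.1 f'.hom -
        T.comp (show 0 + n = n' - 1 by omega) f.hom φ.2.1))
  map_add' φ ψ := by
    ext <;> simp [Units.smul_def]; module
  map_smul' c φ := by
    ext <;> simp [Units.smul_def, smul_sub, smul_comm c]

lemma d_d {X Y : T.Obj} (n n' n'' : ℤ) (f : (T.Hom X Y).X n) :
    ((T.Hom X Y).d n' n'').hom (((T.Hom X Y).d n n').hom f) = 0 := by
  rw [← LinearMap.comp_apply, ← ModuleCat.hom_comp, HomologicalComplex.d_comp_d]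
  rfl

lemma homD_homD (f f' : T.Arrow) (n n' n'' : ℤ) (h : n + 1 = n') (h' : n' + 1 = n'')
    (φ : HomX f f' n) : homD f f' n' n'' h' (homD f f' n n' h φ) = 0 := by
  refine Prod.ext (d_d _ _ _ _) (Prod.ext (d_d _ _ _ _) ?_)
  have e₁ := T.d_comp (show n + 0 = n' - 1 by omega) h (zero_add 1)
    (show n' - 1 + 1 = n'' - 1 by omega) φ.1 f'.hom
  have e₂ := T.d_comp (show 0 + n = n' - 1 by omega) (zero_add 1) h
    (show n' - 1 + 1 = n'' - 1 by omega) f.hom φ.2.1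
  rw [f'.closed, map_zero, zero_add, Int.negOnePow_zero, one_smul] at e₁
  rw [f.closed, map_zero, LinearMap.zero_apply, smul_zero, add_zero] at e₂
  subst h
  simp only [homD, LinearMap.coe_mk, AddHom.coe_mk, map_add, map_sub, Units.smul_def, map_zsmul,
    d_d, e₁, e₂, Int.negOnePow_succ, Prod.snd_zero]
  simp

/-- The complex of morphisms in the dg category of arrows. -/
def homComplex (f f' : T.Arrow) : CochainComplex (ModuleCat.{v} k) ℤ where
  X n := ModuleCat.of k (HomX f f' n)
  d n n' := if h : n + 1 = n' then ModuleCat.ofHom (homD f f' n n' h) else 0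
  shape n n' h := dif_neg h
  d_comp_d' n n' n'' h h' := by
    replace h : n + 1 = n' := h
    replace h' : n' + 1 = n'' := h'
    rw [dif_pos h, dif_pos h']
    exact ModuleCat.hom_ext (LinearMap.ext fun φ => homD_homD f f' n n' n'' h h' φ)

lemma homComplex_d_apply (f f' : T.Arrow) (n n' : ℤ) (h : n + 1 = n') (φ : HomX f f' n) :
    ((homComplex f f').d n n').hom φ = homD f f' n n' h φ := by
  have : (homComplex f f').d n n' = ModuleCat.ofHom (homD f f' n n' h) := dif_pos h
  rw [this]
  rfl

/-- The composition
`(u', v', h') ∘ (u, v, h) = (u' ∘ u, v' ∘ v, v' ∘ h + (-1)^m h' ∘ u)`, where `(u, v, h)` has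
degree `m`. -/
def homComp (f f' f'' : T.Arrow) {m n p : ℤ} (h : m + n = p) :
    HomX f f' m →ₗ[k] HomX f' f'' n →ₗ[k] HomX f f'' p :=
  LinearMap.mk₂ k
    (fun φ ψ => (T.comp h φ.1 ψ.1, T.comp h φ.2.1 ψ.2.1,
      T.comp (show (m - 1) + n = p - 1 by omega) φ.2.2 ψ.2.1 +
        m.negOnePow • T.comp (show m + (n - 1) = p - 1 by omega) φ.1 ψ.2.2))
    (fun φ φ' ψ => by ext <;> simp [Units.smul_def]; module)
    (fun c φ ψ => by ext <;> simp [Units.smul_def, smul_comm c])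
    (fun φ ψ ψ' => by ext <;> simp [Units.smul_def]; module)
    (fun c φ ψ => by ext <;> simp [Units.smul_def, smul_comm c])

lemma homD_homComp (f f' f'' : T.Arrow) {m n p m' n' p' : ℤ} (h : m + n = p) (hm : m + 1 = m')
    (hn : n + 1 = n') (hp : p + 1 = p') (φ : HomX f f' m) (ψ : HomX f' f'' n) :
    homD f f'' p p' hp (homComp f f' f'' h φ ψ) =
      homComp f f' f'' (show m + n' = p' by omega) φ (homD f' f'' n n' hn ψ) +
        n.negOnePow • homComp f f' f'' (show m' + n = p' by omega) (homD f f' m m' hm φ) ψ := by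
  refine Prod.ext (T.d_comp h hm hn hp _ _) (Prod.ext (T.d_comp h hm hn hp _ _) ?_)
  have e₁ := T.d_comp (show (m - 1) + n = p - 1 by omega) (show m - 1 + 1 = m' - 1 by omega) hn
    (show p - 1 + 1 = p' - 1 by omega) φ.2.2 ψ.2.1
  have e₂ := T.d_comp (show m + (n - 1) = p - 1 by omega) hm (show n - 1 + 1 = n' - 1 by omega)
    (show p - 1 + 1 = p' - 1 by omega) φ.1 ψ.2.2
  have e₃ := T.assoc h (show n + 0 = n' - 1 by omega) (show p + 0 = p' - 1 by omega)
    (show m + (n' - 1) = p' - 1 by omega) φ.1 ψ.1 f''.hom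
  have e₄ := T.assoc (show m + 0 = m' - 1 by omega) (show 0 + n = n' - 1 by omega)
    (show m' - 1 + n = p' - 1 by omega) (show m + (n' - 1) = p' - 1 by omega) φ.1 f'.hom ψ.2.1
  have e₅ := T.assoc (show 0 + m = m' - 1 by omega) h (show m' - 1 + n = p' - 1 by omega)
    (show 0 + p = p' - 1 by omega) f.hom φ.2.1 ψ.2.1
  have s₁ : (p.negOnePow : ℤ) = (m.negOnePow : ℤ) * (n.negOnePow : ℤ) := by
    rw [← h, Int.negOnePow_add, Units.val_mul]
  have s₂ : ((n - 1).negOnePow : ℤ) = -(n.negOnePow : ℤ) := by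
    rw [Int.negOnePow_sub, Int.negOnePow_one]; simp
  have s₃ : (m'.negOnePow : ℤ) = -(m.negOnePow : ℤ) := by
    rw [← hm, Int.negOnePow_succ]; simp
  simp only [homD, homComp, LinearMap.coe_mk, AddHom.coe_mk, LinearMap.mk₂_apply, Prod.snd_add,
    Units.smul_def, Prod.smul_snd, map_add, map_sub, map_zsmul, e₁, e₂, e₃, s₁, s₂, s₃,
    LinearMap.add_apply, LinearMap.sub_apply, LinearMap.smul_apply, e₄, ← e₅]
  module

lemma homComp_assoc (f₀ f₁ f₂ f₃ : T.Arrow) {m n l a b p : ℤ} (h₁ : m + n = a) (h₂ : n + l = b)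
    (h₃ : a + l = p) (h₄ : m + b = p) (φ : HomX f₀ f₁ m) (ψ : HomX f₁ f₂ n) (θ : HomX f₂ f₃ l) :
    homComp f₀ f₂ f₃ h₃ (homComp f₀ f₁ f₂ h₁ φ ψ) θ =
      homComp f₀ f₁ f₃ h₄ φ (homComp f₁ f₂ f₃ h₂ ψ θ) := by
  refine Prod.ext (T.assoc _ _ _ _ _ _ _) (Prod.ext (T.assoc _ _ _ _ _ _ _) ?_)
  have e₁ := T.assoc (show (m - 1) + n = a - 1 by omega) h₂ (show a - 1 + l = p - 1 by omega)
    (show m - 1 + b = p - 1 by omega) φ.2.2 ψ.2.1 θ.2.1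
  have e₂ := T.assoc (show m + (n - 1) = a - 1 by omega) (show n - 1 + l = b - 1 by omega)
    (show a - 1 + l = p - 1 by omega) (show m + (b - 1) = p - 1 by omega) φ.1 ψ.2.2 θ.2.1
  have e₃ := T.assoc h₁ (show n + (l - 1) = b - 1 by omega) (show a + (l - 1) = p - 1 by omega)
    (show m + (b - 1) = p - 1 by omega) φ.1 ψ.1 θ.2.2
  have s₁ : (a.negOnePow : ℤ) = (m.negOnePow : ℤ) * (n.negOnePow : ℤ) := by
    rw [← h₁, Int.negOnePow_add, Units.val_mul]
  simp only [homComp, LinearMap.mk₂_apply, Units.smul_def, map_add, map_zsmul,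
    LinearMap.add_apply, LinearMap.smul_apply, e₁, e₂, e₃, s₁]
  module

end Arrow

/-- The dg category of arrows of `T`. -/
def arrow : DGCat.{w, v, max u v} k where
  Obj := T.Arrow
  Hom f f' := Arrow.homComplex f f'
  comp {f f' f'' m n p} h := Arrow.homComp f f' f'' h
  ident f := ((T.ident f.src, T.ident f.tgt, 0) : Arrow.HomX f f 0)
  ident_comp := fun {f f' n} h (φ : Arrow.HomX f f' n) => by
    refine Prod.ext (T.ident_comp _ _) (Prod.ext (T.ident_comp _ _) ?_)
    change T.comp _ (0 : (T.Hom f.src f.tgt).X (-1)) φ.2.1 +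
      (0 : ℤ).negOnePow • T.comp _ (T.ident f.src) φ.2.2 = φ.2.2
    simp [T.ident_comp]
  comp_ident := fun {f f' n} h (φ : Arrow.HomX f f' n) => by
    refine Prod.ext (T.comp_ident _ _) (Prod.ext (T.comp_ident _ _) ?_)
    change T.comp _ φ.2.2 (T.ident f'.tgt) +
      n.negOnePow • T.comp _ φ.1 (0 : (T.Hom f'.src f'.tgt).X (-1)) = φ.2.2
    simp [T.comp_ident]
  assoc h₁ h₂ h₃ h₄ φ ψ θ := Arrow.homComp_assoc _ _ _ _ h₁ h₂ h₃ h₄ φ ψ θ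
  d_comp := fun {f₀ f₁ f₂ m n p m' n' p'} h hm hn hp (φ : Arrow.HomX f₀ f₁ m)
      (ψ : Arrow.HomX f₁ f₂ n) => by
    rw [Arrow.homComplex_d_apply _ _ _ _ hn, Arrow.homComplex_d_apply _ _ _ _ hm]
    exact (Arrow.homComplex_d_apply _ _ _ _ hp _).trans
      (Arrow.homD_homComp _ _ _ h hm hn hp φ ψ)

/-- The source, as a dg functor. -/
def arrowSrc : DGFunctor T.arrow T where
  obj f := f.src
  map {f f'} n := LinearMap.fst k _ _
  map_ident _ := rfl
  map_comp _ _ _ := rfl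
  map_d n n' h φ := by
    refine (congrArg _ (Arrow.homComplex_d_apply _ _ n n' h φ)).trans ?_
    rfl

/-- The target, as a dg functor. -/
def arrowTgt : DGFunctor T.arrow T where
  obj f := f.tgt
  map {f f'} n := (LinearMap.fst k _ _).comp (LinearMap.snd k _ _)
  map_ident _ := rfl
  map_comp _ _ _ := rfl
  map_d n n' h φ := by
    refine (congrArg _ (Arrow.homComplex_d_apply _ _ n n' h φ)).trans ?_
    rfl

/-- The full dg subcategory of `T` on a full subcategory `A` of `H⁰ T`. -/
abbrev sub (A : ObjectProperty T.H0) : DGCat.{w, v, u} k :=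
  T.full fun X => A (T.toH0 X)

/-- The embedding `ι : A → T`. -/
abbrev subIncl (A : ObjectProperty T.H0) : DGFunctor (T.sub A) T :=
  T.incl _

section

variable {T} (A : ObjectProperty T.H0)

/-- An arrow `η : t ⟶ a` is a unit for `A` if it exhibits `a` as the value at `t` of the left adjoint
`π_L` of the embedding of `A`: `a` is in `A`, and composition with `η` is a bijection
`Hom(a, b) ≃ Hom(t, b)` in `H⁰ T` for all `b` in `A`. -/
def IsUnitArrow (η : T.Arrow) : Prop :=
  A (T.toH0 η.tgt) ∧ ∀ b : T.Obj, A (T.toH0 b) →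
    Function.Bijective fun g : T.toH0 η.tgt ⟶ T.toH0 b => T.homH0 η.hom η.closed ≫ g

/-- An arrow `ε : a ⟶ t` is a counit for `A` if it exhibits `a` as the value at `t` of the right
adjoint `π_R` of the embedding of `A`: `a` is in `A`, and composition with `ε` is a bijection
`Hom(b, a) ≃ Hom(b, t)` in `H⁰ T` for all `b` in `A`. -/
def IsCounitArrow (ε : T.Arrow) : Prop :=
  A (T.toH0 ε.src) ∧ ∀ b : T.Obj, A (T.toH0 b) →
    Function.Bijective fun g : T.toH0 b ⟶ T.toH0 ε.src => g ≫ T.homH0 ε.hom ε.closed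

/-- The graph of the dg-enhanced left adjoint `π_L` of the embedding of `A`: the dg category of all
units `η : t ⟶ π_L(t)`. If `A` is left admissible, the projection `(t ⟶ a) ↦ t` to `T` is a
quasi-equivalence, and `π_L : T → A` is the quasi-functor given by the roof
`T ← graphL A → A`, `t ↤ (t ⟶ a) ↦ a`. -/
abbrev graphL : DGCat.{w, v, max u v} k := T.arrow.full (IsUnitArrow A)

/-- The projection `(t ⟶ a) ↦ t`. -/
def graphLToCat : DGFunctor (graphL A) T where
  obj η := η.1.src
  map n := T.arrowSrc.map n
  map_ident η := T.arrowSrc.map_ident η.1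
  map_comp h f g := T.arrowSrc.map_comp h f g
  map_d n n' h f := T.arrowSrc.map_d n n' h f

/-- The projection `(t ⟶ a) ↦ a`. -/
def graphLToSub : DGFunctor (graphL A) (T.sub A) where
  obj η := ⟨η.1.tgt, η.2.1⟩
  map n := T.arrowTgt.map n
  map_ident η := T.arrowTgt.map_ident η.1
  map_comp h f g := T.arrowTgt.map_comp h f g
  map_d n n' h f := T.arrowTgt.map_d n n' h f

/-- The graph of the dg-enhanced right adjoint `π_R` of the embedding of `A`: the dg category of all
counits `ε : π_R(t) ⟶ t`. If `A` is right admissible, the projection `(a ⟶ t) ↦ t` to `T` is a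
quasi-equivalence, and `π_R : T → A` is the quasi-functor given by the roof
`T ← graphR A → A`, `t ↤ (a ⟶ t) ↦ a`. -/
abbrev graphR : DGCat.{w, v, max u v} k := T.arrow.full (IsCounitArrow A)

/-- The projection `(a ⟶ t) ↦ t`. -/
def graphRToCat : DGFunctor (graphR A) T where
  obj ε := ε.1.tgt
  map n := T.arrowTgt.map n
  map_ident ε := T.arrowTgt.map_ident ε.1
  map_comp h f g := T.arrowTgt.map_comp h f g
  map_d n n' h f := T.arrowTgt.map_d n n' h f

/-- The projection `(a ⟶ t) ↦ a`. -/
def graphRToSub : DGFunctor (graphR A) (T.sub A) where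
  obj ε := ⟨ε.1.src, ε.2.1⟩
  map n := T.arrowSrc.map n
  map_ident ε := T.arrowSrc.map_ident ε.1
  map_comp h f g := T.arrowSrc.map_comp h f g
  map_d n n' h f := T.arrowSrc.map_d n n' h f

/-- `F` is the functor `π_L^! : Dᶠᵈ(A) ⥤ Dᶠᵈ(T)`, i.e. `M ↦ M ∘ π_L`: the restrictions of `F(M)` and
`M` to the graph of `π_L` are naturally isomorphic. -/
def IsPiLShriek (F : DerFd.{x} (T.sub A) ⥤ DerFd.{x} T) : Prop :=
  Nonempty (F ⋙ DGFunctor.shriek.{x} (graphLToCat A) ≅ DGFunctor.shriek.{x} (graphLToSub A))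

/-- `F` is the functor `π_R^! : Dᶠᵈ(A) ⥤ Dᶠᵈ(T)`, i.e. `M ↦ M ∘ π_R`: the restrictions of `F(M)` and
`M` to the graph of `π_R` are naturally isomorphic. -/
def IsPiRShriek (F : DerFd.{x} (T.sub A) ⥤ DerFd.{x} T) : Prop :=
  Nonempty (F ⋙ DGFunctor.shriek.{x} (graphRToCat A) ≅ DGFunctor.shriek.{x} (graphRToSub A))

/-- For `A` left admissible in `T`, the category `Dᶠᵈ(A)` seen as a full subcategory of `Dᶠᵈ(T)` via
`π_L^!`: the objects `N` which are isomorphic to `π_L^!(M)` for some `M` in `Dᶠᵈ(A)`. -/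
def fdOfLAdm : ObjectProperty (dgFd.{x} T).H0 := fun N =>
  ∃ M : DerFd.{x} (T.sub A), Nonempty
    ((DGFunctor.shriek.{x} (graphLToCat A)).obj ((fdToDer.{x} T).obj N) ≅
      (DGFunctor.shriek.{x} (graphLToSub A)).obj M)

/-- For `A` right admissible in `T`, the category `Dᶠᵈ(A)` seen as a full subcategory of `Dᶠᵈ(T)` via
`π_R^!`: the objects `N` which are isomorphic to `π_R^!(M)` for some `M` in `Dᶠᵈ(A)`. -/
def fdOfRAdm : ObjectProperty (dgFd.{x} T).H0 := fun N =>
  ∃ M : DerFd.{x} (T.sub A), Nonempty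
    ((DGFunctor.shriek.{x} (graphRToCat A)).obj ((fdToDer.{x} T).obj N) ≅
      (DGFunctor.shriek.{x} (graphRToSub A)).obj M)

end

end DGCat

end

universe z y

noncomputable section

variable {k : Type w} [Field k]

namespace ModuleComplex

variable {K L M : CochainComplex (ModuleCat.{x} k) ℤ}

lemma d_d_apply (K : CochainComplex (ModuleCat.{x} k) ℤ) (n n' n'' : ℤ) (z : K.X n) :
    (K.d n' n'').hom ((K.d n n').hom z) = 0 := by
  rw [← LinearMap.comp_apply, ← ModuleCat.hom_comp, HomologicalComplex.d_comp_d]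
  rfl

lemma comm_apply (f : K ⟶ L) (n n' : ℤ) (z : K.X n) :
    (f.f n').hom ((K.d n n').hom z) = (L.d n n').hom ((f.f n).hom z) := by
  rw [← LinearMap.comp_apply, ← ModuleCat.hom_comp, ← f.comm]
  rfl

/-- The inclusion of the kernel of the differential in the cocycles. -/
def toCyc (K : CochainComplex (ModuleCat.{x} k) ℤ) (n : ℤ) :
    LinearMap.ker (K.d n (n + 1)).hom →ₗ[k] K.cycles n :=
  (K.liftCycles (A := ModuleCat.of k (LinearMap.ker (K.d n (n + 1)).hom))
    (ModuleCat.ofHom (LinearMap.ker (K.d n (n + 1)).hom).subtype) (n + 1) (by simp) (by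
      ext z; exact z.2)).hom

lemma iCycles_toCyc (K : CochainComplex (ModuleCat.{x} k) ℤ) (n : ℤ)
    (z : LinearMap.ker (K.d n (n + 1)).hom) : (K.iCycles n).hom (toCyc K n z) = z.1 :=
  congrArg (fun g : ModuleCat.of k (LinearMap.ker (K.d n (n + 1)).hom) ⟶ K.X n => g.hom z)
    (K.liftCycles_i (A := ModuleCat.of k (LinearMap.ker (K.d n (n + 1)).hom)) _ _ _ _)

lemma iCycles_injective (K : CochainComplex (ModuleCat.{x} k) ℤ) (n : ℤ) :
    Function.Injective (K.iCycles n).hom :=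
  (ModuleCat.mono_iff_injective (K.iCycles n)).1 inferInstance

/-- The cohomology class of a cocycle. -/
def cls (K : CochainComplex (ModuleCat.{x} k) ℤ) (n : ℤ) :
    LinearMap.ker (K.d n (n + 1)).hom →ₗ[k] K.homology n :=
  (K.homologyπ n).hom ∘ₗ toCyc K n

lemma cls_surjective (K : CochainComplex (ModuleCat.{x} k) ℤ) (n : ℤ) :
    Function.Surjective (cls K n) := by
  refine Function.Surjective.comp (g := (K.homologyπ n).hom)
    ((ModuleCat.epi_iff_surjective _).1 inferInstance) fun (y : K.cycles n) => ?_
  refine ⟨⟨(K.iCycles n).hom y, ?_⟩, iCycles_injective K n (iCycles_toCyc K n _)⟩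
  exact congrArg (fun g => g.hom y) (K.iCycles_d n (n + 1))

lemma cls_eq_zero_iff (K : CochainComplex (ModuleCat.{x} k) ℤ) (n : ℤ)
    (z : LinearMap.ker (K.d n (n + 1)).hom) :
    cls K n z = 0 ↔ ∃ y : K.X (n - 1), (K.d (n - 1) n).hom y = z.1 := by
  constructor
  · intro h
    have hE : (ShortComplex.mk (K.toCycles (n - 1) n) (K.homologyπ n)
        (K.toCycles_comp_homologyπ _ _)).Exact :=
      ShortComplex.exact_of_g_is_cokernel _ (K.homologyIsCokernel (n - 1) n (by simp))
    obtain ⟨y, hy⟩ := (ShortComplex.moduleCat_exact_iff _).1 hE (toCyc K n z) h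
    refine ⟨y, ?_⟩
    refine (congrArg (fun g => g.hom y) (K.toCycles_i (n - 1) n)).symm.trans ?_
    exact (congrArg (K.iCycles n).hom hy).trans (iCycles_toCyc K n z)
  · rintro ⟨y, hy⟩
    refine Eq.trans ?_ (congrArg (fun g => g.hom y) (K.toCycles_comp_homologyπ (n - 1) n))
    refine congrArg (K.homologyπ n).hom (iCycles_injective K n ?_)
    refine (iCycles_toCyc K n z).trans ?_
    exact hy.symm.trans (congrArg (fun g => g.hom y) (K.toCycles_i (n - 1) n)).symm

lemma homologyMap_cls (f : K ⟶ L) (n : ℤ) (z : LinearMap.ker (K.d n (n + 1)).hom) :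
    (HomologicalComplex.homologyMap f n).hom (cls K n z) =
      cls L n ⟨(f.f n).hom z.1, by rw [LinearMap.mem_ker, ← comm_apply, z.2, map_zero]⟩ := by
  refine (congrArg (fun g : K.cycles n ⟶ L.homology n => g.hom (toCyc K n z))
    (HomologicalComplex.homologyπ_naturality f n)).trans ?_
  refine congrArg (L.homologyπ n).hom (iCycles_injective L n ?_)
  refine (congrArg (fun g : K.cycles n ⟶ L.X n => g.hom (toCyc K n z))
    (HomologicalComplex.cyclesMap_i f n)).trans ?_
  refine (congrArg (f.f n).hom (iCycles_toCyc K n z)).trans ?_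
  exact (iCycles_toCyc L n ⟨(f.f n).hom z.1, _⟩).symm

lemma acyclic_iff : K.Acyclic ↔ ∀ (n : ℤ) (z : K.X n), (K.d n (n + 1)).hom z = 0 →
    ∃ y : K.X (n - 1), (K.d (n - 1) n).hom y = z := by
  constructor
  · intro h n z hz
    have := ModuleCat.subsingleton_of_isZero (h n).isZero_homology
    exact (cls_eq_zero_iff K n ⟨z, hz⟩).1 (Subsingleton.elim _ _)
  · intro h n
    rw [HomologicalComplex.exactAt_iff_isZero_homology]
    refine @ModuleCat.isZero_of_subsingleton _ _ _ (subsingleton_of_forall_eq 0 fun y => ?_)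
    obtain ⟨z, rfl⟩ := cls_surjective K n y
    exact (cls_eq_zero_iff K n z).2 (h n z.1 z.2)

lemma exists_of_acyclic (h : K.Acyclic) {m n p : ℤ} (hm : m + 1 = n) (hp : n + 1 = p) (z : K.X n)
    (hz : (K.d n p).hom z = 0) : ∃ y : K.X m, (K.d m n).hom y = z := by
  obtain rfl : m = n - 1 := by omega
  subst hp
  exact acyclic_iff.1 h n z hz

lemma quasiIso_iff (f : K ⟶ L) : QuasiIso f ↔ ∀ n : ℤ,
    (∀ y : L.X n, (L.d n (n + 1)).hom y = 0 → ∃ z : K.X n, (K.d n (n + 1)).hom z = 0 ∧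
      ∃ e : L.X (n - 1), (L.d (n - 1) n).hom e = (f.f n).hom z - y) ∧
    (∀ z : K.X n, (K.d n (n + 1)).hom z = 0 → ∀ e : L.X (n - 1),
      (L.d (n - 1) n).hom e = (f.f n).hom z → ∃ e' : K.X (n - 1), (K.d (n - 1) n).hom e' = z) := by
  rw [_root_.quasiIso_iff]
  refine forall_congr' fun n => ?_
  rw [quasiIsoAt_iff_isIso_homologyMap, ConcreteCategory.isIso_iff_bijective]
  constructor
  · rintro ⟨hi, hs⟩
    constructor
    · intro y hy
      obtain ⟨a, ha⟩ := hs (cls L n ⟨y, hy⟩)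
      obtain ⟨z, rfl⟩ := cls_surjective K n a
      refine ⟨z.1, z.2, ?_⟩
      have h := (homologyMap_cls f n z).symm.trans ha
      rw [← sub_eq_zero, ← map_sub] at h
      exact (cls_eq_zero_iff L n _).1 h
    · intro z hz e he
      refine (cls_eq_zero_iff K n ⟨z, hz⟩).1 (hi ?_)
      refine Eq.trans ?_ (map_zero (HomologicalComplex.homologyMap f n).hom).symm
      exact (homologyMap_cls f n ⟨z, hz⟩).trans ((cls_eq_zero_iff L n _).2 ⟨e, he⟩)
  · intro h
    constructor
    · refine (injective_iff_map_eq_zero (HomologicalComplex.homologyMap f n).hom).2 fun a ha => ?_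
      obtain ⟨z, rfl⟩ := cls_surjective K n a
      rw [homologyMap_cls, cls_eq_zero_iff] at ha
      obtain ⟨e, he⟩ := ha
      exact (cls_eq_zero_iff K n z).2 (h.2 z.1 z.2 e he)
    · intro b
      obtain ⟨y, rfl⟩ := cls_surjective L n b
      obtain ⟨z, hz, e, he⟩ := h.1 y.1 y.2
      refine ⟨cls K n ⟨z, hz⟩, (homologyMap_cls f n ⟨z, hz⟩).trans ?_⟩
      rw [← sub_eq_zero, ← map_sub]
      exact (cls_eq_zero_iff L n _).2 ⟨e, he⟩

lemma exists_of_quasiIso {f : K ⟶ L} (hf : QuasiIso f) {m n p : ℤ} (hm : m + 1 = n)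
    (hp : n + 1 = p) (y : L.X n) (hy : (L.d n p).hom y = 0) : ∃ z : K.X n, (K.d n p).hom z = 0 ∧
      ∃ e : L.X m, (L.d m n).hom e = (f.f n).hom z - y := by
  obtain rfl : m = n - 1 := by omega
  subst hp
  exact ((quasiIso_iff f).1 hf n).1 y hy

lemma exists_of_quasiIso' {f : K ⟶ L} (hf : QuasiIso f) {m n p : ℤ} (hm : m + 1 = n)
    (hp : n + 1 = p) (z : K.X n) (hz : (K.d n p).hom z = 0) (e : L.X m)
    (he : (L.d m n).hom e = (f.f n).hom z) : ∃ e' : K.X m, (K.d m n).hom e' = z := by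
  obtain rfl : m = n - 1 := by omega
  subst hp
  exact ((quasiIso_iff f).1 hf n).2 z hz e he

lemma units_smul_smul {V : Type x} [AddCommGroup V] (s : ℤˣ) (a : V) : s • s • a = a := by
  rw [smul_smul, Int.units_mul_self, one_smul]

lemma map_units_smul {V W : Type*} [AddCommGroup V] [Module k V] [AddCommGroup W] [Module k W]
    (f : V →ₗ[k] W) (s : ℤˣ) (a : V) : f (s • a) = s • f a := by
  rw [Units.smul_def, map_zsmul, Units.smul_def]

/-- A complex `C` which is an extension of a shift of `A` by a shift of `B`, with connecting
morphism `f : A ⟶ B` up to signs, is acyclic if and only if `f` is a quasi-isomorphism. -/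
lemma acyclic_iff_quasiIso_of_extension {A B C : CochainComplex (ModuleCat.{x} k) ℤ} (f : A ⟶ B)
    (e : ℤ) (i : ∀ {n m : ℤ}, n + e = m → (B.X n →ₗ[k] C.X m))
    (p : ∀ {m n : ℤ}, n + e = m + 1 → (C.X m →ₗ[k] A.X n))
    (j : ∀ {n m : ℤ}, n + e = m + 1 → (A.X n →ₗ[k] C.X m)) (τ ω : ℤˣ) (υ : ℤ → ℤˣ)
    (di : ∀ {n n' m m' : ℤ} (_ : n + 1 = n') (_ : m + 1 = m') (hm : n + e = m) (hm' : n' + e = m')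
      (b : B.X n), (C.d m m').hom (i hm b) = i hm' ((B.d n n').hom b))
    (dp : ∀ {n n' m m' : ℤ} (_ : n + 1 = n') (_ : m + 1 = m') (hm : n + e = m + 1)
      (hm' : n' + e = m' + 1) (c : C.X m), p hm' ((C.d m m').hom c) = τ • (A.d n n').hom (p hm c))
    (dj : ∀ {n n' m m' : ℤ} (_ : n + 1 = n') (_ : m + 1 = m') (hm : n + e = m + 1)
      (hm' : n' + e = m' + 1) (hi : n + e = m') (a : A.X n),
      (C.d m m').hom (j hm a) = υ n • i hi ((f.f n).hom a) + ω • j hm' ((A.d n n').hom a))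
    (pj : ∀ {n m : ℤ} (h : n + e = m + 1) (a : A.X n), p h (j h a) = a)
    (pi : ∀ {n n' m : ℤ} (h : n + e = m) (h' : n' + e = m + 1) (b : B.X n), p h' (i h b) = 0)
    (hi : ∀ {n m : ℤ} (h : n + e = m) (b : B.X n), i h b = 0 → b = 0)
    (hp : ∀ {n n' m : ℤ} (h : n + e = m) (h' : n' + e = m + 1) (c : C.X m), p h' c = 0 →
      ∃ b, i h b = c) : C.Acyclic ↔ QuasiIso f := by
  constructor
  · intro h
    rw [quasiIso_iff]
    intro n
    have h₁ : n + e = (n + e - 1) + 1 := by omega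
    have h₂ : n - 1 + e = n + e - 1 := by omega
    have h₃ : n + e - 1 + 1 = n + e := by omega
    have h₄ : n - 1 + 1 = n := by omega
    have h₅ : n + 1 + e = n + e + 1 := by omega
    constructor
    · intro y hy
      obtain ⟨c, hc⟩ := exists_of_acyclic h h₃ rfl (i rfl y) (by
        rw [di rfl rfl rfl h₅, hy, map_zero])
      obtain ⟨b, hb⟩ := hp h₂ h₁ (c - j h₁ (p h₁ c)) (by rw [map_sub, pj, sub_self])
      have ha : (A.d n (n + 1)).hom (p h₁ c) = 0 := by
        have := dp rfl h₃ h₁ h₅ c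
        rw [hc, pi rfl] at this
        rw [← units_smul_smul τ ((A.d n (n + 1)).hom _), ← this, smul_zero]
      refine ⟨υ n • p h₁ c, by rw [map_units_smul, ha, smul_zero], -b, ?_⟩
      have e₁ : c = j h₁ (p h₁ c) + i h₂ b := by rw [hb, add_sub_cancel]
      rw [e₁, map_add, dj rfl h₃ h₁ h₅ rfl, ha, di h₄ h₃ h₂ rfl, map_zero, smul_zero, add_zero,
        ← map_units_smul] at hc
      have e₂ := hi rfl (υ n • (f.f n).hom (p h₁ c) + (B.d (n - 1) n).hom b - y) (by
        rw [map_sub, map_add, hc, sub_self])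
      rw [map_neg, map_units_smul, eq_comm, ← sub_eq_zero, ← e₂]
      abel
    · intro z hz b hb
      obtain ⟨c, hc⟩ := exists_of_acyclic h (m := n + e - 1 - 1) (by omega) h₃
        (j h₁ z - υ n • i h₂ b) (by
          rw [map_sub, dj rfl h₃ h₁ h₅ rfl, map_units_smul, di h₄ h₃ h₂ rfl, hb, hz, map_zero,
            smul_zero, add_zero, sub_self])
      have := congrArg (p h₁) hc
      rw [dp h₄ (by omega) (show n - 1 + e = n + e - 1 - 1 + 1 by omega) h₁, map_sub, pj,
        map_units_smul, pi h₂, smul_zero, sub_zero, ← map_units_smul] at this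
      exact ⟨_, this⟩
  · intro h
    rw [acyclic_iff]
    intro m c hc
    obtain ⟨n, h₁⟩ : ∃ n, n + e = m + 1 := ⟨m + 1 - e, by omega⟩
    obtain ⟨l, h₂⟩ : ∃ l, l + e = m := ⟨m - e, by omega⟩
    have h₃ : l + 1 = n := by omega
    have h₄ : (n + 1) + e = m + 1 + 1 := by omega
    have h₅ : m - 1 + 1 = m := by omega
    have h₆ : l + e = m - 1 + 1 := by omega
    have h₇ : l - 1 + e = m - 1 := by omega
    have h₈ : l - 1 + 1 = l := by omega
    have ha : (A.d n (n + 1)).hom (p h₁ c) = 0 := by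
      have := dp rfl rfl h₁ h₄ c
      rw [hc, map_zero] at this
      rw [← units_smul_smul τ ((A.d _ _).hom _), ← this, smul_zero]
    obtain ⟨b, hb⟩ := hp h₂ h₁ (c - j h₁ (p h₁ c)) (by rw [map_sub, pj, sub_self])
    have e₁ : c = j h₁ (p h₁ c) + i h₂ b := by rw [hb, add_sub_cancel]
    have e₂ := hc
    rw [e₁, map_add, dj rfl rfl h₁ h₄ h₁, ha, di h₃ rfl h₂ h₁, map_zero, smul_zero, add_zero,
      ← map_units_smul, ← map_add] at e₂
    have e₃ := hi _ _ e₂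
    generalize p h₁ c = a at *
    obtain ⟨a', ha'⟩ := exists_of_quasiIso' h h₃ rfl a ha (-(υ n • b)) (by
      rw [map_neg, map_units_smul, neg_eq_iff_add_eq_zero, ← smul_zero (υ n), ← e₃, smul_add,
        units_smul_smul, add_comm])
    have e₄ : (B.d l n).hom (b - ω • υ l • (f.f l).hom a') = 0 := by
      have e₅ := dj h₃ h₅ h₆ h₁ h₂ a'
      have e₆ : i h₂ (b - ω • υ l • (f.f l).hom a') = c - ω • (C.d (m - 1) m).hom (j h₆ a') := by
        rw [map_sub, hb, map_units_smul, map_units_smul, e₅, ha', smul_add, units_smul_smul]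
        abel
      refine hi h₁ _ ?_
      rw [← di h₃ rfl h₂ h₁, e₆, map_sub, hc, map_units_smul, d_d_apply, smul_zero, sub_zero]
    obtain ⟨z, hz, y, hy⟩ := exists_of_quasiIso h h₈ h₃ _ e₄
    refine ⟨ω • j h₆ a' + υ l • j h₆ z - i h₇ y, ?_⟩
    rw [map_sub, map_add, map_units_smul, map_units_smul, dj h₃ h₅ h₆ h₁ h₂, dj h₃ h₅ h₆ h₁ h₂,
      di h₈ h₅ h₇ h₂, hy, hz, ha', e₁, map_zero, smul_zero, add_zero, map_sub, map_sub, smul_add,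
      units_smul_smul, units_smul_smul, map_units_smul, map_units_smul]
    abel

lemma exists_comp_eq_of_ker_le {U V W : Type*} [AddCommGroup U] [Module k U] [AddCommGroup V]
    [Module k V] [AddCommGroup W] [Module k W] (g : U →ₗ[k] V) (f : U →ₗ[k] W)
    (h : ∀ z, g z = 0 → f z = 0) : ∃ l : V →ₗ[k] W, ∀ z, l (g z) = f z := by
  obtain ⟨s, hs⟩ := g.rangeRestrict.exists_rightInverse_of_surjective g.range_rangeRestrict
  obtain ⟨l, hl⟩ := (f.comp s).exists_extend
  refine ⟨l, fun z => ?_⟩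
  have h₁ := congrArg (fun t => t (g.rangeRestrict z)) hl
  have h₂ := congrArg (fun t => (t (g.rangeRestrict z)).1) hs
  refine h₁.trans (sub_eq_zero.1 ?_)
  rw [LinearMap.comp_apply, ← map_sub]
  exact h _ (by rw [map_sub, sub_eq_zero]; exact h₂)

section Dual

variable (V : Type y) [AddCommGroup V] [Module k V]

/-- The dual of a complex, with values in a vector space `V`. -/
def dual (K : CochainComplex (ModuleCat.{x} k) ℤ) : CochainComplex (ModuleCat.{max x y} k) ℤ where
  X n := ModuleCat.of k (K.X (-n) →ₗ[k] V)
  d n n' := ModuleCat.ofHom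
    ((n + 1).negOnePow • LinearMap.lcomp k V (K.d (-n') (-n)).hom)
  shape n n' h := by
    have h' : ¬ (ComplexShape.up ℤ).Rel (-n') (-n) := by
      simp only [ComplexShape.up_Rel] at h ⊢
      omega
    have h'' : (K.d (-n') (-n)).hom = 0 := by rw [K.shape _ _ h']; rfl
    ext ξ : 2
    rw [h'']
    refine LinearMap.ext fun b => ?_
    change ((n + 1).negOnePow • ξ.comp (0 : K.X (-n') →ₗ[k] K.X (-n))) b = 0
    rw [LinearMap.comp_zero, smul_zero, LinearMap.zero_apply]
  d_comp_d' n n' n'' _ _ := by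
    have h : (K.d (-n') (-n)).hom ∘ₗ (K.d (-n'') (-n')).hom = 0 := by
      rw [← ModuleCat.hom_comp, K.d_comp_d]; rfl
    ext ξ : 2
    simp only [ModuleCat.hom_comp, ModuleCat.hom_ofHom, LinearMap.comp_apply, Units.smul_def,
      LinearMap.smul_apply, map_zsmul, LinearMap.lcomp_apply', LinearMap.comp_assoc]
    rw [h]
    simp

/-- The differential of the dual of a complex. -/
def dualD (n n' : ℤ) (ξ : K.X (-n) →ₗ[k] V) : K.X (-n') →ₗ[k] V := ((dual V K).d n n').hom ξ

lemma dualD_apply (n n' : ℤ) (ξ : K.X (-n) →ₗ[k] V) (z : K.X (-n')) :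
    dualD V n n' ξ z = ((n + 1).negOnePow : ℤ) • ξ ((K.d (-n') (-n)).hom z) := rfl

/-- The transpose of a morphism of complexes. -/
def dualMap (f : K ⟶ L) : dual V L ⟶ dual V K where
  f n := ModuleCat.ofHom (LinearMap.lcomp k V (f.f (-n)).hom)
  comm' n n' h := by
    ext ξ : 2
    refine LinearMap.ext fun z => ?_
    change ((n + 1).negOnePow • (ξ.comp (f.f (-n)).hom).comp (K.d (-n') (-n)).hom) z =
      ((n + 1).negOnePow • ξ.comp (L.d (-n') (-n)).hom) ((f.f (-n')).hom z)
    change ((n + 1).negOnePow : ℤ) • DFunLike.coe (F := L.X (-n) →ₗ[k] V) ξ _ =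
      ((n + 1).negOnePow : ℤ) • DFunLike.coe (F := L.X (-n) →ₗ[k] V) ξ _
    rw [comm_apply]

variable {V}

lemma dual_d_eq_zero_iff {n n' : ℤ} (ξ : K.X (-n) →ₗ[k] V) :
    ((dual V K).d n n').hom ξ = 0 ↔ ∀ z, ξ ((K.d (-n') (-n)).hom z) = 0 := by
  change dualD V n n' ξ = (0 : K.X (-n') →ₗ[k] V) ↔ _
  rw [LinearMap.ext_iff]
  refine forall_congr' fun z => ?_
  rw [dualD_apply, LinearMap.zero_apply, ← Units.smul_def, smul_eq_zero_iff_eq]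

lemma exists_dual_d_eq {m n n' : ℤ} (hm : m + 1 = n) (hn : -n + 1 = n') (ξ : K.X (-n) →ₗ[k] V)
    (h : ∀ z, (K.d (-n) n').hom z = 0 → ξ z = 0) :
    ∃ ζ : K.X (-m) →ₗ[k] V, ((dual V K).d m n).hom ζ = ξ := by
  obtain rfl : n' = -m := by omega
  obtain ⟨l, hl⟩ := exists_comp_eq_of_ker_le (K.d (-n) (-m)).hom ξ h
  refine ⟨((m + 1).negOnePow : ℤ) • l, LinearMap.ext fun z => ?_⟩
  refine (dualD_apply V m n _ z).trans ?_
  rw [LinearMap.smul_apply, ← Units.smul_def, ← Units.smul_def, units_smul_smul]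
  exact hl z

lemma apply_eq_zero_of_exact {m n n' : ℤ} (ζ : K.X (-m) →ₗ[k] V) (z : K.X (-n))
    (hz : (K.d (-n) n').hom z = 0) (hn : -n + 1 = n') (hm : m + 1 = n) :
    dualD V m n ζ z = 0 := by
  obtain rfl : n' = -m := by omega
  rw [dualD_apply, hz, map_zero, smul_zero]

lemma quasiIso_dualMap {f : K ⟶ L} (hf : QuasiIso f) : QuasiIso (dualMap V f) := by
  rw [quasiIso_iff]
  intro n
  have h₁ : -n + 1 = -(n - 1) := by ring
  have h₂ : -(n + 1) + 1 = -n := by ring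
  constructor
  · intro (ξ : K.X (-n) →ₗ[k] V) hξ
    rw [dual_d_eq_zero_iff] at hξ
    let Z := LinearMap.ker (K.d (-n) (-(n - 1))).hom
    obtain ⟨l, hl⟩ := exists_comp_eq_of_ker_le
      (((f.f (-n)).hom.comp Z.subtype).coprod (L.d (-(n + 1)) (-n)).hom)
      ((ξ.comp Z.subtype).comp (LinearMap.fst k Z (L.X (-(n + 1))))) (by
        rintro ⟨z, e⟩ h
        obtain ⟨e', he'⟩ := exists_of_quasiIso' hf h₂ h₁ z.1 z.2 (-e) (by
          rw [map_neg]
          exact neg_eq_of_add_eq_zero_left h)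
        exact (congrArg ξ he').symm.trans (hξ e'))
    refine ⟨l, ?_, exists_dual_d_eq (by omega) h₁ (l.comp (f.f (-n)).hom - ξ) fun z hz => ?_⟩
    · exact (dual_d_eq_zero_iff (K := L) _).2 fun z => by simpa using hl (0, z)
    · simpa [sub_eq_zero] using hl (⟨z, hz⟩, 0)
  · intro (ζ : L.X (-n) →ₗ[k] V) hζ e he
    rw [dual_d_eq_zero_iff (K := L)] at hζ
    refine exists_dual_d_eq (by omega) h₁ ζ fun y hy => ?_
    obtain ⟨z, hz, a, ha⟩ := exists_of_quasiIso hf h₂ h₁ y hy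
    have h₃ := congrArg ζ ha
    have h₄ := apply_eq_zero_of_exact (K := K) e z hz h₁ (by omega)
    rw [show dualD V _ _ e = ζ.comp (f.f (-n)).hom from he] at h₄
    rw [hζ, map_sub] at h₃
    exact (sub_eq_zero.1 h₃.symm).symm.trans h₄

lemma exists_functional [Nontrivial V] {W : Type*} [AddCommGroup W] [Module k W]
    (p : Submodule k W) (z : W) (hz : z ∉ p) : ∃ ξ : W →ₗ[k] V, (∀ y ∈ p, ξ y = 0) ∧ ξ z ≠ 0 := by
  obtain ⟨φ, h₁, h₂⟩ := p.exists_le_ker_of_notMem hz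
  obtain ⟨v, hv⟩ := exists_ne (0 : V)
  refine ⟨(LinearMap.toSpanSingleton k V v).comp φ, fun y hy => ?_, ?_⟩
  · simp [LinearMap.mem_ker.1 (h₂ hy)]
  · simpa [hv] using h₁

lemma quasiIso_of_dualMap [Nontrivial V] {f : K ⟶ L} (hf : QuasiIso (dualMap V f)) :
    QuasiIso f := by
  rw [quasiIso_iff]
  intro m
  obtain ⟨n, rfl⟩ : ∃ n, m = -n := ⟨-m, by simp⟩
  have h₀ : -(n + 1) = -n - 1 := by ring
  have h₁ : -n + 1 = -(n - 1) := by ring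
  have h₂ : -(n + 1) + 1 = -n := by ring
  rw [← h₀, h₁]
  constructor
  · intro y hy
    by_contra! H
    obtain ⟨ξ, h₃, h₄⟩ := exists_functional (V := V) (LinearMap.range
      (((f.f (-n)).hom.comp (LinearMap.ker (K.d (-n) (-(n - 1))).hom).subtype).coprod
        (L.d (-(n + 1)) (-n)).hom)) y (by
          rintro ⟨⟨z, e⟩, h⟩
          refine H z.1 z.2 (-e) ?_
          rw [map_neg, eq_sub_iff_add_eq, neg_add_eq_iff_eq_add]
          exact h.symm.trans (add_comm _ _))
    have h₅ : ((dual V L).d n (n + 1)).hom ξ = 0 :=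
      (dual_d_eq_zero_iff (K := L) _).2 fun z => h₃ _ ⟨(0, z), by simp⟩
    obtain ⟨e, he⟩ := exists_dual_d_eq (m := n - 1) (by omega) h₁ (ξ.comp (f.f (-n)).hom)
      fun z hz => h₃ _ ⟨(⟨z, hz⟩, 0), by simp⟩
    obtain ⟨ζ, hζ⟩ := exists_of_quasiIso' hf (m := n - 1) (by omega) rfl ξ h₅ e he
    refine h₄ ?_
    rw [show ξ = dualD V (n - 1) n ζ from hζ.symm]
    exact apply_eq_zero_of_exact (K := L) ζ y hy h₁ (by omega)
  · intro z hz e he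
    by_contra H
    obtain ⟨ξ, h₃, h₄⟩ := exists_functional (V := V) (LinearMap.range (K.d (-(n + 1)) (-n)).hom) z H
    obtain ⟨ζ, hζ, η, hη⟩ := exists_of_quasiIso hf (m := n - 1) (by omega) rfl ξ
      ((dual_d_eq_zero_iff (K := K) _).2 fun z => h₃ _ ⟨z, rfl⟩)
    have h₅ := apply_eq_zero_of_exact (K := K) η z hz h₁ (by omega)
    rw [show dualD V _ _ η = LinearMap.comp ζ (f.f (-n)).hom - ξ from hη] at h₅
    have h₆ : DFunLike.coe (F := L.X (-n) →ₗ[k] V) ζ ((f.f (-n)).hom z) = 0 := by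
      rw [← he]
      exact (dual_d_eq_zero_iff (K := L) _).1 hζ e
    exact h₄ ((sub_eq_zero.1 h₅).symm.trans h₆)

lemma exists_eval_eq {H : Type*} [AddCommGroup H] [Module k H] [Module.Finite k H]
    (Λ : (H →ₗ[k] ULift.{y} k) →ₗ[k] ULift.{y} k) : ∃ h : H, ∀ l, Λ l = l h := by
  let e : ULift.{y} k ≃ₗ[k] k := ULift.moduleEquiv
  let Λ' : Module.Dual k (Module.Dual k H) :=
    e.toLinearMap ∘ₗ Λ ∘ₗ LinearMap.compRight k e.symm.toLinearMap
  obtain ⟨h, hh⟩ := (Module.evalEquiv k H).surjective Λ'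
  refine ⟨h, fun l => e.injective ?_⟩
  have h₁ := congrArg (fun t => t (e.toLinearMap ∘ₗ l)) hh
  refine Eq.trans ?_ h₁.symm
  change e (Λ l) = e (Λ _)
  rfl

section Pairing

variable {P : CochainComplex (ModuleCat.{x} k) ℤ}
    (b : ∀ {p q : ℤ}, p + q = 0 → P.X p →ₗ[k] K.X q →ₗ[k] ULift.{y} k)

/-- A pairing of two complexes which is perfect in cohomology, seen from the left, is perfect seen
from the right. -/
lemma exact_of_pairing
    (h₁ : ∀ {p q : ℤ} (h : p + q = 0) (ξ : K.X q →ₗ[k] ULift.{y} k),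
      (∀ z, ξ ((K.d (q - 1) q).hom z) = 0) → ∃ a : P.X p, (P.d p (p + 1)).hom a = 0 ∧
        ∀ z, (K.d q (q + 1)).hom z = 0 → b h a z = ξ z)
    {p q : ℤ} (h : p + q = 0) (z : K.X q) (hz : (K.d q (q + 1)).hom z = 0)
    (hb : ∀ a : P.X p, (P.d p (p + 1)).hom a = 0 → b h a z = 0) :
    ∃ e, (K.d (q - 1) q).hom e = z := by
  by_contra H
  obtain ⟨ξ, h₂, h₃⟩ := exists_functional (V := ULift.{y} k)
    (LinearMap.range (K.d (q - 1) q).hom) z H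
  obtain ⟨a, ha, h₄⟩ := h₁ h ξ fun z => h₂ _ ⟨z, rfl⟩
  exact h₃ ((h₄ z hz).symm.trans (hb a ha))

lemma exists_of_pairing
    (hd : ∀ {p q : ℤ} (h : p + q = 0) (a : P.X p), (P.d p (p + 1)).hom a = 0 →
      ∀ z, b h a ((K.d (q - 1) q).hom z) = 0)
    (h₂ : ∀ {p q : ℤ} (h : p + q = 0) (a : P.X p), (P.d p (p + 1)).hom a = 0 →
      (∀ z, (K.d q (q + 1)).hom z = 0 → b h a z = 0) → ∃ e, (P.d (p - 1) p).hom e = a)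
    {p q : ℤ} (h : p + q = 0) [Module.Finite k (K.homology q)] (ζ : P.X p →ₗ[k] ULift.{y} k)
    (hζ : ∀ a, ζ ((P.d (p - 1) p).hom a) = 0) :
    ∃ z : K.X q, (K.d q (q + 1)).hom z = 0 ∧
      ∀ a, (P.d p (p + 1)).hom a = 0 → b h a z = ζ a := by
  let Z := LinearMap.ker (P.d p (p + 1)).hom
  let Y := LinearMap.ker (K.d q (q + 1)).hom
  obtain ⟨s, hs⟩ := (cls K q).exists_rightInverse_of_surjective
    (LinearMap.range_eq_top.2 (cls_surjective K q))
  have hs' : ∀ c, cls K q (s c) = c := fun c => congrArg (fun t => t c) hs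
  let R : Z →ₗ[k] (K.homology q →ₗ[k] ULift.{y} k) :=
    (LinearMap.lcomp k _ (Y.subtype ∘ₗ s)) ∘ₗ (b h) ∘ₗ Z.subtype
  have hR : ∀ (a : Z) (z : Y), R a (cls K q z) = b h a.1 z.1 := by
    intro a z
    obtain ⟨e, he⟩ := (cls_eq_zero_iff K q (s (cls K q z) - z)).1 (by
      rw [map_sub, hs', sub_self])
    have := hd h a.1 a.2 e
    rw [he] at this
    exact sub_eq_zero.1 ((map_sub (b h a.1) _ _).symm.trans this)
  obtain ⟨Λ, hΛ⟩ := exists_comp_eq_of_ker_le R (ζ ∘ₗ Z.subtype) (by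
    intro a ha
    obtain ⟨e, he⟩ := h₂ h a.1 a.2 fun z hz => by
      rw [← hR a ⟨z, hz⟩, ha, LinearMap.zero_apply]
    exact (congrArg ζ he).symm.trans (hζ e))
  obtain ⟨c, hc⟩ := exists_eval_eq Λ
  obtain ⟨z, rfl⟩ := cls_surjective K q c
  refine ⟨z.1, z.2, fun a ha => ?_⟩
  rw [← hR ⟨a, ha⟩ z, ← hc, hΛ]
  rfl

end Pairing

end Dual

end ModuleComplex
end

noncomputable section

variable {k : Type w} [Field k]

namespace ModuleComplex

/-- The identification of the components of a complex in equal degrees. -/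
def castX (K : CochainComplex (ModuleCat.{x} k) ℤ) {p q : ℤ} (h : p = q) : K.X p →ₗ[k] K.X q :=
  h ▸ LinearMap.id

end ModuleComplex

namespace DGMod

open ModuleComplex

variable {T : DGCat.{w, v, u} k}

section Homs

variable {L M N : DGMod.{x} T}

/-- The components of a morphism of degree `n` of dg modules. -/
def ap {n : ℤ} (φ : (T.dgMod.Hom M N).X n) (t : T.Obj) {p q : ℤ} (h : p + n = q) :
    (M.obj t).X p →ₗ[k] (N.obj t).X q :=
  ((φ.1 t).v p q h).hom

/-- The morphism of degree `n` of dg modules with given components. -/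
def mkHom {n : ℤ} (f : ∀ (t : T.Obj) (p q : ℤ), p + n = q → ((M.obj t).X p →ₗ[k] (N.obj t).X q))
    (hf : ∀ {s t : T.Obj} {m l p m' p' : ℤ} (h : m + l = p) (hm : m + n = m') (hp : p + n = p')
      (h' : m' + l = p') (a : (M.obj t).X m) (g : (T.Hom s t).X l),
      f s _ _ hp (M.act h a g) = N.act h' (f t _ _ hm a) g) : (T.dgMod.Hom M N).X n :=
  (⟨fun t => CochainComplex.HomComplex.Cochain.mk fun p q h => ModuleCat.ofHom (f t _ _ h),
    fun _ _ _ _ _ _ _ h hm hp a g => hf h hm hp _ a g⟩ : homSubmodule M N n)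

lemma hom_ext {n : ℤ} {φ ψ : (T.dgMod.Hom M N).X n}
    (h : ∀ (t : T.Obj) {p q : ℤ} (h : p + n = q) (a : (M.obj t).X p), ap φ t h a = ap ψ t h a) :
    φ = ψ := by
  refine Subtype.ext (funext fun t => ?_)
  ext p q hpq : 2
  exact LinearMap.ext fun a => h t hpq a

lemma ap_act {n : ℤ} (φ : (T.dgMod.Hom M N).X n) {s t : T.Obj} {m l p m' p' : ℤ} (h : m + l = p)
    (hm : m + n = m') (hp : p + n = p') (h' : m' + l = p') (a : (M.obj t).X m)
    (g : (T.Hom s t).X l) : ap φ s hp (M.act h a g) = N.act h' (ap φ t hm a) g :=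
  φ.2 h hm hp a g

lemma ap_comp {m n l p q r : ℤ} (h : m + n = l) (φ : (T.dgMod.Hom L M).X m)
    (ψ : (T.dgMod.Hom M N).X n) (t : T.Obj) (hp : p + l = r) (h₁ : p + m = q) (h₂ : q + n = r)
    (a : (L.obj t).X p) : ap (T.dgMod.comp h φ ψ) t hp a = ap ψ t h₂ (ap φ t h₁ a) :=
  congrArg (fun g : (L.obj t).X p ⟶ (N.obj t).X r => g.hom a)
    (CochainComplex.HomComplex.Cochain.comp_v (φ.1 t) (ψ.1 t) h p q r h₁ h₂)

@[simp]
lemma ap_ident (t : T.Obj) {p : ℤ} (h : p + 0 = p) (a : (M.obj t).X p) :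
    ap (T.dgMod.ident M) t h a = a :=
  congrArg (fun g : (M.obj t).X p ⟶ (M.obj t).X p => g.hom a)
    (CochainComplex.HomComplex.Cochain.ofHom_v (𝟙 (M.obj t)) p)

@[simp]
lemma ap_add {n : ℤ} (φ ψ : (T.dgMod.Hom M N).X n) (t : T.Obj) {p q : ℤ} (h : p + n = q)
    (a : (M.obj t).X p) : ap (φ + ψ) t h a = ap φ t h a + ap ψ t h a := rfl

@[simp]
lemma ap_sub {n : ℤ} (φ ψ : (T.dgMod.Hom M N).X n) (t : T.Obj) {p q : ℤ} (h : p + n = q)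
    (a : (M.obj t).X p) : ap (φ - ψ) t h a = ap φ t h a - ap ψ t h a := rfl

@[simp]
lemma ap_neg {n : ℤ} (φ : (T.dgMod.Hom M N).X n) (t : T.Obj) {p q : ℤ} (h : p + n = q)
    (a : (M.obj t).X p) : ap (-φ) t h a = -ap φ t h a := rfl

@[simp]
lemma ap_zero {n : ℤ} (t : T.Obj) {p q : ℤ} (h : p + n = q)
    (a : (M.obj t).X p) : ap (0 : (T.dgMod.Hom M N).X n) t h a = 0 := rfl

@[simp]
lemma ap_smul {n : ℤ} (c : k) (φ : (T.dgMod.Hom M N).X n) (t : T.Obj) {p q : ℤ} (h : p + n = q)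
    (a : (M.obj t).X p) : ap (c • φ) t h a = c • ap φ t h a := rfl

lemma ap_d {n n' p q p' q' : ℤ} (hn : n + 1 = n') (φ : (T.dgMod.Hom M N).X n) (t : T.Obj)
    (h : p + n' = q) (h₁ : p + n = q') (h₂ : p' + n = q) (a : (M.obj t).X p) :
    ap (((T.dgMod.Hom M N).d n n').hom φ) t h a =
      ((N.obj t).d q' q).hom (ap φ t h₁ a) + n'.negOnePow • ap φ t h₂ (((M.obj t).d p p').hom a) := by
  refine (congrArg (fun g : (M.obj t).X p ⟶ (N.obj t).X q => g.hom a)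
    (CochainComplex.HomComplex.δ_v n n' hn (φ.1 t) p q h q' p' (by omega) (by omega))).trans ?_
  simp only [ModuleCat.hom_add, LinearMap.add_apply, Units.smul_def, ModuleCat.hom_zsmul,
    LinearMap.smul_apply]
  rfl

lemma ap_d_of_closed {n n' p q p' q' : ℤ} (hn : n + 1 = n') (φ : (T.dgMod.Hom M N).X n)
    (hφ : ((T.dgMod.Hom M N).d n n').hom φ = 0) (t : T.Obj)
    (h₁ : p + n = q') (h₂ : p' + n = q) (hp : p + 1 = p') (a : (M.obj t).X p) :
    ap φ t h₂ (((M.obj t).d p p').hom a) = n.negOnePow • ((N.obj t).d q' q).hom (ap φ t h₁ a) := by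
  have := ap_d hn φ t (show p + n' = q by omega) h₁ h₂ a
  rw [hφ, ap_zero, ← hn, Int.negOnePow_succ, Units.neg_smul] at this
  rw [← sub_eq_add_neg] at this
  rw [sub_eq_zero.1 this.symm, units_smul_smul]

/-- A closed morphism of degree `0`, evaluated at an object. -/
def evalMap (φ : (T.dgMod.Hom M N).X 0) (hφ : ((T.dgMod.Hom M N).d 0 1).hom φ = 0) (t : T.Obj) :
    M.obj t ⟶ N.obj t :=
  (evalZ0 T t).map (X := ⟨M⟩) (Y := ⟨N⟩) ⟨φ, hφ⟩

lemma evalMap_apply (φ : (T.dgMod.Hom M N).X 0) (hφ : ((T.dgMod.Hom M N).d 0 1).hom φ = 0)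
    (t : T.Obj) (p : ℤ) (a : (M.obj t).X p) :
    ((evalMap φ hφ t).f p).hom a = ap φ t (add_zero p) a := rfl

end Homs

/-- The dg module with values in a larger universe. -/
def ulift (M : DGMod.{z} T) : DGMod.{max x z} T where
  obj t :=
    { X := fun n => ModuleCat.of k (ULift.{x} ((M.obj t).X n))
      d := fun n n' => ModuleCat.ofHom (ULift.moduleEquiv.symm.toLinearMap ∘ₗ
        ((M.obj t).d n n').hom ∘ₗ ULift.moduleEquiv.toLinearMap)
      shape := fun n n' h => by
        rw [(M.obj t).shape _ _ h]
        rfl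
      d_comp_d' := fun n n' n'' _ _ => ModuleCat.hom_ext (LinearMap.ext fun a =>
        congrArg ULift.up (d_d_apply (M.obj t) n n' n'' a.down)) }
  act h := (((M.act h).comp ULift.moduleEquiv.toLinearMap)).compr₂ ULift.moduleEquiv.symm.toLinearMap
  act_ident h a := congrArg ULift.up (M.act_ident h a.down)
  act_act h₁ h₂ h₃ h₄ a g f := congrArg ULift.up (M.act_act h₁ h₂ h₃ h₄ a.down g f)
  d_act {s t m n p m' n' p'} h hm hn hp a f := by
    refine (congrArg ULift.up (M.d_act h hm hn hp a.down f)).trans ?_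
    simp only [Units.smul_def]
    rfl

/-- The representable dg module `T(-, t)`. -/
def repr (T : DGCat.{w, v, u} k) (t : T.Obj) : DGMod.{v} T where
  obj s := T.Hom s t
  act h := (T.comp ((add_comm _ _).trans h)).flip
  act_ident _ a := T.ident_comp _ a
  act_act _ _ _ _ a g f := (T.assoc _ _ _ _ f g a).symm
  d_act h hm hn hp a f := T.d_comp _ hn hm hp f a

/-- The representable dg module `T(-, t)`, with values in a larger universe. -/
def rep (T : DGCat.{w, v, u} k) (t : T.Obj) : DGMod.{max x u v w} T :=
  ulift.{max x u w} (repr T t)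

/-- The shift of a dg module. -/
def shift (M : DGMod.{x} T) (a : ℤ) : DGMod.{x} T where
  obj t :=
    { X := fun n => (M.obj t).X (n + a)
      d := fun n n' => ModuleCat.ofHom ((a.negOnePow : ℤ) • ((M.obj t).d (n + a) (n' + a)).hom)
      shape := fun n n' h => by
        rw [(M.obj t).shape _ _ fun h' => h (by simp at h' ⊢; omega)]
        exact ModuleCat.hom_ext (smul_zero _)
      d_comp_d' := fun n n' n'' _ _ => ModuleCat.hom_ext (LinearMap.ext fun y => by
        change (a.negOnePow : ℤ) • ((M.obj t).d _ _).hom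
          ((a.negOnePow : ℤ) • ((M.obj t).d _ _).hom y) = 0
        rw [map_zsmul, d_d_apply, smul_zero, smul_zero]) }
  act h := M.act (by omega)
  act_ident _ y := M.act_ident _ y
  act_act _ _ h₃ _ y g f := M.act_act _ _ h₃ _ y g f
  d_act {s t m n p m' n' p'} h hm hn hp y f := by
    have h₁ := M.d_act (show m + a + n = p + a by omega) (show m + a + 1 = m' + a by omega) hn
      (show p + a + 1 = p' + a by omega) y f
    change (a.negOnePow : ℤ) • ((M.obj s).d _ _).hom (M.act _ y f) =
      M.act _ ((a.negOnePow : ℤ) • ((M.obj t).d _ _).hom y) f + (m.negOnePow : ℤ) • M.act _ y _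
    rw [h₁, smul_add, Units.smul_def, smul_smul, ← Units.val_mul, ← Int.negOnePow_add,
      show a + (m + a) = m + 2 * a by ring, Int.negOnePow_add, Int.negOnePow_two_mul, mul_one,
      map_zsmul, LinearMap.smul_apply]

/-- The cochain complex given by its differentials. -/
def _root_.ModuleComplex.ofD (X : ℤ → Type x) [∀ n, AddCommGroup (X n)] [∀ n, Module k (X n)]
    (d : ∀ {n n' : ℤ}, n + 1 = n' → (X n →ₗ[k] X n'))
    (hd : ∀ {n n' n'' : ℤ} (h : n + 1 = n') (h' : n' + 1 = n'') (a : X n), d h' (d h a) = 0) :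
    CochainComplex (ModuleCat.{x} k) ℤ where
  X n := ModuleCat.of k (X n)
  d n n' := if h : n + 1 = n' then ModuleCat.ofHom (d h) else 0
  shape n n' h := dif_neg h
  d_comp_d' n n' n'' h h' := by
    simp only [dif_pos (show n + 1 = n' from h), dif_pos (show n' + 1 = n'' from h')]
    exact ModuleCat.hom_ext (LinearMap.ext (hd h h'))

lemma _root_.ModuleComplex.ofD_d_apply (X : ℤ → Type x) [∀ n, AddCommGroup (X n)]
    [∀ n, Module k (X n)] (d : ∀ {n n' : ℤ}, n + 1 = n' → (X n →ₗ[k] X n')) (hd) {n n' : ℤ}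
    (h : n + 1 = n') (a : X n) : ((ofD X d hd).d n n').hom a = d h a := by
  have : (ofD X d hd).d n n' = ModuleCat.ofHom (d h) := dif_pos h
  rw [this]
  rfl

/-- The dg module given by its differentials and actions. -/
def ofD (X : T.Obj → ℤ → Type x) [∀ t n, AddCommGroup (X t n)] [∀ t n, Module k (X t n)]
    (d : ∀ (t) {n n' : ℤ}, n + 1 = n' → (X t n →ₗ[k] X t n'))
    (hd : ∀ (t) {n n' n'' : ℤ} (h : n + 1 = n') (h' : n' + 1 = n'') (a : X t n),
      d t h' (d t h a) = 0)
    (act : ∀ {s t : T.Obj} {m n p : ℤ}, m + n = p → (X t m →ₗ[k] (T.Hom s t).X n →ₗ[k] X s p))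
    (act_ident : ∀ {t : T.Obj} {m : ℤ} (h : m + 0 = m) (y : X t m), act h y (T.ident t) = y)
    (act_act : ∀ {r s t : T.Obj} {m n l a b p : ℤ} (h₁ : m + n = a) (h₂ : a + l = p)
      (h₃ : l + n = b) (h₄ : m + b = p) (y : X t m) (g : (T.Hom s t).X n) (f : (T.Hom r s).X l),
      act h₂ (act h₁ y g) f = act h₄ y (T.comp h₃ f g))
    (d_act : ∀ {s t : T.Obj} {m n p m' n' p' : ℤ} (h : m + n = p) (hm : m + 1 = m')
      (hn : n + 1 = n') (hp : p + 1 = p') (h₁ : m' + n = p') (h₂ : m + n' = p') (y : X t m)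
      (f : (T.Hom s t).X n), d s hp (act h y f) = act h₁ (d t hm y) f +
        m.negOnePow • act h₂ y (((T.Hom s t).d n n').hom f)) : DGMod.{x} T where
  obj t := ModuleComplex.ofD (X t) (d t) (hd t)
  act h := act h
  act_ident := act_ident
  act_act := act_act
  d_act {s t m n p m' n' p'} h hm hn hp y f :=
    (ofD_d_apply (X s) (d s) (hd s) hp _).trans ((d_act h hm hn hp (by omega) (by omega) y f).trans
      (congrArg (fun z => act (show m' + n = p' by omega) z f + _)
        (ofD_d_apply (X t) (d t) (hd t) hm y).symm))

lemma ofD_d (X : T.Obj → ℤ → Type x) [∀ t n, AddCommGroup (X t n)] [∀ t n, Module k (X t n)]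
    (d : ∀ (t) {n n' : ℤ}, n + 1 = n' → (X t n →ₗ[k] X t n')) (hd)
    (act : ∀ {s t : T.Obj} {m n p : ℤ}, m + n = p → (X t m →ₗ[k] (T.Hom s t).X n →ₗ[k] X s p))
    (h₁) (h₂) (h₃) (t : T.Obj) {n n' : ℤ} (h : n + 1 = n') (a : X t n) :
    (((ofD X d hd act h₁ h₂ h₃).obj t).d n n').hom a = d t h a :=
  ofD_d_apply (X t) (d t) (hd t) h a

/-- The cone of a closed morphism of degree `0` of dg modules. -/
def cone {M N : DGMod.{x} T} (φ : (T.dgMod.Hom M N).X 0)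
    (hφ : ((T.dgMod.Hom M N).d 0 1).hom φ = 0) : DGMod.{x} T :=
  ofD (fun t n => (M.obj t).X (n + 1) × (N.obj t).X n)
    (fun t {n n'} h => LinearMap.prod (-(((M.obj t).d (n + 1) (n' + 1)).hom ∘ₗ LinearMap.fst k _ _))
        (((N.obj t).d n n').hom ∘ₗ LinearMap.snd k _ _ +
          ap φ t ((add_zero _).trans h) ∘ₗ LinearMap.fst k _ _))
    (fun t {n n' n''} h h' a => by
      refine Prod.ext ?_ ?_
      · change -((M.obj t).d _ _).hom (-((M.obj t).d _ _).hom a.1) = 0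
        rw [map_neg, d_d_apply, neg_zero, neg_zero]
      · change ((N.obj t).d _ _).hom (((N.obj t).d _ _).hom a.2 + ap φ t _ a.1) +
            ap φ t _ (-((M.obj t).d _ _).hom a.1) = 0
        rw [map_neg, ap_d_of_closed (zero_add 1) φ hφ t (q' := n') (by omega) _ (by omega) a.1, map_add,
          d_d_apply, Int.negOnePow_zero, one_smul, zero_add]
        exact add_neg_cancel _)
    (fun h => LinearMap.mk₂ k (fun a g => (M.act (by omega) a.1 g, N.act h a.2 g))
      (fun _ _ _ => by simp) (fun _ _ _ => by simp) (fun _ _ _ => by simp) (fun _ _ _ => by simp))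
    (fun h a => Prod.ext (M.act_ident _ _) (N.act_ident _ _))
    (fun _ _ h₃ _ a g f => Prod.ext (M.act_act _ _ h₃ _ _ _ _) (N.act_act _ _ h₃ _ _ _ _))
    (fun {s t m n p m' n' p'} h hm hn hp h₁ h₂ a f => by
      have e₁ := M.d_act (show m + 1 + n = p + 1 by omega) (show m + 1 + 1 = m' + 1 by omega) hn
        (show p + 1 + 1 = p' + 1 by omega) a.1 f
      have e₂ := N.d_act h hm hn hp a.2 f
      have e₃ := ap_act φ (show m + 1 + n = p + 1 by omega) (show m + 1 + 0 = m' by omega)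
        (show p + 1 + 0 = p' by omega) h₁ a.1 f
      refine Prod.ext ?_ ?_
      · change -((M.obj s).d (p + 1) (p' + 1)).hom (M.act _ a.1 f) =
          M.act _ (-((M.obj t).d _ _).hom a.1) f + m.negOnePow • M.act _ a.1 _
        rw [e₁, neg_add, Int.negOnePow_succ, Units.neg_smul, neg_neg, map_neg, LinearMap.neg_apply]
      · change ((N.obj s).d p p').hom (N.act h a.2 f) + ap φ s _ (M.act _ a.1 f) =
          N.act _ (((N.obj t).d _ _).hom a.2 + ap φ t _ a.1) f + m.negOnePow • N.act _ a.2 _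
        rw [e₂, e₃, map_add, LinearMap.add_apply]
        abel)

section Cone

variable {M N : DGMod.{x} T} (φ : (T.dgMod.Hom M N).X 0)
    (hφ : ((T.dgMod.Hom M N).d 0 1).hom φ = 0)

/-- The element of the cone with given components. -/
def coneMk (t : T.Obj) {n : ℤ} (a : (M.obj t).X (n + 1)) (b : (N.obj t).X n) :
    ((cone φ hφ).obj t).X n :=
  ((a, b) : (M.obj t).X (n + 1) × (N.obj t).X n)

lemma exists_coneMk (t : T.Obj) {n : ℤ} (c : ((cone φ hφ).obj t).X n) :
    ∃ a b, c = coneMk φ hφ t a b := ⟨_, _, rfl⟩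

lemma coneMk_add (t : T.Obj) {n : ℤ} (a a' : (M.obj t).X (n + 1)) (b b' : (N.obj t).X n) :
    coneMk φ hφ t a b + coneMk φ hφ t a' b' = coneMk φ hφ t (a + a') (b + b') := rfl

lemma coneMk_zero (t : T.Obj) (n : ℤ) : coneMk φ hφ t (n := n) 0 0 = 0 := rfl

lemma coneMk_inj (t : T.Obj) {n : ℤ} {a a' : (M.obj t).X (n + 1)} {b b' : (N.obj t).X n} :
    coneMk φ hφ t a b = coneMk φ hφ t a' b' ↔ a = a' ∧ b = b' := Prod.ext_iff

lemma cone_d_apply (t : T.Obj) {n n' : ℤ} (h : n + 1 = n') (a : (M.obj t).X (n + 1))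
    (b : (N.obj t).X n) : (((cone φ hφ).obj t).d n n').hom (coneMk φ hφ t a b) =
      coneMk φ hφ t (-((M.obj t).d (n + 1) (n' + 1)).hom a)
        (((N.obj t).d n n').hom b + ap φ t ((add_zero _).trans h) a) :=
  ofD_d (fun t n => (M.obj t).X (n + 1) × (N.obj t).X n) _ _ _ _ _ _ t h (a, b)

lemma cone_act_apply {s t : T.Obj} {m n p : ℤ} (h : m + n = p) (a : (M.obj t).X (m + 1))
    (b : (N.obj t).X m) (f : (T.Hom s t).X n) : (cone φ hφ).act h (coneMk φ hφ t a b) f =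
      coneMk φ hφ s (M.act (show m + 1 + n = p + 1 by omega) a f) (N.act h b f) := rfl

/-- The morphism of degree `0` from the target to the cone. -/
def coneInr : (T.dgMod.Hom N (cone φ hφ)).X 0 :=
  mkHom (N := cone φ hφ) (fun t p q h => (LinearMap.inr k ((M.obj t).X (q + 1)) ((N.obj t).X q)) ∘ₗ
    castX (N.obj t) (by omega)) (by
      intro s t m l p m' p' h hm hp h' a g
      obtain rfl : m = m' := by omega
      obtain rfl : p = p' := by omega
      exact (coneMk_inj φ hφ s).2 ⟨(LinearMap.map_zero₂ _ g).symm, rfl⟩)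

/-- The morphism of degree `-1` from the source to the cone. -/
def coneInl : (T.dgMod.Hom M (cone φ hφ)).X (-1) :=
  mkHom (N := cone φ hφ) (fun t p q h => (LinearMap.inl k ((M.obj t).X (q + 1)) ((N.obj t).X q)) ∘ₗ
    castX (M.obj t) (by omega)) (by
      intro s t m l p m' p' h hm hp h' a g
      obtain rfl : m = m' + 1 := by omega
      obtain rfl : p = p' + 1 := by omega
      exact (coneMk_inj φ hφ s).2 ⟨rfl, (LinearMap.map_zero₂ _ g).symm⟩)

/-- The morphism of degree `1` from the cone to the source. -/
def coneFst : (T.dgMod.Hom (cone φ hφ) M).X 1 :=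
  mkHom (M := cone φ hφ) (fun t p q h => castX (M.obj t) h ∘ₗ
      LinearMap.fst k ((M.obj t).X (p + 1)) ((N.obj t).X p)) (by
      intro s t m l p m' p' h hm hp h' a g
      subst hm hp
      rfl)

/-- The morphism of degree `0` from the cone to the target. -/
def coneSnd : (T.dgMod.Hom (cone φ hφ) N).X 0 :=
  mkHom (M := cone φ hφ) (fun t p q h => castX (N.obj t) (by omega) ∘ₗ
      LinearMap.snd k ((M.obj t).X (p + 1)) ((N.obj t).X p)) (by
      intro s t m l p m' p' h hm hp h' a g
      obtain rfl : m = m' := by omega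
      obtain rfl : p = p' := by omega
      rfl)

@[simp]
lemma ap_coneInr (t : T.Obj) (p : ℤ) (b : (N.obj t).X p) :
    ap (coneInr φ hφ) t (add_zero p) b = coneMk φ hφ t 0 b := rfl

@[simp]
lemma ap_coneInl (t : T.Obj) (p : ℤ) (h : p + 1 + -1 = p) (a : (M.obj t).X (p + 1)) :
    ap (coneInl φ hφ) t h a = coneMk φ hφ t a 0 := rfl

@[simp]
lemma ap_coneFst (t : T.Obj) (p : ℤ) (a : (M.obj t).X (p + 1)) (b : (N.obj t).X p) :
    ap (coneFst φ hφ) t rfl (coneMk φ hφ t a b) = a := rfl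

@[simp]
lemma ap_coneSnd (t : T.Obj) (p : ℤ) (a : (M.obj t).X (p + 1)) (b : (N.obj t).X p) :
    ap (coneSnd φ hφ) t (add_zero p) (coneMk φ hφ t a b) = b := rfl

lemma d_coneInr : ((T.dgMod.Hom N (cone φ hφ)).d 0 1).hom (coneInr φ hφ) = 0 := by
  refine hom_ext fun t p q h b => ?_
  subst h
  rw [ap_d (zero_add 1) _ t rfl (add_zero p) (add_zero _), ap_coneInr, ap_coneInr,
    cone_d_apply φ hφ t rfl]
  simp [coneMk_add, coneMk_zero]

lemma d_coneInl : ((T.dgMod.Hom M (cone φ hφ)).d (-1) 0).hom (coneInl φ hφ) =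
    T.dgMod.comp (add_zero 0) φ (coneInr φ hφ) := by
  refine hom_ext fun t p q h a => ?_
  obtain ⟨p, rfl⟩ : ∃ r, r + 1 = p := ⟨p - 1, by omega⟩
  obtain rfl : p + 1 = q := by omega
  rw [ap_d (by omega) _ t h (show p + 1 + -1 = p by omega) (show p + 1 + 1 + -1 = p + 1 by omega),
    ap_coneInl, ap_coneInl, cone_d_apply φ hφ t rfl, ap_comp _ _ _ t h (add_zero _) (add_zero _),
    ap_coneInr]
  simp [coneMk_add]

lemma d_coneFst : ((T.dgMod.Hom (cone φ hφ) M).d 1 2).hom (coneFst φ hφ) = 0 := by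
  refine hom_ext fun t p q h a => ?_
  obtain ⟨a, b, rfl⟩ := exists_coneMk φ hφ t a
  obtain rfl : p + 1 + 1 = q := by omega
  rw [ap_d (by omega) _ t h rfl rfl, cone_d_apply φ hφ t rfl, ap_coneFst, ap_coneFst]
  simp [Int.negOnePow_even 2 (by decide)]

lemma d_coneSnd : ((T.dgMod.Hom (cone φ hφ) N).d 0 1).hom (coneSnd φ hφ) =
    -T.dgMod.comp (add_zero 1) (coneFst φ hφ) φ := by
  refine hom_ext fun t p q h a => ?_
  obtain ⟨a, b, rfl⟩ := exists_coneMk φ hφ t a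
  subst h
  rw [ap_d (by omega) _ t rfl (add_zero p) (add_zero _), ap_neg,
    ap_comp _ _ _ t rfl rfl (add_zero _), cone_d_apply φ hφ t rfl, ap_coneFst, ap_coneSnd,
    ap_coneSnd]
  simp

lemma coneInl_coneFst : T.dgMod.comp (neg_add_cancel 1) (coneInl φ hφ) (coneFst φ hφ) =
    T.dgMod.ident M := by
  refine hom_ext fun t p q h a => ?_
  obtain ⟨p, rfl⟩ : ∃ r, r + 1 = p := ⟨p - 1, by omega⟩
  obtain rfl : p + 1 = q := by omega
  rw [ap_comp _ _ _ t h (show p + 1 + -1 = p by omega) rfl, ap_ident]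
  rfl

lemma coneInr_coneSnd : T.dgMod.comp (add_zero 0) (coneInr φ hφ) (coneSnd φ hφ) =
    T.dgMod.ident N := by
  refine hom_ext fun t p q h a => ?_
  obtain rfl : p = q := by omega
  rw [ap_comp _ _ _ t h h h, ap_ident]
  rfl

lemma coneInr_coneFst : T.dgMod.comp (zero_add 1) (coneInr φ hφ) (coneFst φ hφ) = 0 := by
  refine hom_ext fun t p q h a => ?_
  subst h
  rw [ap_comp _ _ _ t rfl (add_zero p) rfl]
  rfl

lemma cone_ident : T.dgMod.comp (add_neg_cancel 1) (coneFst φ hφ) (coneInl φ hφ) +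
    T.dgMod.comp (add_zero 0) (coneSnd φ hφ) (coneInr φ hφ) = T.dgMod.ident (cone φ hφ) := by
  refine hom_ext fun t p q h a => ?_
  obtain ⟨a, b, rfl⟩ := exists_coneMk φ hφ t a
  obtain rfl : p = q := by omega
  rw [ap_add, ap_ident, ap_comp _ _ _ t h rfl (show p + 1 + -1 = p by omega), ap_comp _ _ _ t h h h]
  rw [ap_coneFst, ap_coneSnd, ap_coneInl, ap_coneInr, coneMk_add, add_zero, zero_add]

end Cone

end DGMod
end

noncomputable section

variable {k : Type w} [Field k]

namespace DGCat

open ModuleComplex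

variable (T : DGCat.{w, v, u} k)

/-- Composition with a closed morphism of degree `0` on the right. -/
def post (X : T.Obj) {Y Z : T.Obj} (g : (T.Hom Y Z).X 0) (hg : ((T.Hom Y Z).d 0 1).hom g = 0) :
    T.Hom X Y ⟶ T.Hom X Z where
  f n := ModuleCat.ofHom ((T.comp (add_zero n)).flip g)
  comm' n n' h := by
    ext f : 2
    refine (T.d_comp (add_zero n) h (zero_add 1) h f g).trans ?_
    rw [hg, map_zero, zero_add, Int.negOnePow_zero, one_smul]
    rfl

/-- Composition with a closed morphism of degree `0` on the left. -/
def pre {X Y : T.Obj} (f : (T.Hom X Y).X 0) (hf : ((T.Hom X Y).d 0 1).hom f = 0) (Z : T.Obj) :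
    T.Hom Y Z ⟶ T.Hom X Z where
  f n := ModuleCat.ofHom (T.comp (zero_add n) f)
  comm' n n' h := by
    ext g : 2
    refine (T.d_comp (zero_add n) (zero_add 1) h h f g).trans ?_
    rw [hf, map_zero, LinearMap.zero_apply, smul_zero, add_zero]
    rfl

lemma d_comp_of_closed_right {X Y Z : T.Obj} {m n p m' p' : ℤ} (h : m + n = p)
    (hm : m + 1 = m') (hp : p + 1 = p') (h' : m' + n = p') (f : (T.Hom X Y).X m)
    (g : (T.Hom Y Z).X n) (hg : ((T.Hom Y Z).d n (n + 1)).hom g = 0) :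
    ((T.Hom X Z).d p p').hom (T.comp h f g) =
      n.negOnePow • T.comp h' (((T.Hom X Y).d m m').hom f) g := by
  rw [T.d_comp h hm rfl hp, hg, map_zero, zero_add]

lemma d_comp_of_closed_left {X Y Z : T.Obj} {m n p n' p' : ℤ} (h : m + n = p)
    (hn : n + 1 = n') (hp : p + 1 = p') (h' : m + n' = p') (f : (T.Hom X Y).X m)
    (g : (T.Hom Y Z).X n) (hf : ((T.Hom X Y).d m (m + 1)).hom f = 0) :
    ((T.Hom X Z).d p p').hom (T.comp h f g) = T.comp h' f (((T.Hom Y Z).d n n').hom g) := by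
  rw [T.d_comp h rfl hn hp, hf, map_zero, LinearMap.zero_apply, smul_zero, add_zero]

lemma d_comp_of_closed {X Y Z : T.Obj} {m n p : ℤ} (h : m + n = p) (f : (T.Hom X Y).X m)
    (g : (T.Hom Y Z).X n) (hf : ((T.Hom X Y).d m (m + 1)).hom f = 0)
    (hg : ((T.Hom Y Z).d n (n + 1)).hom g = 0) :
    ((T.Hom X Z).d p (p + 1)).hom (T.comp h f g) = 0 := by
  rw [T.d_comp_of_closed_left h rfl rfl (by omega) f g hf, hg, map_zero]

end DGCat

namespace DGMod

open ModuleComplex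

variable {T : DGCat.{w, v, u} k}

/-- The action of a closed morphism of degree `0` on a dg module. -/
def actMap (M : DGMod.{x} T) {s t : T.Obj} (f : (T.Hom s t).X 0)
    (hf : ((T.Hom s t).d 0 1).hom f = 0) : M.obj t ⟶ M.obj s where
  f n := ModuleCat.ofHom ((M.act (add_zero n)).flip f)
  comm' n n' h := by
    ext y : 2
    refine (M.d_act (add_zero n) h (zero_add 1) h y f).trans ?_
    rw [hf, map_zero, smul_zero, add_zero]
    rfl

@[simp]
lemma actMap_apply (M : DGMod.{x} T) {s t : T.Obj} (f : (T.Hom s t).X 0)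
    (hf : ((T.Hom s t).d 0 1).hom f = 0) (n : ℤ) (y : (M.obj t).X n) :
    ((actMap M f hf).f n).hom y = M.act (add_zero n) y f := rfl

section

variable {M N : DGMod.{x} T} (φ : (T.dgMod.Hom M N).X 0)
    (hφ : ((T.dgMod.Hom M N).d 0 1).hom φ = 0)

lemma cone_acyclic_iff (t : T.Obj) :
    ((cone φ hφ).obj t).Acyclic ↔ QuasiIso (evalMap φ hφ t) := by
  refine acyclic_iff_quasiIso_of_extension (evalMap φ hφ t) 0
    (fun {n m} h => ap (coneInr φ hφ) t h) (fun {m n} h => ap (coneFst φ hφ) t (by omega))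
    (fun {n m} h => ap (coneInl φ hφ) t (by omega)) (-1) (-1) (fun _ => 1) ?_ ?_ ?_ ?_ ?_ ?_ ?_
  · intro n n' m m' h h' hm hm' b
    rw [ap_d_of_closed (zero_add 1) _ (d_coneInr φ hφ) t hm hm' h, Int.negOnePow_zero, one_smul]
  · intro n n' m m' h h' hm hm' c
    rw [ap_d_of_closed (show (1 : ℤ) + 1 = 2 by norm_num) _ (d_coneFst φ hφ) t
      (show m + 1 = n by omega) _ h', Int.negOnePow_one]
  · intro n n' m m' h h' hm hm' hi a
    have := ap_d (show (-1 : ℤ) + 1 = 0 by norm_num) (coneInl φ hφ) t hi (show n + -1 = m by omega)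
      (show n' + -1 = m' by omega) a
    rw [d_coneInl, ap_comp _ _ _ t _ (add_zero n) hi, Int.negOnePow_zero, one_smul] at this
    rw [eq_sub_of_add_eq this.symm, sub_eq_add_neg, one_smul, Units.neg_smul, one_smul]
    rfl
  · intro n m h a
    have := ap_comp (neg_add_cancel 1) (coneInl φ hφ) (coneFst φ hφ) t (add_zero n)
      (show n + -1 = m by omega) (by omega) a
    rw [← this, coneInl_coneFst, ap_ident]
  · intro n n' m h h' b
    have := ap_comp (zero_add 1) (coneInr φ hφ) (coneFst φ hφ) t (show n + 1 = n' by omega)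
      h (show m + 1 = n' by omega) b
    rw [← this, coneInr_coneFst, ap_zero]
  · intro n m h b hb
    have := ap_comp (add_zero 0) (coneInr φ hφ) (coneSnd φ hφ) t (add_zero n)
      h (show m + 0 = n by omega) b
    rw [hb, map_zero, coneInr_coneSnd, ap_ident] at this
    exact this
  · intro n n' m h h' c hc
    refine ⟨ap (coneSnd φ hφ) t (show m + 0 = n by omega) c, ?_⟩
    have h₁ := ap_comp (add_zero 0) (coneSnd φ hφ) (coneInr φ hφ) t (add_zero m)
      (show m + 0 = n by omega) h c
    have h₂ := ap_comp (add_neg_cancel 1) (coneFst φ hφ) (coneInl φ hφ) t (add_zero m)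
      (show m + 1 = n' by omega) (show n' + -1 = m by omega) c
    rw [hc, map_zero] at h₂
    have h₃ : ap (T.dgMod.ident (cone φ hφ)) t (add_zero m) c = c := ap_ident t _ c
    rw [← cone_ident, ap_add, h₂, zero_add, h₁] at h₃
    exact h₃

lemma hom_cone_acyclic_iff (W : DGMod.{x} T) :
    (T.dgMod.Hom W (cone φ hφ)).Acyclic ↔ QuasiIso (T.dgMod.post W φ hφ) := by
  refine acyclic_iff_quasiIso_of_extension (T.dgMod.post W φ hφ) 0
    (fun {n m} h => (T.dgMod.comp h).flip (coneInr φ hφ))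
    (fun {m n} h => (T.dgMod.comp (show m + 1 = n by omega)).flip (coneFst φ hφ))
    (fun {n m} h => (T.dgMod.comp (show n + -1 = m by omega)).flip (coneInl φ hφ))
    (-1) (-1) (fun _ => 1) ?_ ?_ ?_ ?_ ?_ ?_ ?_
  · intro n n' m m' h h' hm hm' b
    refine (T.dgMod.d_comp_of_closed_right hm h h' hm' b _ (d_coneInr φ hφ)).trans ?_
    rw [Int.negOnePow_zero, one_smul]
    rfl
  · intro n n' m m' h h' hm hm' c
    have := T.dgMod.d_comp_of_closed_right (show m + 1 = n by omega) h' h (show m' + 1 = n' by omega)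
      c _ (d_coneFst φ hφ)
    rw [Int.negOnePow_one, Units.neg_smul, one_smul] at this
    rw [Units.neg_smul, one_smul]
    exact (neg_eq_iff_eq_neg.2 this).symm
  · intro n n' m m' h h' hm hm' hi a
    have := T.dgMod.d_comp (show n + -1 = m by omega) h (neg_add_cancel 1) h' a (coneInl φ hφ)
    rw [Int.negOnePow_neg, Int.negOnePow_one, Units.neg_smul, one_smul] at this
    refine this.trans ?_
    rw [one_smul, Units.neg_smul, one_smul]
    refine congrArg₂ _ ?_ rfl
    refine Eq.trans ?_ (T.dgMod.assoc (add_zero n) (add_zero 0) hi hi a φ (coneInr φ hφ)).symm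
    exact congrArg _ (d_coneInl φ hφ)
  · intro n m h a
    refine (T.dgMod.assoc _ (neg_add_cancel 1) _ (add_zero n) a (coneInl φ hφ) _).trans ?_
    exact (congrArg _ (coneInl_coneFst φ hφ)).trans (T.dgMod.comp_ident _ a)
  · intro n n' m h h' b
    refine (T.dgMod.assoc h (zero_add 1) (show m + 1 = n' by omega) (by omega) b (coneInr φ hφ)
      _).trans ?_
    exact (congrArg _ (coneInr_coneFst φ hφ)).trans (map_zero _)
  · intro n m h b hb
    have := T.dgMod.assoc h (add_zero 0) (show m + 0 = n by omega) (add_zero n) b (coneInr φ hφ)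
      (coneSnd φ hφ)
    rw [show T.dgMod.comp h b (coneInr φ hφ) = 0 from hb, map_zero, LinearMap.zero_apply,
      coneInr_coneSnd] at this
    exact (this.trans (T.dgMod.comp_ident _ b)).symm
  · intro n n' m h h' c hc
    refine ⟨T.dgMod.comp (show m + 0 = n by omega) c (coneSnd φ hφ), ?_⟩
    refine (T.dgMod.assoc _ (add_zero 0) h (add_zero m) c (coneSnd φ hφ) (coneInr φ hφ)).trans ?_
    have h₂ := T.dgMod.assoc (show m + 1 = n' by omega) (add_neg_cancel 1)
      (show n' + -1 = m by omega) (add_zero m) c (coneFst φ hφ) (coneInl φ hφ)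
    rw [show T.dgMod.comp _ c (coneFst φ hφ) = 0 from hc, map_zero, LinearMap.zero_apply] at h₂
    have h₃ := T.dgMod.comp_ident (add_zero m) c
    refine Eq.trans ?_ h₃
    refine Eq.trans ?_ (congrArg _ (cone_ident φ hφ))
    rw [map_add, ← h₂, zero_add]

lemma cone_hom_acyclic_iff (W : DGMod.{x} T) :
    (T.dgMod.Hom (cone φ hφ) W).Acyclic ↔ QuasiIso (T.dgMod.pre φ hφ W) := by
  refine acyclic_iff_quasiIso_of_extension (T.dgMod.pre φ hφ W) 1
    (fun {n m} h => T.dgMod.comp (show 1 + n = m by omega) (coneFst φ hφ))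
    (fun {m n} h => T.dgMod.comp (show 0 + m = n by omega) (coneInr φ hφ))
    (fun {n m} h => T.dgMod.comp (show 0 + n = m by omega) (coneSnd φ hφ))
    1 1 (fun n => (n + 1).negOnePow) ?_ ?_ ?_ ?_ ?_ ?_ ?_
  · intro n n' m m' h h' hm hm' b
    exact T.dgMod.d_comp_of_closed_left _ h h' _ _ b (d_coneFst φ hφ)
  · intro n n' m m' h h' hm hm' c
    rw [one_smul]
    exact (T.dgMod.d_comp_of_closed_left _ h' h _ _ c (d_coneInr φ hφ)).symm
  · intro n n' m m' h h' hm hm' hi a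
    have := T.dgMod.d_comp (show 0 + n = m by omega) (zero_add 1) h h' (coneSnd φ hφ) a
    refine this.trans ?_
    rw [add_comm, one_smul]
    refine congrArg₂ _ ?_ rfl
    rw [Int.negOnePow_succ, Units.neg_smul, ← smul_neg]
    refine congrArg _ ?_
    refine (congrArg (fun g => T.dgMod.comp (show 1 + n = m' by omega) g a)
      (d_coneSnd φ hφ)).trans ?_
    rw [map_neg, LinearMap.neg_apply]
    exact congrArg _ (T.dgMod.assoc (add_zero 1) (zero_add n) _ _ (coneFst φ hφ) φ a)
  · intro n m h a
    refine (T.dgMod.assoc (add_zero 0) _ (zero_add n) _ (coneInr φ hφ) (coneSnd φ hφ) a).symm.trans ?_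
    exact (congrArg (fun g => T.dgMod.comp (zero_add n) g a) (coneInr_coneSnd φ hφ)).trans
      (T.dgMod.ident_comp _ a)
  · intro n n' m h h' b
    refine (T.dgMod.assoc (zero_add 1) _ (show 1 + n = n' by omega) _ (coneInr φ hφ)
      (coneFst φ hφ) b).symm.trans ?_
    exact (congrArg (fun g => T.dgMod.comp (show 1 + n = n' by omega) g b)
      (coneInr_coneFst φ hφ)).trans (LinearMap.map_zero₂ _ _)
  · intro n m h b hb
    have := T.dgMod.assoc (neg_add_cancel 1) (show 1 + n = m by omega) (zero_add n)
      (show -1 + m = n by omega) (coneInl φ hφ) (coneFst φ hφ) b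
    rw [hb, map_zero, coneInl_coneFst] at this
    exact (T.dgMod.ident_comp _ b).symm.trans this
  · intro n n' m h h' c hc
    refine ⟨T.dgMod.comp (show -1 + m = n by omega) (coneInl φ hφ) c, ?_⟩
    refine (T.dgMod.assoc (add_neg_cancel 1) _ (zero_add m) _ (coneFst φ hφ) (coneInl φ hφ)
      c).symm.trans ?_
    have h₂ := T.dgMod.assoc (add_zero 0) (show 0 + m = n' by omega)
      (zero_add m) (show 0 + n' = m by omega) (coneSnd φ hφ) (coneInr φ hφ) c
    rw [hc, map_zero] at h₂
    have h₃ := T.dgMod.ident_comp (zero_add m) c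
    refine Eq.trans ?_ h₃
    refine Eq.trans ?_ (congrArg (fun g => T.dgMod.comp (zero_add m) g c) (cone_ident φ hφ))
    rw [map_add, LinearMap.add_apply, h₂, add_zero]

end

end DGMod
end

noncomputable section

variable {k : Type w} [Field k]

namespace DGCat

open ModuleComplex

variable (T : DGCat.{w, v, u} k)

lemma hom_acyclic_of_retract {X Y : T.Obj} {n n' : ℤ} (hn : n + n' = 0) (f : (T.Hom Y X).X n)
    (g : (T.Hom X Y).X n')
    (hf : ((T.Hom Y X).d n (n + 1)).hom f = 0) (hg : ((T.Hom X Y).d n' (n' + 1)).hom g = 0)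
    (h : (T.Hom Y Y).X (-1)) (hh : ((T.Hom Y Y).d (-1) 0).hom h = T.comp hn f g - T.ident Y)
    (W : T.Obj) (hX : (T.Hom X W).Acyclic) : (T.Hom Y W).Acyclic := by
  rw [acyclic_iff]
  intro p φ hφ
  obtain ⟨ψ, hψ⟩ := exists_of_acyclic hX (show n' + p - 1 + 1 = n' + p by omega) rfl
    (T.comp rfl g φ) (T.d_comp_of_closed rfl g φ hg hφ)
  refine ⟨T.comp (show n + (n' + p - 1) = p - 1 by omega) f ψ -
    p.negOnePow • T.comp (show -1 + p = p - 1 by omega) h φ, ?_⟩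
  rw [map_sub, T.d_comp_of_closed_left _ (show n' + p - 1 + 1 = n' + p by omega)
    (sub_add_cancel p 1) (by omega) f ψ hf, hψ, map_units_smul,
    T.d_comp_of_closed_right _ (neg_add_cancel 1) (sub_add_cancel p 1) (zero_add p) h φ hφ,
    units_smul_smul, hh, map_sub, LinearMap.sub_apply, T.ident_comp,
    ← T.assoc hn rfl (zero_add p) _ f g φ]
  exact sub_sub_cancel _ _

variable {T}

lemma quasiIso_of_acyclic {K L : CochainComplex (ModuleCat.{x} k) ℤ} (f : K ⟶ L) (hK : K.Acyclic)
    (hL : L.Acyclic) : QuasiIso f := by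
  rw [ModuleComplex.quasiIso_iff]
  intro n
  refine ⟨fun y hy => ?_, fun z hz _ _ => acyclic_iff.1 hK n z hz⟩
  obtain ⟨e, he⟩ := acyclic_iff.1 hL n y hy
  exact ⟨0, map_zero _, -e, by rw [map_neg, he, map_zero, zero_sub]⟩

end DGCat

namespace DGMod

open ModuleComplex

section Yoneda

variable {T : DGCat.{w, v, u} k} {X Y : DGMod.{max x u v w} T}

/-- The morphism from a representable dg module given by an element. -/
def yo {t : T.Obj} {n : ℤ} (a : (X.obj t).X n) : (T.dgMod.Hom (rep.{x} T t) X).X n :=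
  mkHom (M := rep.{x} T t) (fun s p q h => (X.act (by omega) a : (T.Hom s t).X p →ₗ[k] _) ∘ₗ
    (ULift.moduleEquiv (R := k) (M := (T.Hom s t).X p)).toLinearMap)
    (fun h hm hp h' b g => (X.act_act _ _ _ _ _ _ _).symm)

/-- The element of a representable dg module. -/
def repMk {s t : T.Obj} {n : ℤ} (f : (T.Hom s t).X n) : ((rep.{x} T t).obj s).X n := ULift.up f

lemma exists_repMk {s t : T.Obj} {n : ℤ} (a : ((rep.{x} T t).obj s).X n) :
    ∃ f, a = repMk.{x} f := ⟨ULift.down a, rfl⟩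

lemma repMk_inj {s t : T.Obj} {n : ℤ} {f g : (T.Hom s t).X n} (h : repMk.{x} f = repMk g) :
    f = g := congrArg ULift.down h

lemma repMk_zero {s t : T.Obj} {n : ℤ} : repMk.{x} (0 : (T.Hom s t).X n) = 0 := rfl

lemma rep_d {s t : T.Obj} {n n' : ℤ} (f : (T.Hom s t).X n) :
    (((rep.{x} T t).obj s).d n n').hom (repMk f) = repMk (((T.Hom s t).d n n').hom f) := rfl

lemma rep_act {r s t : T.Obj} {m n p : ℤ} (h : m + n = p) (h' : n + m = p) (f : (T.Hom s t).X m)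
    (g : (T.Hom r s).X n) : (rep.{x} T t).act h (repMk f) g = repMk (T.comp h' g f) := rfl

@[simp]
lemma ap_yo {s t : T.Obj} {n p q : ℤ} (a : (X.obj t).X n) (h : p + n = q) (h' : n + p = q)
    (f : (T.Hom s t).X p) : ap (yo.{x} a) s h (repMk f) = X.act h' a f := rfl

lemma ap_repMk {s t : T.Obj} {n p q : ℤ} (φ : (T.dgMod.Hom (rep.{x} T t) X).X n) (h : p + n = q)
    (h' : n + p = q) (f : (T.Hom s t).X p) :
    ap φ s h (repMk f) = X.act h' (ap φ t (zero_add n) (repMk (T.ident t))) f := by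
  rw [← ap_act φ (zero_add p), rep_act _ (add_zero p), T.comp_ident]

lemma yo_ap {t : T.Obj} {n : ℤ} (φ : (T.dgMod.Hom (rep.{x} T t) X).X n) :
    yo.{x} (ap φ t (zero_add n) (repMk (T.ident t))) = φ := by
  refine hom_ext fun s p q h a => ?_
  obtain ⟨f, rfl⟩ := exists_repMk a
  rw [ap_yo _ _ (by omega), ap_repMk φ h (by omega)]

lemma ap_yo_ident {t : T.Obj} {n : ℤ} (a : (X.obj t).X n) :
    ap (yo.{x} a) t (zero_add n) (repMk (T.ident t)) = a := by
  rw [ap_yo _ _ (add_zero n), X.act_ident]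

lemma d_yo {t : T.Obj} {n n' : ℤ} (hn : n + 1 = n') (a : (X.obj t).X n) :
    ((T.dgMod.Hom (rep.{x} T t) X).d n n').hom (yo.{x} a) = yo (((X.obj t).d n n').hom a) := by
  rw [← yo_ap (((T.dgMod.Hom (rep.{x} T t) X).d n n').hom (yo.{x} a)),
    ap_d hn _ t _ (zero_add n) (show 0 + 1 + n = n' by omega), rep_d,
    show ((T.Hom t t).d 0 (0 + 1)).hom (T.ident t) = 0 from T.d_ident t, ap_yo_ident,
    repMk_zero, map_zero, smul_zero, add_zero]

lemma yo_comp {t : T.Obj} {m n p : ℤ} (h : m + n = p) (a : (X.obj t).X m)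
    (φ : (T.dgMod.Hom X Y).X n) : T.dgMod.comp h (yo.{x} a) φ = yo (ap φ t h a) := by
  rw [← yo_ap (T.dgMod.comp h (yo.{x} a) φ), ap_comp _ _ _ t _ (zero_add m) h, ap_yo_ident]

lemma yo_add {t : T.Obj} {n : ℤ} (a b : (X.obj t).X n) : yo.{x} (a + b) = yo a + yo b := by
  rw [← yo_ap (yo a + yo b), ap_add, ap_yo_ident, ap_yo_ident]

end Yoneda

section Shift

variable {T : DGCat.{w, v, u} k} (M : DGMod.{x} T) (c : ℤ)

/-- The element of a shifted dg module. -/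
def shiftMk {t : T.Obj} {n m : ℤ} (h : n + c = m) (a : (M.obj t).X m) : ((shift M c).obj t).X n :=
  castX (M.obj t) h.symm a

/-- The tautological morphism of degree `c` from a shifted dg module. -/
def shiftTo : (T.dgMod.Hom (shift M c) M).X c :=
  mkHom (M := shift M c) (fun t _ _ h => castX (M.obj t) h) (by
    intro s t m l p m' p' h hm hp h' a g
    subst hm hp
    rfl)

/-- The tautological morphism of degree `-c` to a shifted dg module. -/
def shiftFrom : (T.dgMod.Hom M (shift M c)).X (-c) :=
  mkHom (N := shift M c) (fun t p q h => castX (M.obj t) (show p = q + c by omega)) (by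
    intro s t m l p m' p' h hm hp h' a g
    obtain rfl : m = m' + c := by omega
    obtain rfl : p = p' + c := by omega
    rfl)

@[simp]
lemma ap_shiftTo_shiftMk {t : T.Obj} {n m : ℤ} (h : n + c = m) (a : (M.obj t).X m) :
    ap (shiftTo M c) t h (shiftMk M c h a) = a := by
  subst h
  rfl

lemma d_shiftTo : ((T.dgMod.Hom (shift M c) M).d c (c + 1)).hom (shiftTo M c) = 0 := by
  refine hom_ext fun t p q h a => ?_
  obtain rfl : p + 1 + c = q := by omega
  rw [ap_d rfl _ t h rfl rfl]
  change ((M.obj t).d _ _).hom a +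
    (c + 1).negOnePow • (c.negOnePow : ℤ) • ((M.obj t).d _ _).hom a = 0
  rw [Int.negOnePow_succ, Units.neg_smul, ← Units.smul_def, units_smul_smul, add_neg_cancel]

lemma d_shiftFrom : ((T.dgMod.Hom M (shift M c)).d (-c) (-c + 1)).hom (shiftFrom M c) = 0 := by
  refine hom_ext fun t p q h a => ?_
  obtain ⟨r, rfl⟩ : ∃ r, p = r + c := ⟨p - c, by omega⟩
  obtain rfl : r + 1 = q := by omega
  rw [ap_d rfl _ t h (show r + c + -c = r by omega) (show r + 1 + c + -c = r + 1 by omega)]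
  change (c.negOnePow : ℤ) • ((M.obj t).d _ _).hom a +
    (-c + 1).negOnePow • ((M.obj t).d _ _).hom a = 0
  rw [Int.negOnePow_succ, Units.neg_smul, Int.negOnePow_neg, Units.smul_def]
  exact add_neg_cancel _

lemma shiftTo_shiftFrom : T.dgMod.comp (add_neg_cancel c) (shiftTo M c) (shiftFrom M c) =
    T.dgMod.ident (shift M c) := by
  refine hom_ext fun t p q h a => ?_
  obtain rfl : p = q := by omega
  rw [ap_comp _ _ _ t h rfl (by omega), ap_ident]
  rfl

lemma shiftFrom_shiftTo : T.dgMod.comp (neg_add_cancel c) (shiftFrom M c) (shiftTo M c) =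
    T.dgMod.ident M := by
  refine hom_ext fun t p q h a => ?_
  obtain ⟨r, rfl⟩ : ∃ r, p = r + c := ⟨p - c, by omega⟩
  obtain rfl : r + c = q := by omega
  rw [ap_comp _ _ _ t h (show r + c + -c = r by omega) rfl, ap_ident]
  rfl

end Shift

section Coprod

open DirectSum

variable {T : DGCat.{w, v, u} k} {J : Type x} (M : J → DGMod.{max x y} T)

/-- The coproduct of a family of dg modules. -/
def coprod : DGMod.{max x y} T :=
  ofD (fun t n => ⨁ j, ((M j).obj t).X n)
    (fun t {n n'} _ => DirectSum.lmap fun j => (((M j).obj t).d n n').hom)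
    (fun t {n n' n''} _ _ a => by
      refine DFinsupp.ext fun j => ?_
      rw [DirectSum.lmap_apply, DirectSum.lmap_apply, d_d_apply]
      rfl)
    (fun h => LinearMap.mk₂ k (fun a g => DirectSum.lmap (fun j => ((M j).act h).flip g) a)
      (fun _ _ _ => map_add _ _ _) (fun _ _ _ => map_smul _ _ _)
      (fun _ _ _ => DFinsupp.ext fun j => by
        simp only [DirectSum.lmap_apply, DirectSum.add_apply, map_add, LinearMap.add_apply])
      (fun _ _ _ => DFinsupp.ext fun j => by
        simp only [DirectSum.lmap_apply, DirectSum.smul_apply, map_smul, LinearMap.smul_apply]))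
    (fun h y => DFinsupp.ext fun j => (DirectSum.lmap_apply _ _ _).trans ((M j).act_ident _ _))
    (fun h₁ h₂ h₃ h₄ y g f => DFinsupp.ext fun j => by
      simp only [LinearMap.mk₂_apply, DirectSum.lmap_apply, LinearMap.flip_apply]
      exact (M j).act_act _ _ _ _ _ _ _)
    (fun {s t m n p m' n' p'} h hm hn hp h₁ h₂ y f => DFinsupp.ext fun j => by
      simp only [LinearMap.mk₂_apply, DirectSum.lmap_apply, LinearMap.flip_apply, Units.smul_def,
        DirectSum.add_apply]
      refine ((M j).d_act h hm hn hp _ f).trans ?_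
      rw [Units.smul_def]
      rcases Int.units_eq_one_or m.negOnePow with h | h <;> rw [h]
      · simp [DirectSum.lmap_apply]
      · simp only [Units.val_neg, Units.val_one, neg_smul, one_smul]
        exact congrArg₂ _ rfl (congrArg Neg.neg (DirectSum.lmap_apply
          (fun j => ((M j).act h₂).flip (((T.Hom s t).d n n').hom f)) y j).symm))

lemma coprod_d_apply (t : T.Obj) {n n' : ℤ} (h : n + 1 = n')
    (a : ⨁ j, ((M j).obj t).X n) : (((coprod M).obj t).d n n').hom a =
      DirectSum.lmap (fun j => (((M j).obj t).d n n').hom) a :=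
  ofD_d (fun t n => ⨁ j, ((M j).obj t).X n) _ _ _ _ _ _ t h a

open Classical in
/-- The element of a coproduct given by an element of a term. -/
def coprodOf (j : J) {t : T.Obj} {n : ℤ} : ((M j).obj t).X n →ₗ[k] ((coprod M).obj t).X n :=
  (DirectSum.lof k J (fun j => ((M j).obj t).X n) j :)

/-- A component of an element of a coproduct. -/
def coprodComp (j : J) {t : T.Obj} {n : ℤ} : ((coprod M).obj t).X n →ₗ[k] ((M j).obj t).X n :=
  (DirectSum.component k J (fun j => ((M j).obj t).X n) j :)

lemma coprod_ext {t : T.Obj} {n : ℤ} {a b : ((coprod M).obj t).X n}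
    (h : ∀ j, coprodComp M j a = coprodComp M j b) : a = b := DFinsupp.ext h

lemma coprodComp_of (j : J) {t : T.Obj} {n : ℤ} (a : ((M j).obj t).X n) :
    coprodComp M j (coprodOf M j a) = a := by
  classical
  exact DirectSum.component.lof_self k (M := fun j => ((M j).obj t).X n) j a

lemma coprodComp_of_ne {i j : J} (h : i ≠ j) {t : T.Obj} {n : ℤ} (a : ((M i).obj t).X n) :
    coprodComp M j (coprodOf M i a) = 0 := by
  classical
  exact DirectSum.of_eq_of_ne (β := fun j => ((M j).obj t).X n) i j a h.symm

lemma exists_finset_coprodComp {t : T.Obj} {n : ℤ} (a : ((coprod M).obj t).X n) :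
    ∃ s : Finset J, ∀ j, j ∉ s → coprodComp M j a = 0 := by
  classical
  exact ⟨DFinsupp.support (a : ⨁ j, ((M j).obj t).X n), fun j hj => by
    exact DFinsupp.notMem_support_iff.1 hj⟩

lemma coprod_d_of (j : J) {t : T.Obj} {n n' : ℤ} (h : n + 1 = n') (a : ((M j).obj t).X n) :
    (((coprod M).obj t).d n n').hom (coprodOf M j a) =
      coprodOf M j ((((M j).obj t).d n n').hom a) := by
  classical
  exact (coprod_d_apply M t h _).trans (DirectSum.lmap_lof _ _ _)

lemma coprod_act_of (j : J) {s t : T.Obj} {m n p : ℤ} (h : m + n = p) (a : ((M j).obj t).X m)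
    (g : (T.Hom s t).X n) :
    (coprod M).act h (coprodOf M j a) g = coprodOf M j ((M j).act h a g) := by
  classical
  exact DirectSum.lmap_lof (fun j => ((M j).act h).flip g) _ a

lemma coprod_induction {t : T.Obj} {n : ℤ} {p : ((coprod M).obj t).X n → Prop} (h₀ : p 0)
    (h₁ : ∀ j a, p (coprodOf M j a)) (h₂ : ∀ a b, p a → p b → p (a + b))
    (a : ((coprod M).obj t).X n) : p a := by
  classical
  exact DirectSum.induction_on (motive := p) (a : ⨁ j, ((M j).obj t).X n) h₀ h₁ h₂

/-- The inclusion of a term in a coproduct. -/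
def coprodIncl (j : J) : (T.dgMod.Hom (M j) (coprod M)).X 0 :=
  mkHom (N := coprod M) (fun t p q h => coprodOf M j ∘ₗ castX ((M j).obj t) (by omega)) (by
    intro s t m l p m' p' h hm hp h' a g
    obtain rfl : m = m' := by omega
    obtain rfl : p = p' := by omega
    exact (coprod_act_of M j h' a g).symm)

@[simp]
lemma ap_coprodIncl (j : J) {t : T.Obj} {p : ℤ} (h : p + 0 = p) (a : ((M j).obj t).X p) :
    ap (coprodIncl M j) t h a = coprodOf M j a := rfl

lemma d_coprodIncl (j : J) :
    ((T.dgMod.Hom (M j) (coprod M)).d 0 1).hom (coprodIncl M j) = 0 := by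
  refine hom_ext fun t p q h a => ?_
  subst h
  rw [ap_d (zero_add 1) _ t rfl (add_zero p) (add_zero _), ap_coprodIncl, ap_coprodIncl,
    coprod_d_of M j rfl]
  simp

variable {M} {N : DGMod.{max x y} T} {n : ℤ}

/-- The morphism from a coproduct given by its restrictions to the terms. -/
def coprodLift (φ : ∀ j, (T.dgMod.Hom (M j) N).X n) : (T.dgMod.Hom (coprod M) N).X n := by
  classical
  exact mkHom (M := coprod M) (fun t p q h =>
    (DirectSum.toModule k J _ fun j => ap (φ j) t h :
      (⨁ j, ((M j).obj t).X p) →ₗ[k] (N.obj t).X q)) (by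
    intro s t m l p m' p' h hm hp h' a g
    refine coprod_induction M (p := fun a => DirectSum.toModule k J _ (fun j => ap (φ j) s hp)
      ((coprod M).act h a g) = N.act h' (DirectSum.toModule k J _ (fun j => ap (φ j) t hm) a) g)
      ?_ ?_ ?_ a
    · rw [LinearMap.map_zero₂]
      exact (map_zero _).trans ((congrArg (fun z => N.act h' z g) (map_zero _)).trans
        (LinearMap.map_zero₂ _ _)).symm
    · intro j a
      rw [coprod_act_of]
      exact (DirectSum.toModule_lof k (φ := fun j => ap (φ j) s hp) j _).trans
        ((ap_act (φ j) h hm hp h' a g).trans (congrArg (fun z => N.act h' z g)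
          (DirectSum.toModule_lof k (φ := fun j => ap (φ j) t hm) j a).symm))
    · intro a b ha hb
      rw [map_add, LinearMap.add_apply]
      refine (map_add _ _ _).trans ?_
      refine (congrArg₂ _ ha hb).trans ?_
      rw [← LinearMap.add_apply, ← map_add]
      exact congrArg (fun z => N.act h' z g) (map_add _ _ _).symm)

@[simp]
lemma ap_coprodLift_of (φ : ∀ j, (T.dgMod.Hom (M j) N).X n) (j : J) {t : T.Obj} {p q : ℤ}
    (h : p + n = q) (a : ((M j).obj t).X p) :
    ap (coprodLift φ) t h (coprodOf M j a) = ap (φ j) t h a := by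
  classical
  exact DirectSum.toModule_lof k (φ := fun j => ap (φ j) t h) j a

lemma coprodIncl_lift (φ : ∀ j, (T.dgMod.Hom (M j) N).X n) (j : J) :
    T.dgMod.comp (zero_add n) (coprodIncl M j) (coprodLift φ) = φ j :=
  hom_ext fun t p q h a => by
    rw [ap_comp _ _ _ t h (add_zero p) h, ap_coprodIncl, ap_coprodLift_of]

lemma coprod_hom_ext {φ ψ : (T.dgMod.Hom (coprod M) N).X n}
    (h : ∀ j, T.dgMod.comp (zero_add n) (coprodIncl M j) φ =
      T.dgMod.comp (zero_add n) (coprodIncl M j) ψ) : φ = ψ := by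
  refine hom_ext fun t p q hp a => ?_
  refine coprod_induction M (p := fun a => ap φ t hp a = ap ψ t hp a) ?_ ?_ ?_ a
  · rw [map_zero, map_zero]
  · intro j a
    have := congrArg (fun χ => ap χ t hp a) (h j)
    rwa [ap_comp _ _ _ t hp (add_zero p) hp, ap_comp _ _ _ t hp (add_zero p) hp] at this
  · intro a b ha hb
    rw [map_add, map_add, ha, hb]

end Coprod

section RelKProj

variable {T : DGCat.{w, v, u} k} (A : T.Obj → Prop)

/-- A dg module is K-projective relative to a set of objects if all morphism complexes to dg modules
which are acyclic on these objects are acyclic. -/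
def RelKProj (P : DGMod.{x} T) : Prop :=
  ∀ X : DGMod.{x} T, (∀ t, A t → (X.obj t).Acyclic) → (T.dgMod.Hom P X).Acyclic

variable {A}

lemma RelKProj.isKProj {P : DGMod.{x} T} (hP : RelKProj A P) : P.IsKProj :=
  fun X hX => hP X fun t _ => hX t

lemma relKProj_true_iff {P : DGMod.{x} T} : RelKProj (fun _ => True) P ↔ P.IsKProj :=
  ⟨fun h => h.isKProj, fun h X hX => h X fun t => hX t trivial⟩

lemma RelKProj.of_retract {P Q : DGMod.{x} T} (hP : RelKProj A P) {n n' : ℤ} (hn : n + n' = 0)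
    (f : (T.dgMod.Hom Q P).X n) (g : (T.dgMod.Hom P Q).X n')
    (hf : ((T.dgMod.Hom Q P).d n (n + 1)).hom f = 0)
    (hg : ((T.dgMod.Hom P Q).d n' (n' + 1)).hom g = 0) (h : (T.dgMod.Hom Q Q).X (-1))
    (hh : ((T.dgMod.Hom Q Q).d (-1) 0).hom h = T.dgMod.comp hn f g - T.dgMod.ident Q) :
    RelKProj A Q :=
  fun X hX => T.dgMod.hom_acyclic_of_retract hn f g hf hg h hh X (hP X hX)

lemma RelKProj.shift {P : DGMod.{x} T} (hP : RelKProj A P) (c : ℤ) : RelKProj A (P.shift c) :=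
  hP.of_retract (add_neg_cancel c) (shiftTo P c) (shiftFrom P c) (d_shiftTo P c) (d_shiftFrom P c) 0
    (by rw [map_zero, shiftTo_shiftFrom]; exact (sub_self _).symm)

lemma RelKProj.cone {P Q : DGMod.{x} T} (hP : RelKProj A P) (hQ : RelKProj A Q)
    (φ : (T.dgMod.Hom P Q).X 0) (hφ : ((T.dgMod.Hom P Q).d 0 1).hom φ = 0) :
    RelKProj A (cone φ hφ) :=
  fun X hX => (cone_hom_acyclic_iff φ hφ X).2
    (DGCat.quasiIso_of_acyclic _ (hQ X hX) (hP X hX))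

lemma RelKProj.coprod {J : Type x} {P : J → DGMod.{max x y} T} (hP : ∀ j, RelKProj A (P j)) :
    RelKProj A (coprod P) := by
  intro X hX
  rw [acyclic_iff]
  intro n φ hφ
  have H : ∀ j, ∃ ψ, ((T.dgMod.Hom (P j) X).d (n - 1) n).hom ψ =
      T.dgMod.comp (zero_add n) (coprodIncl P j) φ := fun j =>
    exists_of_acyclic (hP j X hX) (sub_add_cancel n 1) rfl _ (T.dgMod.d_comp_of_closed
      (X := P j) (Y := DGMod.coprod P) (Z := X) _ _ _ (d_coprodIncl P j) hφ)
  choose ψ hψ using H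
  refine ⟨coprodLift ψ, coprod_hom_ext fun j => ?_⟩
  refine (T.dgMod.d_comp_of_closed_left (X := P j) (Y := DGMod.coprod P) (Z := X)
    (zero_add (n - 1)) (sub_add_cancel n 1) (sub_add_cancel n 1) _ _ _
    (d_coprodIncl P j)).symm.trans ?_
  rw [← hψ j]
  exact congrArg _ (coprodIncl_lift ψ j)

lemma relKProj_rep {a : T.Obj} (ha : A a) : RelKProj A (rep.{x} T a) := by
  intro X hX
  rw [acyclic_iff]
  intro n φ hφ
  obtain ⟨y, hy⟩ := exists_of_acyclic (hX a ha) (sub_add_cancel n 1) rfl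
    (ap φ a (zero_add n) (repMk (T.ident a))) (by
      have := ap_d (show n + 1 = n + 1 from rfl) φ a (zero_add (n + 1)) (zero_add n)
        (show 0 + 1 + n = n + 1 by omega) (repMk (T.ident a))
      rw [hφ, ap_zero, rep_d] at this
      rw [this, show ((T.Hom a a).d 0 (0 + 1)).hom (T.ident a) = 0 from T.d_ident a, repMk_zero,
        map_zero, smul_zero, add_zero])
  exact ⟨yo.{x} y, by rw [d_yo (sub_add_cancel n 1), hy, yo_ap]⟩

end RelKProj

end DGMod
end

noncomputable section

variable {k : Type w} [Field k]

namespace ModuleComplex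

lemma quasiIso_mk {K L : CochainComplex (ModuleCat.{x} k) ℤ} (f : K ⟶ L)
    (h₁ : ∀ (m : ℤ) (y : L.X (m + 1)), (L.d (m + 1) (m + 1 + 1)).hom y = 0 → ∃ z : K.X (m + 1),
      (K.d (m + 1) (m + 1 + 1)).hom z = 0 ∧
        ∃ e : L.X m, (L.d m (m + 1)).hom e = (f.f (m + 1)).hom z - y)
    (h₂ : ∀ (m : ℤ) (z : K.X (m + 1)), (K.d (m + 1) (m + 1 + 1)).hom z = 0 → ∀ e : L.X m,
      (L.d m (m + 1)).hom e = (f.f (m + 1)).hom z → ∃ e' : K.X m, (K.d m (m + 1)).hom e' = z) :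
    QuasiIso f := by
  have h₁' : ∀ (m n : ℤ) (h : m + 1 = n) (y : L.X n), (L.d n (n + 1)).hom y = 0 → ∃ z : K.X n,
      (K.d n (n + 1)).hom z = 0 ∧ ∃ e : L.X m, (L.d m n).hom e = (f.f n).hom z - y := by
    rintro m _ rfl
    exact h₁ m
  have h₂' : ∀ (m n : ℤ) (h : m + 1 = n) (z : K.X n), (K.d n (n + 1)).hom z = 0 → ∀ e : L.X m,
      (L.d m n).hom e = (f.f n).hom z → ∃ e' : K.X m, (K.d m n).hom e' = z := by
    rintro m _ rfl
    exact h₂ m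
  exact (quasiIso_iff f).2 fun n =>
    ⟨h₁' (n - 1) n (sub_add_cancel n 1), h₂' (n - 1) n (sub_add_cancel n 1)⟩

end ModuleComplex

namespace DGMod

open ModuleComplex

section Hom

variable {T : DGCat.{w, v, u} k} {K L M N : DGMod.{x} T}

lemma hom_assoc {m n l a b p : ℤ} (h₁ : m + n = a) (h₂ : n + l = b) (h₃ : a + l = p)
    (h₄ : m + b = p) (f : (T.dgMod.Hom K L).X m) (g : (T.dgMod.Hom L M).X n)
    (e : (T.dgMod.Hom M N).X l) :
    T.dgMod.comp h₃ (T.dgMod.comp h₁ f g) e = T.dgMod.comp h₄ f (T.dgMod.comp h₂ g e) :=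
  T.dgMod.assoc h₁ h₂ h₃ h₄ f g e

lemma hom_ident_comp {n : ℤ} (h : 0 + n = n) (f : (T.dgMod.Hom K L).X n) :
    T.dgMod.comp h (T.dgMod.ident K) f = f := T.dgMod.ident_comp h f

lemma hom_d_comp_right {m n p m' p' : ℤ} (h : m + n = p) (hm : m + 1 = m') (hp : p + 1 = p')
    (h' : m' + n = p') (f : (T.dgMod.Hom K L).X m) (g : (T.dgMod.Hom L M).X n)
    (hg : ((T.dgMod.Hom L M).d n (n + 1)).hom g = 0) :
    ((T.dgMod.Hom K M).d p p').hom (T.dgMod.comp h f g) =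
      n.negOnePow • T.dgMod.comp h' (((T.dgMod.Hom K L).d m m').hom f) g :=
  T.dgMod.d_comp_of_closed_right h hm hp h' f g hg

lemma hom_d_comp_left {m n p n' p' : ℤ} (h : m + n = p) (hn : n + 1 = n') (hp : p + 1 = p')
    (h' : m + n' = p') (f : (T.dgMod.Hom K L).X m) (g : (T.dgMod.Hom L M).X n)
    (hf : ((T.dgMod.Hom K L).d m (m + 1)).hom f = 0) :
    ((T.dgMod.Hom K M).d p p').hom (T.dgMod.comp h f g) =
      T.dgMod.comp h' f (((T.dgMod.Hom L M).d n n').hom g) :=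
  T.dgMod.d_comp_of_closed_left h hn hp h' f g hf

lemma hom_d_comp_closed {m n p : ℤ} (h : m + n = p) (f : (T.dgMod.Hom K L).X m)
    (g : (T.dgMod.Hom L M).X n) (hf : ((T.dgMod.Hom K L).d m (m + 1)).hom f = 0)
    (hg : ((T.dgMod.Hom L M).d n (n + 1)).hom g = 0) :
    ((T.dgMod.Hom K M).d p (p + 1)).hom (T.dgMod.comp h f g) = 0 :=
  T.dgMod.d_comp_of_closed h f g hf hg

end Hom

section Resolution

variable {T : DGCat.{w, v, u} k} {A : T.Obj → Prop}

/-- The shift of a representable dg module is free on its tautological element. -/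
lemma exists_free_one {a : T.Obj} (ha : A a) (m : ℤ) :
    ∃ (R : DGMod.{max x u v w} T) (e : (R.obj a).X m), RelKProj A R ∧
      ((R.obj a).d m (m + 1)).hom e = 0 ∧
      (∀ (X : DGMod.{max x u v w} T) (n p : ℤ) (h : m + n = p) (c : (X.obj a).X p),
        ∃ φ : (T.dgMod.Hom R X).X n, ap φ a h e = c) ∧
      ∀ (X : DGMod.{max x u v w} T) (n p : ℤ) (h : m + n = p) (φ ψ : (T.dgMod.Hom R X).X n),
        ap φ a h e = ap ψ a h e → φ = ψ := by
  have h₀ : m + -m = 0 := add_neg_cancel m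
  refine ⟨shift (rep.{x} T a) (-m), shiftMk (rep.{x} T a) (-m) (t := a) h₀ (repMk.{x} (T.ident a)),
    (relKProj_rep.{x} ha).shift _, ?_, ?_, ?_⟩
  · obtain ⟨e, he⟩ : ∃ e, e = shiftMk (rep.{x} T a) (-m) (t := a) h₀ (repMk.{x} (T.ident a)) :=
      ⟨_, rfl⟩
    rw [← he]
    have h₁ := ap_d_of_closed (p := m) (p' := m + 1) (q := 1)
      (q' := 0) rfl (shiftTo (rep.{x} T a) (-m)) (d_shiftTo _ _) a h₀ (by ring) rfl e
    rw [he, ap_shiftTo_shiftMk, rep_d, T.d_ident, repMk_zero, smul_zero, ← he] at h₁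
    have h₂ := ap_comp (add_neg_cancel (-m)) (shiftTo (rep.{x} T a) (-m))
      (shiftFrom (rep.{x} T a) (-m)) a (add_zero (m + 1))
      (show m + 1 + -m = 1 by ring) (by ring)
      ((((shift (rep.{x} T a) (-m)).obj a).d m (m + 1)).hom e)
    rw [shiftTo_shiftFrom, h₁, map_zero] at h₂
    exact (ap_ident (M := shift (rep.{x} T a) (-m)) a _ _).symm.trans h₂
  · intro X n p h c
    refine ⟨T.dgMod.comp (show -m + p = n by omega) (shiftTo _ _) (yo.{x} c), ?_⟩
    rw [ap_comp _ _ _ a _ h₀ (zero_add _), ap_shiftTo_shiftMk, ap_yo_ident]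
  · intro X n p h φ ψ H
    have key : ∀ φ : (T.dgMod.Hom (shift (rep.{x} T a) (-m)) X).X n,
        T.dgMod.comp (show -m + p = n by omega) (shiftTo (rep.{x} T a) (-m))
          (yo.{x} (ap φ a h (shiftMk (rep.{x} T a) (-m) (t := a) h₀ (repMk.{x} (T.ident a))))) =
          φ := by
      intro φ
      refine hom_ext fun s i j hij b => ?_
      have h₃ := ap_ident (M := shift (rep.{x} T a) (-m)) s (add_zero i) b
      rw [← shiftTo_shiftFrom, ap_comp _ _ _ s _ rfl (by omega)] at h₃
      rw [ap_comp _ _ _ s hij rfl (by omega)]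
      obtain ⟨f, hf⟩ := exists_repMk (ap (shiftTo (rep.{x} T a) (-m)) s rfl b)
      rw [hf] at h₃ ⊢
      rw [ap_yo _ _ (by omega), ← h₃, ← ap_act φ (show m + (i + -m) = i by omega)]
      refine congrArg _ ?_
      obtain ⟨r, rfl⟩ : ∃ r, i = r + m := ⟨i - m, by omega⟩
      have h₄ := ap_act (shiftFrom (rep.{x} T a) (-m)) (zero_add (r + m + -m))
        (show 0 + - -m = m by ring) (show r + m + -m + - -m = r + m by ring) (by ring)
        (repMk.{x} (T.ident a)) f
      rw [rep_act _ (add_zero _), T.comp_ident] at h₄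
      rw [h₄]
      refine congrArg (fun c => (shift (rep.{x} T a) (-m)).act _ c f) ?_
      have h₅ := ap_ident (M := shift (rep.{x} T a) (-m)) a (add_zero m)
        (shiftMk (rep.{x} T a) (-m) (t := a) h₀ (repMk.{x} (T.ident a)))
      rw [← shiftTo_shiftFrom, ap_comp _ _ _ a _ h₀ (by omega), ap_shiftTo_shiftMk] at h₅
      exact h₅.symm
    rw [← key φ, H, key ψ]

/-- Free dg modules. -/
lemma exists_free {J : Type (max x u v w)} (a : J → T.Obj) (ha : ∀ j, A (a j)) (m : J → ℤ) :
    ∃ (R : DGMod.{max x u v w} T) (e : ∀ j, (R.obj (a j)).X (m j)), RelKProj A R ∧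
      (∀ j, ((R.obj (a j)).d (m j) (m j + 1)).hom (e j) = 0) ∧
      (∀ (X : DGMod.{max x u v w} T) (n : ℤ) (p : J → ℤ) (h : ∀ j, m j + n = p j)
        (c : ∀ j, (X.obj (a j)).X (p j)), ∃ φ : (T.dgMod.Hom R X).X n,
          ∀ j, ap φ (a j) (h j) (e j) = c j) ∧
      ∀ (X : DGMod.{max x u v w} T) (n : ℤ) (p : J → ℤ) (h : ∀ j, m j + n = p j)
        (φ ψ : (T.dgMod.Hom R X).X n),
        (∀ j, ap φ (a j) (h j) (e j) = ap ψ (a j) (h j) (e j)) → φ = ψ := by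
  choose R e h₁ h₂ h₃ h₄ using fun j => exists_free_one.{x} (ha j) (m j)
  refine ⟨coprod.{max x u v w, w, v, u, max x u v w} R, fun j => coprodOf R j (e j),
    RelKProj.coprod.{max x u v w, w, v, u, max x u v w} h₁, fun j => ?_, fun X n p h c => ?_,
    fun X n p h φ ψ H => ?_⟩
  · rw [coprod_d_of.{max x u v w, w, v, u, max x u v w} R j rfl, h₂, map_zero]
  · choose φ hφ using fun j => h₃ j X n _ (h j) (c j)
    refine ⟨coprodLift.{max x u v w, w, v, u, max x u v w} φ, fun j => ?_⟩
    rw [ap_coprodLift_of.{max x u v w, w, v, u, max x u v w}, hφ]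
  · refine coprod_hom_ext.{max x u v w, w, v, u, max x u v w} fun j => h₄ j X n _ (h j) _ _ ?_
    rw [ap_comp _ _ _ _ _ (add_zero (m j)) (h j), ap_comp _ _ _ _ _ (add_zero (m j)) (h j)]
    exact H j

variable (A) in
/-- A cocycle of `P` together with an element of `N` whose differential is its image. -/
structure KillDatum {P N : DGMod.{x} T} (f : (T.dgMod.Hom P N).X 0) where
  /-- the object -/
  pt : T.Obj
  mem : A pt
  /-- the degree -/
  deg : ℤ
  /-- the cocycle -/
  cyc : (P.obj pt).X (deg + 1)
  /-- the element -/
  elt : (N.obj pt).X deg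
  d_cyc : ((P.obj pt).d (deg + 1) (deg + 1 + 1)).hom cyc = 0
  d_elt : ((N.obj pt).d deg (deg + 1)).hom elt = ap f pt (add_zero _) cyc

lemma exists_attach {P N : DGMod.{max x u v w} T} (hP : RelKProj A P) (f : (T.dgMod.Hom P N).X 0)
    (hf : ((T.dgMod.Hom P N).d 0 1).hom f = 0) :
    ∃ (P' : DGMod.{max x u v w} T) (s : (T.dgMod.Hom P P').X 0) (f' : (T.dgMod.Hom P' N).X 0),
      RelKProj A P' ∧ ((T.dgMod.Hom P P').d 0 1).hom s = 0 ∧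
      ((T.dgMod.Hom P' N).d 0 1).hom f' = 0 ∧ T.dgMod.comp (add_zero 0) s f' = f ∧
      ∀ (a : T.Obj) (_ : A a) (m : ℤ) (b : (P.obj a).X (m + 1)) (y : (N.obj a).X m),
        ((P.obj a).d (m + 1) (m + 1 + 1)).hom b = 0 →
        ((N.obj a).d m (m + 1)).hom y = ap f a (add_zero _) b →
        ∃ e : (P'.obj a).X m, ((P'.obj a).d m (m + 1)).hom e = ap s a (add_zero _) b ∧
          ap f' a (add_zero _) e = y := by
  obtain ⟨G, e, hG, he, hG₁, hG₂⟩ := exists_free.{x} (fun j : KillDatum A f => j.pt) (fun j => j.mem)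
    (fun j => j.deg + 1)
  obtain ⟨g, hg₀⟩ := hG₁ P 0 (fun j => j.deg + 1) (fun j => add_zero (j.deg + 1)) fun j => j.cyc
  obtain ⟨h, hh₀⟩ := hG₁ N (-1) (fun j => j.deg) (fun j => add_neg_cancel_right j.deg 1) fun j => j.elt
  beta_reduce at he hg₀ hh₀
  have hg : ((T.dgMod.Hom G P).d 0 1).hom g = 0 := by
    refine hG₂ P 1 (fun j => j.deg + 1 + 1) (fun _ => rfl) _ _ fun j => ?_
    rw [ap_d (zero_add 1) g _ _ (add_zero (j.deg + 1)) (add_zero (j.deg + 1 + 1)), hg₀ j, he j,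
      j.d_cyc, map_zero, smul_zero, add_zero, ap_zero]
  have hh : ((T.dgMod.Hom G N).d (-1) 0).hom h = T.dgMod.comp (add_zero 0) g f := by
    refine hG₂ N 0 (fun j => j.deg + 1) (fun j => add_zero (j.deg + 1)) _ _ fun j => ?_
    rw [ap_d (neg_add_cancel 1) h _ _ (add_neg_cancel_right j.deg 1)
      (add_neg_cancel_right (j.deg + 1) 1), hh₀ j, he j, map_zero, smul_zero, add_zero, j.d_elt,
      ap_comp _ _ _ _ _ (add_zero _) (add_zero _), hg₀ j]
  refine ⟨cone g hg, coneInr g hg, T.dgMod.comp (add_zero 0) (coneSnd g hg) f +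
    T.dgMod.comp (add_neg_cancel 1) (coneFst g hg) h, hG.cone hP g hg, d_coneInr g hg, ?_, ?_, ?_⟩
  · rw [map_add, hom_d_comp_right _ (zero_add 1) (zero_add 1) (add_zero 1) _ _ hf,
      hom_d_comp_left _ (neg_add_cancel 1) (zero_add 1) (add_zero 1) _ _
        (d_coneFst g hg), hh, d_coneSnd, Int.negOnePow_zero, one_smul, map_neg,
      LinearMap.neg_apply, neg_add_eq_zero]
    exact hom_assoc _ _ _ _ _ _ _
  · rw [map_add, ← hom_assoc (add_zero 0) _ (zero_add 0), coneInr_coneSnd,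
      ← hom_assoc (zero_add 1) _ (add_neg_cancel 1), coneInr_coneFst, hom_ident_comp,
      LinearMap.map_zero₂, add_zero]
  · intro a ha m b y hb hy
    let j : KillDatum A f := ⟨a, ha, m, b, y, hb, hy⟩
    refine ⟨coneMk g hg a (e j) 0, ?_, ?_⟩
    · rw [cone_d_apply g hg a rfl, ap_coneInr, map_zero, zero_add]
      exact (coneMk_inj g hg a).2 ⟨neg_eq_zero.2 (he j), hg₀ j⟩
    · rw [ap_add, ap_comp _ _ _ a _ (add_zero m) (add_zero m),
        ap_comp _ _ _ a _ rfl (add_neg_cancel_right m 1), ap_coneFst, ap_coneSnd, map_zero,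
        zero_add]
      exact hh₀ j

/-- The universal property of the attached cells of a stage in the construction of a resolution. -/
def KillsCocycles (A : T.Obj → Prop) {P P' N : DGMod.{x} T} (s : (T.dgMod.Hom P P').X 0)
    (f : (T.dgMod.Hom P N).X 0) (f' : (T.dgMod.Hom P' N).X 0) : Prop :=
  ∀ (a : T.Obj) (_ : A a) (m : ℤ) (b : (P.obj a).X (m + 1)) (y : (N.obj a).X m),
    ((P.obj a).d (m + 1) (m + 1 + 1)).hom b = 0 →
    ((N.obj a).d m (m + 1)).hom y = ap f a (add_zero _) b →
    ∃ e : (P'.obj a).X m, ((P'.obj a).d m (m + 1)).hom e = ap s a (add_zero _) b ∧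
      ap f' a (add_zero _) e = y

/-- A tower of relatively K-projective dg modules over `N`, each of which kills the cocycles of the
previous one which are exact in `N`. -/
structure ResTower (A : T.Obj → Prop) (N : DGMod.{x} T) where
  /-- the stages -/
  P : ℕ → DGMod.{x} T
  /-- the transition morphisms -/
  s (i : ℕ) : (T.dgMod.Hom (P i) (P (i + 1))).X 0
  /-- the morphisms to `N` -/
  f (i : ℕ) : (T.dgMod.Hom (P i) N).X 0
  relKProj (i : ℕ) : RelKProj A (P i)
  d_s (i : ℕ) : ((T.dgMod.Hom (P i) (P (i + 1))).d 0 1).hom (s i) = 0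
  d_f (i : ℕ) : ((T.dgMod.Hom (P i) N).d 0 1).hom (f i) = 0
  s_f (i : ℕ) : T.dgMod.comp (add_zero 0) (s i) (f (i + 1)) = f i
  kills (i : ℕ) : KillsCocycles A (s i) (f i) (f (i + 1))

variable (A) in
/-- A stage in the construction of a resolution. -/
structure ResStage (N : DGMod.{x} T) where
  /-- the dg module -/
  P : DGMod.{x} T
  /-- the morphism to `N` -/
  f : (T.dgMod.Hom P N).X 0
  relKProj : RelKProj A P
  d_f : ((T.dgMod.Hom P N).d 0 1).hom f = 0

lemma nonempty_resTower (A : T.Obj → Prop) (N : DGMod.{max x u v w} T) :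
    Nonempty (ResTower A N) := by
  have H : ∀ S : ResStage A N, ∃ (S' : ResStage A N) (s : (T.dgMod.Hom S.P S'.P).X 0),
      ((T.dgMod.Hom S.P S'.P).d 0 1).hom s = 0 ∧ T.dgMod.comp (add_zero 0) s S'.f = S.f ∧
        KillsCocycles A s S.f S'.f := by
    intro S
    obtain ⟨P', s, f', h₁, h₂, h₃, h₄, h₅⟩ := exists_attach.{x} S.relKProj S.f S.d_f
    exact ⟨⟨P', f', h₁, h₃⟩, s, h₂, h₄, h₅⟩
  choose next s h₁ h₂ h₃ using H
  let S₀ : ResStage A N := ⟨coprod.{0, w, v, u, max x u v w} (fun j : PEmpty.{1} => j.elim), 0,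
    RelKProj.coprod.{0, w, v, u, max x u v w} fun j => j.elim, map_zero _⟩
  let S : ℕ → ResStage A N := Nat.rec S₀ fun _ => next
  exact ⟨{ P := fun i => (S i).P
           s := fun i => s (S i)
           f := fun i => (S i).f
           relKProj := fun i => (S i).relKProj
           d_s := fun i => h₁ (S i)
           d_f := fun i => (S i).d_f
           s_f := fun i => h₂ (S i)
           kills := fun i => h₃ (S i) }⟩

namespace ResTower

variable {N : DGMod.{x} T} (R : ResTower A N)

/-- The coproduct of the stages of a tower. -/
abbrev sum : DGMod.{x} T := coprod.{0, w, v, u, x} R.P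

/-- The sum of the transition morphisms. -/
def tr : (T.dgMod.Hom R.sum R.sum).X 0 :=
  coprodLift.{0, w, v, u, x} fun i => T.dgMod.comp (X := R.P i) (Y := R.P (i + 1)) (Z := R.sum) (add_zero 0)
    (R.s i) (coprodIncl.{0, w, v, u, x} R.P (i + 1))

lemma ap_tr_of (i : ℕ) (a : T.Obj) {n : ℤ} (b : ((R.P i).obj a).X n) :
    ap R.tr a (add_zero n) (coprodOf.{0, w, v, u, x} R.P i b) =
      coprodOf.{0, w, v, u, x} R.P (i + 1) (ap (R.s i) a (add_zero n) b) := by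
  rw [tr, ap_coprodLift_of.{0, w, v, u, x}, ap_comp _ _ _ a _ (add_zero n) (add_zero n), ap_coprodIncl.{0, w, v, u, x}]

lemma d_tr : ((T.dgMod.Hom R.sum R.sum).d 0 1).hom R.tr = 0 := by
  refine coprod_hom_ext.{0, w, v, u, x} fun i => ?_
  have h := hom_d_comp_left (zero_add 0) (zero_add 1) (zero_add 1) (zero_add 1) _ R.tr
    (d_coprodIncl.{0, w, v, u, x} R.P i)
  refine h.symm.trans ?_
  rw [tr, coprodIncl_lift.{0, w, v, u, x}, map_zero]
  exact hom_d_comp_closed (add_zero 0) (R.s i) _ (R.d_s i) (d_coprodIncl.{0, w, v, u, x} R.P (i + 1))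

/-- The difference of the identity and the transition morphism. -/
def U : (T.dgMod.Hom R.sum R.sum).X 0 := T.dgMod.ident R.sum - R.tr

lemma d_U : ((T.dgMod.Hom R.sum R.sum).d 0 1).hom R.U = 0 := by
  rw [U, map_sub, d_tr]
  exact (sub_zero _).trans (T.dgMod.d_ident R.sum)

lemma ap_U (a : T.Obj) {n : ℤ} (b : (R.sum.obj a).X n) :
    ap R.U a (add_zero n) b = b - ap R.tr a (add_zero n) b := by
  rw [U, ap_sub, ap_ident]

lemma ap_U_of (i : ℕ) (a : T.Obj) {n : ℤ} (b : ((R.P i).obj a).X n) :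
    ap R.U a (add_zero n) (coprodOf.{0, w, v, u, x} R.P i b) = coprodOf.{0, w, v, u, x} R.P i b -
      coprodOf.{0, w, v, u, x} R.P (i + 1) (ap (R.s i) a (add_zero n) b) := by
  rw [ap_U, ap_tr_of]

lemma comp_tr_zero (a : T.Obj) {n : ℤ} (b : (R.sum.obj a).X n) :
    coprodComp.{0, w, v, u, x} R.P 0 (ap R.tr a (add_zero n) b) = 0 := by
  refine coprod_induction.{0, w, v, u, x} R.P
    (p := fun b => coprodComp.{0, w, v, u, x} R.P 0 (ap R.tr a (add_zero n) b) = 0) ?_ ?_ ?_ b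
  · rw [map_zero, map_zero]
  · intro i b
    rw [ap_tr_of, coprodComp_of_ne.{0, w, v, u, x} R.P (Nat.succ_ne_zero i)]
  · intro b c hb hc
    rw [map_add, map_add, hb, hc, add_zero]

lemma comp_tr_succ (i : ℕ) (a : T.Obj) {n : ℤ} (b : (R.sum.obj a).X n) :
    coprodComp.{0, w, v, u, x} R.P (i + 1) (ap R.tr a (add_zero n) b) =
      ap (R.s i) a (add_zero n) (coprodComp.{0, w, v, u, x} R.P i b) := by
  refine coprod_induction.{0, w, v, u, x} R.P
    (p := fun b => coprodComp.{0, w, v, u, x} R.P (i + 1) (ap R.tr a (add_zero n) b) =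
      ap (R.s i) a (add_zero n) (coprodComp.{0, w, v, u, x} R.P i b)) ?_ ?_ ?_ b
  · simp only [map_zero]
  · intro j b
    rw [ap_tr_of]
    by_cases h : j = i
    · subst h
      rw [coprodComp_of.{0, w, v, u, x}, coprodComp_of.{0, w, v, u, x}]
    · rw [coprodComp_of_ne.{0, w, v, u, x} R.P (show j + 1 ≠ i + 1 by omega),
        coprodComp_of_ne.{0, w, v, u, x} R.P h, map_zero]
  · intro b c hb hc
    simp only [map_add, hb, hc]

lemma comp_eq_zero_of_lt (i : ℕ) (a : T.Obj) {n : ℤ} (b : (R.sum.obj a).X n)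
    (h : ∀ j < i, coprodComp.{0, w, v, u, x} R.P j (ap R.U a (add_zero n) b) = 0) :
    ∀ j < i, coprodComp.{0, w, v, u, x} R.P j b = 0 := by
  intro j
  induction j with
  | zero =>
    intro hj
    have := h 0 hj
    rwa [ap_U, map_sub, comp_tr_zero, sub_zero] at this
  | succ j ih =>
    intro hj
    have := h (j + 1) hj
    rwa [ap_U, map_sub, comp_tr_succ, ih (by omega), map_zero, sub_zero] at this

lemma exists_of_eq (i j : ℕ) (hij : i ≤ j) (a : T.Obj) {n : ℤ} (b : ((R.P i).obj a).X n) :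
    ∃ (b' : ((R.P j).obj a).X n) (c : (R.sum.obj a).X n),
      coprodOf.{0, w, v, u, x} R.P i b = coprodOf.{0, w, v, u, x} R.P j b' + ap R.U a (add_zero n) c := by
  induction j, hij using Nat.le_induction with
  | base => exact ⟨b, 0, by rw [map_zero, add_zero]⟩
  | succ j hj ih =>
    obtain ⟨b', c, h⟩ := ih
    refine ⟨ap (R.s j) a (add_zero n) b', coprodOf.{0, w, v, u, x} R.P j b' + c, ?_⟩
    rw [h, map_add, ap_U_of]
    abel

lemma exists_eq (a : T.Obj) {n : ℤ} (b : (R.sum.obj a).X n) :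
    ∃ (i : ℕ) (b' : ((R.P i).obj a).X n) (c : (R.sum.obj a).X n),
      b = coprodOf.{0, w, v, u, x} R.P i b' + ap R.U a (add_zero n) c := by
  refine coprod_induction.{0, w, v, u, x} R.P (p := fun b => ∃ (i : ℕ) (b' : ((R.P i).obj a).X n)
    (c : (R.sum.obj a).X n), b = coprodOf.{0, w, v, u, x} R.P i b' + ap R.U a (add_zero n) c) ?_ ?_ ?_ b
  · exact ⟨0, 0, 0, by simp only [map_zero, add_zero]⟩
  · exact fun j b => ⟨j, b, 0, by rw [map_zero, add_zero]⟩
  · rintro _ _ ⟨i, b, c, rfl⟩ ⟨j, b', c', rfl⟩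
    obtain ⟨e, g, h⟩ := R.exists_of_eq i (max i j) (le_max_left _ _) a b
    obtain ⟨e', g', h'⟩ := R.exists_of_eq j (max i j) (le_max_right _ _) a b'
    refine ⟨max i j, e + e', g + g' + c + c', ?_⟩
    rw [h, h']
    simp only [map_add]
    abel

/-- The sum of the morphisms of a tower to its target. -/
def toTarget : (T.dgMod.Hom R.sum N).X 0 := coprodLift.{0, w, v, u, x} R.f

lemma d_toTarget : ((T.dgMod.Hom R.sum N).d 0 1).hom R.toTarget = 0 := by
  refine coprod_hom_ext.{0, w, v, u, x} fun i => ?_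
  have h := hom_d_comp_left (zero_add 0) (zero_add 1) (zero_add 1) (zero_add 1) _ R.toTarget
    (d_coprodIncl.{0, w, v, u, x} R.P i)
  refine h.symm.trans ?_
  rw [toTarget, coprodIncl_lift.{0, w, v, u, x}, map_zero, R.d_f]

lemma U_toTarget : T.dgMod.comp (add_zero 0) R.U R.toTarget = 0 := by
  refine coprod_hom_ext.{0, w, v, u, x} fun i => ?_
  refine hom_ext fun a p q h b => ?_
  obtain rfl : p = q := by omega
  rw [ap_comp _ _ _ a h h h, ap_comp _ _ _ a h h h, ap_coprodIncl.{0, w, v, u, x}, ap_U_of, map_sub, toTarget,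
    ap_coprodLift_of.{0, w, v, u, x}, ap_coprodLift_of.{0, w, v, u, x}, map_zero, ap_zero,
    ← ap_comp (add_zero 0) _ _ a h, R.s_f, sub_self]

lemma exists_d_eq (a : T.Obj) (ha : A a) (m : ℤ) (y : (N.obj a).X m) (l : ℕ) : ∀ (i : ℕ)
    (b : ((R.P i).obj a).X (m + 1)) (c : (R.sum.obj a).X (m + 1 + 1)),
    coprodOf.{0, w, v, u, x} R.P i ((((R.P i).obj a).d (m + 1) (m + 1 + 1)).hom b) +
      ap R.U a (add_zero _) c = 0 →
    (∀ j, i + l ≤ j → coprodComp.{0, w, v, u, x} R.P j c = 0) →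
    ((N.obj a).d m (m + 1)).hom y = ap (R.f i) a (add_zero _) b →
    ∃ e : ((cone R.U R.d_U).obj a).X m, (((cone R.U R.d_U).obj a).d m (m + 1)).hom e =
      coneMk R.U R.d_U a c (coprodOf.{0, w, v, u, x} R.P i b) := by
  induction l with
  | zero =>
    intro i b c h₁ h₂ h₃
    have h₄ : ∀ j < i, coprodComp.{0, w, v, u, x} R.P j c = 0 := by
      refine R.comp_eq_zero_of_lt i a c fun j hj => ?_
      have := congrArg (coprodComp.{0, w, v, u, x} R.P j) h₁
      rwa [map_add, coprodComp_of_ne.{0, w, v, u, x} R.P hj.ne', zero_add, map_zero] at this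
    have h₅ : c = 0 := coprod_ext.{0, w, v, u, x} R.P fun j => by
      rw [map_zero]
      rcases lt_or_ge j i with h | h
      · exact h₄ j h
      · exact h₂ j h
    subst h₅
    rw [map_zero, add_zero] at h₁
    have h₆ : (((R.P i).obj a).d (m + 1) (m + 1 + 1)).hom b = 0 := by
      have := congrArg (coprodComp.{0, w, v, u, x} R.P i) h₁
      rwa [coprodComp_of.{0, w, v, u, x}, map_zero] at this
    obtain ⟨e, he, -⟩ := R.kills i a ha m b y h₆ h₃
    refine ⟨coneMk R.U R.d_U a (coprodOf.{0, w, v, u, x} R.P i b) (coprodOf.{0, w, v, u, x} R.P (i + 1) e), ?_⟩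
    rw [cone_d_apply R.U R.d_U a rfl, coprod_d_of.{0, w, v, u, x} R.P i rfl, h₆, map_zero, neg_zero,
      coprod_d_of.{0, w, v, u, x} R.P (i + 1) rfl, he, ap_U_of, add_sub_cancel]
  | succ l ih =>
    intro i b c h₁ h₂ h₃
    obtain ⟨e, he⟩ := ih (i + 1) (ap (R.s i) a (add_zero _) b)
      (c + coprodOf.{0, w, v, u, x} R.P i ((((R.P i).obj a).d (m + 1) (m + 1 + 1)).hom b)) (by
        rw [map_add, ap_U_of, ap_d_of_closed (zero_add 1) _ (R.d_s i) a (add_zero (m + 1)) _ rfl,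
          Int.negOnePow_zero, one_smul]
        refine Eq.trans ?_ h₁
        abel) (fun j hj => by
        rw [map_add, h₂ j (by omega), coprodComp_of_ne.{0, w, v, u, x} R.P (by omega), add_zero]) (by
        rw [h₃, ← R.s_f i, ap_comp _ _ _ a _ (add_zero _) (add_zero _)])
    refine ⟨e + coneMk R.U R.d_U a (coprodOf.{0, w, v, u, x} R.P i b) 0, ?_⟩
    rw [map_add, he, cone_d_apply R.U R.d_U a rfl, coneMk_add, coprod_d_of.{0, w, v, u, x} R.P i rfl,
      map_zero, ap_U_of, zero_add, add_sub_cancel, add_neg_cancel_right]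

end ResTower

lemma exists_relKProj_resolution (A : T.Obj → Prop) (N : DGMod.{max x u v w} T) :
    ∃ (P : DGMod.{max x u v w} T) (f : (T.dgMod.Hom P N).X 0)
      (hf : ((T.dgMod.Hom P N).d 0 1).hom f = 0), RelKProj A P ∧
        ∀ a, A a → QuasiIso (evalMap f hf a) := by
  obtain ⟨R⟩ := nonempty_resTower.{x} A N
  have hR : RelKProj A R.sum := RelKProj.coprod.{0, w, v, u, max x u v w} R.relKProj
  have hf : ((T.dgMod.Hom (cone R.U R.d_U) N).d 0 1).hom
      (T.dgMod.comp (add_zero 0) (coneSnd R.U R.d_U) R.toTarget) = 0 := by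
    rw [hom_d_comp_right _ (zero_add 1) (zero_add 1) (add_zero 1) _ _ R.d_toTarget, d_coneSnd,
      map_neg, LinearMap.neg_apply, hom_assoc (add_zero 1) (add_zero 0) _ (add_zero 1), R.U_toTarget,
      map_zero, neg_zero, smul_zero]
  have hap : ∀ (a : T.Obj) (n : ℤ) (b) (c), ap (T.dgMod.comp (add_zero 0) (coneSnd R.U R.d_U)
      R.toTarget) a (add_zero n) (coneMk R.U R.d_U a b c) = ap R.toTarget a (add_zero n) c := by
    intro a n b c
    rw [ap_comp _ _ _ a _ (add_zero n) (add_zero n), ap_coneSnd]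
  have hof : ∀ (i : ℕ) (a : T.Obj) (n : ℤ) (b : ((R.P i).obj a).X n),
      ap R.toTarget a (add_zero n) (coprodOf.{0, w, v, u, max x u v w} R.P i b) =
        ap (R.f i) a (add_zero n) b := fun i a n b => ap_coprodLift_of.{0, w, v, u, max x u v w} _ _ _ _
  refine ⟨cone R.U R.d_U, T.dgMod.comp (add_zero 0) (coneSnd R.U R.d_U) R.toTarget, hf,
    hR.cone hR _ _, fun a ha => quasiIso_mk _ (fun m y hy => ?_) fun m z hz y hy => ?_⟩
  · obtain ⟨e, he, hy'⟩ := R.kills 0 a ha (m + 1) 0 y (map_zero _) (by rw [hy, map_zero])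
    rw [map_zero] at he
    refine ⟨coneMk R.U R.d_U a 0 (coprodOf.{0, w, v, u, max x u v w} R.P 1 e), ?_, 0, ?_⟩
    · rw [cone_d_apply R.U R.d_U a rfl, map_zero, map_zero,
        coprod_d_of.{0, w, v, u, max x u v w} R.P 1 rfl, he, map_zero, neg_zero, add_zero, coneMk_zero]
    · rw [map_zero, evalMap_apply, hap, hof, hy', sub_self]
  · obtain ⟨α, β, rfl⟩ := exists_coneMk R.U R.d_U a z
    rw [evalMap_apply, hap] at hy
    rw [cone_d_apply R.U R.d_U a rfl, ← coneMk_zero, coneMk_inj] at hz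
    obtain ⟨i, b, c, rfl⟩ := R.exists_eq a β
    rw [map_add, hof, ← ap_comp (add_zero 0) R.U R.toTarget a (add_zero _), R.U_toTarget, ap_zero,
      add_zero] at hy
    obtain ⟨hz₁, hz₂⟩ := hz
    obtain ⟨s, hs⟩ := exists_finset_coprodComp.{0, w, v, u, max x u v w} R.P
      (α + ((R.sum.obj a).d (m + 1) (m + 1 + 1)).hom c)
    obtain ⟨l, hl⟩ : ∃ l, ∀ j ∈ s, j < l := ⟨s.sup id + 1, fun j hj =>
      Nat.lt_succ_of_le (Finset.le_sup (f := id) hj)⟩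
    obtain ⟨e, he⟩ := R.exists_d_eq a ha m y l i b
      (α + ((R.sum.obj a).d (m + 1) (m + 1 + 1)).hom c) (by
        rw [map_add, coprod_d_of.{0, w, v, u, max x u v w} R.P i rfl] at hz₂
        rw [map_add, ← hz₂, ap_d_of_closed (zero_add 1) _ R.d_U a (add_zero (m + 1)) _ rfl,
          Int.negOnePow_zero, one_smul]
        abel) (fun j hj => hs j fun h => by have := hl j h; omega) hy
    refine ⟨e + coneMk R.U R.d_U a c 0, ?_⟩
    rw [map_add, he, cone_d_apply R.U R.d_U a rfl, coneMk_add, map_zero, zero_add,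
      add_neg_cancel_right]

end Resolution

end DGMod
end

noncomputable section

variable {k : Type w} [Field k]

lemma negOnePow_eq_of_even {a b : ℤ} (h : Even (a - b)) :
    (a.negOnePow : ℤ) = (b.negOnePow : ℤ) := by
  rw [(Int.negOnePow_eq_iff a b).2 h]

namespace ModuleComplex

section Ev

variable (V : Type x) [AddCommGroup V] [Module k V] (K : CochainComplex (ModuleCat.{x} k) ℤ)

/-- The evaluation of elements of the dual of a complex. -/
def ev {c b : ℤ} (h : c + b = 0) : (dual V K).X c →ₗ[k] K.X b →ₗ[k] V :=
  LinearMap.lcomp k V (castX K (show b = -c by omega))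

/-- The element of the dual of a complex given by a functional. -/
def mkDual {c b : ℤ} (h : c + b = 0) : (K.X b →ₗ[k] V) →ₗ[k] (dual V K).X c :=
  LinearMap.lcomp k V (castX K (show -c = b by omega))

@[simp]
lemma ev_mkDual {c b : ℤ} (h : c + b = 0) (l : K.X b →ₗ[k] V) (y : K.X b) :
    ev V K h (mkDual V K h l) y = l y := by
  obtain rfl : b = -c := by omega
  rfl

variable {V K}

lemma ev_ext {c b : ℤ} (h : c + b = 0) {ξ ζ : (dual V K).X c}
    (H : ∀ y, ev V K h ξ y = ev V K h ζ y) : ξ = ζ := by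
  obtain rfl : b = -c := by omega
  exact LinearMap.ext H

lemma ev_d {c c' b b' : ℤ} (h : c' + b = 0) (h' : c + b' = 0) (ξ : (dual V K).X c)
    (y : K.X b) : ev V K h (((dual V K).d c c').hom ξ) y =
      ((c + 1).negOnePow : ℤ) • ev V K h' ξ ((K.d b b').hom y) := by
  obtain rfl : b = -c' := by omega
  obtain rfl : b' = -c := by omega
  exact dualD_apply V c c' ξ y

lemma ev_units_smul {c b : ℤ} (h : c + b = 0) (s : ℤ) (ξ : (dual V K).X c) (y : K.X b) :
    ev V K h (s • ξ) y = s • ev V K h ξ y := by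
  rw [map_zsmul, LinearMap.smul_apply]

end Ev

end ModuleComplex

/-- The opposite dg category. -/
def DGCat.op (T : DGCat.{w, v, u} k) : DGCat.{w, v, u} k where
  Obj := T.Obj
  Hom X Y := T.Hom Y X
  comp {X Y Z m n p} h :=
    ((m * n).negOnePow : ℤ) • (T.comp (X := Z) (Y := Y) (Z := X) ((add_comm n m).trans h)).flip
  ident X := T.ident X
  ident_comp h f := by
    rw [LinearMap.smul_apply, LinearMap.smul_apply, LinearMap.flip_apply, T.comp_ident]
    simp
  comp_ident h f := by
    rw [LinearMap.smul_apply, LinearMap.smul_apply, LinearMap.flip_apply, T.ident_comp]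
    simp
  assoc {X Y Z W m n l a b p} h₁ h₂ h₃ h₄ f g e := by
    simp only [LinearMap.smul_apply, LinearMap.flip_apply, map_zsmul, smul_smul]
    rw [T.assoc (show l + n = b by omega) (show n + m = a by omega) (show b + m = p by omega)
      (show l + a = p by omega), ← Units.val_mul, ← Units.val_mul, ← Int.negOnePow_add,
      ← Int.negOnePow_add]
    congr 2
    subst h₁ h₂
    ring_nf
  d_comp {X Y Z m n p m' n' p'} h hm hn hp f g := by
    simp only [LinearMap.smul_apply, LinearMap.flip_apply, map_zsmul, Units.smul_def]
    rw [T.d_comp (show n + m = p by omega) hn hm hp, smul_add, add_comm, smul_smul, Units.smul_def,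
      smul_smul, ← Units.val_mul, ← Units.val_mul, ← Int.negOnePow_add, ← Int.negOnePow_add]
    refine congrArg₂ _ ?_ ?_
    · congr 2
      subst hn
      ring_nf
    · congr 1
      refine negOnePow_eq_of_even ?_
      subst hm
      rw [show m * n - (n + (m + 1) * n) = -(2 * n) by ring]
      simp

lemma DGCat.op_comp (T : DGCat.{w, v, u} k) {X Y Z : T.Obj} {m n p : ℤ} (h : m + n = p)
    (h' : n + m = p) (f : (T.Hom Y X).X m) (g : (T.Hom Z Y).X n) :
    T.op.comp (X := X) (Y := Y) (Z := Z) h f g = ((m * n).negOnePow : ℤ) • T.comp h' g f := rfl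

/-- The identification of a dg category with the opposite of its opposite. -/
def DGCat.toOpOp (T : DGCat.{w, v, u} k) : DGFunctor T T.op.op where
  obj X := X
  map n := LinearMap.id
  map_ident _ := rfl
  map_comp {X Y Z m n p} h f g := by
    refine Eq.trans ?_ (DGCat.op_comp T.op (X := X) (Y := Y) (Z := Z) h (by omega) f g).symm
    refine Eq.trans ?_ (congrArg (fun e => ((m * n).negOnePow : ℤ) • e)
      (DGCat.op_comp T (X := Z) (Y := Y) (Z := X) (by omega) h g f).symm)
    have : ((m * n).negOnePow : ℤ) * ((n * m).negOnePow : ℤ) = 1 := by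
      rw [← Units.val_mul, mul_comm n m, Int.units_mul_self, Units.val_one]
    exact ((smul_smul _ _ _).trans ((congrArg (· • T.comp h f g) this).trans (one_smul ℤ _))).symm
  map_d _ _ _ _ := rfl

namespace DGMod

open ModuleComplex

section Dual

variable {T : DGCat.{w, v, u} k} (V : Type x) [AddCommGroup V] [Module k V]

/-- The action on the dual of a dg module: `(ξ · f)(y) = (-1) ^ (|ξ| |f| + |f|) ξ (y · f)`. -/
def dualAct (M : DGMod.{x} T) {s t : T.Obj} {m n p : ℤ} (h : m + n = p) :
    (dual V (M.obj t)).X m →ₗ[k] (T.Hom t s).X n →ₗ[k] (dual V (M.obj s)).X p :=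
  LinearMap.mk₂ k (fun (ξ : (dual V (M.obj t)).X m) (f : (T.Hom t s).X n) =>
      ((m * n + n).negOnePow : ℤ) • mkDual V (M.obj s) (add_neg_cancel p)
        (ev V (M.obj t) (add_neg_cancel m) ξ ∘ₗ (M.act (show -p + n = -m by omega)).flip f))
    (fun ξ ξ' f => by rw [map_add, LinearMap.add_comp, map_add, smul_add])
    (fun c ξ f => by rw [map_smul, LinearMap.smul_comp, map_smul, smul_comm])
    (fun ξ f f' => by rw [map_add, LinearMap.comp_add, map_add, smul_add])
    (fun c ξ f => by rw [map_smul, LinearMap.comp_smul, map_smul, smul_comm])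

lemma ev_dualAct {M : DGMod.{x} T} {s t : T.Obj} {m n p b c : ℤ} (h : m + n = p)
    (ξ : (dual V (M.obj t)).X m) (f : (T.Hom t s).X n) (h₁ : p + b = 0) (h₂ : m + c = 0)
    (h₃ : b + n = c) (y : (M.obj s).X b) :
    ev V (M.obj s) h₁ (dualAct V M h ξ f) y =
      ((m * n + n).negOnePow : ℤ) • ev V (M.obj t) h₂ ξ (M.act h₃ y f) := by
  obtain rfl : b = -p := by omega
  obtain rfl : c = -m := by omega
  refine (ev_units_smul _ _ _ _).trans ?_
  rw [ev_mkDual]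
  rfl

lemma dualAct_dualAct (M : DGMod.{x} T) {r s t : T.Obj} {m n l a b p : ℤ} (h₁ : m + n = a)
    (h₂ : a + l = p) (h₃ : n + l = b) (h₄ : m + b = p) (ξ : (dual V (M.obj t)).X m)
    (g : (T.Hom t s).X n) (f : (T.Hom s r).X l) :
    dualAct V M h₂ (dualAct V M h₁ ξ g) f =
      dualAct V M h₄ ξ (((l * n).negOnePow : ℤ) • T.comp h₃ g f) := by
  refine ev_ext (add_neg_cancel p) fun y => ?_
  rw [ev_dualAct V h₂ _ f _ (add_neg_cancel a) (show -p + l = -a by omega) y,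
    ev_dualAct V h₁ ξ g _ (add_neg_cancel m) (show -a + n = -m by omega),
    ev_dualAct V h₄ ξ _ _ (add_neg_cancel m) (show -p + b = -m by omega),
    M.act_act _ _ (show n + l = b by omega) (show -p + b = -m by omega), map_zsmul, map_zsmul,
    smul_smul, smul_smul, ← Units.val_mul, ← Units.val_mul, ← Int.negOnePow_add,
    ← Int.negOnePow_add]
  congr 1
  refine negOnePow_eq_of_even ?_
  subst h₁ h₃
  ring_nf
  simp

lemma d_dualAct (M : DGMod.{x} T) {s t : T.Obj} {m n p m' n' p' : ℤ} (h : m + n = p)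
    (hm : m + 1 = m') (hn : n + 1 = n') (hp : p + 1 = p') (h₁ : m' + n = p') (h₂ : m + n' = p')
    (ξ : (dual V (M.obj t)).X m) (f : (T.Hom t s).X n) :
    ((dual V (M.obj s)).d p p').hom (dualAct V M h ξ f) =
      dualAct V M h₁ (((dual V (M.obj t)).d m m').hom ξ) f +
        m.negOnePow • dualAct V M h₂ ξ (((T.Hom t s).d n n').hom f) := by
  refine ev_ext (add_neg_cancel p') fun y => ?_
  rw [map_add, LinearMap.add_apply, Units.smul_def, ev_units_smul, ev_d _ (add_neg_cancel p),
    ev_dualAct V h ξ f _ (add_neg_cancel m) (show -p + n = -m by omega),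
    ev_dualAct V h₁ _ f _ (add_neg_cancel m') (show -p' + n = -m' by omega),
    ev_dualAct V h₂ ξ _ _ (add_neg_cancel m) (show -p' + n' = -m by omega),
    ev_d _ (add_neg_cancel m)]
  have e := M.d_act (show -p' + n = -m' by omega) (show -p' + 1 = -p by omega) hn
    (show -m' + 1 = -m by omega) y f
  rw [e, map_add, Units.smul_def, map_zsmul, smul_add, smul_add, smul_smul, smul_smul, smul_smul,
    smul_smul, smul_smul, add_assoc]
  simp only [← Units.val_mul, ← Int.negOnePow_add]
  have e₁ : ((p + 1 + (m * n + n)).negOnePow : ℤ) = ((m' * n + n + (m + 1)).negOnePow : ℤ) := by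
    refine negOnePow_eq_of_even ?_
    subst h hm
    ring_nf
    simp
  have e₂ : ((m + (m * n' + n')).negOnePow : ℤ) =
      -((m' * n + n + (m + 1 + -p')).negOnePow : ℤ) := by
    rw [← Units.val_neg, ← Int.negOnePow_succ]
    refine negOnePow_eq_of_even ?_
    subst hp h hm hn
    ring_nf
    simp
  rw [e₁, add_assoc (m' * n + n) (m + 1) (-p'), e₂, neg_smul, add_neg_cancel, add_zero]

/-- The dual of a dg module, as a dg module over the opposite dg category. -/
def dualMod (M : DGMod.{x} T) : DGMod.{x} T.op where
  obj t := dual V (M.obj t)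
  act {s t m n p} h := dualAct V M (s := s) (t := t) h
  act_ident {t m} h ξ := by
    refine ev_ext (add_neg_cancel m) fun y => ?_
    refine (ev_dualAct V _ ξ _ _ (add_neg_cancel m) (add_zero _) y).trans ?_
    rw [mul_zero, add_zero, Int.negOnePow_zero, Units.val_one, one_smul]
    exact congrArg _ (M.act_ident _ _)
  act_act {r s t m n l a b p} h₁ h₂ h₃ h₄ ξ g f :=
    dualAct_dualAct V M (r := r) (s := s) (t := t) h₁ h₂ (by omega) h₄ ξ g f
  d_act {s t m n p m' n' p'} h hm hn hp ξ f :=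
    d_dualAct V M (s := s) (t := t) h hm hn hp (by omega) (by omega) ξ f

/-- The dual of a dg module over the opposite dg category. -/
def dualMod' (P : DGMod.{x} T.op) : DGMod.{x} T := T.toOpOp.resObj (dualMod V P)

lemma ev_act' {P : DGMod.{x} T.op} {s t : T.Obj} {m n p b c : ℤ} (h : m + n = p)
    (ξ : ((dualMod' V P).obj t).X m) (f : (T.Hom s t).X n) (h₁ : p + b = 0) (h₂ : m + c = 0)
    (h₃ : b + n = c) (y : (P.obj s).X b) :
    ev V (P.obj s) h₁ ((dualMod' V P).act h ξ f) y =
      ((m * n + n).negOnePow : ℤ) • ev V (P.obj t) h₂ ξ (P.act (s := t) (t := s) h₃ y f) :=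
  ev_dualAct (T := T.op) V h ξ f h₁ h₂ h₃ y

end Dual

end DGMod
end

noncomputable section

variable {k : Type w} [Field k]

namespace DGMod

open ModuleComplex

section Transp

variable {T : DGCat.{w, v, u} k} (V : Type x) [AddCommGroup V] [Module k V]
  {X : DGMod.{x} T} {P : DGMod.{x} T.op}

/-- The value of a dg module over the opposite dg category. -/
def opObj (P : DGMod.{x} T.op) (t : T.Obj) : CochainComplex (ModuleCat.{x} k) ℤ := P.obj t

/-- The action on a dg module over the opposite dg category. -/
def opAct (P : DGMod.{x} T.op) {s t : T.Obj} {m n p : ℤ} (h : m + n = p) :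
    (opObj P t).X m →ₗ[k] (T.Hom t s).X n →ₗ[k] (opObj P s).X p :=
  P.act (s := s) (t := t) h

variable {V}

lemma ev_add_apply {K : CochainComplex (ModuleCat.{x} k) ℤ} {c b : ℤ} (h : c + b = 0)
    (ξ ζ : (dual V K).X c) (y : K.X b) :
    ev V K h (ξ + ζ) y = ev V K h ξ y + ev V K h ζ y :=
  LinearMap.map_add₂ _ _ _ _

/-- The components of a morphism to the dual of a dg module over the opposite dg category. -/
def apD {n : ℤ} (φ : (T.dgMod.Hom X (dualMod' V P)).X n) (t : T.Obj) {p q : ℤ} (h : p + n = q) :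
    (X.obj t).X p →ₗ[k] (dual V (opObj P t)).X q :=
  ap φ t h

/-- The components of a morphism over the opposite dg category to the dual of a dg module. -/
def apD' {n : ℤ} (φ : (T.op.dgMod.Hom P (dualMod V X)).X n) (t : T.Obj) {p q : ℤ} (h : p + n = q) :
    (opObj P t).X p →ₗ[k] (dual V (X.obj t)).X q :=
  ap (T := T.op) φ t h

lemma apD_ext {n : ℤ} {φ ψ : (T.dgMod.Hom X (dualMod' V P)).X n}
    (H : ∀ (t : T.Obj) {p q r : ℤ} (h : p + n = q) (h' : q + r = 0) (y : (X.obj t).X p)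
      (z : (opObj P t).X r), ev V (opObj P t) h' (apD φ t h y) z =
        ev V (opObj P t) h' (apD ψ t h y) z) : φ = ψ :=
  hom_ext fun t _ q h y => ev_ext (K := opObj P t) (add_neg_cancel q) fun z => H t h _ y z

lemma apD'_ext {n : ℤ} {φ ψ : (T.op.dgMod.Hom P (dualMod V X)).X n}
    (H : ∀ (t : T.Obj) {p q r : ℤ} (h : p + n = q) (h' : q + r = 0) (y : (opObj P t).X p)
      (z : (X.obj t).X r), ev V (X.obj t) h' (apD' φ t h y) z =
        ev V (X.obj t) h' (apD' ψ t h y) z) : φ = ψ :=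
  hom_ext (T := T.op) fun t _ q h y => ev_ext (K := X.obj t) (add_neg_cancel q) fun z => H t h _ y z

lemma ev_apD_act {n : ℤ} (φ : (T.dgMod.Hom X (dualMod' V P)).X n) {s t : T.Obj}
    {m l p m' p' b c : ℤ} (h : m + l = p) (hm : m + n = m') (hp : p + n = p') (h₁ : p' + b = 0)
    (h₂ : m' + c = 0) (h₃ : b + l = c) (y : (X.obj t).X m) (g : (T.Hom s t).X l)
    (z : (opObj P s).X b) : ev V (opObj P s) h₁ (apD φ s hp (X.act h y g)) z =
      ((m' * l + l).negOnePow : ℤ) • ev V (opObj P t) h₂ (apD φ t hm y)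
        (opAct P (s := t) (t := s) h₃ z g) :=
  (congrArg (fun e => ev V (opObj P s) h₁ e z) (ap_act φ h hm hp (by omega) y g)).trans
    (ev_act' V (by omega) (ap φ t hm y) g h₁ h₂ h₃ z)

lemma ev_apD'_act {n : ℤ} (φ : (T.op.dgMod.Hom P (dualMod V X)).X n) {s t : T.Obj}
    {m l p m' p' b c : ℤ} (h : m + l = p) (hm : m + n = m') (hp : p + n = p') (h₁ : p' + b = 0)
    (h₂ : m' + c = 0) (h₃ : b + l = c) (y : (opObj P t).X m) (g : (T.Hom t s).X l)
    (z : (X.obj s).X b) : ev V (X.obj s) h₁ (apD' φ s hp (opAct P h y g)) z =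
      ((m' * l + l).negOnePow : ℤ) • ev V (X.obj t) h₂ (apD' φ t hm y) (X.act h₃ z g) :=
  (congrArg (fun e => ev V (X.obj s) h₁ e z)
    (ap_act (T := T.op) φ (s := s) (t := t) h hm hp (by omega) y g)).trans
    (ev_dualAct V (by omega) (apD' φ t hm y) g h₁ h₂ h₃ z)

lemma ev_apD_d {n n' p q p' r r' : ℤ} (hn : n + 1 = n') (φ : (T.dgMod.Hom X (dualMod' V P)).X n)
    (t : T.Obj) (h : p + n' = q) (h₁ : p + n = r') (h₂ : p' + n = q) (h₃ : q + r = 0)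
    (h₄ : r' + p'' = 0) (y : (X.obj t).X p) (z : (opObj P t).X r) :
    ev V (opObj P t) h₃ (apD (((T.dgMod.Hom X (dualMod' V P)).d n n').hom φ) t h y) z =
      ((r' + 1).negOnePow : ℤ) • ev V (opObj P t) h₄ (apD φ t h₁ y) (((opObj P t).d r p'').hom z) +
      (n'.negOnePow : ℤ) • ev V (opObj P t) h₃ (apD φ t h₂ (((X.obj t).d p p').hom y)) z := by
  refine (congrArg (fun e => ev V (opObj P t) h₃ e z) (ap_d hn φ t h h₁ h₂ y)).trans ?_
  exact (ev_add_apply (K := opObj P t) h₃ _ _ z).trans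
    (congrArg₂ _ (ev_d (K := opObj P t) h₃ h₄ _ z) (ev_units_smul _ _ _ _))

lemma ev_apD'_d {n n' p q p' r r' : ℤ} (hn : n + 1 = n')
    (φ : (T.op.dgMod.Hom P (dualMod V X)).X n)
    (t : T.Obj) (h : p + n' = q) (h₁ : p + n = r') (h₂ : p' + n = q) (h₃ : q + r = 0)
    (h₄ : r' + p'' = 0) (y : (opObj P t).X p) (z : (X.obj t).X r) :
    ev V (X.obj t) h₃ (apD' (((T.op.dgMod.Hom P (dualMod V X)).d n n').hom φ) t h y) z =
      ((r' + 1).negOnePow : ℤ) • ev V (X.obj t) h₄ (apD' φ t h₁ y) (((X.obj t).d r p'').hom z) +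
      (n'.negOnePow : ℤ) • ev V (X.obj t) h₃ (apD' φ t h₂ (((opObj P t).d p p').hom y)) z := by
  refine (congrArg (fun e => ev V (X.obj t) h₃ e z) (ap_d (T := T.op) hn φ t h h₁ h₂ y)).trans ?_
  exact (ev_add_apply (K := X.obj t) h₃ _ _ z).trans
    (congrArg₂ _ (ev_d (K := X.obj t) h₃ h₄ _ z) (ev_units_smul _ _ _ _))

variable (V)

/-- The transposition of morphisms of complexes to a dual. -/
def transpAp {K L : CochainComplex (ModuleCat.{x} k) ℤ} {a b p q : ℤ} (h : a + p = 0)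
    (h' : q + b = 0) (f : K.X p →ₗ[k] (dual V L).X q) : L.X b →ₗ[k] (dual V K).X a :=
  mkDual V K h ∘ₗ (((p * b).negOnePow : ℤ) • ((ev V L h').comp f).flip)

lemma ev_transpAp {K L : CochainComplex (ModuleCat.{x} k) ℤ} {a b p q : ℤ} (h : a + p = 0)
    (h' : q + b = 0) (f : K.X p →ₗ[k] (dual V L).X q) (y : L.X b) (z : K.X p) :
    ev V K h (transpAp V h h' f y) z = ((p * b).negOnePow : ℤ) • ev V L h' (f z) y := by
  rw [transpAp, LinearMap.comp_apply, ev_mkDual]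
  rfl

lemma negOnePow_transp {n m l p m' p' : ℤ} (h : m + l = p) (hm : m + n = m') (hp : p + n = p') :
    ((-p' * p).negOnePow : ℤ) = ((m' * l + l + -m' * m + (-p * l + l)).negOnePow : ℤ) := by
  refine negOnePow_eq_of_even ?_
  subst h hm hp
  exact ⟨-(m + n) * l - l, by ring⟩

lemma transpAp_act {n : ℤ} (φ : (T.dgMod.Hom X (dualMod' V P)).X n) {s t : T.Obj}
    {m l p m' p' : ℤ} (h : m + l = p) (hm : m + n = m') (hp : p + n = p') (h' : m' + l = p')
    (hm' : -m' + n = -m) (hp' : -p' + n = -p) (y : (opObj P t).X m) (g : (T.Hom t s).X l) :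
    transpAp V (add_neg_cancel p') (neg_add_cancel p) (apD φ s hp') (opAct P h y g) =
      dualAct V X h' (transpAp V (add_neg_cancel m') (neg_add_cancel m) (apD φ t hm') y) g := by
  refine ev_ext (add_neg_cancel p') fun z => ?_
  rw [ev_transpAp, ev_dualAct V h' _ g _ (add_neg_cancel m') (show -p' + l = -m' by omega),
    ev_transpAp, ev_apD_act φ (show -p' + l = -m' by omega) hp' hm' (neg_add_cancel m)
      (neg_add_cancel p) h z g y, smul_smul, smul_smul, ← Units.val_mul, ← Units.val_mul, ← Int.negOnePow_add,
    ← Int.negOnePow_add, negOnePow_transp h hm hp]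

lemma transpAp_act' {n : ℤ} (φ : (T.op.dgMod.Hom P (dualMod V X)).X n) {s t : T.Obj}
    {m l p m' p' : ℤ} (h : m + l = p) (hm : m + n = m') (hp : p + n = p') (h' : m' + l = p')
    (hm' : -m' + n = -m) (hp' : -p' + n = -p) (y : (X.obj t).X m) (g : (T.Hom s t).X l) :
    transpAp V (add_neg_cancel p') (neg_add_cancel p) (apD' φ s hp') (X.act h y g) =
      (dualMod' V P).act h'
        (transpAp V (add_neg_cancel m') (neg_add_cancel m) (apD' φ t hm') y) g := by
  refine ev_ext (K := opObj P s) (add_neg_cancel p') fun z => ?_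
  refine Eq.trans ?_ (ev_act' V h' _ g _ (add_neg_cancel m') (show -p' + l = -m' by omega) z).symm
  refine Eq.trans ?_ (congrArg _ (ev_transpAp V _ _ (apD' φ t hm') y
    (opAct P (s := t) (t := s) (show -p' + l = -m' by omega) z g))).symm
  refine (ev_transpAp V _ _ (apD' φ s hp') (X.act h y g) z).trans ?_
  rw [ev_apD'_act φ (show -p' + l = -m' by omega) hp' hm' (neg_add_cancel m)
      (neg_add_cancel p) h z g y, smul_smul, smul_smul, ← Units.val_mul, ← Units.val_mul,
    ← Int.negOnePow_add, ← Int.negOnePow_add, negOnePow_transp h hm hp]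

/-- The transposition of morphisms of dg modules to a dual. -/
def transp {n : ℤ} (φ : (T.dgMod.Hom X (dualMod' V P)).X n) :
    (T.op.dgMod.Hom P (dualMod V X)).X n :=
  mkHom (T := T.op) (M := P) (N := dualMod V X) (fun (t : T.Obj) p q h =>
    transpAp V (add_neg_cancel q) (neg_add_cancel p) (apD φ t (show -q + n = -p by omega)))
    @fun s t _ _ _ _ _ h hm hp h' y g => transpAp_act V (s := s) (t := t) φ h hm hp h'
      (by omega) (by omega) y g

/-- The transposition of morphisms of dg modules to a dual. -/
def transp' {n : ℤ} (φ : (T.op.dgMod.Hom P (dualMod V X)).X n) :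
    (T.dgMod.Hom X (dualMod' V P)).X n :=
  mkHom (M := X) (N := dualMod' V P) (fun (t : T.Obj) p q h =>
    transpAp V (add_neg_cancel q) (neg_add_cancel p) (apD' φ t (show -q + n = -p by omega)))
    @fun s t _ _ _ _ _ h hm hp h' y g => transpAp_act' V (s := s) (t := t) φ h hm hp h'
      (by omega) (by omega) y g

variable {V}

lemma ev_transp {n p q a b : ℤ} (φ : (T.dgMod.Hom X (dualMod' V P)).X n) (t : T.Obj)
    (h : p + n = q) (h₁ : q + a = 0) (h₂ : a + n = b) (h₃ : b + p = 0) (y : (opObj P t).X p)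
    (z : (X.obj t).X a) : ev V (X.obj t) h₁ (apD' (transp V φ) t h y) z =
      ((a * p).negOnePow : ℤ) • ev V (opObj P t) h₃ (apD φ t h₂ z) y := by
  obtain rfl : a = -q := by omega
  obtain rfl : b = -p := by omega
  exact ev_transpAp V (K := X.obj t) (L := opObj P t) _ _ _ _ _

lemma ev_transp' {n p q a b : ℤ} (φ : (T.op.dgMod.Hom P (dualMod V X)).X n) (t : T.Obj)
    (h : p + n = q) (h₁ : q + a = 0) (h₂ : a + n = b) (h₃ : b + p = 0) (y : (X.obj t).X p)
    (z : (opObj P t).X a) : ev V (opObj P t) h₁ (apD (transp' V φ) t h y) z =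
      ((a * p).negOnePow : ℤ) • ev V (X.obj t) h₃ (apD' φ t h₂ z) y := by
  obtain rfl : a = -q := by omega
  obtain rfl : b = -p := by omega
  exact ev_transpAp V (K := opObj P t) (L := X.obj t) _ _ _ _ _

lemma transp'_transp {n : ℤ} (φ : (T.dgMod.Hom X (dualMod' V P)).X n) :
    transp' V (transp V φ) = φ := by
  refine apD_ext fun t p q r h h' y z => ?_
  rw [ev_transp' _ t h h' (show r + n = -p by omega) (neg_add_cancel p),
    ev_transp φ t _ _ h (by omega), smul_smul, mul_comm p r, ← Units.val_mul,
    Int.units_mul_self, Units.val_one, one_smul]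

lemma transp_transp' {n : ℤ} (φ : (T.op.dgMod.Hom P (dualMod V X)).X n) :
    transp V (transp' V φ) = φ := by
  refine apD'_ext fun t p q r h h' y z => ?_
  rw [ev_transp _ t h h' (show r + n = -p by omega) (neg_add_cancel p),
    ev_transp' φ t _ _ h (by omega), smul_smul, mul_comm p r, ← Units.val_mul,
    Int.units_mul_self, Units.val_one, one_smul]

lemma transp_d {n n' : ℤ} (hn : n + 1 = n') (φ : (T.dgMod.Hom X (dualMod' V P)).X n) :
    transp V (((T.dgMod.Hom X (dualMod' V P)).d n n').hom φ) =
      ((T.op.dgMod.Hom P (dualMod V X)).d n n').hom (transp V φ) := by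
  refine apD'_ext fun t p q r h h' y z => ?_
  rw [ev_transp _ t h h' (show r + n' = -p by omega) (neg_add_cancel p),
    ev_apD_d hn φ t (r' := -(p + 1)) (p' := r + 1) (p'' := p + 1) _ (by omega) (by omega) _
      (by omega),
    ev_apD'_d hn (transp V φ) t (r' := p + n) (p' := p + 1) (p'' := r + 1) _ rfl (by omega)
      _ (by omega),
    ev_transp φ t rfl (show p + n + (r + 1) = 0 by omega) (show r + 1 + n = -p by omega)
      (neg_add_cancel p),
    ev_transp φ t (show p + 1 + n = q by omega) h' (show r + n = -(p + 1) by omega)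
      (show -(p + 1) + (p + 1) = 0 by omega), smul_add, smul_smul, smul_smul, smul_smul, smul_smul,
    add_comm]
  refine congrArg₂ (· + ·) (congrArg₂ (· • ·) ?_ rfl) (congrArg₂ (· • ·) ?_ rfl)
  · rw [← Units.val_mul, ← Units.val_mul, ← Int.negOnePow_add, ← Int.negOnePow_add]
    refine negOnePow_eq_of_even ?_
    subst hn
    exact ⟨-p, by ring⟩
  · rw [← Units.val_mul, ← Units.val_mul, ← Int.negOnePow_add, ← Int.negOnePow_add]
    refine negOnePow_eq_of_even ?_
    subst hn
    exact ⟨0, by linear_combination -h - h'⟩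

end Transp

end DGMod
end

noncomputable section

variable {k : Type w} [Field k]

namespace ModuleComplex

section

variable {V : Type x} [AddCommGroup V] [Module k V] {K L : CochainComplex (ModuleCat.{x} k) ℤ}

lemma ev_of_closed {c c' b b' : ℤ} (h : c' + b = 0) (h' : c + b' = 0) (ξ : (dual V K).X c)
    (hξ : ((dual V K).d c c').hom ξ = 0) (y : K.X b) :
    ev V K h' ξ ((K.d b b').hom y) = 0 := by
  have e := ev_d h h' ξ y
  rw [hξ, map_zero, LinearMap.zero_apply, ← Units.smul_def] at e
  exact (smul_eq_zero_iff_eq _).1 e.symm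

lemma exists_d_eq_of_ev {m n b b' : ℤ} (hm : m + 1 = n) (h : n + b = 0) (hb : b + 1 = b')
    (ξ : (dual V K).X n) (H : ∀ z, (K.d b b').hom z = 0 → ev V K h ξ z = 0) :
    ∃ ζ, ((dual V K).d m n).hom ζ = ξ := by
  obtain rfl : b = -n := by omega
  exact exists_dual_d_eq hm hb ξ H

lemma acyclic_dual (hK : K.Acyclic) : (dual V K).Acyclic := by
  refine acyclic_iff.2 fun n ξ hξ => exists_d_eq_of_ev (sub_add_cancel n 1) (add_neg_cancel n)
    rfl ξ fun z hz => ?_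
  obtain ⟨e, rfl⟩ := exists_of_acyclic hK (show -(n + 1) + 1 = -n by omega) rfl z hz
  exact ev_of_closed (add_neg_cancel (n + 1)) _ ξ hξ e

lemma quasiIso_of_bijective (f : K ⟶ L) (hf : ∀ n, Function.Bijective (f.f n).hom) :
    QuasiIso f := by
  refine quasiIso_mk f (fun m y hy => ?_) fun m z hz e he => ?_
  · obtain ⟨z, rfl⟩ := (hf _).2 y
    refine ⟨z, (hf _).1 ?_, 0, by rw [map_zero, sub_self]⟩
    rw [comm_apply, hy, map_zero]
  · obtain ⟨e', rfl⟩ := (hf _).2 e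
    exact ⟨e', (hf _).1 ((comm_apply f m (m + 1) e').trans he)⟩

end

/-- The transpose of a quasi-isomorphism to the dual of a complex with finite-dimensional cohomology
is a quasi-isomorphism. -/
lemma quasiIso_of_transpose {K P : CochainComplex (ModuleCat.{max w x} k) ℤ}
    (hK : ∀ n, Module.Finite k (K.homology n)) (f : P ⟶ dual (ULift.{x} k) K) (hf : QuasiIso f)
    (g : K ⟶ dual (ULift.{x} k) P)
    (hg : ∀ {p q : ℤ} (h : p + q = 0) (h' : q + p = 0) (a : P.X p) (z : K.X q),
      ev (ULift.{x} k) P h' ((g.f q).hom z) a =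
        ((p * q).negOnePow : ℤ) • ev (ULift.{x} k) K h ((f.f p).hom a) z) : QuasiIso g := by
  let b : ∀ {p q : ℤ}, p + q = 0 → P.X p →ₗ[k] K.X q →ₗ[k] ULift.{x} k :=
    fun {p q} h => (ev (ULift.{x} k) K h).comp (f.f p).hom
  have h₁ : ∀ {p q : ℤ} (h : p + q = 0) (ξ : K.X q →ₗ[k] ULift.{x} k),
      (∀ z, ξ ((K.d (q - 1) q).hom z) = 0) → ∃ a : P.X p, (P.d p (p + 1)).hom a = 0 ∧
        ∀ z, (K.d q (q + 1)).hom z = 0 → b h a z = ξ z := by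
    intro p q h ξ hξ
    obtain ⟨a, ha, e, he⟩ := exists_of_quasiIso hf (sub_add_cancel p 1) rfl
      (mkDual (ULift.{x} k) K h ξ) (ev_ext (show p + 1 + (q - 1) = 0 by omega) fun z => by
        rw [ev_d _ h, ev_mkDual, hξ, smul_zero, map_zero, LinearMap.zero_apply])
    refine ⟨a, ha, fun z hz => ?_⟩
    have := congrArg (fun t => ev (ULift.{x} k) K h t z) he
    beta_reduce at this
    rw [ev_d h (show p - 1 + (q + 1) = 0 by omega), hz, map_zero, smul_zero, map_sub,
      LinearMap.sub_apply, ev_mkDual] at this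
    exact sub_eq_zero.1 this.symm
  have h₂ : ∀ {p q : ℤ} (h : p + q = 0) (a : P.X p), (P.d p (p + 1)).hom a = 0 →
      (∀ z, (K.d q (q + 1)).hom z = 0 → b h a z = 0) → ∃ e, (P.d (p - 1) p).hom e = a := by
    intro p q h a ha hz
    obtain ⟨ζ, hζ⟩ := exists_d_eq_of_ev (sub_add_cancel p 1) h rfl ((f.f p).hom a) hz
    exact exists_of_quasiIso' hf (sub_add_cancel p 1) rfl a ha ζ hζ
  have hd : ∀ {p q : ℤ} (h : p + q = 0) (a : P.X p), (P.d p (p + 1)).hom a = 0 →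
      ∀ z, b h a ((K.d (q - 1) q).hom z) = 0 := by
    intro p q h a ha z
    exact ev_of_closed (show p + 1 + (q - 1) = 0 by omega) h _
      (by rw [← comm_apply, ha, map_zero]) z
  refine quasiIso_mk g (fun m y hy => ?_) fun m z hz e he => ?_
  · have hq : m + 1 + -(m + 1) = 0 := by omega
    obtain ⟨z, hz, h₃⟩ := exists_of_pairing b hd h₂ (show -(m + 1) + (m + 1) = 0 by omega)
      (ev (ULift.{x} k) P hq y) (fun a => ev_of_closed (show m + 1 + 1 + (-(m + 1) - 1) = 0 by omega)
        hq y hy a)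
    refine ⟨(-(m + 1) * (m + 1)).negOnePow • z, by rw [Units.smul_def, map_zsmul, hz, smul_zero], ?_⟩
    refine exists_d_eq_of_ev rfl hq rfl _ fun a ha => ?_
    rw [map_sub, LinearMap.sub_apply, hg (neg_add_cancel (m + 1)), ← h₃ a ha, Units.smul_def,
      map_zsmul, ← Units.smul_def, ← Units.smul_def, units_smul_smul]
    exact sub_self _
  · obtain ⟨e, he⟩ := exact_of_pairing b h₁ (show -(m + 1) + (m + 1) = 0 by omega) z hz
      fun a ha => by
        have h₃ := hg (neg_add_cancel (m + 1)) (add_neg_cancel (m + 1)) a z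
        rw [← he, ev_d _ (show m + (-(m + 1) + 1) = 0 by omega), ha, map_zero, smul_zero,
          ← Units.smul_def, eq_comm, smul_eq_zero_iff_eq] at h₃
        exact h₃
    have h₃ : ∀ r, r + 1 = m + 1 → (∃ e, (K.d r (m + 1)).hom e = z) →
        ∃ e, (K.d m (m + 1)).hom e = z := by
      intro r hr
      obtain rfl : r = m := by omega
      exact id
    exact h₃ _ (sub_add_cancel _ _) ⟨e, he⟩

end ModuleComplex

namespace DGMod

open ModuleComplex

variable {T : DGCat.{w, v, u} k}

/-- A dg module is K-injective if all morphism complexes from acyclic dg modules to it are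
acyclic. -/
def IsKInj (I : DGMod.{x} T) : Prop :=
  ∀ N : DGMod.{x} T, (∀ t, (N.obj t).Acyclic) → (homComplex N I).Acyclic

section

variable {V : Type x} [AddCommGroup V] [Module k V] {X : DGMod.{x} T} {P : DGMod.{x} T.op}

lemma transp_zero {n : ℤ} : transp V (0 : (T.dgMod.Hom X (dualMod' V P)).X n) = 0 := by
  refine apD'_ext fun t p q r h h' y z => ?_
  rw [ev_transp _ t h h' (show r + n = -p by omega) (neg_add_cancel p)]
  change _ • ev V (opObj P t) _ (0 : (dual V (opObj P t)).X (-p)) y =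
    ev V (X.obj t) _ (0 : (dual V (X.obj t)).X q) z
  rw [map_zero, map_zero, LinearMap.zero_apply, LinearMap.zero_apply, smul_zero]

lemma hom_dualMod'_acyclic_iff : (T.dgMod.Hom X (dualMod' V P)).Acyclic ↔
    (T.op.dgMod.Hom P (dualMod V X)).Acyclic := by
  constructor
  · intro h
    refine acyclic_iff.2 fun n φ hφ => ?_
    obtain ⟨ψ, hψ⟩ := exists_of_acyclic h (sub_add_cancel n 1) rfl (transp' V φ) (by
      rw [← transp'_transp (((T.dgMod.Hom X (dualMod' V P)).d n (n + 1)).hom (transp' V φ)),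
        transp_d rfl, transp_transp', hφ, ← transp_zero, transp'_transp])
    exact ⟨transp V ψ, by rw [← transp_d (sub_add_cancel n 1), hψ, transp_transp']⟩
  · intro h
    refine acyclic_iff.2 fun n φ hφ => ?_
    obtain ⟨ψ, hψ⟩ := exists_of_acyclic h (sub_add_cancel n 1) rfl (transp V φ) (by
      rw [← transp_d rfl, hφ, transp_zero])
    refine ⟨transp' V ψ, ?_⟩
    rw [← transp'_transp (((T.dgMod.Hom X (dualMod' V P)).d _ _).hom (transp' V ψ)),
      transp_d (sub_add_cancel n 1), transp_transp', hψ, transp'_transp]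

variable (V) in
lemma isKInj_dualMod' (hP : P.IsKProj) : (dualMod' V P).IsKInj := fun X hX =>
  hom_dualMod'_acyclic_iff.2 (hP (dualMod V X) fun t => acyclic_dual (hX t))

end

/-- Every homologically finite-dimensional dg module has a K-injective resolution. -/
lemma exists_isKInj_resolution {X : DGMod.{max x u v w} T} (hX : X.IsFd) :
    ∃ (I : DGMod.{max x u v w} T) (g : (T.dgMod.Hom X I).X 0)
      (hg : ((T.dgMod.Hom X I).d 0 1).hom g = 0), I.IsKInj ∧ ∀ t, QuasiIso (evalMap g hg t) := by
  let V := ULift.{max x u v w} k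
  obtain ⟨P, f, hf, hP, hq⟩ := exists_relKProj_resolution.{x} (fun _ => True)
    (dualMod (T := T) V X)
  have hg : ((T.dgMod.Hom X (dualMod' V P)).d 0 1).hom (transp' V f) = 0 := by
    rw [← transp'_transp (((T.dgMod.Hom X (dualMod' V P)).d 0 1).hom (transp' V f)),
      transp_d (zero_add 1), transp_transp', hf, ← transp_zero, transp'_transp]
  refine ⟨dualMod' V P, transp' V f, hg, isKInj_dualMod' V (relKProj_true_iff.1 hP), fun t => ?_⟩
  refine quasiIso_of_transpose.{max x u v w} (fun n => (hX t).1 n)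
    (evalMap (T := T.op) f hf t) (hq t trivial) (evalMap (transp' V f) hg t) ?_
  intro p q h h' a z
  exact ev_transp' f t (add_zero q) h' (add_zero p) h z a

section Unit

lemma _root_.DGCat.op_comp_zero {X Y Z : T.Obj} {p : ℤ} (f : (T.Hom Y X).X p)
    (g : (T.Hom Z Y).X 0) : T.op.comp (X := X) (Y := Y) (Z := Z) (add_zero p) f g =
      T.comp (zero_add p) g f := by
  refine (T.op_comp (X := X) (Y := Y) (Z := Z) (add_zero p) (zero_add p) f g).trans ?_
  rw [mul_zero, Int.negOnePow_zero, Units.val_one, one_smul]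

/-- The Yoneda isomorphism. -/
def yoMap (X : DGMod.{max x u v w} T) (t : T.Obj) : X.obj t ⟶ T.dgMod.Hom (rep.{x} T t) X where
  f n := ModuleCat.ofHom
    { toFun := fun a => yo.{x} a
      map_add' := yo_add
      map_smul' := fun c a => (congrArg yo.{x} ((ap_smul c (yo.{x} a) t _ _).trans
        (congrArg (c • ·) (ap_yo_ident.{x} a))).symm).trans (yo_ap (c • yo.{x} a)) }
  comm' n n' h := by
    ext a : 2
    exact d_yo h a

lemma quasiIso_yoMap (X : DGMod.{max x u v w} T) (t : T.Obj) : QuasiIso (yoMap.{x} X t) := by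
  refine quasiIso_of_bijective _ fun n => ⟨fun a b h => ?_, fun φ => ⟨_, yo_ap φ⟩⟩
  have h' : yo.{x} a = yo.{x} b := h
  rw [← ap_yo_ident.{x} a, h', ap_yo_ident]

/-- The morphism of representable dg modules given by a morphism. -/
def repMap {s t : T.Obj} (f : (T.Hom s t).X 0) :
    (T.dgMod.Hom (rep.{x} T s) (rep.{x} T t)).X 0 := yo.{x} (repMk.{x} f)

lemma d_repMap {s t : T.Obj} (f : (T.Hom s t).X 0) (hf : ((T.Hom s t).d 0 1).hom f = 0) :
    ((T.dgMod.Hom (rep.{x} T s) (rep.{x} T t)).d 0 1).hom (repMap.{x} f) = 0 := by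
  rw [repMap, d_yo (zero_add 1), rep_d, hf, repMk_zero, ← yo_ap.{x} 0, ap_zero]

lemma quasiIso_pre_repMap_iff (X : DGMod.{max x u v w} T) {s t : T.Obj} (f : (T.Hom s t).X 0)
    (hf : ((T.Hom s t).d 0 1).hom f = 0) :
    QuasiIso (T.dgMod.pre (repMap.{x} f) (d_repMap f hf) X) ↔ QuasiIso (actMap X f hf) := by
  have e : yoMap.{x} X t ≫ T.dgMod.pre (repMap.{x} f) (d_repMap f hf) X =
      actMap X f hf ≫ yoMap.{x} X s := by
    ext n a : 3
    refine (yo_comp.{x} (zero_add n) (repMk.{x} f) (yo.{x} a)).trans (congrArg (yo.{x} ·) ?_)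
    exact ap_yo _ _ _ f
  have := quasiIso_yoMap.{x} X t
  have := quasiIso_yoMap.{x} X s
  rw [← quasiIso_iff_comp_left (yoMap.{x} X t), e, quasiIso_iff_comp_right]

lemma quasiIso_evalMap_op {s t : T.Obj} (f : (T.Hom s t).X 0)
    (hf : ((T.Hom s t).d 0 1).hom f = 0) (a : T.Obj) (h : QuasiIso (T.pre f hf a)) :
    QuasiIso (evalMap (T := T.op) _ (d_repMap.{x} (T := T.op) (s := t) (t := s) f hf) a) := by
  have e : ∀ {p : ℤ} (g : (T.Hom t a).X p),
      ap (T := T.op) (repMap.{x} (T := T.op) (s := t) (t := s) f) a (add_zero p)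
        (repMk.{x} (T := T.op) (s := a) (t := t) g) =
      repMk.{x} (T := T.op) (s := a) (t := s) (((T.pre f hf a).f p).hom g) := by
    intro p g
    refine (ap_yo (T := T.op) _ _ (zero_add p) _).trans ?_
    exact congrArg (repMk.{x} (T := T.op) (s := a) (t := s))
      (T.op_comp_zero (X := a) (Y := t) (Z := s) g f)
  refine quasiIso_mk _ (fun m y hy => ?_) fun m z hz e' he => ?_
  · obtain ⟨y, rfl⟩ := exists_repMk (T := T.op) (s := a) (t := s) y
    obtain ⟨z, hz, e', he⟩ := exists_of_quasiIso h rfl rfl y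
      (repMk_inj (T := T.op) (s := a) (t := s) hy)
    exact ⟨repMk.{x} (T := T.op) (s := a) (t := t) z,
      congrArg (repMk.{x} (T := T.op) (s := a) (t := t)) hz,
      repMk.{x} (T := T.op) (s := a) (t := s) e',
      (congrArg (repMk.{x} (T := T.op) (s := a) (t := s)) he).trans
        (congrArg (· - repMk.{x} (T := T.op) (s := a) (t := s) y) (e z).symm)⟩
  · obtain ⟨z, rfl⟩ := exists_repMk (T := T.op) (s := a) (t := t) z
    obtain ⟨e', rfl⟩ := exists_repMk (T := T.op) (s := a) (t := s) e'
    obtain ⟨e₁, he₁⟩ := exists_of_quasiIso' h rfl rfl z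
      (repMk_inj (T := T.op) (s := a) (t := t) hz) e'
      (repMk_inj (T := T.op) (s := a) (t := s) (he.trans (e z)))
    exact ⟨repMk.{x} (T := T.op) (s := a) (t := t) e₁,
      congrArg (repMk.{x} (T := T.op) (s := a) (t := t)) he₁⟩

/-- A dg module which is K-projective relative to a class of objects inverts all morphisms
`f : s ⟶ t` such that `T(t, a) ⟶ T(s, a)` is a quasi-isomorphism for all `a` in this class. -/
lemma RelKProj.quasiIso_actMap {A : T.Obj → Prop} {P : DGMod.{max x u v w} T} (hP : RelKProj A P)
    {s t : T.Obj} (f : (T.Hom s t).X 0) (hf : ((T.Hom s t).d 0 1).hom f = 0)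
    (h : ∀ a, A a → QuasiIso (T.pre f hf a)) : QuasiIso (actMap P f hf) := by
  let V := ULift.{max x u v w} k
  let r : (T.op.dgMod.Hom (rep.{x} T.op t) (rep.{x} T.op s)).X 0 :=
    repMap.{x} (T := T.op) (s := t) (t := s) f
  have hr := d_repMap.{x} (T := T.op) (s := t) (t := s) f hf
  have h₁ : (T.dgMod.Hom P (dualMod' V (DGMod.cone (T := T.op) r hr))).Acyclic := by
    refine hP _ fun a ha => acyclic_dual (K := (DGMod.cone (T := T.op) r hr).obj a) ?_
    refine (cone_acyclic_iff (T := T.op) r hr a).2 ?_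
    exact quasiIso_evalMap_op f hf a (h a ha)
  have h₂ := (quasiIso_pre_repMap_iff (T := T.op) (dualMod V P) (s := t) (t := s) f hf).1
    ((cone_hom_acyclic_iff (T := T.op) r hr _).1 (hom_dualMod'_acyclic_iff.1 h₁))
  refine quasiIso_of_dualMap (V := V) ?_
  have : actMap (T := T.op) (dualMod V P) (s := t) (t := s) f hf = dualMap V (actMap P f hf) := by
    ext n ξ : 3
    refine ev_ext (add_neg_cancel n) fun y => ?_
    refine (ev_dualAct V (add_zero n) ξ f (add_neg_cancel n) (add_neg_cancel n)
      (add_zero _) y).trans ?_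
    rw [mul_zero, add_zero, Int.negOnePow_zero, Units.val_one, one_smul]
    rfl
  rw [← this]
  exact h₂

end Unit

end DGMod
end

noncomputable section

variable {k : Type w} [Field k]

/-- The composition of dg functors. -/
def DGFunctor.comp {R : DGCat.{w, v, u} k} {S : DGCat.{w, v', u'} k} {T : DGCat.{w, x, y} k}
    (F : DGFunctor R S) (G : DGFunctor S T) : DGFunctor R T where
  obj X := G.obj (F.obj X)
  map n := (G.map n).comp (F.map n)
  map_ident X := (congrArg (G.map 0) (F.map_ident X)).trans (G.map_ident _)
  map_comp h f g := (congrArg (G.map _) (F.map_comp h f g)).trans (G.map_comp h _ _)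
  map_d n n' h f := (congrArg (G.map n') (F.map_d n n' h f)).trans (G.map_d n n' h _)

namespace DGMod

open ModuleComplex

lemma yo_smul {T : DGCat.{w, v, u} k} {X : DGMod.{max x u v w} T} {t : T.Obj} {n : ℤ} (c : k)
    (a : (X.obj t).X n) : yo.{x} (c • a) = c • yo a :=
  (congrArg yo.{x} ((ap_smul c (yo.{x} a) t _ _).trans
    (congrArg (c • ·) (ap_yo_ident.{x} a))).symm).trans (yo_ap (c • yo.{x} a))

/-- The Yoneda embedding of a dg category. -/
def yoneda (T : DGCat.{w, v, u} k) : DGFunctor T (T.dgMod.{max x u v w}) where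
  obj t := rep.{x} T t
  map {s t} n :=
    { toFun := fun f => yo.{x} (repMk.{x} f)
      map_add' := fun f g => yo_add _ _
      map_smul' := fun c f => yo_smul _ _ }
  map_ident t := yo_ap.{x} (T.dgMod.ident (rep.{x} T t))
  map_comp {r s t m n p} h f g := by
    refine Eq.trans (congrArg yo.{x} ?_)
      (yo_comp.{x} (X := rep.{x} T s) (Y := rep.{x} T t) h (repMk.{x} f) (yo.{x} (repMk.{x} g))).symm
    exact (ap_yo.{x} (X := rep.{x} T t) (repMk.{x} g) h (by omega) f).symm
  map_d n n' h f := (d_yo.{x} h (repMk.{x} f)).symm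

lemma quasiIso_pre_of_isKInj {T : DGCat.{w, v, u} k} {X Y I : DGMod.{x} T} (hI : I.IsKInj)
    (q : (T.dgMod.Hom X Y).X 0) (hq : ((T.dgMod.Hom X Y).d 0 1).hom q = 0)
    (h : ∀ t, QuasiIso (evalMap q hq t)) : QuasiIso (T.dgMod.pre q hq I) :=
  (cone_hom_acyclic_iff q hq I).1 (hI _ fun t => (cone_acyclic_iff q hq t).2 (h t))

lemma RelKProj.quasiIso_post {T : DGCat.{w, v, u} k} {A : T.Obj → Prop} {X Y P : DGMod.{x} T}
    (hP : RelKProj A P) (q : (T.dgMod.Hom X Y).X 0) (hq : ((T.dgMod.Hom X Y).d 0 1).hom q = 0)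
    (h : ∀ t, A t → QuasiIso (evalMap q hq t)) : QuasiIso (T.dgMod.post P q hq) :=
  (hom_cone_acyclic_iff q hq P).1 (hP _ fun t ht => (cone_acyclic_iff q hq t).2 (h t ht))

section Res

variable {C : DGCat.{w, v, u} k} {T : DGCat.{w, v', u'} k} (φ : DGFunctor C T)
  {L M N : DGMod.{x} T}

/-- The restriction of morphisms of dg modules along a dg functor. -/
def resMap {n : ℤ} (ψ : (T.dgMod.Hom M N).X n) :
    (C.dgMod.Hom (φ.resObj M) (φ.resObj N)).X n := φ.res.map n ψ

lemma resMap_d {n n' : ℤ} (hn : n + 1 = n') (ψ : (T.dgMod.Hom M N).X n) :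
    ((C.dgMod.Hom (φ.resObj M) (φ.resObj N)).d n n').hom (resMap φ ψ) =
      resMap φ (((T.dgMod.Hom M N).d n n').hom ψ) := (φ.res.map_d n n' hn ψ).symm

lemma d_resMap (ψ : (T.dgMod.Hom M N).X 0) (hψ : ((T.dgMod.Hom M N).d 0 1).hom ψ = 0) :
    ((C.dgMod.Hom (φ.resObj M) (φ.resObj N)).d 0 1).hom (resMap φ ψ) = 0 := by
  rw [resMap_d φ (zero_add 1), hψ]
  rfl

end Res

section Coind

variable {C : DGCat.{w, v, u} k} {T : DGCat.{w, v', u'} k} (φ : DGFunctor C T)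
  (I : DGMod.{max x u v w u' v'} C)

/-- The coinduction of a dg module along a dg functor. -/
def coind : DGMod.{max x u v w u' v'} T :=
  ((yoneda.{max x u v w u' v'} T).comp φ.res).resObj (repr C.dgMod I)

/-- The elements of a coinduced dg module. -/
def coindMk {t : T.Obj} {n : ℤ}
    (χ : (C.dgMod.Hom (φ.resObj (rep.{max x u v w u' v'} T t)) I).X n) :
    ((coind.{x} φ I).obj t).X n := χ

variable {φ I}

lemma exists_coindMk {t : T.Obj} {n : ℤ} (a : ((coind.{x} φ I).obj t).X n) :
    ∃ χ, a = coindMk.{x} φ I χ := ⟨a, rfl⟩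

variable (φ I)

/-- The counit of coinduction. -/
def coindCounit : (C.dgMod.Hom (φ.resObj (coind.{x} φ I)) I).X 0 :=
  mkHom (M := φ.resObj (coind.{x} φ I)) (N := I) (fun c p q h =>
    { toFun := fun (χ : (C.dgMod.Hom (φ.resObj (rep.{max x u v w u' v'} T (φ.obj c))) I).X p) =>
        ap χ c (show 0 + p = q by omega) (repMk.{max x u v w u' v'} (T.ident (φ.obj c)))
      map_add' := fun χ χ' => ap_add _ _ _ _ _
      map_smul' := fun a χ => ap_smul _ _ _ _ _ }) (by
    intro s t m l p m' p' h hm hp h'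
      (χ : (C.dgMod.Hom (φ.resObj (rep.{max x u v w u' v'} T (φ.obj t))) I).X m) g
    refine (ap_comp (show l + m = p by omega) (resMap φ (yo.{max x u v w u' v'}
      (repMk.{max x u v w u' v'} (φ.map l g)))) χ s (show 0 + p = p' by omega) (zero_add l)
      (show l + m = p' by omega) (repMk.{max x u v w u' v'} (T.ident (φ.obj s)))).trans ?_
    refine (congrArg (ap χ s (show l + m = p' by omega)) (ap_yo_ident.{max x u v w u' v'} (X :=
      rep.{max x u v w u' v'} T (φ.obj t)) (repMk.{max x u v w u' v'} (φ.map l g)))).trans ?_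
    refine Eq.trans ?_ (ap_act χ (zero_add l) (show 0 + m = m' by omega)
      (show l + m = p' by omega) h' (repMk.{max x u v w u' v'} (T.ident (φ.obj t))) g)
    exact congrArg (ap χ s (show l + m = p' by omega))
      (congrArg repMk.{max x u v w u' v'} (T.comp_ident (add_zero l) (φ.map l g)).symm))

variable {φ I}

lemma ap_coindCounit {c : C.Obj} {p q : ℤ} (h : p + 0 = q) (h' : 0 + p = q)
    (χ : (C.dgMod.Hom (φ.resObj (rep.{max x u v w u' v'} T (φ.obj c))) I).X p) :
    ap (coindCounit.{x} φ I) c h (coindMk.{x} φ I χ) =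
      ap χ c h' (repMk.{max x u v w u' v'} (T.ident (φ.obj c))) := rfl

variable (φ I) in
lemma d_coindCounit : ((C.dgMod.Hom (φ.resObj (coind.{x} φ I)) I).d 0 1).hom
    (coindCounit.{x} φ I) = 0 := by
  refine hom_ext fun c p q h a => ?_
  obtain ⟨χ, hχ⟩ := exists_coindMk.{x} a
  rw [hχ]
  have e₁ := ap_d h χ c (zero_add q) (zero_add p) (show 0 + 1 + p = q by omega)
    (repMk.{max x u v w u' v'} (T := T) (s := φ.obj c) (t := φ.obj c) (T.ident (φ.obj c)))
  have e₂ : ((((φ.resObj (rep.{max x u v w u' v'} T (φ.obj c))).obj c)).d 0 (0 + 1)).hom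
      (repMk.{max x u v w u' v'} (T := T) (s := φ.obj c) (t := φ.obj c) (T.ident (φ.obj c))) = 0 :=
    congrArg repMk.{max x u v w u' v'} (T.d_ident (φ.obj c))
  rw [e₂, map_zero, smul_zero, add_zero] at e₁
  have e₃ := ap_d (zero_add 1) (coindCounit.{x} φ I) c h (add_zero p) (add_zero q)
    (coindMk.{x} φ I χ)
  refine e₃.trans ?_
  rw [ap_coindCounit (add_zero p) (zero_add p), ← e₁, Int.negOnePow_one, Units.neg_smul, one_smul]
  exact add_neg_cancel _

/-- A morphism to a coinduced dg module is determined by its composition with the counit. -/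
lemma comp_yo_coindCounit {t : T.Obj} {n : ℤ}
    (χ : (C.dgMod.Hom (φ.resObj (rep.{max x u v w u' v'} T t)) I).X n) :
    C.dgMod.comp (add_zero n) (resMap φ (yo.{max x u v w u' v'} (coindMk.{x} φ I χ)))
      (coindCounit.{x} φ I) = χ := by
  refine hom_ext fun c p q h a => ?_
  obtain ⟨f, rfl⟩ : ∃ f, a = repMk.{max x u v w u' v'} (T := T) (s := φ.obj c) f :=
    exists_repMk.{max x u v w u' v'} (T := T) a
  refine (ap_comp (add_zero n) _ _ c h h (add_zero q) _).trans ?_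
  have e : ap (resMap φ (yo.{max x u v w u' v'} (coindMk.{x} φ I χ))) c h
      (repMk.{max x u v w u' v'} f) = coindMk.{x} φ I (C.dgMod.comp h
        (resMap φ (yo.{max x u v w u' v'} (repMk.{max x u v w u' v'} f))) χ) := rfl
  rw [e, ap_coindCounit (add_zero q) (zero_add q)]
  refine (ap_comp h _ _ c (zero_add q) (zero_add p) h _).trans ?_
  exact congrArg (ap χ c h) (ap_yo_ident.{max x u v w u' v'}
    (X := rep.{max x u v w u' v'} T t) (repMk.{max x u v w u' v'} f))

variable {N : DGMod.{max x u v w u' v'} T}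

/-- The components of `coindLift`. -/
def coindLiftAp {n p q : ℤ} (χ : (C.dgMod.Hom (φ.resObj N) I).X n) (t : T.Obj) (h : p + n = q) :
    (N.obj t).X p →ₗ[k] (C.dgMod.Hom (φ.resObj (rep.{max x u v w u' v'} T t)) I).X q :=
  (C.dgMod.comp h).flip χ ∘ₗ φ.res.map (X := rep.{max x u v w u' v'} T t) (Y := N) p ∘ₗ
    ((yoMap.{max x u v w u' v'} N t).f p).hom

lemma coindLiftAp_apply {n p q : ℤ} (χ : (C.dgMod.Hom (φ.resObj N) I).X n) (t : T.Obj)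
    (h : p + n = q) (y : (N.obj t).X p) : coindLiftAp.{x} χ t h y =
      C.dgMod.comp h (resMap φ (yo.{max x u v w u' v'} y)) χ := rfl

lemma coindLiftAp_act {n : ℤ} (χ : (C.dgMod.Hom (φ.resObj N) I).X n) {s t : T.Obj}
    {m l p m' p' : ℤ} (h : m + l = p) (hm : m + n = m') (hp : p + n = p') (h' : l + m' = p')
    (y : (N.obj t).X m) (f : (T.Hom s t).X l) :
    coindLiftAp.{x} χ s hp (N.act h y f) = C.dgMod.comp h'
      (resMap φ (yo.{max x u v w u' v'} (repMk.{max x u v w u' v'} f)))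
      (coindLiftAp.{x} χ t hm y) := by
  rw [coindLiftAp_apply, coindLiftAp_apply]
  refine Eq.trans ?_ (C.dgMod.assoc (show l + m = p by omega) hm hp h' _ _ χ)
  refine congrArg (fun e => C.dgMod.comp hp e χ) ?_
  refine Eq.trans ?_ (congrArg (resMap φ) (yo_comp.{max x u v w u' v'}
    (X := rep.{max x u v w u' v'} T t) (show l + m = p by omega)
    (repMk.{max x u v w u' v'} f) (yo.{max x u v w u' v'} y))).symm
  exact congrArg (fun e => resMap φ (yo.{max x u v w u' v'} e)) (ap_yo _ _ h f).symm

/-- The morphism to a coinduced dg module given by a morphism from the restriction. -/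
def coindLift {n : ℤ} (χ : (C.dgMod.Hom (φ.resObj N) I).X n) :
    (T.dgMod.Hom N (coind.{x} φ I)).X n :=
  mkHom (M := N) (N := coind.{x} φ I) (fun t p q h => coindLiftAp.{x} χ t h)
    fun h hm hp h' y f => coindLiftAp_act.{x} χ h hm hp (by omega) y f

lemma ap_coindLift {n p q : ℤ} (χ : (C.dgMod.Hom (φ.resObj N) I).X n) (t : T.Obj) (h : p + n = q)
    (y : (N.obj t).X p) : ap (coindLift.{x} χ) t h y = coindMk.{x} φ I
      (C.dgMod.comp h (resMap φ (yo.{max x u v w u' v'} y)) χ) := rfl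

lemma coindLift_counit {n : ℤ} (χ : (C.dgMod.Hom (φ.resObj N) I).X n) :
    C.dgMod.comp (add_zero n) (resMap φ (coindLift.{x} χ)) (coindCounit.{x} φ I) = χ := by
  refine hom_ext fun c p q h y => ?_
  refine (ap_comp (add_zero n) _ _ c h h (add_zero q) _).trans ?_
  refine (congrArg (ap _ c (add_zero q)) (ap_coindLift.{x} χ (φ.obj c) h y)).trans ?_
  rw [ap_coindCounit (add_zero q) (zero_add q)]
  refine (ap_comp h _ _ c (zero_add q) (zero_add p) h _).trans ?_
  exact congrArg (ap χ c h) (ap_yo_ident.{max x u v w u' v'} (T := T) (X := N) (t := φ.obj c) y)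

lemma coindLift_comp_counit {n : ℤ} (ψ : (T.dgMod.Hom N (coind.{x} φ I)).X n) :
    coindLift.{x} (C.dgMod.comp (add_zero n) (resMap φ ψ) (coindCounit.{x} φ I)) = ψ := by
  refine hom_ext fun t p q h y => ?_
  rw [ap_coindLift]
  obtain ⟨χ, hχ⟩ := exists_coindMk.{x} (ap ψ t h y)
  rw [hχ]
  refine congrArg (coindMk.{x} φ I) ?_
  refine (C.dgMod.assoc h (add_zero n) (add_zero q) h _ _ _).symm.trans ?_
  refine Eq.trans ?_ (comp_yo_coindCounit.{x} χ)
  refine congrArg (fun e => C.dgMod.comp (add_zero q) e (coindCounit.{x} φ I)) ?_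
  refine (congrArg (resMap φ) (yo_comp.{max x u v w u' v'} h y ψ)).trans ?_
  rw [hχ]

variable (φ I N) in
/-- The adjunction isomorphism of coinduction. -/
def coindAdj : T.dgMod.Hom N (coind.{x} φ I) ⟶ C.dgMod.Hom (φ.resObj N) I where
  f n := ModuleCat.ofHom ((C.dgMod.comp (add_zero n)).flip (coindCounit.{x} φ I) ∘ₗ
    φ.res.map (X := N) (Y := coind.{x} φ I) n)
  comm' n n' h := by
    ext ψ : 2
    replace h : n + 1 = n' := h
    refine (C.dgMod.d_comp_of_closed_right (add_zero n) h h (add_zero n')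
      (resMap (M := N) (N := coind.{x} φ I) φ ψ) (coindCounit.{x} φ I)
      (d_coindCounit.{x} φ I)).trans ?_
    rw [Int.negOnePow_zero, one_smul]
    exact congrArg (fun e => C.dgMod.comp (add_zero n') e (coindCounit.{x} φ I)) (resMap_d φ h ψ)

lemma quasiIso_coindAdj : QuasiIso (coindAdj.{x} φ I N) :=
  quasiIso_of_bijective _ fun _ => ⟨fun ψ ψ' h => (coindLift_comp_counit.{x} ψ).symm.trans
    ((congrArg coindLift.{x} h).trans (coindLift_comp_counit.{x} ψ')),
    fun χ => ⟨coindLift.{x} χ, coindLift_counit.{x} χ⟩⟩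

lemma d_coindLift {n n' : ℤ} (hn : n + 1 = n') (χ : (C.dgMod.Hom (φ.resObj N) I).X n) :
    ((T.dgMod.Hom N (coind.{x} φ I)).d n n').hom (coindLift.{x} χ) =
      coindLift.{x} (((C.dgMod.Hom (φ.resObj N) I).d n n').hom χ) := by
  rw [← coindLift_comp_counit.{x} (((T.dgMod.Hom N (coind.{x} φ I)).d n n').hom _)]
  refine congrArg coindLift.{x} ?_
  refine (comm_apply (coindAdj.{x} φ I N) n n' (coindLift.{x} χ)).trans ?_
  exact congrArg _ (coindLift_counit.{x} χ)

lemma isKInj_coind (hI : I.IsKInj) : (coind.{x} φ I).IsKInj := fun N hN => by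
  change (T.dgMod.Hom N (coind.{x} φ I)).Acyclic
  refine acyclic_iff.2 fun n ψ hψ => ?_
  obtain ⟨χ, hχ⟩ := exists_of_acyclic (hI (φ.resObj N) fun c => hN (φ.obj c)) (sub_add_cancel n 1)
    rfl (((coindAdj.{x} φ I N).f n).hom ψ) 
    ((comm_apply (coindAdj.{x} φ I N) n (n + 1) ψ).symm.trans ((congrArg _ hψ).trans (map_zero _)))
  exact ⟨coindLift.{x} χ, (d_coindLift.{x} (sub_add_cancel n 1) χ).trans
    ((congrArg coindLift.{x} hχ).trans (coindLift_comp_counit.{x} ψ))⟩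

end Coind

end DGMod
end

noncomputable section

variable {k : Type w} [Field k]

/-- A dg functor is quasi-fully faithful if it induces quasi-isomorphisms on the complexes of
morphisms. -/
def DGFunctor.IsQuasiFF {C : DGCat.{w, v, u} k} {T : DGCat.{w, v', u'} k} (φ : DGFunctor C T) :
    Prop :=
  ∀ (c c' : C.Obj) (m : ℤ),
    (∀ y : (T.Hom (φ.obj c) (φ.obj c')).X (m + 1), ((T.Hom _ _).d (m + 1) (m + 1 + 1)).hom y = 0 →
      ∃ z : (C.Hom c c').X (m + 1), ((C.Hom c c').d (m + 1) (m + 1 + 1)).hom z = 0 ∧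
        ∃ e, ((T.Hom (φ.obj c) (φ.obj c')).d m (m + 1)).hom e = φ.map (m + 1) z - y) ∧
    (∀ z : (C.Hom c c').X (m + 1), ((C.Hom c c').d (m + 1) (m + 1 + 1)).hom z = 0 →
      ∀ e, ((T.Hom (φ.obj c) (φ.obj c')).d m (m + 1)).hom e = φ.map (m + 1) z →
        ∃ e', ((C.Hom c c').d m (m + 1)).hom e' = z)

lemma DGCat.isQuasiFF_incl (T : DGCat.{w, v, u} k) (P : T.Obj → Prop) : (T.incl P).IsQuasiFF :=
  fun _ _ _ => ⟨fun y hy => ⟨y, hy, 0, (map_zero _).trans (sub_self y).symm⟩,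
    fun _ _ e he => ⟨e, he⟩⟩

namespace DGMod

open ModuleComplex

lemma quasiIso_evalMap_repMap {T : DGCat.{w, v, u} k} {s t : T.Obj} (f : (T.Hom s t).X 0)
    (hf : ((T.Hom s t).d 0 1).hom f = 0) (a : T.Obj) (h : QuasiIso (T.post a f hf)) :
    QuasiIso (evalMap _ (d_repMap.{x} f hf) a) := by
  have e : ∀ {p : ℤ} (g : (T.Hom a s).X p), ap (repMap.{x} f) a (add_zero p) (repMk.{x} g) =
      repMk.{x} (((T.post a f hf).f p).hom g) := fun g =>
    (ap_yo _ _ (zero_add _) _).trans rfl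
  refine quasiIso_mk _ (fun m y hy => ?_) fun m z hz e' he => ?_
  · obtain ⟨y, rfl⟩ := exists_repMk y
    obtain ⟨z, hz, e', he⟩ := exists_of_quasiIso h rfl rfl y (repMk_inj hy)
    exact ⟨repMk.{x} z, congrArg repMk.{x} hz, repMk.{x} e',
      (congrArg repMk.{x} he).trans (congrArg (· - repMk.{x} y) (e z).symm)⟩
  · obtain ⟨z, rfl⟩ := exists_repMk z
    obtain ⟨e', rfl⟩ := exists_repMk e'
    obtain ⟨e₁, he₁⟩ := exists_of_quasiIso' h rfl rfl z (repMk_inj hz) e'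
      (repMk_inj (he.trans (e z)))
    exact ⟨repMk.{x} e₁, congrArg repMk.{x} he₁⟩

section

variable {C : DGCat.{w, v, u} k} {T : DGCat.{w, v', u'} k} (φ : DGFunctor C T)

/-- The morphism from a representable dg module to the restriction of a representable dg module. -/
def repToRes (c : C.Obj) : (C.dgMod.Hom (rep.{max x u v w u' v'} C c)
    (φ.resObj (rep.{max x u v w u' v'} T (φ.obj c)))).X 0 :=
  yo.{max x u v w u' v'} (X := φ.resObj (rep.{max x u v w u' v'} T (φ.obj c)))
    (repMk.{max x u v w u' v'} (T := T) (s := φ.obj c) (T.ident (φ.obj c)))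

lemma d_repToRes (c : C.Obj) : ((C.dgMod.Hom _ _).d 0 1).hom (repToRes.{x} φ c) = 0 := by
  refine (d_yo.{max x u v w u' v'} (zero_add 1) _).trans ?_
  refine (congrArg yo.{max x u v w u' v'} (show _ = 0 from ?_)).trans
    (yo_ap.{max x u v w u' v'} (0 : (C.dgMod.Hom (rep.{max x u v w u' v'} C c)
      (φ.resObj (rep.{max x u v w u' v'} T (φ.obj c)))).X 1))
  exact congrArg repMk.{max x u v w u' v'} (T.d_ident (φ.obj c))

lemma ap_repToRes {c a : C.Obj} {p : ℤ} (g : (C.Hom a c).X p) :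
    ap (repToRes.{x} φ c) a (add_zero p) (repMk.{max x u v w u' v'} g) =
      repMk.{max x u v w u' v'} (T := T) (s := φ.obj a) (φ.map p g) :=
  (ap_yo.{max x u v w u' v'} (X := φ.resObj (rep.{max x u v w u' v'} T (φ.obj c))) _ _
    (zero_add p) g).trans (congrArg repMk.{max x u v w u' v'} (T.comp_ident (add_zero p) _))

variable {φ}

lemma quasiIso_evalMap_repToRes (hφ : φ.IsQuasiFF) (c a : C.Obj) :
    QuasiIso (evalMap (repToRes.{x} φ c) (d_repToRes.{x} φ c) a) := by
  refine quasiIso_mk _ (fun m y hy => ?_) fun m z hz e' he => ?_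
  · obtain ⟨y, rfl⟩ : ∃ f, y = repMk.{max x u v w u' v'} (T := T) (s := φ.obj a) f :=
      exists_repMk.{max x u v w u' v'} (T := T) y
    obtain ⟨z, hz, e', he⟩ := (hφ a c m).1 y (repMk_inj.{max x u v w u' v'} (T := T) (s := φ.obj a) hy)
    exact ⟨repMk.{max x u v w u' v'} z, congrArg repMk.{max x u v w u' v'} hz,
      repMk.{max x u v w u' v'} (T := T) (s := φ.obj a) e',
      (congrArg (repMk.{max x u v w u' v'} (T := T) (s := φ.obj a)) he).trans
        (congrArg (· - repMk.{max x u v w u' v'} (T := T) (s := φ.obj a) y)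
          (ap_repToRes.{x} φ z).symm)⟩
  · obtain ⟨z, rfl⟩ := exists_repMk z
    obtain ⟨e', rfl⟩ : ∃ f, e' = repMk.{max x u v w u' v'} (T := T) (s := φ.obj a) f :=
      exists_repMk.{max x u v w u' v'} (T := T) e'
    obtain ⟨e₁, he₁⟩ := (hφ a c m).2 z (repMk_inj.{max x u v w u' v'} hz) e'
      (repMk_inj.{max x u v w u' v'} (T := T) (s := φ.obj a) (he.trans (ap_repToRes.{x} φ z)))
    exact ⟨repMk.{max x u v w u' v'} e₁, congrArg repMk.{max x u v w u' v'} he₁⟩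

variable {I : DGMod.{max x u v w u' v'} C}

lemma quasiIso_evalMap_coindCounit (hI : I.IsKInj) (hφ : φ.IsQuasiFF) (c : C.Obj) :
    QuasiIso (evalMap (coindCounit.{x} φ I) (d_coindCounit.{x} φ I) c) := by
  have h₁ := quasiIso_pre_of_isKInj hI (repToRes.{x} φ c) (d_repToRes.{x} φ c)
    (quasiIso_evalMap_repToRes.{x} hφ c)
  have e : evalMap (coindCounit.{x} φ I) (d_coindCounit.{x} φ I) c ≫
      yoMap.{max x u v w u' v'} I c = C.dgMod.pre (repToRes.{x} φ c) (d_repToRes.{x} φ c) I := by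
    ext n χ : 3
    exact (yo_comp.{max x u v w u' v'} (zero_add n) _
      (χ : (C.dgMod.Hom (φ.resObj (rep.{max x u v w u' v'} T (φ.obj c))) I).X n)).symm
  have := quasiIso_yoMap.{max x u v w u' v'} I c
  rw [← e] at h₁
  exact (quasiIso_iff_comp_right (evalMap (coindCounit.{x} φ I) (d_coindCounit.{x} φ I) c)
    (yoMap.{max x u v w u' v'} I c)).1 h₁

lemma quasiIso_actMap_coind (hI : I.IsKInj) {s t : T.Obj} (f : (T.Hom s t).X 0)
    (hf : ((T.Hom s t).d 0 1).hom f = 0) (h : ∀ c, QuasiIso (T.post (φ.obj c) f hf)) :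
    QuasiIso (actMap (coind.{x} φ I) f hf) :=
  quasiIso_pre_of_isKInj hI (resMap φ (repMap.{max x u v w u' v'} f))
    (d_resMap φ _ (d_repMap.{max x u v w u' v'} f hf)) fun c =>
      quasiIso_evalMap_repMap.{max x u v w u' v'} f hf (φ.obj c) (h c)

end

end DGMod
end

noncomputable section

section Localization

variable {C : Type u} [Category.{v} C] {D : Type u'} [Category.{v'} D] (L : C ⥤ D)
  (W : MorphismProperty C) [L.IsLocalization W]

/-- If all morphisms in `W` become bijections after applying `Hom(P, -)`, then the localization
functor induces bijections on the morphisms from `P`. -/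
lemma CategoryTheory.Localization.map_bijective_of_colocal (P X : C)
    (hP : ∀ ⦃Y Z : C⦄ (f : Y ⟶ Z), W f → Function.Bijective fun g : P ⟶ Y => g ≫ f) :
    Function.Bijective (L.map : (P ⟶ X) → (L.obj P ⟶ L.obj X)) := by
  let F : C ⥤ Type (max v v') := coyoneda.obj (Opposite.op P) ⋙ uliftFunctor.{v'}
  have hF : W.IsInvertedBy F := by
    intro Y Z f hf
    rw [isIso_iff_bijective]
    constructor
    · rintro ⟨a⟩ ⟨b⟩ h
      exact congrArg ULift.up ((hP f hf).1 (congrArg ULift.down h))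
    · rintro ⟨b⟩
      obtain ⟨a, ha⟩ := (hP f hf).2 b
      exact ⟨⟨a⟩, congrArg ULift.up ha⟩
  let F' : D ⥤ Type (max v v') := Localization.lift F hF L
  let e : L ⋙ F' ≅ F := Localization.fac F hF L
  let G : D ⥤ Type (max v v') := coyoneda.obj (Opposite.op (L.obj P)) ⋙ uliftFunctor.{v}
  let τ : F ⟶ L ⋙ G :=
    { app := fun Y => TypeCat.ofHom fun a => ⟨L.map a.down⟩
      naturality := fun Y Z f => by
        ext ⟨a⟩
        exact congrArg ULift.up (L.map_comp a f) }
  let θ : F' ⟶ G := (Localization.whiskeringLeftFunctor' L W (Type (max v v'))).preimage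
    (e.hom ≫ τ)
  have hθ : ∀ Y (a : F'.obj (L.obj Y)), θ.app (L.obj Y) a = τ.app Y (e.hom.app Y a) := by
    intro Y a
    have := congr_app (Functor.map_preimage
      (Localization.whiskeringLeftFunctor' L W (Type (max v v'))) (e.hom ≫ τ)) Y
    exact ConcreteCategory.congr_hom this a
  let i : F'.obj (L.obj P) := e.inv.app P ⟨𝟙 P⟩
  have hi : e.hom.app P i = ⟨𝟙 P⟩ :=
    ConcreteCategory.congr_hom (e.inv_hom_id_app P) (⟨𝟙 P⟩ : F.obj P)
  have h₁ : ∀ g : P ⟶ X, e.hom.app X (F'.map (L.map g) i) = ⟨g⟩ := by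
    intro g
    refine (ConcreteCategory.congr_hom (e.hom.naturality g) i).trans ?_
    refine (congrArg (F.map g) hi).trans ?_
    exact congrArg ULift.up (Category.id_comp g)
  constructor
  · intro g g' h
    have := (h₁ g).symm.trans ((congrArg (fun f => e.hom.app X (F'.map f i)) h).trans (h₁ g'))
    exact congrArg ULift.down this
  · intro f
    refine ⟨(e.hom.app X (F'.map f i)).down, ?_⟩
    have h₂ := hθ X (F'.map f i)
    have h₃ : θ.app (L.obj X) (F'.map f i) = G.map f (θ.app (L.obj P) i) :=
      ConcreteCategory.congr_hom (θ.naturality f) i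
    have h₄ : θ.app (L.obj P) i = ⟨𝟙 (L.obj P)⟩ := by
      rw [hθ, hi]
      exact congrArg ULift.up (L.map_id P)
    rw [h₄] at h₃
    exact (congrArg ULift.down (h₂.symm.trans h₃)).trans (Category.id_comp f)

lemma CategoryTheory.Localization.map_bijective_of_local (X I : C)
    (hI : ∀ ⦃Y Z : C⦄ (f : Y ⟶ Z), W f → Function.Bijective fun g : Z ⟶ I => f ≫ g) :
    Function.Bijective (L.map : (X ⟶ I) → (L.obj X ⟶ L.obj I)) := by
  have h := Localization.map_bijective_of_colocal L.op W.op (Opposite.op I) (Opposite.op X)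
    fun Y Z f hf => by
      have := hI f.unop hf
      refine ⟨fun a b h => Quiver.Hom.unop_inj (this.1 (congrArg Quiver.Hom.unop h)), fun b => ?_⟩
      obtain ⟨a, ha⟩ := this.2 b.unop
      exact ⟨a.op, congrArg Quiver.Hom.op ha⟩
  refine ⟨fun a b h' => Quiver.Hom.op_inj (h.1 (congrArg Quiver.Hom.op h')), fun b => ?_⟩
  obtain ⟨a, ha⟩ := h.2 b.op
  exact ⟨a.unop, congrArg Quiver.Hom.unop ha⟩

end Localization

variable {k : Type w} [Field k]

namespace DGCat

section H0

variable (T : DGCat.{w, v, u} k) {X Y Z : T.Obj}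

lemma exists_homH0 (φ : T.toH0 X ⟶ T.toH0 Y) : ∃ f hf, φ = T.homH0 f hf := by
  obtain ⟨f, rfl⟩ := (CategoryTheory.Quotient.functor T.homotopic).map_surjective φ
  exact ⟨f.1, f.2, rfl⟩

lemma homH0_eq_iff {f g : (T.Hom X Y).X 0} (hf : ((T.Hom X Y).d 0 1).hom f = 0)
    (hg : ((T.Hom X Y).d 0 1).hom g = 0) :
    T.homH0 f hf = T.homH0 g hg ↔ ∃ h, ((T.Hom X Y).d (-1) 0).hom h = f - g :=
  CategoryTheory.Quotient.functor_map_eq_iff _ _ _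

lemma d_comp_zero {f : (T.Hom X Y).X 0} {g : (T.Hom Y Z).X 0}
    (hf : ((T.Hom X Y).d 0 1).hom f = 0) (hg : ((T.Hom Y Z).d 0 1).hom g = 0) :
    ((T.Hom X Z).d 0 1).hom (T.comp (add_zero 0) f g) = 0 :=
  T.d_comp_of_closed (add_zero 0) f g hf hg

lemma homH0_comp {f : (T.Hom X Y).X 0} {g : (T.Hom Y Z).X 0}
    (hf : ((T.Hom X Y).d 0 1).hom f = 0) (hg : ((T.Hom Y Z).d 0 1).hom g = 0) :
    T.homH0 f hf ≫ T.homH0 g hg = T.homH0 (T.comp (add_zero 0) f g) (T.d_comp_zero hf hg) := rfl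

open ModuleComplex in
lemma bijective_of_quasiIso {S : DGCat.{w, v, u'} k} {X' Y' : S.Obj}
    (F : T.Hom X Y ⟶ S.Hom X' Y') (hF : QuasiIso F)
    (G : (T.toH0 X ⟶ T.toH0 Y) → (S.toH0 X' ⟶ S.toH0 Y'))
    (hG : ∀ f hf, G (T.homH0 f hf) = S.homH0 ((F.f 0).hom f)
      (by rw [← comm_apply, hf, map_zero])) : Function.Bijective G := by
  constructor
  · intro φ ψ h
    obtain ⟨f, hf, rfl⟩ := T.exists_homH0 φ
    obtain ⟨g, hg, rfl⟩ := T.exists_homH0 ψ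
    rw [hG, hG, S.homH0_eq_iff] at h
    obtain ⟨e, he⟩ := h
    exact (T.homH0_eq_iff hf hg).2 (exists_of_quasiIso' hF (neg_add_cancel 1) (zero_add 1) (f - g)
      (by rw [map_sub, hf, hg, sub_zero]) e (by rw [he, map_sub]))
  · intro φ
    obtain ⟨f, hf, rfl⟩ := S.exists_homH0 φ
    obtain ⟨z, hz, e, he⟩ := exists_of_quasiIso hF (neg_add_cancel 1) (zero_add 1) f hf
    refine ⟨T.homH0 z hz, ?_⟩
    rw [hG]
    exact (S.homH0_eq_iff _ _).2 ⟨e, he⟩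

lemma bijective_comp_of_quasiIso_post (g : (T.Hom Y Z).X 0) (hg : ((T.Hom Y Z).d 0 1).hom g = 0)
    (h : QuasiIso (T.post X g hg)) :
    Function.Bijective fun f : T.toH0 X ⟶ T.toH0 Y => f ≫ T.homH0 g hg :=
  T.bijective_of_quasiIso _ h _ fun _ _ => rfl

lemma bijective_comp_of_quasiIso_pre (f : (T.Hom X Y).X 0) (hf : ((T.Hom X Y).d 0 1).hom f = 0)
    (h : QuasiIso (T.pre f hf Z)) :
    Function.Bijective fun g : T.toH0 Y ⟶ T.toH0 Z => T.homH0 f hf ≫ g :=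
  T.bijective_of_quasiIso _ h _ fun _ _ => rfl

end H0

section Der

open ModuleComplex DGMod

variable {T : DGCat.{w, v, u} k} {M N : DGMod.{x} T}

lemma qis_homH0_iff (φ : (T.dgMod.Hom M N).X 0) (hφ : ((T.dgMod.Hom M N).d 0 1).hom φ = 0) :
    qis T (T.dgMod.homH0 φ hφ) ↔ ∀ t, QuasiIso (evalMap φ hφ t) :=
  forall_congr' fun t => by
    change HomotopyCategory.quasiIso _ _ ((HomotopyCategory.quotient _ _).map (evalMap φ hφ t)) ↔ _
    rw [HomotopyCategory.quotient_map_mem_quasiIso_iff, HomologicalComplex.mem_quasiIso_iff]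

lemma exists_homH0_of_qis {X Y : (T.dgMod.{x}).H0} (f : X ⟶ Y) (hf : qis T f) :
    ∃ (φ : (T.dgMod.Hom X.as.obj Y.as.obj).X 0)
      (hφ : ((T.dgMod.Hom X.as.obj Y.as.obj).d 0 1).hom φ = 0),
      f = T.dgMod.homH0 φ hφ ∧ ∀ t, QuasiIso (evalMap φ hφ t) := by
  obtain ⟨φ, hφ, rfl⟩ := T.dgMod.exists_homH0 (X := X.as.obj) (Y := Y.as.obj) f
  exact ⟨φ, hφ, rfl, (qis_homH0_iff φ hφ).1 hf⟩

/-- A dg module, as an object of the homotopy category. -/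
def modH0 (M : DGMod.{x} T) : (T.dgMod.{x}).H0 := T.dgMod.toH0 M

/-- A dg module, as an object of the derived category. -/
def der (M : DGMod.{x} T) : Der.{x} T := (toDer T).obj (modH0 M)

/-- The class of a closed morphism of degree `0` of dg modules in the homotopy category. -/
def modHom (φ : (T.dgMod.Hom M N).X 0) (hφ : ((T.dgMod.Hom M N).d 0 1).hom φ = 0) :
    modH0 M ⟶ modH0 N := T.dgMod.homH0 φ hφ

/-- The localization functor, on morphisms. -/
def qMap (f : modH0 M ⟶ modH0 N) : der M ⟶ der N := (toDer T).map f

lemma qMap_comp {L M N : DGMod.{x} T} (f : modH0 L ⟶ modH0 M) (g : modH0 M ⟶ modH0 N) :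
    qMap (f ≫ g) = qMap f ≫ qMap g := (toDer T).map_comp f g

/-- The image in the derived category of a closed morphism of degree `0` of dg modules. -/
def derMap (φ : (T.dgMod.Hom M N).X 0) (hφ : ((T.dgMod.Hom M N).d 0 1).hom φ = 0) :
    der M ⟶ der N := qMap (modHom φ hφ)

lemma derMap_comp {L M N : DGMod.{x} T} {φ : (T.dgMod.Hom L M).X 0} {ψ : (T.dgMod.Hom M N).X 0}
    (hφ : ((T.dgMod.Hom L M).d 0 1).hom φ = 0) (hψ : ((T.dgMod.Hom M N).d 0 1).hom ψ = 0) :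
    derMap φ hφ ≫ derMap ψ hψ =
      derMap (T.dgMod.comp (add_zero 0) φ ψ) (T.dgMod.d_comp_zero hφ hψ) :=
  (qMap_comp _ _).symm

lemma exists_modHom (f : modH0 M ⟶ modH0 N) : ∃ φ hφ, f = modHom φ hφ := T.dgMod.exists_homH0 f

lemma isIso_toDer_map_iff {X Y : (T.dgMod.{x}).H0} (f : X ⟶ Y) :
    IsIso ((toDer T).map f) ↔ qis T f := by
  constructor
  · intro h t
    rw [HomotopyCategory.mem_quasiIso_iff]
    intro n
    let F := evalH0 T t ⋙ HomotopyCategory.homologyFunctor (ModuleCat.{x} k) (ComplexShape.up ℤ) n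
    have hF : (qis.{x} T).IsInvertedBy F := fun X Y g hg =>
      (HomotopyCategory.mem_quasiIso_iff _).1 (hg t) n
    have e := Localization.fac F hF (toDer T)
    have : IsIso ((toDer T ⋙ Localization.lift F hF (toDer T)).map f) := by
      rw [Functor.comp_map]
      infer_instance
    exact (NatIso.isIso_map_iff e f).1 this
  · intro h
    exact Localization.inverts (toDer T) (qis T) f h

lemma isIso_derMap_iff (φ : (T.dgMod.Hom M N).X 0) (hφ : ((T.dgMod.Hom M N).d 0 1).hom φ = 0) :
    IsIso (derMap φ hφ) ↔ ∀ t, QuasiIso (evalMap φ hφ t) :=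
  (isIso_toDer_map_iff _).trans (qis_homH0_iff φ hφ)

lemma qMap_bijective_of_isKProj (hM : M.IsKProj) (N : DGMod.{x} T) :
    Function.Bijective (qMap : (modH0 M ⟶ modH0 N) → _) := by
  refine Localization.map_bijective_of_colocal (toDer T) (qis T) _ _ fun Y Z f hf => ?_
  obtain ⟨φ, hφ, rfl, h⟩ := exists_homH0_of_qis f hf
  exact T.dgMod.bijective_comp_of_quasiIso_post φ hφ
    ((relKProj_true_iff.2 hM).quasiIso_post φ hφ fun t _ => h t)

lemma qMap_bijective_of_isKInj (M : DGMod.{x} T) (hN : N.IsKInj) :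
    Function.Bijective (qMap : (modH0 M ⟶ modH0 N) → _) := by
  refine Localization.map_bijective_of_local (toDer T) (qis T) _ _ fun Y Z f hf => ?_
  obtain ⟨φ, hφ, rfl, h⟩ := exists_homH0_of_qis f hf
  exact T.dgMod.bijective_comp_of_quasiIso_pre φ hφ (quasiIso_pre_of_isKInj hN φ hφ h)

lemma exists_derMap_of_isKProj (hM : M.IsKProj) (f : der M ⟶ der N) :
    ∃ φ hφ, f = derMap φ hφ := by
  obtain ⟨g, rfl⟩ := (qMap_bijective_of_isKProj hM N).2 f
  obtain ⟨φ, hφ, rfl⟩ := exists_modHom g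
  exact ⟨φ, hφ, rfl⟩

end Der

section Roof

open ModuleComplex DGMod

variable {T : DGCat.{w, v, u} k} {M N : DGMod.{max x u v w} T}

/-- Isomorphic objects of the derived category are related by a roof of quasi-isomorphisms. -/
lemma exists_roof (e : der M ≅ der N) :
    ∃ (P : DGMod.{max x u v w} T) (f : (T.dgMod.Hom P M).X 0)
      (hf : ((T.dgMod.Hom P M).d 0 1).hom f = 0) (g : (T.dgMod.Hom P N).X 0)
      (hg : ((T.dgMod.Hom P N).d 0 1).hom g = 0), P.IsKProj ∧
      (∀ t, QuasiIso (evalMap f hf t)) ∧ ∀ t, QuasiIso (evalMap g hg t) := by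
  obtain ⟨P, f, hf, hP, hq⟩ := exists_relKProj_resolution.{x} (fun _ => True) M
  have hf' := (isIso_derMap_iff f hf).2 fun t => hq t trivial
  obtain ⟨g, hg, h⟩ := exists_derMap_of_isKProj (relKProj_true_iff.1 hP) (derMap f hf ≫ e.hom)
  refine ⟨P, f, hf, g, hg, relKProj_true_iff.1 hP, fun t => hq t trivial,
    (isIso_derMap_iff g hg).1 ?_⟩
  rw [← h]
  infer_instance

/-- A complex with finite-dimensional total cohomology. -/
def _root_.ModuleComplex.HFinite (K : CochainComplex (ModuleCat.{x} k) ℤ) : Prop :=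
  (∀ n, Module.Finite k (K.homology n)) ∧ {n | ¬ Limits.IsZero (K.homology n)}.Finite

lemma _root_.ModuleComplex.hFinite_iff {K L : CochainComplex (ModuleCat.{x} k) ℤ} {f : K ⟶ L}
    (hf : QuasiIso f) : HFinite K ↔ HFinite L := by
  have e : ∀ n, K.homology n ≅ L.homology n := fun n => asIso (HomologicalComplex.homologyMap f n)
  refine and_congr (forall_congr' fun n => ⟨fun _ => Module.Finite.equiv (e n).toLinearEquiv,
    fun _ => Module.Finite.equiv (e n).symm.toLinearEquiv⟩) ?_
  have : {n | ¬ Limits.IsZero (K.homology n)} = {n | ¬ Limits.IsZero (L.homology n)} :=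
    Set.ext fun n => not_congr (e n).isZero_iff
  rw [this]

lemma isFd_of_quasiIso {M N : DGMod.{x} T} (f : (T.dgMod.Hom M N).X 0)
    (hf : ((T.dgMod.Hom M N).d 0 1).hom f = 0) (h : ∀ t, QuasiIso (evalMap f hf t)) :
    M.IsFd ↔ N.IsFd :=
  forall_congr' fun t => hFinite_iff (h t)

lemma isFd_iff_of_iso (e : der M ≅ der N) :
    M.IsFd ↔ N.IsFd := by
  obtain ⟨P, f, hf, g, hg, -, hf', hg'⟩ := exists_roof.{x} e
  exact (isFd_of_quasiIso f hf hf').symm.trans (isFd_of_quasiIso g hg hg')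

lemma quasiIso_actMap_of_quasiIso {M N : DGMod.{x} T} (φ : (T.dgMod.Hom M N).X 0)
    (hφ : ((T.dgMod.Hom M N).d 0 1).hom φ = 0) {s t : T.Obj} (f : (T.Hom s t).X 0)
    (hf : ((T.Hom s t).d 0 1).hom f = 0) (hs : QuasiIso (evalMap φ hφ s))
    (ht : QuasiIso (evalMap φ hφ t)) : QuasiIso (actMap M f hf) ↔ QuasiIso (actMap N f hf) := by
  have e : actMap M f hf ≫ evalMap φ hφ s = evalMap φ hφ t ≫ actMap N f hf := by
    ext n y : 3
    exact ap_act φ (add_zero n) (add_zero n) (add_zero n) _ y f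
  rw [← quasiIso_iff_comp_right (actMap M f hf) (evalMap φ hφ s), e, quasiIso_iff_comp_left]

lemma quasiIso_evalMap_of_actMap {M N : DGMod.{x} T} (φ : (T.dgMod.Hom M N).X 0)
    (hφ : ((T.dgMod.Hom M N).d 0 1).hom φ = 0) {s t : T.Obj} (f : (T.Hom s t).X 0)
    (hf : ((T.Hom s t).d 0 1).hom f = 0) (hM : QuasiIso (actMap M f hf))
    (hN : QuasiIso (actMap N f hf)) : QuasiIso (evalMap φ hφ s) ↔ QuasiIso (evalMap φ hφ t) := by
  have e : actMap M f hf ≫ evalMap φ hφ s = evalMap φ hφ t ≫ actMap N f hf := by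
    ext n y : 3
    exact ap_act φ (add_zero n) (add_zero n) (add_zero n) _ y f
  rw [← quasiIso_iff_comp_left (actMap M f hf) (evalMap φ hφ s), e, quasiIso_iff_comp_right]

lemma quasiIso_actMap_iff_of_iso
    (e : der M ≅ der N)
    {s t : T.Obj} (f : (T.Hom s t).X 0) (hf : ((T.Hom s t).d 0 1).hom f = 0) :
    QuasiIso (actMap M f hf) ↔ QuasiIso (actMap N f hf) := by
  obtain ⟨P, g, hg, h, hh, -, hg', hh'⟩ := exists_roof.{x} e
  exact (quasiIso_actMap_of_quasiIso g hg f hf (hg' s) (hg' t)).symm.trans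
    (quasiIso_actMap_of_quasiIso h hh f hf (hh' s) (hh' t))

end Roof

end DGCat
end

noncomputable section

variable {k : Type w} [Field k]

lemma CategoryTheory.Functor.map_bijective_iff_of_iso {C : Type u} [Category.{v} C] {D : Type u'}
    [Category.{v'} D] (F : C ⥤ D) {X X' Y Y' : C} (e : X ≅ X') (e' : Y ≅ Y') :
    Function.Bijective (F.map : (X ⟶ Y) → _) ↔ Function.Bijective (F.map : (X' ⟶ Y') → _) := by
  have h : (F.map : (X' ⟶ Y') → _) =
      ((F.mapIso e).homCongr (F.mapIso e')) ∘ F.map ∘ (e.homCongr e').symm := by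
    funext f
    simp
  rw [h, Equiv.comp_bijective, Equiv.bijective_comp]

namespace DGFunctor

open DGCat DGMod ModuleComplex

section

variable {C : DGCat.{w, v, u} k} {T : DGCat.{w, v', u'} k} (φ : DGFunctor C T)

/-- The restriction functor on derived categories is induced by the restriction of dg modules. -/
def resFac : toDer.{x} T ⋙ φ.resDer ≅ φ.res.toH0 ⋙ toDer.{x} C :=
  Localization.fac _ _ _

/-- The restriction functor on derived categories is induced by the restriction of dg modules. -/
def resIso (M : DGMod.{x} T) : φ.resDer.obj (der M) ≅ der (φ.resObj M) := φ.resFac.app (modH0 M)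

/-- The restriction of morphisms in the homotopy category of dg modules. -/
def resH0 {M N : DGMod.{x} T} (f : modH0 M ⟶ modH0 N) :
    modH0 (φ.resObj M) ⟶ modH0 (φ.resObj N) := φ.res.toH0.map f

lemma resIso_naturality {M N : DGMod.{x} T} (f : modH0 M ⟶ modH0 N) :
    φ.resDer.map (qMap f) ≫ (φ.resIso N).hom = (φ.resIso M).hom ≫ qMap (φ.resH0 f) :=
  φ.resFac.hom.naturality f

lemma resIso_naturality' {M N : DGMod.{x} T} (f : (T.dgMod.Hom M N).X 0)
    (hf : ((T.dgMod.Hom M N).d 0 1).hom f = 0) :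
    φ.resDer.map (derMap f hf) ≫ (φ.resIso N).hom =
      (φ.resIso M).hom ≫ derMap (resMap φ f) (d_resMap φ f hf) :=
  φ.resIso_naturality (modHom f hf)

/-- A morphism `ε : φ(c) ⟶ t` is a counit if it induces quasi-isomorphisms on the complexes of
morphisms from the image of `φ`. -/
def IsCounit {c : C.Obj} {t : T.Obj} (ε : (T.Hom (φ.obj c) t).X 0)
    (hε : ((T.Hom (φ.obj c) t).d 0 1).hom ε = 0) : Prop :=
  ∀ a, QuasiIso (T.post (φ.obj a) ε hε)

/-- A morphism `η : t ⟶ φ(c)` is a unit if it induces quasi-isomorphisms on the complexes of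
morphisms to the image of `φ`. -/
def IsUnit {c : C.Obj} {t : T.Obj} (η : (T.Hom t (φ.obj c)).X 0)
    (hη : ((T.Hom t (φ.obj c)).d 0 1).hom η = 0) : Prop :=
  ∀ a, QuasiIso (T.pre η hη (φ.obj a))

end

section

variable {C : DGCat.{w, v, u} k} {T : DGCat.{w, v', u'} k} {φ : DGFunctor C T}

/-- The restriction functor is fully faithful on morphisms to `N` if the morphisms to `N` and to the
coinduction of a K-injective resolution of the restriction of `N` agree. -/
lemma resDer_map_bijective {M N : DGMod.{max x u v w u' v'} T} {I : DGMod.{max x u v w u' v'} C}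
    (hI : I.IsKInj) (g : (C.dgMod.Hom (φ.resObj N) I).X 0)
    (hg : ((C.dgMod.Hom (φ.resObj N) I).d 0 1).hom g = 0) (hgq : ∀ c, QuasiIso (evalMap g hg c))
    (h : (T.dgMod.Hom N (coind.{x} φ I)).X 0)
    (hh : ((T.dgMod.Hom N (coind.{x} φ I)).d 0 1).hom h = 0)
    (hhg : C.dgMod.comp (add_zero 0) (resMap φ h) (coindCounit.{x} φ I) = g)
    (H : Function.Bijective fun f : der M ⟶ der N => f ≫ derMap h hh) :
    Function.Bijective (φ.resDer.map : (der M ⟶ der N) → _) := by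
  let e := derMap (coindCounit.{x} φ I) (d_coindCounit.{x} φ I)
  let α : (der M ⟶ der (coind.{x} φ I)) → (φ.resDer.obj (der M) ⟶ der I) :=
    fun f => φ.resDer.map f ≫ (φ.resIso (coind.{x} φ I)).hom ≫ e
  have hα : Function.Bijective α := by
    have h₁ := qMap_bijective_of_isKInj M (isKInj_coind.{x} (φ := φ) hI)
    have h₂ := qMap_bijective_of_isKInj (φ.resObj M) hI
    let G : (modH0 M ⟶ modH0 (coind.{x} φ I)) → (modH0 (φ.resObj M) ⟶ modH0 I) := fun f =>
      φ.resH0 f ≫ modHom (coindCounit.{x} φ I) (d_coindCounit.{x} φ I)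
    have h₃ : Function.Bijective G := T.dgMod.bijective_of_quasiIso (S := C.dgMod)
      (coindAdj.{x} φ I M) quasiIso_coindAdj.{x} G fun _ _ => rfl
    refine (Function.Bijective.of_comp_iff α h₁).1 ?_
    have h₄ : α ∘ qMap = (fun f => (φ.resIso M).hom ≫ f) ∘ qMap ∘ G := by
      funext f
      change φ.resDer.map (qMap f) ≫ _ ≫ e = _ ≫ qMap (_ ≫ _)
      rw [← Category.assoc, resIso_naturality, qMap_comp, Category.assoc]
      rfl
    rw [h₄]
    exact ((φ.resIso M).symm.homFromEquiv.bijective).comp (h₂.comp h₃)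
  have hge : IsIso (φ.resDer.map (derMap h hh) ≫ (φ.resIso (coind.{x} φ I)).hom ≫ e) := by
    have h₅ : derMap (resMap φ h) (d_resMap φ h hh) ≫ e = derMap g hg := by
      subst hhg
      exact derMap_comp _ _
    rw [← Category.assoc, resIso_naturality', Category.assoc, h₅]
    have := (isIso_derMap_iff g hg).2 hgq
    infer_instance
  refine (Function.Bijective.of_comp_iff' (asIso (φ.resDer.map (derMap h hh) ≫
      (φ.resIso (coind.{x} φ I)).hom ≫ e)).homToEquiv.bijective _).1 ?_
  convert hα.comp H using 1
  funext f
  simp only [Function.comp_apply, α, Functor.map_comp, Category.assoc, Iso.homToEquiv_apply,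
    asIso_hom]

/-- The unit of coinduction, for a K-injective resolution of the restriction. -/
lemma exists_coind_unit (hφ : φ.IsQuasiFF) {N : DGMod.{max x u v w u' v'} T} (hN : N.IsFd) :
    ∃ (I : DGMod.{max x u v w u' v'} C) (g : (C.dgMod.Hom (φ.resObj N) I).X 0)
      (hg : ((C.dgMod.Hom (φ.resObj N) I).d 0 1).hom g = 0)
      (h : (T.dgMod.Hom N (coind.{x} φ I)).X 0)
      (hh : ((T.dgMod.Hom N (coind.{x} φ I)).d 0 1).hom h = 0), I.IsKInj ∧
      (∀ c, QuasiIso (evalMap g hg c)) ∧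
      C.dgMod.comp (add_zero 0) (resMap φ h) (coindCounit.{x} φ I) = g ∧
      ∀ c, QuasiIso (evalMap h hh (φ.obj c)) := by
  obtain ⟨I, g, hg, hI, hq⟩ := exists_isKInj_resolution.{max x u v w u' v'}
    (X := φ.resObj N) fun c => hN (φ.obj c)
  have hh : ((T.dgMod.Hom N (coind.{x} φ I)).d 0 1).hom (coindLift.{x} g) = 0 := by
    rw [d_coindLift.{x} (zero_add 1), hg, ← coindLift_comp_counit.{x} (φ := φ) (I := I) (N := N) 0]
    exact congrArg coindLift.{x} (LinearMap.map_zero₂ (C.dgMod.comp (add_zero 1)) _).symm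
  refine ⟨I, g, hg, coindLift.{x} g, hh, hI, hq, coindLift_counit.{x} g, fun c => ?_⟩
  let p : (coind.{x} φ I).obj (φ.obj c) ⟶ I.obj c :=
    evalMap (coindCounit.{x} φ I) (d_coindCounit.{x} φ I) c
  have hp : QuasiIso p := quasiIso_evalMap_coindCounit.{x} hI hφ c
  let q : N.obj (φ.obj c) ⟶ I.obj c := evalMap g hg c
  have h₂ : QuasiIso q := hq c
  have e : evalMap (coindLift.{x} g) hh (φ.obj c) ≫ p = q := by
    ext n y : 3
    refine (ap_comp (add_zero 0) (resMap φ (coindLift.{x} g)) (coindCounit.{x} φ I) c (add_zero n)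
      (add_zero n) (add_zero n) y).symm.trans ?_
    rw [coindLift_counit.{x} g]
    rfl
  rw [← e, quasiIso_iff_comp_right] at h₂
  exact h₂

end

end DGFunctor
end

noncomputable section

variable {k : Type w} [Field k]

namespace DGFunctor

open DGCat DGMod ModuleComplex

variable {C : DGCat.{w, v, u} k} {T : DGCat.{w, v', u'} k} {φ : DGFunctor C T}

/-- The essential image of `φ`, up to equality. -/
def range (φ : DGFunctor C T) (t : T.Obj) : Prop := ∃ c, φ.obj c = t

lemma IsUnit.quasiIso_actMap {P : DGMod.{max x u v w u' v'} T} (hP : RelKProj φ.range P) {c : C.Obj}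
    {t : T.Obj} {η : (T.Hom t (φ.obj c)).X 0} {hη : ((T.Hom t (φ.obj c)).d 0 1).hom η = 0}
    (h : φ.IsUnit η hη) : QuasiIso (actMap P η hη) :=
  RelKProj.quasiIso_actMap.{max x u v w u' v'} hP η hη (by
    rintro _ ⟨a, rfl⟩
    exact h a)

lemma resDer_map_bijective_of_counit (hφ : φ.IsQuasiFF) {N : DGMod.{max x u v w u' v'} T}
    (hN : N.IsFd) (h : ∀ t, ∃ (c : C.Obj) (ε : (T.Hom (φ.obj c) t).X 0)
      (hε : ((T.Hom (φ.obj c) t).d 0 1).hom ε = 0), φ.IsCounit ε hε ∧ QuasiIso (actMap N ε hε))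
    (M : DGMod.{max x u v w u' v'} T) :
    Function.Bijective (φ.resDer.map : (der M ⟶ der N) → _) := by
  obtain ⟨I, g, hg, l, hl, hI, hgq, hlg, hlq⟩ := exists_coind_unit.{x} hφ hN
  refine resDer_map_bijective.{x} hI g hg hgq l hl hlg ?_
  have : IsIso (derMap l hl) := by
    refine (isIso_derMap_iff l hl).2 fun t => ?_
    obtain ⟨c, ε, hε, h₁, h₂⟩ := h t
    exact (quasiIso_evalMap_of_actMap l hl ε hε h₂ (quasiIso_actMap_coind.{x} hI ε hε h₁)).1 (hlq c)
  exact (asIso (derMap l hl)).homToEquiv.bijective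

lemma resDer_map_bijective_of_unit (hφ : φ.IsQuasiFF) {M N : DGMod.{max x u v w u' v'} T}
    (hN : N.IsFd) (h : ∀ t, ∃ (c : C.Obj) (η : (T.Hom t (φ.obj c)).X 0)
      (hη : ((T.Hom t (φ.obj c)).d 0 1).hom η = 0), φ.IsUnit η hη ∧ QuasiIso (actMap M η hη)) :
    Function.Bijective (φ.resDer.map : (der M ⟶ der N) → _) := by
  obtain ⟨P, f, hf, hP, hq⟩ := exists_relKProj_resolution.{max x u v w u' v'} φ.range M
  have : IsIso (derMap f hf) := by
    refine (isIso_derMap_iff f hf).2 fun t => ?_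
    obtain ⟨c, η, hη, h₁, h₂⟩ := h t
    exact (quasiIso_evalMap_of_actMap f hf η hη (h₁.quasiIso_actMap.{x} hP) h₂).2 (hq _ ⟨c, rfl⟩)
  refine (φ.resDer.map_bijective_iff_of_iso (asIso (derMap f hf)) (Iso.refl (der N))).1 ?_
  obtain ⟨I, g, hg, l, hl, hI, hgq, hlg, hlq⟩ := exists_coind_unit.{x} hφ hN
  refine resDer_map_bijective.{x} hI g hg hgq l hl hlg ?_
  refine (Function.Bijective.of_comp_iff _ (qMap_bijective_of_isKProj hP.isKProj N)).1 ?_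
  have h₁ : Function.Bijective fun f : modH0 P ⟶ modH0 N => f ≫ modHom l hl :=
    T.dgMod.bijective_comp_of_quasiIso_post l hl (hP.quasiIso_post l hl (by
      rintro _ ⟨c, rfl⟩
      exact hlq c))
  convert (qMap_bijective_of_isKProj hP.isKProj _).comp h₁ using 1
  funext f
  exact (qMap_comp _ _).symm

lemma exists_resObj_of_counit (hφ : φ.IsQuasiFF) (h : ∀ t, ∃ (c : C.Obj)
    (ε : (T.Hom (φ.obj c) t).X 0) (hε : ((T.Hom (φ.obj c) t).d 0 1).hom ε = 0), φ.IsCounit ε hε)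
    {G : DGMod.{max x u v w u' v'} C} (hG : G.IsFd) :
    ∃ E : DGMod.{max x u v w u' v'} T, E.IsFd ∧ Nonempty (der (φ.resObj E) ≅ der G) ∧
      ∀ (c : C.Obj) (t : T.Obj) (ε : (T.Hom (φ.obj c) t).X 0)
        (hε : ((T.Hom (φ.obj c) t).d 0 1).hom ε = 0), φ.IsCounit ε hε →
        QuasiIso (actMap E ε hε) := by
  obtain ⟨I, g, hg, hI, hgq⟩ := exists_isKInj_resolution.{max x u v w u' v'} hG
  have := (isIso_derMap_iff g hg).2 hgq
  have := (isIso_derMap_iff _ (d_coindCounit.{x} φ I)).2 (quasiIso_evalMap_coindCounit.{x} hI hφ)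
  refine ⟨coind.{x} φ I, fun t => ?_, ⟨asIso (derMap _ (d_coindCounit.{x} φ I)) ≪≫
    (asIso (derMap g hg)).symm⟩, fun c t ε hε h => quasiIso_actMap_coind.{x} hI ε hε h⟩
  obtain ⟨c, ε, hε, h₁⟩ := h t
  exact (hFinite_iff (quasiIso_actMap_coind.{x} hI ε hε h₁)).2
    ((hFinite_iff (quasiIso_evalMap_coindCounit.{x} hI hφ c)).2 ((hFinite_iff (hgq c)).1 (hG c)))

lemma exists_resObj_of_unit (hφ : φ.IsQuasiFF) (h : ∀ t, ∃ (c : C.Obj)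
    (η : (T.Hom t (φ.obj c)).X 0) (hη : ((T.Hom t (φ.obj c)).d 0 1).hom η = 0), φ.IsUnit η hη)
    {G : DGMod.{max x u v w u' v'} C} (hG : G.IsFd) :
    ∃ E : DGMod.{max x u v w u' v'} T, E.IsFd ∧ Nonempty (der (φ.resObj E) ≅ der G) ∧
      ∀ (c : C.Obj) (t : T.Obj) (η : (T.Hom t (φ.obj c)).X 0)
        (hη : ((T.Hom t (φ.obj c)).d 0 1).hom η = 0), φ.IsUnit η hη →
        QuasiIso (actMap E η hη) := by
  obtain ⟨I, g, hg, hI, hgq⟩ := exists_isKInj_resolution.{max x u v w u' v'} hG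
  obtain ⟨P, f, hf, hP, hq⟩ := exists_relKProj_resolution.{max x u v w u' v'} φ.range
    (coind.{x} φ I)
  have := (isIso_derMap_iff g hg).2 hgq
  have := (isIso_derMap_iff _ (d_coindCounit.{x} φ I)).2 (quasiIso_evalMap_coindCounit.{x} hI hφ)
  have := (isIso_derMap_iff _ (d_resMap φ f hf)).2 fun c => hq _ ⟨c, rfl⟩
  refine ⟨P, fun t => ?_, ⟨asIso (derMap _ (d_resMap φ f hf)) ≪≫
    asIso (derMap _ (d_coindCounit.{x} φ I)) ≪≫ (asIso (derMap g hg)).symm⟩,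
    fun c t η hη h => h.quasiIso_actMap.{x} hP⟩
  obtain ⟨c, η, hη, h₁⟩ := h t
  exact (hFinite_iff (h₁.quasiIso_actMap.{x} hP)).1 ((hFinite_iff (hq _ ⟨c, rfl⟩)).2
    ((hFinite_iff (quasiIso_evalMap_coindCounit.{x} hI hφ c)).2 ((hFinite_iff (hgq c)).1 (hG c))))

end DGFunctor
end

noncomputable section

variable {k : Type w} [Field k]

namespace DGCat

open DGMod ModuleComplex

section

variable {T : DGCat.{w, v, u} k}

/-- The object of `Dᶠᵈ(T)` given by a homologically finite-dimensional dg module. -/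
def derFd (M : DGMod.{x} T) (hM : M.IsFd) : DerFd.{x} T := ⟨der M, M, hM, ⟨Iso.refl _⟩⟩

/-- Isomorphisms in `D(T)` are isomorphisms in `Dᶠᵈ(T)`. -/
def isoMkFd {X Y : DerFd.{x} T} (e : X.obj ≅ Y.obj) : X ≅ Y := ObjectProperty.isoMk _ e

/-- Isomorphisms in `Dᶠᵈ(T)` are isomorphisms in `D(T)`. -/
def isoFd {X Y : DerFd.{x} T} (e : X ≅ Y) : X.obj ≅ Y.obj := (isFd.{x} T).ι.mapIso e

lemma exists_derFd_iso (X : DerFd.{x} T) : ∃ M hM, Nonempty (derFd M hM ≅ X) := by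
  obtain ⟨M, hM, ⟨e⟩⟩ := X.property
  exact ⟨M, hM, ⟨isoMkFd e⟩⟩

instance : (fdToDer.{x} T).Full where
  map_surjective {M N} f := by
    obtain ⟨φ, hφ, h⟩ := exists_derMap_of_isKProj (N := N.as.obj.1) M.as.obj.2.2
      (f.hom : der M.as.obj.1 ⟶ der N.as.obj.1)
    exact ⟨(dgFd T).homH0 (X := M.as.obj) (Y := N.as.obj) φ hφ,
      ObjectProperty.hom_ext _ h.symm⟩

instance : (fdToDer.{x} T).Faithful where
  map_injective {M N} f g h := by
    obtain ⟨φ, hφ, rfl⟩ := (dgFd T).exists_homH0 (X := M.as.obj) (Y := N.as.obj) f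
    obtain ⟨ψ, hψ, rfl⟩ := (dgFd T).exists_homH0 (X := M.as.obj) (Y := N.as.obj) g
    have h₁ : derMap (M := M.as.obj.1) (N := N.as.obj.1) φ hφ = derMap ψ hψ :=
      congrArg (fun f => f.hom) h
    have h₂ := (qMap_bijective_of_isKProj M.as.obj.2.2 N.as.obj.1).1 h₁
    exact ((dgFd T).homH0_eq_iff (X := M.as.obj) (Y := N.as.obj) hφ hψ).2
      ((T.dgMod.homH0_eq_iff hφ hψ).1 h₂)

lemma exists_isKProj_resolution (M : DGMod.{max x u v w} T) :
    ∃ (P : DGMod.{max x u v w} T) (f : (T.dgMod.Hom P M).X 0)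
      (hf : ((T.dgMod.Hom P M).d 0 1).hom f = 0), P.IsKProj ∧ ∀ t, QuasiIso (evalMap f hf t) := by
  obtain ⟨P, f, hf, hP, hq⟩ := exists_relKProj_resolution.{x} (fun _ => True) M
  exact ⟨P, f, hf, relKProj_true_iff.1 hP, fun t => hq t trivial⟩

/-- The object of the homotopy category of `Dᶠᵈ(T)` given by a dg module. -/
def fdObj (M : DGMod.{x} T) (h₁ : M.IsFd) (h₂ : M.IsKProj) : (dgFd.{x} T).H0 :=
  (dgFd.{x} T).toH0 ⟨M, h₁, h₂⟩

lemma exists_fdToDer_iso (X : DerFd.{max x u v w} T) :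
    ∃ N, Nonempty ((fdToDer.{max x u v w} T).obj N ≅ X) := by
  obtain ⟨M, hM, ⟨e⟩⟩ := exists_derFd_iso X
  obtain ⟨P, f, hf, hP, hq⟩ := exists_isKProj_resolution.{x} M
  have := (isIso_derMap_iff f hf).2 hq
  have i' : der P ≅ der M := asIso (derMap f hf)
  have i : derFd P ((isFd_of_quasiIso f hf hq).2 hM) ≅ derFd M hM :=
    isoMkFd (X := derFd P _) (Y := derFd M hM) i'
  exact ⟨fdObj P ((isFd_of_quasiIso f hf hq).2 hM) hP, ⟨i ≪≫ e⟩⟩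

lemma isEquivalence_fdToDer : (fdToDer.{max x u v w} T).IsEquivalence where
  essSurj := ⟨exists_fdToDer_iso.{x}⟩

/-- An object of `Dᶠᵈ(T)` inverts a closed morphism of degree `0` of `T`. -/
def Inverts (X : DerFd.{x} T) {s t : T.Obj} (f : (T.Hom s t).X 0)
    (hf : ((T.Hom s t).d 0 1).hom f = 0) : Prop :=
  ∃ M : DGMod.{x} T, Nonempty (der M ≅ X.obj) ∧ QuasiIso (actMap M f hf)

lemma inverts_iff {X : DerFd.{max x u v w} T} {M : DGMod.{max x u v w} T} (e : der M ≅ X.obj)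
    {s t : T.Obj} (f : (T.Hom s t).X 0) (hf : ((T.Hom s t).d 0 1).hom f = 0) :
    Inverts X f hf ↔ QuasiIso (actMap M f hf) := by
  refine ⟨?_, fun h => ⟨M, ⟨e⟩, h⟩⟩
  rintro ⟨N, ⟨e'⟩, h⟩
  exact (quasiIso_actMap_iff_of_iso.{x} (e' ≪≫ e.symm) f hf).1 h

lemma inverts_derFd_iff {M : DGMod.{max x u v w} T} (hM : M.IsFd)
    {s t : T.Obj} (f : (T.Hom s t).X 0) (hf : ((T.Hom s t).d 0 1).hom f = 0) :
    Inverts (derFd M hM) f hf ↔ QuasiIso (actMap M f hf) :=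
  inverts_iff.{x} (Iso.refl _) f hf

lemma Inverts.of_iso {X Y : DerFd.{x} T} (e : X ≅ Y) {s t : T.Obj} {f : (T.Hom s t).X 0}
    {hf : ((T.Hom s t).d 0 1).hom f = 0} (h : Inverts X f hf) : Inverts Y f hf := by
  obtain ⟨M, ⟨e'⟩, h⟩ := h
  exact ⟨M, ⟨e' ≪≫ isoFd e⟩, h⟩

end

end DGCat

namespace DGFunctor

open DGCat DGMod ModuleComplex

variable {C : DGCat.{w, v, u} k} {T : DGCat.{w, v', u'} k} (φ : DGFunctor C T)

lemma d_map {s t : C.Obj} {f : (C.Hom s t).X 0} (hf : ((C.Hom s t).d 0 1).hom f = 0) :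
    ((T.Hom (φ.obj s) (φ.obj t)).d 0 1).hom (φ.map 0 f) = 0 := by
  rw [← φ.map_d 0 1 (zero_add 1), hf, map_zero]

lemma isFd_resObj {M : DGMod.{x} T} (hM : M.IsFd) : (φ.resObj M).IsFd := fun c => hM (φ.obj c)

/-- The restriction of the object given by a dg module is given by the restriction of this
dg module. -/
def shriekIso {M : DGMod.{x} T} (hM : M.IsFd) :
    φ.shriek.obj (derFd M hM) ≅ derFd (φ.resObj M) (φ.isFd_resObj hM) :=
  isoMkFd (φ.resIso M)

lemma shriek_map_bijective_iff (X Y : DerFd.{x} T) :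
    Function.Bijective (φ.shriek.map : (X ⟶ Y) → _) ↔
      Function.Bijective (φ.resDer.map : (X.obj ⟶ Y.obj) → _) := by
  constructor
  · intro h
    refine ⟨fun f g e => ?_, fun f => ?_⟩
    · exact congrArg (fun f => f.hom) (h.1 (a₁ := ObjectProperty.homMk f)
        (a₂ := ObjectProperty.homMk g) (ObjectProperty.hom_ext _ e))
    · obtain ⟨g, hg⟩ := h.2 (ObjectProperty.homMk f)
      exact ⟨g.hom, congrArg (fun f => f.hom) hg⟩
  · intro h
    refine ⟨fun f g e => ObjectProperty.hom_ext _ (h.1 (congrArg (fun f => f.hom) e)), fun f => ?_⟩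
    obtain ⟨g, hg⟩ := h.2 f.hom
    exact ⟨ObjectProperty.homMk g, ObjectProperty.hom_ext _ hg⟩

variable {φ}

lemma Inverts.shriek_iff {X : DerFd.{max x u v w u' v'} T} {s t : C.Obj} {f : (C.Hom s t).X 0}
    (hf : ((C.Hom s t).d 0 1).hom f = 0) :
    Inverts (φ.shriek.obj X) f hf ↔ Inverts X (φ.map 0 f) (φ.d_map hf) := by
  obtain ⟨M, hM, ⟨e⟩⟩ := X.property
  have e : der M ≅ X.obj := e
  have e' : der (φ.resObj M) ≅ (φ.shriek.obj X).obj := (φ.resIso M).symm ≪≫ φ.resDer.mapIso e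
  exact (inverts_iff.{max x u v w u' v'} e' f hf).trans
    (inverts_iff.{max x u v w u' v'} e (φ.map 0 f) (φ.d_map hf)).symm

lemma shriek_map_bijective_of_counit (hφ : φ.IsQuasiFF) {N : DerFd.{max x u v w u' v'} T}
    (h : ∀ t, ∃ (c : C.Obj) (ε : (T.Hom (φ.obj c) t).X 0)
      (hε : ((T.Hom (φ.obj c) t).d 0 1).hom ε = 0), φ.IsCounit ε hε ∧ Inverts N ε hε)
    (M : DerFd.{max x u v w u' v'} T) : Function.Bijective (φ.shriek.map : (M ⟶ N) → _) := by
  obtain ⟨M', hM', ⟨i⟩⟩ := exists_derFd_iso M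
  obtain ⟨N', hN', ⟨j⟩⟩ := exists_derFd_iso N
  refine (φ.shriek.map_bijective_iff_of_iso i j).1 ((φ.shriek_map_bijective_iff _ _).2
    (resDer_map_bijective_of_counit.{x} hφ hN' (fun t => ?_) M'))
  obtain ⟨c, ε, hε, h₁, h₂⟩ := h t
  exact ⟨c, ε, hε, h₁, (inverts_iff.{max x u v w u' v'} (isoFd j) ε hε).1 h₂⟩

lemma shriek_map_bijective_of_unit (hφ : φ.IsQuasiFF) {M : DerFd.{max x u v w u' v'} T}
    (h : ∀ t, ∃ (c : C.Obj) (η : (T.Hom t (φ.obj c)).X 0)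
      (hη : ((T.Hom t (φ.obj c)).d 0 1).hom η = 0), φ.IsUnit η hη ∧ Inverts M η hη)
    (N : DerFd.{max x u v w u' v'} T) : Function.Bijective (φ.shriek.map : (M ⟶ N) → _) := by
  obtain ⟨M', hM', ⟨i⟩⟩ := exists_derFd_iso M
  obtain ⟨N', hN', ⟨j⟩⟩ := exists_derFd_iso N
  refine (φ.shriek.map_bijective_iff_of_iso i j).1 ((φ.shriek_map_bijective_iff _ _).2
    (resDer_map_bijective_of_unit.{x} hφ hN' fun t => ?_))
  obtain ⟨c, η, hη, h₁, h₂⟩ := h t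
  exact ⟨c, η, hη, h₁, (inverts_iff.{max x u v w u' v'} (isoFd i) η hη).1 h₂⟩

lemma exists_shriek_of_counit (hφ : φ.IsQuasiFF) (h : ∀ t, ∃ (c : C.Obj)
    (ε : (T.Hom (φ.obj c) t).X 0) (hε : ((T.Hom (φ.obj c) t).d 0 1).hom ε = 0), φ.IsCounit ε hε)
    (G : DerFd.{max x u v w u' v'} C) :
    ∃ E : DerFd.{max x u v w u' v'} T, Nonempty (φ.shriek.obj E ≅ G) ∧
      ∀ (c : C.Obj) (t : T.Obj) (ε : (T.Hom (φ.obj c) t).X 0)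
        (hε : ((T.Hom (φ.obj c) t).d 0 1).hom ε = 0), φ.IsCounit ε hε → Inverts E ε hε := by
  obtain ⟨G', hG', ⟨i⟩⟩ := exists_derFd_iso G
  obtain ⟨E, hE, ⟨e⟩, h₁⟩ := exists_resObj_of_counit.{x} hφ h hG'
  have j : derFd (φ.resObj E) (φ.isFd_resObj hE) ≅ derFd G' hG' :=
    isoMkFd (X := derFd _ (φ.isFd_resObj hE)) (Y := derFd G' hG') e
  exact ⟨derFd E hE, ⟨φ.shriekIso hE ≪≫ j ≪≫ i⟩, fun c t ε hε h₂ =>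
    (inverts_derFd_iff.{max x u v w u' v'} hE ε hε).2 (h₁ c t ε hε h₂)⟩

lemma exists_shriek_of_unit (hφ : φ.IsQuasiFF) (h : ∀ t, ∃ (c : C.Obj)
    (η : (T.Hom t (φ.obj c)).X 0) (hη : ((T.Hom t (φ.obj c)).d 0 1).hom η = 0), φ.IsUnit η hη)
    (G : DerFd.{max x u v w u' v'} C) :
    ∃ E : DerFd.{max x u v w u' v'} T, Nonempty (φ.shriek.obj E ≅ G) ∧
      ∀ (c : C.Obj) (t : T.Obj) (η : (T.Hom t (φ.obj c)).X 0)
        (hη : ((T.Hom t (φ.obj c)).d 0 1).hom η = 0), φ.IsUnit η hη → Inverts E η hη := by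
  obtain ⟨G', hG', ⟨i⟩⟩ := exists_derFd_iso G
  obtain ⟨E, hE, ⟨e⟩, h₁⟩ := exists_resObj_of_unit.{x} hφ h hG'
  have j : derFd (φ.resObj E) (φ.isFd_resObj hE) ≅ derFd G' hG' :=
    isoMkFd (X := derFd _ (φ.isFd_resObj hE)) (Y := derFd G' hG') e
  exact ⟨derFd E hE, ⟨φ.shriekIso hE ≪≫ j ≪≫ i⟩, fun c t η hη h₂ =>
    (inverts_derFd_iff.{max x u v w u' v'} hE η hη).2 (h₁ c t η hη h₂)⟩

end DGFunctor
end

noncomputable section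

variable {k : Type w} [Field k]

section

open ModuleComplex

variable {R : DGCat.{w, x, y} k} {C : DGCat.{w, v, u} k} {T : DGCat.{w, v', u'} k}

/-- A dg functor induces a quasi-isomorphism on the complex of morphisms from `c` to `c'`. -/
def DGFunctor.QuasiFFAt (φ : DGFunctor C T) (c c' : C.Obj) : Prop :=
  ∀ m : ℤ,
    (∀ y : (T.Hom (φ.obj c) (φ.obj c')).X (m + 1), ((T.Hom _ _).d (m + 1) (m + 1 + 1)).hom y = 0 →
      ∃ z : (C.Hom c c').X (m + 1), ((C.Hom c c').d (m + 1) (m + 1 + 1)).hom z = 0 ∧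
        ∃ e, ((T.Hom (φ.obj c) (φ.obj c')).d m (m + 1)).hom e = φ.map (m + 1) z - y) ∧
    (∀ z : (C.Hom c c').X (m + 1), ((C.Hom c c').d (m + 1) (m + 1 + 1)).hom z = 0 →
      ∀ e, ((T.Hom (φ.obj c) (φ.obj c')).d m (m + 1)).hom e = φ.map (m + 1) z →
        ∃ e', ((C.Hom c c').d m (m + 1)).hom e' = z)

namespace DGFunctor.QuasiFFAt

variable {φ : DGFunctor C T} {c c' : C.Obj}

lemma surj (h : φ.QuasiFFAt c c') {m n p : ℤ} (hm : m + 1 = n) (hp : n + 1 = p)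
    (y : (T.Hom (φ.obj c) (φ.obj c')).X n) (hy : ((T.Hom _ _).d n p).hom y = 0) :
    ∃ z : (C.Hom c c').X n, ((C.Hom c c').d n p).hom z = 0 ∧
      ∃ e, ((T.Hom (φ.obj c) (φ.obj c')).d m n).hom e = φ.map n z - y := by
  subst hm hp
  exact (h m).1 y hy

lemma inj (h : φ.QuasiFFAt c c') {m n p : ℤ} (hm : m + 1 = n) (hp : n + 1 = p)
    (z : (C.Hom c c').X n) (hz : ((C.Hom c c').d n p).hom z = 0)
    (e) (he : ((T.Hom (φ.obj c) (φ.obj c')).d m n).hom e = φ.map n z) :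
    ∃ e', ((C.Hom c c').d m n).hom e' = z := by
  subst hm hp
  exact (h m).2 z hz e he

lemma mk' (h : ∀ n : ℤ,
    (∀ y : (T.Hom (φ.obj c) (φ.obj c')).X n, ((T.Hom _ _).d n (n + 1)).hom y = 0 →
      ∃ z : (C.Hom c c').X n, ((C.Hom c c').d n (n + 1)).hom z = 0 ∧
        ∃ e, ((T.Hom (φ.obj c) (φ.obj c')).d (n - 1) n).hom e = φ.map n z - y) ∧
    (∀ z : (C.Hom c c').X n, ((C.Hom c c').d n (n + 1)).hom z = 0 →
      ∀ e, ((T.Hom (φ.obj c) (φ.obj c')).d (n - 1) n).hom e = φ.map n z →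
        ∃ e', ((C.Hom c c').d (n - 1) n).hom e' = z)) : φ.QuasiFFAt c c' := by
  intro m
  obtain ⟨n, hn⟩ : ∃ n, n = m + 1 := ⟨_, rfl⟩
  obtain rfl : m = n - 1 := by omega
  rw [← hn]
  exact h n

/-- A right inverse of a quasi-fully faithful functor is quasi-fully faithful. -/
lemma of_comp {φ : DGFunctor R C} {ψ : DGFunctor C T} {c c' : R.Obj}
    (h : (φ.comp ψ).QuasiFFAt c c') (h' : ψ.QuasiFFAt (φ.obj c) (φ.obj c')) :
    φ.QuasiFFAt c c' := by
  refine fun m => ⟨fun y hy => ?_, fun z hz e he => ?_⟩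
  · obtain ⟨z, hz, e, he⟩ := (h m).1 (ψ.map (m + 1) y) (by
      refine (ψ.map_d _ _ rfl y).symm.trans ?_
      rw [hy]
      exact map_zero (ψ.map _))
    refine ⟨z, hz, (h' m).2 (φ.map (m + 1) z - y) ?_ e (he.trans (map_sub (ψ.map _) _ _).symm)⟩
    rw [map_sub, hy, sub_zero, ← φ.map_d _ _ rfl, hz, map_zero]
  · refine (h m).2 z hz (ψ.map m e) ((ψ.map_d _ _ rfl e).symm.trans ?_)
    rw [he]
    rfl

lemma quasiIso_pre {a b : C.Obj} (ha : φ.QuasiFFAt a c) (hb : φ.QuasiFFAt b c)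
    (f : (C.Hom a b).X 0) (hf : ((C.Hom a b).d 0 1).hom f = 0)
    (h : QuasiIso (T.pre (φ.map 0 f) (φ.d_map hf) (φ.obj c))) : QuasiIso (C.pre f hf c) := by
  refine quasiIso_mk _ (fun m y hy => ?_) fun m z hz e he => ?_
  · obtain ⟨z, hz, e, he⟩ := exists_of_quasiIso h rfl rfl (φ.map (m + 1) y) (by
      rw [← φ.map_d _ _ rfl, hy, map_zero])
    obtain ⟨z', hz', e', he'⟩ := hb.surj rfl rfl z hz
    refine ⟨z', hz', ?_⟩
    refine ha.inj rfl rfl (C.comp (zero_add _) f z' - y) ?_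
      (T.comp (zero_add _) (φ.map 0 f) e' + e) ?_
    · rw [map_sub, hy, C.d_comp_of_closed _ _ _ hf hz', sub_zero]
    · rw [map_add, map_sub, φ.map_comp, he,
        T.d_comp_of_closed_left _ rfl rfl (zero_add _) _ _ (φ.d_map hf), he', map_sub]
      exact sub_add_sub_cancel _ _ _
  · obtain ⟨e₁, he₁⟩ := exists_of_quasiIso' h rfl rfl (φ.map (m + 1) z)
      (by rw [← φ.map_d _ _ rfl, hz, map_zero]) (φ.map m e) (by
        rw [← φ.map_d _ _ rfl, he]
        exact φ.map_comp _ _ _)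
    exact hb.inj rfl rfl z hz e₁ he₁

lemma quasiIso_post {a b : C.Obj} (ha : φ.QuasiFFAt c a) (hb : φ.QuasiFFAt c b)
    (f : (C.Hom a b).X 0) (hf : ((C.Hom a b).d 0 1).hom f = 0)
    (h : QuasiIso (T.post (φ.obj c) (φ.map 0 f) (φ.d_map hf))) : QuasiIso (C.post c f hf) := by
  refine quasiIso_mk _ (fun m y hy => ?_) fun m z hz e he => ?_
  · obtain ⟨z, hz, e, he⟩ := exists_of_quasiIso h rfl rfl (φ.map (m + 1) y) (by
      rw [← φ.map_d _ _ rfl, hy, map_zero])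
    obtain ⟨z', hz', e', he'⟩ := ha.surj rfl rfl z hz
    refine ⟨z', hz', ?_⟩
    refine hb.inj rfl rfl (C.comp (add_zero _) z' f - y) ?_
      (T.comp (add_zero _) e' (φ.map 0 f) + e) ?_
    · rw [map_sub, hy, C.d_comp_of_closed _ _ _ hz' hf, sub_zero]
    · rw [map_add, map_sub, φ.map_comp, he,
        T.d_comp_of_closed_right _ rfl rfl (add_zero _) _ _ (φ.d_map hf), he', map_sub,
        Int.negOnePow_zero, one_smul, LinearMap.sub_apply]
      exact sub_add_sub_cancel _ _ _
  · obtain ⟨e₁, he₁⟩ := exists_of_quasiIso' h rfl rfl (φ.map (m + 1) z)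
      (by rw [← φ.map_d _ _ rfl, hz, map_zero]) (φ.map m e) (by
        rw [← φ.map_d _ _ rfl, he]
        exact φ.map_comp _ _ _)
    exact ha.inj rfl rfl z hz e₁ he₁

end DGFunctor.QuasiFFAt

end

namespace DGCat

open ModuleComplex

variable {T : DGCat.{w, v, u} k}

lemma quasiIso_pre_ident (t s : T.Obj) : QuasiIso (T.pre (T.ident t) (T.d_ident t) s) := by
  have : T.pre (T.ident t) (T.d_ident t) s = 𝟙 _ := by
    ext n f : 3
    exact T.ident_comp _ f
  rw [this]
  infer_instance

lemma quasiIso_post_ident (t s : T.Obj) : QuasiIso (T.post s (T.ident t) (T.d_ident t)) := by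
  have : T.post s (T.ident t) (T.d_ident t) = 𝟙 _ := by
    ext n f : 3
    exact T.comp_ident _ f
  rw [this]
  infer_instance

namespace Arrow

lemma d_eq {f f' : T.Arrow} {n n' : ℤ} (h : n + 1 = n') (φ : HomX f f' n) :
    ((T.arrow.Hom f f').d n n').hom φ = homD f f' n n' h φ :=
  homComplex_d_apply f f' n n' h φ

lemma quasiFFAt_arrowSrc {f f' : T.Arrow} (h : QuasiIso (T.pre f.hom f.closed f'.tgt)) :
    T.arrowSrc.QuasiFFAt f f' := by
  refine .mk' fun n => ⟨fun (u : (T.Hom f.src f'.src).X n) hu => ?_,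
    fun (z : HomX f f' n) hz (e : (T.Hom f.src f'.src).X (n - 1)) he => ?_⟩
  · obtain ⟨v, hv, e, he⟩ := exists_of_quasiIso h (sub_add_cancel n 1) rfl
      (T.comp (add_zero n) u f'.hom) (T.d_comp_of_closed _ _ _ hu f'.closed)
    refine ⟨((u, v, n.negOnePow • e) : HomX f f' n), ?_, 0, (map_zero _).trans (sub_self u).symm⟩
    rw [d_eq rfl]
    refine Prod.ext hu (Prod.ext hv ?_)
    change ((T.Hom f.src f'.tgt).d (n - 1) (n + 1 - 1)).hom (n.negOnePow • e) +
      n.negOnePow • (T.comp (show n + 0 = n + 1 - 1 by omega) u f'.hom -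
        T.comp (show 0 + n = n + 1 - 1 by omega) f.hom v) = 0
    have : ∀ p (hp : p = n), ((T.Hom f.src f'.tgt).d (n - 1) p).hom e =
        T.comp (show 0 + n = p by omega) f.hom v -
          T.comp (show n + 0 = p by omega) u f'.hom := by
      rintro _ rfl
      exact he
    rw [Units.smul_def, map_zsmul, this _ (by omega), Units.smul_def]
    module
  · obtain ⟨u, v, b⟩ := z
    rw [d_eq rfl] at hz
    have hu : ((T.Hom f.src f'.src).d n (n + 1)).hom u = 0 := congrArg Prod.fst hz
    have hv : ((T.Hom f.tgt f'.tgt).d n (n + 1)).hom v = 0 := congrArg (fun x => x.2.1) hz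
    have hb : ((T.Hom f.src f'.tgt).d (n - 1) n).hom b + n.negOnePow •
        (T.comp (add_zero n) u f'.hom - T.comp (zero_add n) f.hom v) = 0 := by
      have : ∀ p (hp : p = n), ((T.Hom f.src f'.tgt).d (n - 1) p).hom b + n.negOnePow •
          (T.comp (show n + 0 = p by omega) u f'.hom -
            T.comp (show 0 + n = p by omega) f.hom v) = 0 →
          ((T.Hom f.src f'.tgt).d (n - 1) n).hom b + n.negOnePow •
            (T.comp (add_zero n) u f'.hom - T.comp (zero_add n) f.hom v) = 0 := by
        rintro _ rfl h
        exact h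
      exact this (n + 1 - 1) (by omega) (congrArg (fun x => x.2.2) hz)
    have he : ((T.Hom f.src f'.src).d (n - 1) n).hom e = u := he
    have s : ((n - 1).negOnePow : ℤ) = -(n.negOnePow : ℤ) := by
      rw [Int.negOnePow_sub, Int.negOnePow_one]; simp
    have s' : (n.negOnePow : ℤ) * (n.negOnePow : ℤ) = 1 := Int.units_coe_mul_self _
    have h₁ : ((T.Hom f.src f'.tgt).d (n - 1) n).hom
        (T.comp (add_zero (n - 1)) e f'.hom + n.negOnePow • b) = T.comp (zero_add n) f.hom v := by
      rw [map_add, T.d_comp_of_closed_right _ (sub_add_cancel n 1) (sub_add_cancel n 1)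
        (add_zero n) _ _ f'.closed, he, Units.smul_def, Units.smul_def, map_zsmul,
        eq_neg_of_add_eq_zero_left hb, Units.smul_def, smul_neg, smul_smul, s']
      simp
    obtain ⟨v₁, hv₁⟩ := exists_of_quasiIso' h (sub_add_cancel n 1) rfl v hv _ h₁
    obtain ⟨v₂, hv₂, b₂, hb₂⟩ := exists_of_quasiIso h (sub_add_cancel (n - 1) 1)
      (sub_add_cancel n 1) (T.comp (add_zero (n - 1)) e f'.hom + n.negOnePow • b -
        T.comp (zero_add (n - 1)) f.hom v₁) (by
          rw [map_sub, h₁, T.d_comp_of_closed_left _ (sub_add_cancel n 1) (sub_add_cancel n 1)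
            (zero_add n) _ _ f.closed, hv₁, sub_self])
    refine ⟨((e, v₁ + v₂, (n - 1).negOnePow • b₂) : HomX f f' (n - 1)), ?_⟩
    rw [d_eq (sub_add_cancel n 1)]
    refine Prod.ext he (Prod.ext ?_ ?_)
    · exact (map_add _ _ _).trans (by rw [hv₁, hv₂, add_zero])
    · change ((T.Hom f.src f'.tgt).d (n - 1 - 1) (n - 1)).hom ((n - 1).negOnePow • b₂) +
        (n - 1).negOnePow • (T.comp (add_zero (n - 1)) e f'.hom -
          T.comp (zero_add (n - 1)) f.hom (v₁ + v₂)) = b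
      rw [Units.smul_def, map_zsmul, hb₂, Units.smul_def, Units.smul_def, s]
      have h₂ : ((T.pre f.hom f.closed f'.tgt).f (n - 1)).hom v₂ =
        T.comp (zero_add (n - 1)) f.hom v₂ := rfl
      rw [h₂, map_add]
      have h₃ : (n.negOnePow : ℤ) • (n.negOnePow : ℤ) • b = b := by rw [smul_smul, s', one_smul]
      refine Eq.trans ?_ h₃
      module

lemma quasiFFAt_arrowTgt {f f' : T.Arrow} (h : QuasiIso (T.post f.src f'.hom f'.closed)) :
    T.arrowTgt.QuasiFFAt f f' := by
  refine .mk' fun n => ⟨fun (v : (T.Hom f.tgt f'.tgt).X n) hv => ?_,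
    fun (z : HomX f f' n) hz (e : (T.Hom f.tgt f'.tgt).X (n - 1)) he => ?_⟩
  · obtain ⟨u, hu, e, he⟩ := exists_of_quasiIso h (sub_add_cancel n 1) rfl
      (T.comp (zero_add n) f.hom v) (T.d_comp_of_closed _ _ _ f.closed hv)
    refine ⟨((u, v, -(n.negOnePow • e)) : HomX f f' n), ?_, 0,
      (map_zero _).trans (sub_self v).symm⟩
    rw [d_eq rfl]
    refine Prod.ext hu (Prod.ext hv ?_)
    change ((T.Hom f.src f'.tgt).d (n - 1) (n + 1 - 1)).hom (-(n.negOnePow • e)) +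
      n.negOnePow • (T.comp (show n + 0 = n + 1 - 1 by omega) u f'.hom -
        T.comp (show 0 + n = n + 1 - 1 by omega) f.hom v) = 0
    have : ∀ p (hp : p = n), ((T.Hom f.src f'.tgt).d (n - 1) p).hom e =
        T.comp (show n + 0 = p by omega) u f'.hom -
          T.comp (show 0 + n = p by omega) f.hom v := by
      rintro _ rfl
      exact he
    rw [map_neg, Units.smul_def, map_zsmul, this _ (by omega), Units.smul_def,
      neg_add_cancel]
  · obtain ⟨u, v, b⟩ := z
    rw [d_eq rfl] at hz
    have hu : ((T.Hom f.src f'.src).d n (n + 1)).hom u = 0 := congrArg Prod.fst hz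
    have hv : ((T.Hom f.tgt f'.tgt).d n (n + 1)).hom v = 0 := congrArg (fun x => x.2.1) hz
    have hb : ((T.Hom f.src f'.tgt).d (n - 1) n).hom b + n.negOnePow •
        (T.comp (add_zero n) u f'.hom - T.comp (zero_add n) f.hom v) = 0 := by
      have : ∀ p (hp : p = n), ((T.Hom f.src f'.tgt).d (n - 1) p).hom b + n.negOnePow •
          (T.comp (show n + 0 = p by omega) u f'.hom -
            T.comp (show 0 + n = p by omega) f.hom v) = 0 →
          ((T.Hom f.src f'.tgt).d (n - 1) n).hom b + n.negOnePow •
            (T.comp (add_zero n) u f'.hom - T.comp (zero_add n) f.hom v) = 0 := by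
        rintro _ rfl h
        exact h
      exact this (n + 1 - 1) (by omega) (congrArg (fun x => x.2.2) hz)
    have he : ((T.Hom f.tgt f'.tgt).d (n - 1) n).hom e = v := he
    have s : ((n - 1).negOnePow : ℤ) = -(n.negOnePow : ℤ) := by
      rw [Int.negOnePow_sub, Int.negOnePow_one]; simp
    have s' : (n.negOnePow : ℤ) * (n.negOnePow : ℤ) = 1 := Int.units_coe_mul_self _
    have h₁ : ((T.Hom f.src f'.tgt).d (n - 1) n).hom
        (T.comp (zero_add (n - 1)) f.hom e - n.negOnePow • b) = T.comp (add_zero n) u f'.hom := by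
      rw [map_sub, T.d_comp_of_closed_left _ (sub_add_cancel n 1) (sub_add_cancel n 1)
        (zero_add n) _ _ f.closed, he, Units.smul_def, map_zsmul,
        eq_neg_of_add_eq_zero_left hb, Units.smul_def, smul_neg, smul_smul, s']
      simp
    obtain ⟨u₁, hu₁⟩ := exists_of_quasiIso' h (sub_add_cancel n 1) rfl u hu _ h₁
    obtain ⟨u₂, hu₂, b₂, hb₂⟩ := exists_of_quasiIso h (sub_add_cancel (n - 1) 1)
      (sub_add_cancel n 1) (T.comp (zero_add (n - 1)) f.hom e - n.negOnePow • b -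
        T.comp (add_zero (n - 1)) u₁ f'.hom) (by
          rw [map_sub, h₁, T.d_comp_of_closed_right _ (sub_add_cancel n 1) (sub_add_cancel n 1)
            (add_zero n) _ _ f'.closed, hu₁, Int.negOnePow_zero, one_smul, sub_self])
    refine ⟨((u₁ + u₂, e, -((n - 1).negOnePow • b₂)) : HomX f f' (n - 1)), ?_⟩
    rw [d_eq (sub_add_cancel n 1)]
    refine Prod.ext ?_ (Prod.ext he ?_)
    · exact (map_add _ _ _).trans (by rw [hu₁, hu₂, add_zero])
    · change ((T.Hom f.src f'.tgt).d (n - 1 - 1) (n - 1)).hom (-((n - 1).negOnePow • b₂)) +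
        (n - 1).negOnePow • (T.comp (add_zero (n - 1)) (u₁ + u₂) f'.hom -
          T.comp (zero_add (n - 1)) f.hom e) = b
      rw [map_neg, Units.smul_def, map_zsmul, hb₂, Units.smul_def, Units.smul_def, s]
      have h₂ : ((T.post f.src f'.hom f'.closed).f (n - 1)).hom u₂ =
        T.comp (add_zero (n - 1)) u₂ f'.hom := rfl
      rw [h₂, map_add, LinearMap.add_apply]
      have h₃ : (n.negOnePow : ℤ) • (n.negOnePow : ℤ) • b = b := by rw [smul_smul, s', one_smul]
      refine Eq.trans ?_ h₃
      module

end Arrow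

end DGCat
end

noncomputable section

section Categories

variable {𝒜 : Type*} {𝒢 : Type*} {𝒯 : Type*} [Category 𝒜] [Category 𝒢] [Category 𝒯]
  {p : 𝒯 ⥤ 𝒢} {q : 𝒜 ⥤ 𝒢} {j : 𝒢 ⥤ 𝒜} {i : 𝒯 ⥤ 𝒜}

lemma CategoryTheory.Functor.essImage_comp_inv_iff [p.IsEquivalence] (N : 𝒯) :
    (q ⋙ p.inv).essImage N ↔ ∃ M, Nonempty (p.obj N ≅ q.obj M) := by
  constructor
  · rintro ⟨M, ⟨e⟩⟩
    exact ⟨M, ⟨p.mapIso e.symm ≪≫ p.asEquivalence.counitIso.app (q.obj M)⟩⟩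
  · rintro ⟨M, ⟨e⟩⟩
    exact ⟨M, ⟨p.inv.mapIso e.symm ≪≫ (p.asEquivalence.unitIso.app N).symm⟩⟩

lemma CategoryTheory.Functor.map_bijective_of_comp_iso_id (e : q ⋙ j ≅ 𝟭 𝒜) {M M' : 𝒜}
    (h : Function.Bijective (j.map : (q.obj M ⟶ q.obj M') → _)) :
    Function.Bijective (q.map : (M ⟶ M') → _) := by
  refine (Function.Bijective.of_comp_iff' h _).1 ?_
  have : j.map ∘ q.map = ((e.app M).homCongr (e.app M')).symm ∘ (id : (M ⟶ M') → _) := by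
    funext f
    have := e.hom.naturality f
    simp only [Function.comp_apply, id, Iso.homCongr_symm, Iso.homCongr_apply]
    rw [← cancel_mono (e.app M').hom]
    simpa using this
  rw [this]
  exact (Equiv.bijective _).comp Function.bijective_id

/-- If `j` has the section `q`, and is fully faithful on the morphisms from the image of `q`, then
`q` is left adjoint to `j`. -/
def CategoryTheory.Functor.adjunctionOfBijectiveLeft (e : q ⋙ j ≅ 𝟭 𝒜)
    (h : ∀ M X, Function.Bijective (j.map : (q.obj M ⟶ X) → _)) : q ⊣ j :=
  Adjunction.mkOfHomEquiv
    { homEquiv := fun M X => (Equiv.ofBijective _ (h M X)).trans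
        ((e.app M).homCongr (Iso.refl (j.obj X)))
      homEquiv_naturality_left_symm := by
        intro M' M X f g
        rw [Equiv.symm_apply_eq]
        have h₁ := (Equiv.ofBijective _ (h M X)).apply_symm_apply ((e.app M).hom ≫ g)
        have h₂ : j.map (((Equiv.ofBijective _ (h M X)).trans
          ((e.app M).homCongr (Iso.refl (j.obj X)))).symm g) = (e.app M).hom ≫ g := by
          refine Eq.trans (congrArg j.map ?_) h₁
          simp
        have h₃ := e.hom.naturality f
        change f ≫ g = e.inv.app M' ≫ j.map (q.map f ≫ _) ≫ 𝟙 _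
        rw [Functor.map_comp, h₂]
        simp only [Functor.comp_map, Functor.id_map] at h₃
        rw [Iso.app_hom, Category.assoc, Category.assoc, Category.comp_id, reassoc_of% h₃,
          Iso.inv_hom_id_app_assoc]
      homEquiv_naturality_right := by
        intro M X X' f g
        simp }

/-- If `j` has the section `q`, and is fully faithful on the morphisms to the image of `q`, then
`q` is right adjoint to `j`. -/
def CategoryTheory.Functor.adjunctionOfBijectiveRight (e : q ⋙ j ≅ 𝟭 𝒜)
    (h : ∀ X M, Function.Bijective (j.map : (X ⟶ q.obj M) → _)) : j ⊣ q :=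
  Adjunction.mkOfHomEquiv
    { homEquiv := fun X M => ((Equiv.ofBijective _ (h X M)).trans
        ((Iso.refl (j.obj X)).homCongr (e.app M))).symm
      homEquiv_naturality_left_symm := by
        intro M' M X f g
        simp
      homEquiv_naturality_right := by
        intro X M M' f g
        rw [Equiv.symm_apply_eq]
        have h₁ := (Equiv.ofBijective _ (h X M)).apply_symm_apply (f ≫ (e.app M).inv)
        have h₂ : j.map (((Equiv.ofBijective _ (h X M)).trans
          ((Iso.refl (j.obj X)).homCongr (e.app M))).symm f) = f ≫ (e.app M).inv := by
          refine Eq.trans (congrArg j.map ?_) h₁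
          simp
        have h₃ := e.hom.naturality g
        change f ≫ g = 𝟙 _ ≫ j.map (_ ≫ q.map g) ≫ e.hom.app M'
        rw [Functor.map_comp, h₂]
        simp only [Functor.comp_map, Functor.id_map] at h₃
        simp [h₃] }

lemma CategoryTheory.Functor.exists_leftAdjoint_of_roof [p.IsEquivalence] (e : q ⋙ j ≅ 𝟭 𝒜)
    (e' : p ⋙ j ≅ i) (h : ∀ M X, Function.Bijective (j.map : (q.obj M ⟶ X) → _)) :
    ∃ F : 𝒜 ⥤ 𝒯, Nonempty (F ⋙ p ≅ q) ∧ F.Full ∧ F.Faithful ∧ Nonempty (F ⊣ i) ∧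
      ∀ N, F.essImage N ↔ ∃ M, Nonempty (p.obj N ≅ q.obj M) := by
  have h₁ : q.Full := ⟨fun f => (q.map_bijective_of_comp_iso_id e (h _ _)).2 f⟩
  have h₂ : q.Faithful := ⟨fun f => (q.map_bijective_of_comp_iso_id e (h _ _)).1 f⟩
  exact ⟨q ⋙ p.inv, ⟨Functor.associator _ _ _ ≪≫ q.isoWhiskerLeft p.asEquivalence.counitIso ≪≫
    q.rightUnitor⟩, inferInstance, inferInstance,
    ⟨((q.adjunctionOfBijectiveLeft e h).comp p.asEquivalence.symm.toAdjunction).ofNatIsoRight e'⟩,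
    fun N => Functor.essImage_comp_inv_iff N⟩

lemma CategoryTheory.Functor.exists_rightAdjoint_of_roof [p.IsEquivalence] (e : q ⋙ j ≅ 𝟭 𝒜)
    (e' : p ⋙ j ≅ i) (h : ∀ X M, Function.Bijective (j.map : (X ⟶ q.obj M) → _)) :
    ∃ F : 𝒜 ⥤ 𝒯, Nonempty (F ⋙ p ≅ q) ∧ F.Full ∧ F.Faithful ∧ Nonempty (i ⊣ F) ∧
      ∀ N, F.essImage N ↔ ∃ M, Nonempty (p.obj N ≅ q.obj M) := by
  have h₁ : q.Full := ⟨fun f => (q.map_bijective_of_comp_iso_id e (h _ _)).2 f⟩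
  have h₂ : q.Faithful := ⟨fun f => (q.map_bijective_of_comp_iso_id e (h _ _)).1 f⟩
  exact ⟨q ⋙ p.inv, ⟨Functor.associator _ _ _ ≪≫ q.isoWhiskerLeft p.asEquivalence.counitIso ≪≫
    q.rightUnitor⟩, inferInstance, inferInstance,
    ⟨(p.asEquivalence.toAdjunction.comp (q.adjunctionOfBijectiveRight e h)).ofNatIsoLeft e'⟩,
    fun N => Functor.essImage_comp_inv_iff N⟩

end Categories

variable {k : Type w} [Field k]

namespace DGFunctor

open DGCat DGMod

/-- The identity dg functor. -/
def id (T : DGCat.{w, v, u} k) : DGFunctor T T where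
  obj X := X
  map _ := LinearMap.id
  map_ident _ := rfl
  map_comp _ _ _ := rfl
  map_d _ _ _ _ := rfl

section

variable (T : DGCat.{w, v, u} k)

/-- The restriction along the identity, on derived categories. -/
def resDerId : (DGFunctor.id T).resDer ≅ 𝟭 (Der.{x} T) :=
  Localization.liftNatIso (toDer.{x} T) (qis.{x} T) (toDer.{x} T ⋙ (DGFunctor.id T).resDer)
    (toDer.{x} T) _ _ ((DGFunctor.id T).resFac ≪≫ Functor.isoWhiskerRight
      (NatIso.ofComponents (F := (DGFunctor.id T).res.toH0) (G := 𝟭 _)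
        (fun M => Iso.refl (modH0 M.as.obj)) (by
          intro M N f
          obtain ⟨f, rfl⟩ := (CategoryTheory.Quotient.functor _).map_surjective f
          exact (Category.comp_id _).trans (Category.id_comp _).symm)) (toDer.{x} T) ≪≫
      Functor.leftUnitor _)

/-- The restriction along the identity. -/
def shriekId : (DGFunctor.id T).shriek ≅ 𝟭 (DerFd.{x} T) :=
  NatIso.ofComponents (fun X => isoMkFd ((resDerId T).app X.obj)) fun f =>
    ObjectProperty.hom_ext _ ((resDerId T).hom.naturality f.hom)

end

section

variable {R : DGCat.{w, z, y} k} {S : DGCat.{w, v, u} k} {T : DGCat.{w, v', u'} k}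
  (F : DGFunctor R S) (G : DGFunctor S T)

/-- The restriction along a composition, on derived categories. -/
def resDerComp : G.resDer ⋙ F.resDer.{x} ≅ (F.comp G).resDer :=
  Localization.liftNatIso (toDer.{x} T) (qis.{x} T) (toDer.{x} T ⋙ G.resDer ⋙ F.resDer)
    (toDer.{x} T ⋙ (F.comp G).resDer) _ _
    ((Functor.associator _ _ _).symm ≪≫ Functor.isoWhiskerRight G.resFac F.resDer ≪≫
      Functor.associator _ _ _ ≪≫ Functor.isoWhiskerLeft G.res.toH0 F.resFac ≪≫
      (Functor.associator _ _ _).symm ≪≫ Functor.isoWhiskerRight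
      (NatIso.ofComponents (F := G.res.toH0 ⋙ F.res.toH0) (G := (F.comp G).res.toH0)
        (fun M => Iso.refl (modH0 (F.resObj (G.resObj M.as.obj)))) (by
          intro M N f
          obtain ⟨f, rfl⟩ := (CategoryTheory.Quotient.functor _).map_surjective f
          exact (Category.comp_id _).trans (Category.id_comp _).symm)) (toDer.{x} R) ≪≫
      (F.comp G).resFac.symm)

/-- The restriction along a composition. -/
def shriekComp : G.shriek ⋙ F.shriek.{x} ≅ (F.comp G).shriek :=
  NatIso.ofComponents (fun X => isoMkFd ((resDerComp F G).app X.obj)) fun f =>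
    ObjectProperty.hom_ext _ ((resDerComp F G).hom.naturality f.hom)

end

end DGFunctor
end

noncomputable section

variable {k : Type w} [Field k]

namespace DGCat

open ModuleComplex

variable {T : DGCat.{w, v, u} k}

lemma IsShift.exists_section {n : ℤ} {X Y : T.Obj} (h : T.IsShift n X Y) {m : ℤ} (hm : m + n = 0) :
    ∃ (g : (T.Hom X Y).X m) (f : (T.Hom Y X).X n) (b : (T.Hom X X).X (-1)),
      ((T.Hom X Y).d m (m + 1)).hom g = 0 ∧ ((T.Hom Y X).d n (n + 1)).hom f = 0 ∧
      ((T.Hom X X).d (-1) 0).hom b = T.comp hm g f - T.ident X := by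
  obtain rfl : m = -n := by omega
  obtain ⟨f, g, hf, hg, _, b, hb⟩ := h
  exact ⟨g, f, b, hg, hf, hb⟩

/-- Precomposition with `η` is a quasi-isomorphism on the morphisms to `b` if it is bijective in
the homotopy category on the morphisms to all shifts of `b`. -/
lemma quasiIso_pre_of_bijective {t a b : T.Obj} {η : (T.Hom t a).X 0}
    {hη : ((T.Hom t a).d 0 1).hom η = 0}
    (h : ∀ n, ∃ b', T.IsShift n b b' ∧
      Function.Bijective fun g : T.toH0 a ⟶ T.toH0 b' => T.homH0 η hη ≫ g) :
    QuasiIso (T.pre η hη b) := by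
  refine quasiIso_mk _ (fun m y hy => ?_) fun m z hz e he => ?_
  · obtain ⟨b', hb, h⟩ := h (m + 1)
    obtain ⟨g, f, c, hg, hf, hc⟩ := hb.exists_section (m := -(m + 1)) (by omega)
    obtain ⟨z, hz⟩ := h.2 (T.homH0 (T.comp (show m + 1 + -(m + 1) = 0 by omega) y g)
      (T.d_comp_of_closed _ _ _ hy hg))
    obtain ⟨z, hz', rfl⟩ := T.exists_homH0 z
    obtain ⟨e, he⟩ := (T.homH0_eq_iff (T.d_comp_of_closed (add_zero 0) _ _ hη hz') _).1 hz
    refine ⟨T.comp (zero_add _) z f, T.d_comp_of_closed _ _ _ hz' hf,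
      (m + 1).negOnePow • T.comp (show -1 + (m + 1) = m by omega) e f +
        T.comp (show m + 1 + -1 = m by omega) y c, ?_⟩
    rw [map_add, Units.smul_def, map_zsmul, T.d_comp_of_closed_right _ (neg_add_cancel 1) rfl
      (zero_add _) _ _ hf, he, T.d_comp_of_closed_left _ (neg_add_cancel 1) rfl (add_zero _) _ _ hy,
      hc, map_sub, map_sub, LinearMap.sub_apply, Units.smul_def, smul_smul, Int.units_coe_mul_self,
      one_smul, T.comp_ident, T.assoc _ (show -(m + 1) + (m + 1) = 0 by omega) _ (add_zero _) y g f,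
      T.assoc _ (zero_add _) _ (zero_add _) η z f]
    exact sub_add_sub_cancel _ _ _
  · obtain ⟨b', hb, h⟩ := h (m + 1)
    obtain ⟨g, f, c, hg, hf, hc⟩ := hb.exists_section (m := -(m + 1)) (by omega)
    have h₀ := T.d_comp_of_closed (show m + 1 + -(m + 1) = 0 by omega) _ _ hz hg
    have : T.homH0 _ h₀ = T.homH0 0 (map_zero _) := by
      refine h.1 ((T.homH0_eq_iff (T.d_comp_of_closed (add_zero 0) _ _ hη h₀)
        (T.d_comp_of_closed (add_zero 0) _ _ hη (map_zero _))).2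
        ⟨(-(m + 1)).negOnePow • T.comp (show m + -(m + 1) = -1 by omega) e g, ?_⟩)
      rw [Units.smul_def, map_zsmul, T.d_comp_of_closed_right _ rfl (neg_add_cancel 1)
        (show m + 1 + -(m + 1) = 0 by omega) _ _ hg, Units.smul_def, smul_smul,
        Int.units_coe_mul_self, one_smul, he, map_zero, sub_zero]
      exact T.assoc _ _ _ _ η z g
    obtain ⟨e₁, he₁⟩ := (T.homH0_eq_iff _ _).1 this
    rw [sub_zero] at he₁
    refine ⟨(m + 1).negOnePow • T.comp (show -1 + (m + 1) = m by omega) e₁ f -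
      T.comp (show m + 1 + -1 = m by omega) z c, ?_⟩
    rw [map_sub, Units.smul_def, map_zsmul, T.d_comp_of_closed_right _ (neg_add_cancel 1) rfl
      (zero_add _) _ _ hf, he₁, T.d_comp_of_closed_left _ (neg_add_cancel 1) rfl (add_zero _) _ _ hz,
      hc, map_sub, Units.smul_def, smul_smul, Int.units_coe_mul_self,
      one_smul, T.comp_ident, T.assoc _ (show -(m + 1) + (m + 1) = 0 by omega) _ (add_zero _) z g f,
      sub_sub_cancel]

/-- Postcomposition with `ε` is a quasi-isomorphism on the morphisms from `b` if it is bijective in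
the homotopy category on the morphisms from all shifts of `b`. -/
lemma quasiIso_post_of_bijective {t a b : T.Obj} {ε : (T.Hom a t).X 0}
    {hε : ((T.Hom a t).d 0 1).hom ε = 0}
    (h : ∀ n, ∃ b', T.IsShift n b b' ∧
      Function.Bijective fun g : T.toH0 b' ⟶ T.toH0 a => g ≫ T.homH0 ε hε) :
    QuasiIso (T.post b ε hε) := by
  refine quasiIso_mk _ (fun m y hy => ?_) fun m z hz e he => ?_
  · obtain ⟨b', hb, h⟩ := h (-(m + 1))
    obtain ⟨g, f, c, hg, hf, hc⟩ := hb.exists_section (m := m + 1) (by omega)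
    obtain ⟨z, hz⟩ := h.2 (T.homH0 (T.comp (show -(m + 1) + (m + 1) = 0 by omega) f y)
      (T.d_comp_of_closed _ _ _ hf hy))
    obtain ⟨z, hz', rfl⟩ := T.exists_homH0 z
    obtain ⟨e, he⟩ := (T.homH0_eq_iff (T.d_comp_of_closed (add_zero 0) _ _ hz' hε) _).1 hz
    refine ⟨T.comp (add_zero _) g z, T.d_comp_of_closed _ _ _ hg hz',
      T.comp (show m + 1 + -1 = m by omega) g e +
        (m + 1).negOnePow • T.comp (show -1 + (m + 1) = m by omega) c y, ?_⟩
    rw [map_add, Units.smul_def, map_zsmul, T.d_comp_of_closed_right _ (neg_add_cancel 1) rfl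
      (zero_add _) _ _ hy, T.d_comp_of_closed_left _ (neg_add_cancel 1) rfl (add_zero _) _ _ hg, he,
      hc, map_sub, map_sub, LinearMap.sub_apply, Units.smul_def, smul_smul, Int.units_coe_mul_self,
      one_smul, T.ident_comp, T.assoc _ (show -(m + 1) + (m + 1) = 0 by omega) _ (add_zero _) g f y]
    refine Eq.trans ?_ (congrArg (· - y) (T.assoc _ (zero_add _) _ (add_zero _) g z ε).symm)
    exact sub_add_sub_cancel _ _ _
  · obtain ⟨b', hb, h⟩ := h (-(m + 1))
    obtain ⟨g, f, c, hg, hf, hc⟩ := hb.exists_section (m := m + 1) (by omega)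
    have h₀ := T.d_comp_of_closed (show -(m + 1) + (m + 1) = 0 by omega) _ _ hf hz
    have : T.homH0 _ h₀ = T.homH0 0 (map_zero _) := by
      refine h.1 ((T.homH0_eq_iff (T.d_comp_of_closed (add_zero 0) _ _ h₀ hε)
        (T.d_comp_of_closed (add_zero 0) _ _ (map_zero _) hε)).2
        ⟨T.comp (show -(m + 1) + m = -1 by omega) f e, ?_⟩)
      rw [T.d_comp_of_closed_left _ rfl (neg_add_cancel 1)
        (show -(m + 1) + (m + 1) = 0 by omega) _ _ hf, he, LinearMap.map_zero₂, sub_zero]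
      exact (T.assoc _ _ _ _ f z ε).symm
    obtain ⟨e₁, he₁⟩ := (T.homH0_eq_iff _ _).1 this
    rw [sub_zero] at he₁
    refine ⟨T.comp (show m + 1 + -1 = m by omega) g e₁ - (m + 1).negOnePow •
      T.comp (show -1 + (m + 1) = m by omega) c z, ?_⟩
    rw [map_sub, Units.smul_def, map_zsmul, T.d_comp_of_closed_right _ (neg_add_cancel 1) rfl
      (zero_add _) _ _ hz, T.d_comp_of_closed_left _ (neg_add_cancel 1) rfl (add_zero _) _ _ hg, he₁,
      hc, map_sub, LinearMap.sub_apply, Units.smul_def, smul_smul, Int.units_coe_mul_self,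
      one_smul, T.ident_comp, T.assoc _ (show -(m + 1) + (m + 1) = 0 by omega) _ (add_zero _) g f z,
      sub_sub_cancel]

section

variable {A : ObjectProperty T.H0}

lemma IsUnitArrow.quasiIso_pre (hT : T.IsPretriangulated) (hA : IsTriangulatedSubcategory A)
    {η : T.Arrow} (h : IsUnitArrow A η) {b : T.Obj} (hb : A (T.toH0 b)) :
    QuasiIso (T.pre η.hom η.closed b) :=
  quasiIso_pre_of_bijective fun n => by
    obtain ⟨b', hb'⟩ := hT.exists_shift n b
    exact ⟨b', hb', h.2 b' (hA.shift n b b' hb' hb)⟩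

lemma IsCounitArrow.quasiIso_post (hT : T.IsPretriangulated) (hA : IsTriangulatedSubcategory A)
    {ε : T.Arrow} (h : IsCounitArrow A ε) {b : T.Obj} (hb : A (T.toH0 b)) :
    QuasiIso (T.post b ε.hom ε.closed) :=
  quasiIso_post_of_bijective fun n => by
    obtain ⟨b', hb'⟩ := hT.exists_shift n b
    exact ⟨b', hb', h.2 b' (hA.shift n b b' hb' hb)⟩

lemma isRightAdjoint_ι_iff : A.ι.IsRightAdjoint ↔ ∀ t : T.Obj, ∃ (a : T.Obj)
    (η : (T.Hom t a).X 0) (hη : ((T.Hom t a).d 0 1).hom η = 0), IsUnitArrow A ⟨t, a, η, hη⟩ := by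
  constructor
  · intro h t
    let adj := Adjunction.ofIsRightAdjoint A.ι
    let a := A.ι.leftAdjoint.obj (T.toH0 t)
    obtain ⟨η, hη, e⟩ := T.exists_homH0 (X := t) (Y := a.obj.as.obj) (adj.unit.app (T.toH0 t))
    refine ⟨a.obj.as.obj, η, hη, a.property, fun b hb => ?_⟩
    refine ⟨fun f g hfg => ?_, fun g => ?_⟩
    · have : (ObjectProperty.homMk f : a ⟶ ⟨T.toH0 b, hb⟩) = ObjectProperty.homMk g := by
        refine (adj.homEquiv (T.toH0 t) ⟨T.toH0 b, hb⟩).injective ?_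
        rw [adj.homEquiv_unit, adj.homEquiv_unit]
        change adj.unit.app (T.toH0 t) ≫ f = adj.unit.app (T.toH0 t) ≫ g
        rw [e]
        exact hfg
      exact congrArg (fun f => f.hom) this
    · obtain ⟨f, hf⟩ := (adj.homEquiv (T.toH0 t) ⟨T.toH0 b, hb⟩).surjective g
      rw [adj.homEquiv_unit] at hf
      refine ⟨f.hom, ?_⟩
      change T.homH0 η hη ≫ f.hom = g
      rw [← e]
      exact hf
  · intro h
    choose a η hη h using h
    let L : T.H0 → A.FullSubcategory := fun t => ⟨T.toH0 (a t.as.obj), (h t.as.obj).1⟩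
    let E : ∀ t (b : A.FullSubcategory), (L t ⟶ b) ≃ (t ⟶ A.ι.obj b) := fun t b =>
      (ObjectProperty.fullyFaithfulι A).homEquiv.trans (Equiv.ofBijective
        (fun g : T.toH0 (a t.as.obj) ⟶ T.toH0 b.obj.as.obj =>
          T.homH0 (η t.as.obj) (hη t.as.obj) ≫ g) ((h t.as.obj).2 b.obj.as.obj b.property))
    exact ⟨_, ⟨Adjunction.adjunctionOfEquivLeft E fun t b b' g f =>
      (Category.assoc (T.homH0 (η t.as.obj) (hη t.as.obj)) f.hom g.hom).symm⟩⟩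

lemma isLeftAdjoint_ι_iff : A.ι.IsLeftAdjoint ↔ ∀ t : T.Obj, ∃ (a : T.Obj)
    (ε : (T.Hom a t).X 0) (hε : ((T.Hom a t).d 0 1).hom ε = 0), IsCounitArrow A ⟨a, t, ε, hε⟩ := by
  constructor
  · intro h t
    let adj := Adjunction.ofIsLeftAdjoint A.ι
    let a := A.ι.rightAdjoint.obj (T.toH0 t)
    obtain ⟨ε, hε, e⟩ := T.exists_homH0 (X := a.obj.as.obj) (Y := t) (adj.counit.app (T.toH0 t))
    refine ⟨a.obj.as.obj, ε, hε, a.property, fun b hb => ?_⟩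
    refine ⟨fun f g hfg => ?_, fun g => ?_⟩
    · have : (ObjectProperty.homMk f : ⟨T.toH0 b, hb⟩ ⟶ a) = ObjectProperty.homMk g := by
        refine (adj.homEquiv ⟨T.toH0 b, hb⟩ (T.toH0 t)).symm.injective ?_
        rw [adj.homEquiv_counit, adj.homEquiv_counit]
        change f ≫ adj.counit.app (T.toH0 t) = g ≫ adj.counit.app (T.toH0 t)
        rw [e]
        exact hfg
      exact congrArg (fun f => f.hom) this
    · obtain ⟨f, hf⟩ := (adj.homEquiv ⟨T.toH0 b, hb⟩ (T.toH0 t)).symm.surjective g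
      rw [adj.homEquiv_counit] at hf
      refine ⟨f.hom, ?_⟩
      change f.hom ≫ T.homH0 ε hε = g
      rw [← e]
      exact hf
  · intro h
    choose a ε hε h using h
    let R : T.H0 → A.FullSubcategory := fun t => ⟨T.toH0 (a t.as.obj), (h t.as.obj).1⟩
    let E : ∀ (b : A.FullSubcategory) t, (b ⟶ R t) ≃ (A.ι.obj b ⟶ t) := fun b t =>
      (ObjectProperty.fullyFaithfulι A).homEquiv.trans (Equiv.ofBijective
        (fun g : T.toH0 b.obj.as.obj ⟶ T.toH0 (a t.as.obj) =>
          g ≫ T.homH0 (ε t.as.obj) (hε t.as.obj)) ((h t.as.obj).2 b.obj.as.obj b.property))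
    refine ⟨_, ⟨Adjunction.adjunctionOfEquivRight (fun b t => (E b t).symm) ?_⟩⟩
    intro b b' t f g
    rw [Equiv.symm_apply_eq]
    refine (congrArg (A.ι.map f ≫ ·) ((E b' t).apply_symm_apply g).symm).trans ?_
    exact (Category.assoc f.hom ((E b' t).symm g).hom (T.homH0 (ε t.as.obj) (hε t.as.obj))).symm

end

end DGCat
end

noncomputable section

lemma CategoryTheory.Functor.nonempty_iso_of_map_bijective_left {C : Type u} [Category.{v} C]
    {D : Type u'} [Category.{v'} D] (F : C ⥤ D) {X Y : C}
    (hX : ∀ Z, Function.Bijective (F.map : (X ⟶ Z) → _))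
    (hY : ∀ Z, Function.Bijective (F.map : (Y ⟶ Z) → _)) (e : F.obj X ≅ F.obj Y) :
    Nonempty (X ≅ Y) := by
  obtain ⟨f, hf⟩ := (hX Y).2 e.hom
  obtain ⟨g, hg⟩ := (hY X).2 e.inv
  exact ⟨⟨f, g, (hX X).1 (by simp [hf, hg]), (hY Y).1 (by simp [hf, hg])⟩⟩

lemma CategoryTheory.Functor.nonempty_iso_of_map_bijective_right {C : Type u} [Category.{v} C]
    {D : Type u'} [Category.{v'} D] (F : C ⥤ D) {X Y : C}
    (hX : ∀ Z, Function.Bijective (F.map : (Z ⟶ X) → _))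
    (hY : ∀ Z, Function.Bijective (F.map : (Z ⟶ Y) → _)) (e : F.obj X ≅ F.obj Y) :
    Nonempty (X ≅ Y) := by
  obtain ⟨f, hf⟩ := (hY X).2 e.hom
  obtain ⟨g, hg⟩ := (hX Y).2 e.inv
  exact ⟨⟨f, g, (hX X).1 (by simp [hf, hg]), (hY Y).1 (by simp [hf, hg])⟩⟩

variable {k : Type w} [Field k]

namespace DGCat

open ModuleComplex DGMod

section

variable {T : DGCat.{w, v, u} k}

lemma exists_homotopy_inverse {s t : T.Obj} {f : (T.Hom s t).X 0}
    {hf : ((T.Hom s t).d 0 1).hom f = 0} (h : IsIso (T.homH0 f hf)) :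
    ∃ (g : (T.Hom t s).X 0) (b : (T.Hom s s).X (-1)) (c : (T.Hom t t).X (-1)),
      ((T.Hom t s).d 0 1).hom g = 0 ∧
      ((T.Hom s s).d (-1) 0).hom b = T.comp (add_zero 0) f g - T.ident s ∧
      ((T.Hom t t).d (-1) 0).hom c = T.comp (add_zero 0) g f - T.ident t := by
  obtain ⟨g, h₁, h₂⟩ := h
  obtain ⟨g, hg, rfl⟩ := T.exists_homH0 g
  obtain ⟨b, hb⟩ := (T.homH0_eq_iff (T.d_comp_zero hf hg) (T.d_ident s)).1 h₁
  obtain ⟨c, hc⟩ := (T.homH0_eq_iff (T.d_comp_zero hg hf) (T.d_ident t)).1 h₂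
  exact ⟨g, b, c, hg, hb, hc⟩

lemma quasiIso_post_of_isIso {s t : T.Obj} {f : (T.Hom s t).X 0}
    {hf : ((T.Hom s t).d 0 1).hom f = 0} (h : IsIso (T.homH0 f hf)) (X : T.Obj) :
    QuasiIso (T.post X f hf) := by
  obtain ⟨g, b, c, hg, hb, hc⟩ := exists_homotopy_inverse h
  refine quasiIso_mk _ (fun m y hy => ?_) fun m z hz e he => ?_
  · refine ⟨T.comp (add_zero _) y g, T.d_comp_of_closed _ _ _ hy hg,
      T.comp (show m + 1 + -1 = m by omega) y c, ?_⟩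
    rw [T.d_comp_of_closed_left _ (neg_add_cancel 1) rfl (add_zero _) _ _ hy, hc, map_sub,
      T.comp_ident, ← T.assoc (add_zero _) (add_zero 0) (add_zero _) (add_zero _) y g f]
    rfl
  · refine ⟨T.comp (add_zero _) e g - T.comp (show m + 1 + -1 = m by omega) z b, ?_⟩
    rw [map_sub, T.d_comp_of_closed_left _ (neg_add_cancel 1) rfl (add_zero _) _ _ hz, hb, map_sub,
      T.comp_ident, T.d_comp_of_closed_right _ rfl rfl (add_zero _) _ _ hg, he,
      ← T.assoc (add_zero _) (add_zero 0) (add_zero _) (add_zero _) z f g, Int.negOnePow_zero,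
      one_smul]
    exact sub_sub_cancel _ _

lemma quasiIso_actMap_of_isIso {s t : T.Obj} {f : (T.Hom s t).X 0}
    {hf : ((T.Hom s t).d 0 1).hom f = 0} (h : IsIso (T.homH0 f hf)) (M : DGMod.{x} T) :
    QuasiIso (actMap M f hf) := by
  obtain ⟨g, b, c, hg, hb, hc⟩ := exists_homotopy_inverse h
  have s : ∀ m : ℤ, (m.negOnePow : ℤ) * (m.negOnePow : ℤ) = 1 := fun m => Int.units_coe_mul_self _
  refine quasiIso_mk _ (fun m y hy => ?_) fun m z hz e he => ?_
  · refine ⟨M.act (add_zero _) y g, ?_,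
      (m + 1).negOnePow • M.act (show m + 1 + -1 = m by omega) y b, ?_⟩
    · rw [M.d_act _ rfl (zero_add 1) rfl, hy, hg]
      simp
    · rw [Units.smul_def, map_zsmul, M.d_act _ rfl (neg_add_cancel 1) rfl, hy, hb, map_sub,
        M.act_ident, ← M.act_act (add_zero _) (add_zero _) (add_zero 0) (add_zero _) y g f,
        map_zero, LinearMap.zero_apply, zero_add, Units.smul_def, smul_smul, s, one_smul]
      rfl
  · refine ⟨M.act (add_zero _) e g -
      (m + 1).negOnePow • M.act (show m + 1 + -1 = m by omega) z c, ?_⟩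
    rw [map_sub, Units.smul_def, map_zsmul, M.d_act _ rfl (neg_add_cancel 1) rfl, hz, hc, map_sub,
        M.act_ident, ← M.act_act (add_zero _) (add_zero _) (add_zero 0) (add_zero _) z f g,
        map_zero, LinearMap.zero_apply, zero_add, Units.smul_def, smul_smul, s, one_smul,
        M.d_act _ rfl (zero_add 1) rfl, he, hg, map_zero, smul_zero, add_zero]
    exact sub_sub_cancel _ _

lemma inverts_of_isIso {s t : T.Obj} {f : (T.Hom s t).X 0}
    {hf : ((T.Hom s t).d 0 1).hom f = 0} (h : IsIso (T.homH0 f hf)) (X : DerFd.{x} T) :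
    Inverts X f hf := by
  obtain ⟨M, hM, ⟨e⟩⟩ := X.property
  exact ⟨M, ⟨e⟩, quasiIso_actMap_of_isIso h M⟩

lemma inverts_ident (X : DerFd.{x} T) (t : T.Obj) : Inverts X (T.ident t) (T.d_ident t) :=
  inverts_of_isIso (inferInstanceAs (IsIso (𝟙 (T.toH0 t)))) X

/-- The dg functor sending an object to its identity morphism. -/
def diag (T : DGCat.{w, v, u} k) : DGFunctor T T.arrow where
  obj t := ⟨t, t, T.ident t, T.d_ident t⟩
  map n := LinearMap.id.prod (LinearMap.id.prod 0)
  map_ident t := rfl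
  map_comp {r s t m n p} h f g := by
    refine Prod.ext rfl (Prod.ext rfl ?_)
    change 0 = T.comp _ (0 : (T.Hom r s).X (m - 1)) g +
      m.negOnePow • T.comp _ f (0 : (T.Hom s t).X (n - 1))
    rw [map_zero, map_zero, smul_zero, LinearMap.zero_apply, add_zero]
  map_d {s t} n n' h f := by
    refine Eq.trans ?_ (Arrow.d_eq h _).symm
    refine Prod.ext rfl (Prod.ext rfl ?_)
    change 0 = ((T.Hom s t).d (n - 1) (n' - 1)).hom 0 + n.negOnePow •
      (T.comp _ f (T.ident t) - T.comp _ (T.ident s) f)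
    obtain ⟨m, hm⟩ : ∃ m, m = n' - 1 := ⟨_, rfl⟩
    have : ∀ m (hm : m = n), T.comp (show n + 0 = m by omega) f (T.ident t) =
        T.comp (show 0 + n = m by omega) (T.ident s) f := by
      rintro _ rfl
      rw [T.comp_ident, T.ident_comp]
    rw [this _ (by omega), sub_self, smul_zero, map_zero, zero_add]

end

end DGCat

namespace DGFunctor

open DGCat

/-- A dg functor to a full dg subcategory. -/
def liftFull {C : DGCat.{w, v, u} k} {T : DGCat.{w, v', u'} k} (φ : DGFunctor C T)
    (P : T.Obj → Prop) (h : ∀ c, P (φ.obj c)) : DGFunctor C (T.full P) where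
  obj c := ⟨φ.obj c, h c⟩
  map n := φ.map n
  map_ident c := φ.map_ident c
  map_comp h f g := φ.map_comp h f g
  map_d n n' h f := φ.map_d n n' h f

variable {C : DGCat.{w, v, u} k} {T : DGCat.{w, v', u'} k} {φ : DGFunctor C T}

/-- The restriction along a quasi-equivalence is an equivalence. -/
lemma isEquivalence_shriek (hφ : φ.IsQuasiFF)
    (h : ∀ t, ∃ c, Nonempty (T.toH0 (φ.obj c) ≅ T.toH0 t)) :
    (φ.shriek.{max x u v w u' v'}).IsEquivalence := by
  have h' : ∀ t, ∃ (c : C.Obj) (ε : (T.Hom (φ.obj c) t).X 0)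
      (hε : ((T.Hom (φ.obj c) t).d 0 1).hom ε = 0), IsIso (T.homH0 ε hε) := by
    intro t
    obtain ⟨c, ⟨e⟩⟩ := h t
    obtain ⟨ε, hε, he⟩ := T.exists_homH0 e.hom
    exact ⟨c, ε, hε, he ▸ inferInstance⟩
  have h₁ := fun M N => shriek_map_bijective_of_counit.{x} hφ (N := N) (fun t => by
    obtain ⟨c, ε, hε, i⟩ := h' t
    exact ⟨c, ε, hε, fun a => quasiIso_post_of_isIso i _, inverts_of_isIso i N⟩) M
  have h₂ := exists_shriek_of_counit.{x} hφ (fun t => by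
    obtain ⟨c, ε, hε, i⟩ := h' t
    exact ⟨c, ε, hε, fun a => quasiIso_post_of_isIso i _⟩)
  exact
    { full := ⟨fun f => (h₁ _ _).2 f⟩
      faithful := ⟨fun f => (h₁ _ _).1 f⟩
      essSurj := ⟨fun G => by
        obtain ⟨E, e, _⟩ := h₂ G
        exact ⟨E, e⟩⟩ }

end DGFunctor

namespace DGCat

open ModuleComplex DGMod

variable {T : DGCat.{w, v, u} k} (A : ObjectProperty T.H0)

lemma isUnitArrow_diag {a : T.Obj} (ha : A (T.toH0 a)) : IsUnitArrow A (T.diag.obj a) := by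
  refine ⟨ha, fun b hb => ?_⟩
  have : (fun g : T.toH0 a ⟶ T.toH0 b => 𝟙 (T.toH0 a) ≫ g) = _root_.id := by
    funext g
    exact Category.id_comp g
  have h : Function.Bijective fun g : T.toH0 a ⟶ T.toH0 b => 𝟙 (T.toH0 a) ≫ g := by
    rw [this]
    exact Function.bijective_id
  exact h

lemma isCounitArrow_diag {a : T.Obj} (ha : A (T.toH0 a)) : IsCounitArrow A (T.diag.obj a) := by
  refine ⟨ha, fun b hb => ?_⟩
  have : (fun g : T.toH0 b ⟶ T.toH0 a => g ≫ 𝟙 (T.toH0 a)) = _root_.id := by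
    funext g
    exact Category.comp_id g
  have h : Function.Bijective fun g : T.toH0 b ⟶ T.toH0 a => g ≫ 𝟙 (T.toH0 a) := by
    rw [this]
    exact Function.bijective_id
  exact h

/-- The section of the graph of the left adjoint of the embedding of `A`. -/
def graphLSection : DGFunctor (T.sub A) (graphL A) :=
  ((T.subIncl A).comp T.diag).liftFull (IsUnitArrow A) fun a => isUnitArrow_diag A a.2

/-- The section of the graph of the right adjoint of the embedding of `A`. -/
def graphRSection : DGFunctor (T.sub A) (graphR A) :=
  ((T.subIncl A).comp T.diag).liftFull (IsCounitArrow A) fun a => isCounitArrow_diag A a.2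

variable {A}

/-- The morphism from a unit to the identity of its target. -/
def unitToSection (η : (graphL A).Obj) :
    ((graphL A).Hom η ((graphLSection A).obj ((graphLToSub A).obj η))).X 0 :=
  ((η.1.hom, T.ident η.1.tgt, 0) : Arrow.HomX η.1 (T.diag.obj η.1.tgt) 0)

lemma d_unitToSection (η : (graphL A).Obj) :
    (((graphL A).Hom η ((graphLSection A).obj ((graphLToSub A).obj η))).d 0 1).hom
      (unitToSection η) = 0 := by
  refine (Arrow.d_eq (f := η.1) (f' := T.diag.obj η.1.tgt) (zero_add 1) _).trans ?_
  refine Prod.ext η.1.closed (Prod.ext (T.d_ident _) ?_)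
  change ((T.Hom η.1.src η.1.tgt).d (-1) 0).hom 0 + (0 : ℤ).negOnePow • (T.comp (add_zero 0)
    η.1.hom (T.ident η.1.tgt) - T.comp (zero_add 0) η.1.hom (T.ident η.1.tgt)) = 0
  rw [sub_self, smul_zero, map_zero, add_zero]

/-- The morphism from the identity of the source of a counit to the counit. -/
def sectionToCounit (ε : (graphR A).Obj) :
    ((graphR A).Hom ((graphRSection A).obj ((graphRToSub A).obj ε)) ε).X 0 :=
  ((T.ident ε.1.src, ε.1.hom, 0) : Arrow.HomX (T.diag.obj ε.1.src) ε.1 0)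

lemma d_sectionToCounit (ε : (graphR A).Obj) :
    (((graphR A).Hom ((graphRSection A).obj ((graphRToSub A).obj ε)) ε).d 0 1).hom
      (sectionToCounit ε) = 0 := by
  refine (Arrow.d_eq (f := T.diag.obj ε.1.src) (f' := ε.1) (zero_add 1) _).trans ?_
  refine Prod.ext (T.d_ident _) (Prod.ext ε.1.closed ?_)
  change ((T.Hom ε.1.src ε.1.tgt).d (-1) 0).hom 0 + (0 : ℤ).negOnePow • (T.comp (add_zero 0)
    (T.ident ε.1.src) ε.1.hom - T.comp (zero_add 0) (T.ident ε.1.src) ε.1.hom) = 0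
  rw [sub_self, smul_zero, map_zero, add_zero]

section

lemma quasiFFAt_graphLToSub (η : (graphL A).Obj) (b : (T.sub A).Obj) :
    (graphLToSub A).QuasiFFAt η ((graphLSection A).obj b) :=
  Arrow.quasiFFAt_arrowTgt (f := η.1) (f' := T.diag.obj b.1) (quasiIso_post_ident b.1 _)

lemma quasiFFAt_graphRToSub (ε : (graphR A).Obj) (b : (T.sub A).Obj) :
    (graphRToSub A).QuasiFFAt ((graphRSection A).obj b) ε :=
  Arrow.quasiFFAt_arrowSrc (f := T.diag.obj b.1) (f' := ε.1) (quasiIso_pre_ident b.1 _)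

lemma isQuasiFF_id (T : DGCat.{w, v, u} k) : (DGFunctor.id T).IsQuasiFF :=
  fun _ _ _ => ⟨fun y hy => ⟨y, hy, 0, (map_zero _).trans (sub_self y).symm⟩,
    fun _ _ e he => ⟨e, he⟩⟩

lemma isQuasiFF_graphLSection : (graphLSection A).IsQuasiFF := fun a b =>
  DGFunctor.QuasiFFAt.of_comp (ψ := graphLToSub _) (isQuasiFF_id (T.sub _) a b)
    (quasiFFAt_graphLToSub _ b)

lemma isQuasiFF_graphRSection : (graphRSection A).IsQuasiFF := fun a b =>
  DGFunctor.QuasiFFAt.of_comp (ψ := graphRToSub _) (isQuasiFF_id (T.sub _) a b)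
    (quasiFFAt_graphRToSub _ a)

lemma isUnit_unitToSection (η : (graphL A).Obj) :
    (graphLSection A).IsUnit (unitToSection η) (d_unitToSection η) := fun b =>
  (quasiFFAt_graphLToSub η b).quasiIso_pre (quasiFFAt_graphLToSub _ b) _ _
    (quasiIso_pre_ident (T := T.sub A) _ _)

lemma isCounit_sectionToCounit (ε : (graphR A).Obj) :
    (graphRSection A).IsCounit (sectionToCounit ε) (d_sectionToCounit ε) := fun b =>
  (quasiFFAt_graphRToSub _ b).quasiIso_post (quasiFFAt_graphRToSub ε b) _ _
    (quasiIso_post_ident (T := T.sub A) _ _)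

lemma isQuasiFF_graphLToCat (hT : T.IsPretriangulated) (hA : IsTriangulatedSubcategory A) :
    (graphLToCat A).IsQuasiFF := fun η η' =>
  Arrow.quasiFFAt_arrowSrc (η.2.quasiIso_pre hT hA η'.2.1)

lemma isQuasiFF_graphRToCat (hT : T.IsPretriangulated) (hA : IsTriangulatedSubcategory A) :
    (graphRToCat A).IsQuasiFF := fun ε ε' =>
  Arrow.quasiFFAt_arrowTgt (ε'.2.quasiIso_post hT hA ε.2.1)

lemma isEquivalence_graphLToCat (hT : T.IsPretriangulated) (hA : A ∈ T.LAdm) :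
    ((graphLToCat A).shriek.{max u v w}).IsEquivalence :=
  DGFunctor.isEquivalence_shriek.{w} (isQuasiFF_graphLToCat hT hA.1) fun t => by
    obtain ⟨a, η, hη, h⟩ := isRightAdjoint_ι_iff.1 hA.2 t
    exact ⟨⟨⟨t, a, η, hη⟩, h⟩, ⟨Iso.refl _⟩⟩

lemma isEquivalence_graphRToCat (hT : T.IsPretriangulated) (hA : A ∈ T.RAdm) :
    ((graphRToCat A).shriek.{max u v w}).IsEquivalence :=
  DGFunctor.isEquivalence_shriek.{w} (isQuasiFF_graphRToCat hT hA.1) fun t => by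
    obtain ⟨a, ε, hε, h⟩ := isLeftAdjoint_ι_iff.1 hA.2 t
    exact ⟨⟨⟨a, t, ε, hε⟩, h⟩, ⟨Iso.refl _⟩⟩

lemma inverts_unitToSection (M : DerFd.{max u v w} (T.sub A)) (η : (graphL A).Obj) :
    Inverts ((graphLToSub A).shriek.obj M) (unitToSection η) (d_unitToSection η) :=
  (DGFunctor.Inverts.shriek_iff.{w} (d_unitToSection η)).2
    (inverts_ident (T := T.sub A) M ((graphLToSub A).obj η))

lemma inverts_sectionToCounit (M : DerFd.{max u v w} (T.sub A)) (ε : (graphR A).Obj) :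
    Inverts ((graphRToSub A).shriek.obj M) (sectionToCounit ε) (d_sectionToCounit ε) :=
  (DGFunctor.Inverts.shriek_iff.{w} (d_sectionToCounit ε)).2
    (inverts_ident (T := T.sub A) M ((graphRToSub A).obj ε))

lemma graphLSection_map_bijective {X : DerFd.{max u v w} (graphL A)}
    (h : ∀ η, Inverts X (unitToSection η) (d_unitToSection η)) (Y : DerFd.{max u v w} (graphL A)) :
    Function.Bijective ((graphLSection A).shriek.map : (X ⟶ Y) → _) :=
  DGFunctor.shriek_map_bijective_of_unit.{w} isQuasiFF_graphLSection
    (fun η => ⟨_, _, _, isUnit_unitToSection η, h η⟩) Y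

lemma graphRSection_map_bijective {Y : DerFd.{max u v w} (graphR A)}
    (h : ∀ ε, Inverts Y (sectionToCounit ε) (d_sectionToCounit ε))
    (X : DerFd.{max u v w} (graphR A)) :
    Function.Bijective ((graphRSection A).shriek.map : (X ⟶ Y) → _) :=
  DGFunctor.shriek_map_bijective_of_counit.{w} isQuasiFF_graphRSection
    (fun ε => ⟨_, _, _, isCounit_sectionToCounit ε, h ε⟩) X

lemma exists_iso_graphLToSub_shriek {X : DerFd.{max u v w} (graphL A)}
    (h : ∀ η, Inverts X (unitToSection η) (d_unitToSection η)) :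
    ∃ M, Nonempty (X ≅ (graphLToSub A).shriek.obj M) := by
  let e := (DGFunctor.shriekComp (graphLSection A) (graphLToSub A) ≪≫ DGFunctor.shriekId _).app
    ((graphLSection A).shriek.obj X)
  exact ⟨_, (graphLSection A).shriek.nonempty_iso_of_map_bijective_left
    (graphLSection_map_bijective h) (graphLSection_map_bijective (inverts_unitToSection _)) e.symm⟩

/-- The functor `π_L^!` is fully faithful with right adjoint `ι^!`. -/
theorem exists_piLShriek (hT : T.IsPretriangulated) (hA : A ∈ T.LAdm) :
    ∃ F : DerFd.{max u v w} (T.sub A) ⥤ DerFd.{max u v w} T,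
      IsPiLShriek A F ∧ F.Full ∧ F.Faithful ∧
      Nonempty (F ⊣ DGFunctor.shriek.{max u v w} (T.subIncl A)) ∧
      ∀ N, fdOfLAdm A N ↔ F.essImage ((fdToDer.{max u v w} T).obj N) := by
  have := isEquivalence_graphLToCat hT hA
  obtain ⟨F, h₁, h₂, h₃, h₄, h₅⟩ := Functor.exists_leftAdjoint_of_roof
    (p := (graphLToCat A).shriek.{max u v w}) (q := (graphLToSub A).shriek)
    (j := (graphLSection A).shriek) (i := (T.subIncl A).shriek)
    (DGFunctor.shriekComp _ _ ≪≫ DGFunctor.shriekId _) (DGFunctor.shriekComp _ _)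
    fun M X => graphLSection_map_bijective (inverts_unitToSection M) X
  exact ⟨F, h₁, h₂, h₃, h₄, fun N => (h₅ _).symm⟩

lemma exists_iso_graphRToSub_shriek {X : DerFd.{max u v w} (graphR A)}
    (h : ∀ ε, Inverts X (sectionToCounit ε) (d_sectionToCounit ε)) :
    ∃ M, Nonempty (X ≅ (graphRToSub A).shriek.obj M) := by
  let e := (DGFunctor.shriekComp (graphRSection A) (graphRToSub A) ≪≫ DGFunctor.shriekId _).app
    ((graphRSection A).shriek.obj X)
  exact ⟨_, (graphRSection A).shriek.nonempty_iso_of_map_bijective_right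
    (graphRSection_map_bijective h) (graphRSection_map_bijective (inverts_sectionToCounit _)) e.symm⟩

/-- The functor `π_R^!` is fully faithful with left adjoint `ι^!`. -/
theorem exists_piRShriek (hT : T.IsPretriangulated) (hA : A ∈ T.RAdm) :
    ∃ F : DerFd.{max u v w} (T.sub A) ⥤ DerFd.{max u v w} T,
      IsPiRShriek A F ∧ F.Full ∧ F.Faithful ∧
      Nonempty (DGFunctor.shriek.{max u v w} (T.subIncl A) ⊣ F) ∧
      ∀ N, fdOfRAdm A N ↔ F.essImage ((fdToDer.{max u v w} T).obj N) := by
  have := isEquivalence_graphRToCat hT hA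
  obtain ⟨F, h₁, h₂, h₃, h₄, h₅⟩ := Functor.exists_rightAdjoint_of_roof
    (p := (graphRToCat A).shriek.{max u v w}) (q := (graphRToSub A).shriek)
    (j := (graphRSection A).shriek) (i := (T.subIncl A).shriek)
    (DGFunctor.shriekComp _ _ ≪≫ DGFunctor.shriekId _) (DGFunctor.shriekComp _ _)
    fun X M => graphRSection_map_bijective (inverts_sectionToCounit M) X
  exact ⟨F, h₁, h₂, h₃, h₄, fun N => (h₅ _).symm⟩

/-- The objects of the image of `π_L^!` are those which invert the units. -/
theorem fdOfLAdm_iff (N : (dgFd.{max u v w} T).H0) : fdOfLAdm A N ↔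
    ∀ η, IsUnitArrow A η → Inverts ((fdToDer.{max u v w} T).obj N) η.hom η.closed := by
  have h : ∀ η : (graphL A).Obj, Inverts ((graphLToCat A).shriek.obj
      ((fdToDer.{max u v w} T).obj N)) (unitToSection η) (d_unitToSection η) ↔
      Inverts ((fdToDer.{max u v w} T).obj N) η.1.hom η.1.closed :=
    fun η => DGFunctor.Inverts.shriek_iff.{w} (d_unitToSection η)
  constructor
  · rintro ⟨M, ⟨e⟩⟩ η hη
    exact (h ⟨η, hη⟩).1 ((inverts_unitToSection M ⟨η, hη⟩).of_iso e.symm)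
  · intro H
    exact exists_iso_graphLToSub_shriek fun η => (h η).2 (H η.1 η.2)

/-- The objects of the image of `π_R^!` are those which invert the counits. -/
theorem fdOfRAdm_iff (N : (dgFd.{max u v w} T).H0) : fdOfRAdm A N ↔
    ∀ ε, IsCounitArrow A ε → Inverts ((fdToDer.{max u v w} T).obj N) ε.hom ε.closed := by
  have h : ∀ ε : (graphR A).Obj, Inverts ((graphRToCat A).shriek.obj
      ((fdToDer.{max u v w} T).obj N)) (sectionToCounit ε) (d_sectionToCounit ε) ↔
      Inverts ((fdToDer.{max u v w} T).obj N) ε.1.hom ε.1.closed :=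
    fun ε => DGFunctor.Inverts.shriek_iff.{w} (d_sectionToCounit ε)
  constructor
  · rintro ⟨M, ⟨e⟩⟩ ε hε
    exact (h ⟨ε, hε⟩).1 ((inverts_sectionToCounit M ⟨ε, hε⟩).of_iso e.symm)
  · intro H
    exact exists_iso_graphRToSub_shriek fun ε => (h ε).2 (H ε.1 ε.2)

end

end DGCat
end

noncomputable section

variable {k : Type w} [Field k]

lemma ModuleComplex.acyclic_iff_of_quasiIso {K L : CochainComplex (ModuleCat.{x} k) ℤ} (f : K ⟶ L)
    [QuasiIso f] : K.Acyclic ↔ L.Acyclic :=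
  forall_congr' fun i => exactAt_iff_of_quasiIsoAt f i

namespace DGCat

open ModuleComplex DGMod

variable {T : DGCat.{w, v, u} k}

lemma IsCone.exists_of_degree {X Y Z : T.Obj} {f : (T.Hom X Y).X 0} (h : T.IsCone f Z) :
    ∃ (q : (T.Hom Z X).X 1) (r : (T.Hom Z Y).X 0), ((T.Hom Z X).d 1 2).hom q = 0 ∧
      T.comp (add_zero 1) q f + ((T.Hom Z Y).d 0 1).hom r = 0 ∧
      ∀ (W : T.Obj) (l m n p : ℤ) (hl : l + 1 = m) (hn : m + 1 = n) (hp : n + 1 = p),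
        (∀ (a : (T.Hom W X).X n) (b : (T.Hom W Y).X m), ((T.Hom W X).d n p).hom a = 0 →
          T.comp (add_zero n) a f + ((T.Hom W Y).d m n).hom b = 0 →
          ∃ (y : (T.Hom W Z).X m) (a' : (T.Hom W X).X m) (b' : (T.Hom W Y).X l),
            ((T.Hom W Z).d m n).hom y = 0 ∧
            T.comp hn y q - a = -((T.Hom W X).d m n).hom a' ∧
            T.comp (add_zero m) y r - b = T.comp (add_zero m) a' f +
              ((T.Hom W Y).d l m).hom b') ∧
        (∀ (y : (T.Hom W Z).X m) (a' : (T.Hom W X).X m) (b' : (T.Hom W Y).X l),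
          ((T.Hom W Z).d m n).hom y = 0 → T.comp hn y q = -((T.Hom W X).d m n).hom a' →
          T.comp (add_zero m) y r = T.comp (add_zero m) a' f + ((T.Hom W Y).d l m).hom b' →
          ∃ z : (T.Hom W Z).X l, ((T.Hom W Z).d l m).hom z = y) := by
  obtain ⟨q, r, hq, hr, h⟩ := h
  refine ⟨q, r, hq, hr, fun W l m n p hl hn hp => ?_⟩
  obtain rfl : l = m - 1 := by omega
  obtain rfl : p = m + 2 := by omega
  subst hn
  exact h W m

/-- The cone of a morphism represents the cone of the morphism of representable dg modules. -/
lemma IsCone.exists_repMap {X Y Z : T.Obj} {f : (T.Hom X Y).X 0}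
    (hf : ((T.Hom X Y).d 0 1).hom f = 0) (h : T.IsCone f Z) :
    ∃ (θ : (T.dgMod.Hom (rep.{x} T Z) (cone (repMap.{x} f) (d_repMap f hf))).X 0)
      (hθ : ((T.dgMod.Hom _ _).d 0 1).hom θ = 0), ∀ W, QuasiIso (evalMap θ hθ W) := by
  obtain ⟨q, r, hq, hr, h⟩ := h.exists_of_degree
  let C := cone (repMap.{x} f) (d_repMap f hf)
  let mk : ∀ {W : T.Obj} {n n' : ℤ} (hn : n + 1 = n') (a : (T.Hom W X).X n')
    (b : (T.Hom W Y).X n), (C.obj W).X n := fun {W n n'} hn a b =>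
      coneMk _ (d_repMap f hf) W (repMk.{x} (hn ▸ a)) (repMk.{x} b)
  have mk_inj : ∀ {W : T.Obj} {n n' : ℤ} (hn : n + 1 = n') (a a' : (T.Hom W X).X n')
      (b b' : (T.Hom W Y).X n), mk hn a b = mk hn a' b' → a = a' ∧ b = b' := by
    rintro W n _ rfl a a' b b' e
    exact ⟨repMk_inj ((coneMk_inj _ _ _).1 e).1, repMk_inj ((coneMk_inj _ _ _).1 e).2⟩
  have mk_surj : ∀ {W : T.Obj} {n n' : ℤ} (hn : n + 1 = n') (c : (C.obj W).X n),
      ∃ a b, c = mk hn a b := by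
    rintro W n _ rfl c
    obtain ⟨a, b, rfl⟩ := exists_coneMk _ _ _ c
    obtain ⟨a, rfl⟩ := exists_repMk a
    obtain ⟨b, rfl⟩ := exists_repMk b
    exact ⟨a, b, rfl⟩
  have mk_sub : ∀ {W : T.Obj} {n n' : ℤ} (hn : n + 1 = n') (a a' : (T.Hom W X).X n')
      (b b' : (T.Hom W Y).X n), mk hn a b - mk hn a' b' = mk hn (a - a') (b - b') := by
    rintro W n _ rfl a a' b b'
    rfl
  have mk_d : ∀ {W : T.Obj} {m n p : ℤ} (hn : m + 1 = n) (hp : n + 1 = p) (a : (T.Hom W X).X n)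
      (b : (T.Hom W Y).X m), ((C.obj W).d m n).hom (mk hn a b) =
        mk hp (-((T.Hom W X).d n p).hom a)
          (T.comp (add_zero n) a f + ((T.Hom W Y).d m n).hom b) := by
    rintro W m _ _ rfl rfl a b
    refine (cone_d_apply _ (d_repMap f hf) W rfl _ _).trans ((coneMk_inj _ _ _).2 ⟨rfl, ?_⟩)
    refine (add_comm _ _).trans ?_
    exact congrArg₂ (· + ·) ((ap_yo _ _ (zero_add _) _).trans rfl) rfl
  have mk_act : ∀ {W : T.Obj} {m n : ℤ} (hn : m + 1 = n) (y : (T.Hom W Z).X m),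
      C.act (zero_add m) (mk (zero_add 1) q r) y =
        mk hn (T.comp hn y q) (T.comp (add_zero m) y r) := by
    rintro W m _ rfl y
    exact (cone_act_apply _ (d_repMap f hf) (zero_add m) _ _ _).trans
      ((coneMk_inj _ _ _).2 ⟨rfl, rfl⟩)
  have mk_zero : ∀ {W : T.Obj} {n n' : ℤ} (hn : n + 1 = n'),
      mk hn (0 : (T.Hom W X).X n') (0 : (T.Hom W Y).X n) = 0 := by
    rintro W n _ rfl
    rfl
  have hθ : ((T.dgMod.Hom _ _).d 0 1).hom (yo.{x} (X := C) (mk (zero_add 1) q r)) = 0 := by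
    refine (d_yo.{x} (X := C) (zero_add 1) _).trans ?_
    rw [mk_d (zero_add 1) (show (1 : ℤ) + 1 = 2 from rfl), hq, hr, neg_zero]
    exact (congrArg yo.{x} (mk_zero (show (1 : ℤ) + 1 = 2 from rfl))).trans
      (map_zero ((yoMap.{x} C Z).f 1).hom)
  refine ⟨yo.{x} (X := C) (mk (zero_add 1) q r), hθ, fun W => ?_⟩
  have e : ∀ {m n : ℤ} (hn : m + 1 = n) (y : (T.Hom W Z).X m),
      ((evalMap _ hθ W).f m).hom (repMk.{x} y) = mk hn (T.comp hn y q) (T.comp (add_zero m) y r) :=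
    fun {m n} hn y => (ap_yo.{x} (X := C) (mk (zero_add 1) q r) (add_zero m) (zero_add m) y).trans
      (mk_act hn y)
  refine quasiIso_mk _ (fun m c hc => ?_) fun m y hy c hc => ?_
  · obtain ⟨a, b, rfl⟩ := mk_surj rfl c
    rw [mk_d rfl rfl, ← mk_zero rfl] at hc
    obtain ⟨h₁, h₂⟩ := mk_inj rfl _ _ _ _ hc
    obtain ⟨y, a', b', hy, h₃, h₄⟩ := (h W m (m + 1) (m + 1 + 1) _ rfl rfl rfl).1 a b
      (neg_eq_zero.1 h₁) h₂
    refine ⟨repMk.{x} y, congrArg repMk.{x} hy, mk rfl a' b', ?_⟩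
    refine (mk_d rfl rfl a' b').trans (Eq.trans ?_
      ((congrArg (· - _) (e rfl y)).trans (mk_sub rfl _ _ _ _)).symm)
    rw [h₃, h₄]
  · obtain ⟨y, rfl⟩ := exists_repMk y
    obtain ⟨a', b', rfl⟩ := mk_surj rfl c
    rw [mk_d rfl rfl, e rfl] at hc
    obtain ⟨h₁, h₂⟩ := mk_inj rfl _ _ _ _ hc
    obtain ⟨z, hz⟩ := (h W m (m + 1) (m + 1 + 1) _ rfl rfl rfl).2 y a' b' (repMk_inj hy)
      h₁.symm h₂.symm
    exact ⟨repMk.{x} z, congrArg repMk.{x} hz⟩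

end DGCat

namespace DGMod

open ModuleComplex DGCat

variable {T : DGCat.{w, v, u} k}

/-- A quasi-isomorphism of K-projective dg modules is a homotopy equivalence. -/
lemma isIso_homH0_of_isKProj {P Q : DGMod.{max x u v w} T} (hP : P.IsKProj) (hQ : Q.IsKProj)
    (f : (T.dgMod.Hom P Q).X 0) (hf : ((T.dgMod.Hom P Q).d 0 1).hom f = 0)
    (h : ∀ t, QuasiIso (evalMap f hf t)) : IsIso (T.dgMod.homH0 (X := P) (Y := Q) f hf) := by
  have h' : ∀ R : DGMod.{max x u v w} T, R.IsKProj →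
      Function.Bijective fun g : T.dgMod.toH0 R ⟶ T.dgMod.toH0 P => g ≫ T.dgMod.homH0 f hf :=
    fun R hR => T.dgMod.bijective_comp_of_quasiIso_post (X := R) f hf
      ((relKProj_true_iff.2 hR).quasiIso_post f hf fun t _ => h t)
  obtain ⟨g, hg⟩ := (h' Q hQ).2 (𝟙 _)
  refine ⟨g, (h' P hP).1 ?_, hg⟩
  change (T.dgMod.homH0 f hf ≫ g) ≫ T.dgMod.homH0 f hf = 𝟙 _ ≫ T.dgMod.homH0 f hf
  have hg : g ≫ T.dgMod.homH0 f hf = 𝟙 _ := hg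
  rw [Category.assoc, hg, Category.comp_id, Category.id_comp]

lemma RelKProj.of_quasiIso {A : T.Obj → Prop} {P Q : DGMod.{max x u v w} T} (hP : RelKProj A P)
    (hQ : Q.IsKProj) (f : (T.dgMod.Hom Q P).X 0) (hf : ((T.dgMod.Hom Q P).d 0 1).hom f = 0)
    (h : ∀ t, QuasiIso (evalMap f hf t)) : RelKProj A Q := by
  obtain ⟨g, b, _, hg, hb, _⟩ := exists_homotopy_inverse
    (isIso_homH0_of_isKProj.{x} hQ hP.isKProj f hf h)
  exact hP.of_retract (add_zero 0) f g hf hg b hb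

end DGMod

namespace DGCat

open ModuleComplex DGMod

variable {T : DGCat.{w, v, u} k}

lemma isTriangulatedSubcategory_acyclic (K : DGMod.{max x u v w} T) :
    IsTriangulatedSubcategory fun t : T.H0 => (K.obj t.as.obj).Acyclic where
  isClosedUnderIsomorphisms :=
    ⟨fun {X Y} e h => by
      obtain ⟨f, hf, he⟩ := T.exists_homH0 (X := Y.as.obj) (Y := X.as.obj) e.inv
      have i : IsIso (T.homH0 f hf) := he ▸ (inferInstance : IsIso e.inv)
      have := quasiIso_actMap_of_isIso i K
      exact (acyclic_iff_of_quasiIso (actMap K f hf)).1 h⟩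
  zero X hX := by
    obtain ⟨h, hh⟩ := (T.homH0_eq_iff (T.d_ident X) (map_zero _)).1 (hX.eq_of_src _ _)
    change (K.obj X).Acyclic
    refine acyclic_iff.2 fun n y hy => ⟨n.negOnePow • K.act (show n + -1 = n - 1 by omega) y h, ?_⟩
    rw [Units.smul_def, map_zsmul, K.d_act _ rfl (neg_add_cancel 1) (sub_add_cancel n 1), hy, hh,
      map_zero, LinearMap.zero_apply, zero_add, sub_zero, K.act_ident, Units.smul_def, smul_smul,
      Int.units_coe_mul_self, one_smul]
  shift n X Y h hX := by
    obtain ⟨f, g, hf, hg, ⟨b, hb⟩, _⟩ := h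
    change (K.obj X).Acyclic at hX
    change (K.obj Y).Acyclic
    refine acyclic_iff.2 fun p y hy => ?_
    obtain ⟨z, hz⟩ := exists_of_acyclic hX (show p - n - 1 + 1 = p - n by omega) rfl
      (K.act (show p + -n = p - n by omega) y g) (by
        rw [K.d_act _ rfl rfl rfl, hy, hg, map_zero, map_zero, LinearMap.zero_apply, smul_zero,
          add_zero])
    refine ⟨K.act (show p - n - 1 + n = p - 1 by omega) z f -
      p.negOnePow • K.act (show p + -1 = p - 1 by omega) y b, ?_⟩
    rw [map_sub, Units.smul_def, map_zsmul,
      K.d_act _ (show p - n - 1 + 1 = p - n by omega) rfl (sub_add_cancel p 1), hf, hz,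
      K.d_act _ rfl (neg_add_cancel 1) (sub_add_cancel p 1), hy, hb,
      K.act_act _ _ (add_neg_cancel n) (add_zero p), map_sub, map_zero, map_zero,
      LinearMap.zero_apply, zero_add, smul_zero, add_zero, K.act_ident, Units.smul_def, smul_smul,
      Int.units_coe_mul_self, one_smul, sub_sub_cancel]
  cone {X Y} f hf Z h hX hY := by
    obtain ⟨θ, hθ, hq⟩ := h.exists_repMap.{x} hf
    have h₁ : RelKProj (fun t => (K.obj t).Acyclic) (rep.{x} T Z) :=
      ((relKProj_rep.{x} hX).cone (relKProj_rep.{x} hY) _ _).of_quasiIso.{x}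
        (relKProj_rep.{x} (A := fun _ => True) trivial).isKProj θ hθ hq
    have := quasiIso_yoMap.{x} K Z
    exact (acyclic_iff_of_quasiIso (yoMap.{x} K Z)).2 (h₁ K fun t ht => ht)

end DGCat
end

noncomputable section

variable {k : Type w} [Field k]

namespace DGCat

open ModuleComplex DGMod

variable {T : DGCat.{w, v, u} k}

lemma IsTriangulatedSubcategory.forall {ι : Sort*} {P : ι → ObjectProperty T.H0}
    (h : ∀ i, IsTriangulatedSubcategory (P i)) :
    IsTriangulatedSubcategory fun X => ∀ i, P i X where
  isClosedUnderIsomorphisms :=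
    ⟨fun e H i => (h i).isClosedUnderIsomorphisms.of_iso e (H i)⟩
  zero X hX i := (h i).zero X hX
  shift n X Y hXY H i := (h i).shift n X Y hXY (H i)
  cone f hf Z hZ H H' i := (h i).cone f hf Z hZ (H i) (H' i)

section

variable {s t : T.Obj} (f : (T.Hom s t).X 0) (hf : ((T.Hom s t).d 0 1).hom f = 0)

/-- The coevaluation of a closed morphism of degree `0`. -/
def coevHom : ((dgFd.{x} T).dgMod.Hom (coevObj.{x} T s) (coevObj.{x} T t)).X 0 :=
  (coev.{x} T).map 0 f

lemma d_coevHom {s t : T.Obj} (f : (T.Hom s t).X 0) (hf : ((T.Hom s t).d 0 1).hom f = 0) :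
    (((dgFd.{x} T).dgMod.Hom (coevObj.{x} T s) (coevObj.{x} T t)).d 0 1).hom
    (coevHom.{x} f) = 0 := (coev.{x} T).d_map hf

lemma evalMap_coevHom (N : (dgFd.{x} T).Obj) : evalMap (coevHom.{x} f) (d_coevHom.{x} f hf) N =
    dualMap (ULift.{x + 1} k) (actMap N.1 f hf) := by
  ext n : 2
  refine LinearMap.ext fun (ξ : (N.1.obj s).X (-n) →ₗ[k] ULift.{x + 1} k) =>
    LinearMap.ext fun (y : (N.1.obj t).X (-n)) => ?_
  change ((0 : ℤ).negOnePow : ℤ) • ξ (N.1.act (add_zero _) y f) =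
    ξ (N.1.act (add_zero _) y f)
  rw [Int.negOnePow_zero, Units.val_one, one_smul]

lemma quasiIso_evalMap_coevHom_iff (N : (dgFd.{x} T).Obj) :
    QuasiIso (evalMap (coevHom.{x} f) (d_coevHom.{x} f hf) N) ↔ QuasiIso (actMap N.1 f hf) := by
  rw [evalMap_coevHom f hf]
  exact ⟨fun h => quasiIso_of_dualMap h, fun h => quasiIso_dualMap h⟩

end

lemma evalMap_eq_of_dgFd {M N : (dgFd.{x} T).Obj} (g : ((dgFd.{x} T).Hom M N).X 0)
    (hg : (((dgFd.{x} T).Hom M N).d 0 1).hom g = 0) (t : T.Obj) :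
    actMap (coevObj.{x} T t) g hg =
      dualMap (ULift.{x + 1} k) (evalMap (M := M.1) (N := N.1) g hg t) := by
  ext n ξ : 3
  exact LinearMap.ext fun y => rfl

lemma quasiIso_actMap_coevObj_iff {M N : (dgFd.{x} T).Obj} (g : ((dgFd.{x} T).Hom M N).X 0)
    (hg : (((dgFd.{x} T).Hom M N).d 0 1).hom g = 0) (t : T.Obj) :
    QuasiIso (actMap (coevObj.{x} T t) g hg) ↔
      QuasiIso (evalMap (M := M.1) (N := N.1) g hg t) := by
  rw [evalMap_eq_of_dgFd]
  exact ⟨fun h => quasiIso_of_dualMap h, fun h => quasiIso_dualMap h⟩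

lemma inverts_coevFd_iff {M N : (dgFd.{max u v w} T).Obj}
    (g : ((dgFd.{max u v w} T).Hom M N).X 0)
    (hg : (((dgFd.{max u v w} T).Hom M N).d 0 1).hom g = 0) (t : T.Obj) :
    Inverts ((coevFd.{max u v w} T).obj (T.toH0 t)) g hg ↔
      QuasiIso (evalMap (M := M.1) (N := N.1) g hg t) :=
  (inverts_iff.{w} (M := coevObj.{max u v w} T t) (Iso.refl _) g hg).trans
    (quasiIso_actMap_coevObj_iff g hg t)

lemma inverts_fdToDer_iff (N : (dgFd.{max u v w} T).Obj) {s t : T.Obj} (f : (T.Hom s t).X 0)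
    (hf : ((T.Hom s t).d 0 1).hom f = 0) :
    Inverts ((fdToDer.{max u v w} T).obj ((dgFd.{max u v w} T).toH0 N)) f hf ↔
      QuasiIso (actMap N.1 f hf) :=
  inverts_iff.{w} (M := N.1) (Iso.refl _) f hf

lemma isIso_homH0_of_evalMap {M N : (dgFd.{max u v w} T).Obj}
    (g : ((dgFd.{max u v w} T).Hom M N).X 0)
    (hg : (((dgFd.{max u v w} T).Hom M N).d 0 1).hom g = 0)
    (h : ∀ t, QuasiIso (evalMap (M := M.1) (N := N.1) g hg t)) :
    IsIso ((dgFd.{max u v w} T).homH0 g hg) := by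
  have h₁ : IsIso (derMap (M := M.1) (N := N.1) g hg) := (isIso_derMap_iff _ _).2 h
  have h₂ : IsIso ((isFd T).ι.map ((fdToDer.{max u v w} T).map
    ((dgFd.{max u v w} T).homH0 g hg))) := h₁
  have h₃ := isIso_of_reflects_iso ((fdToDer.{max u v w} T).map
    ((dgFd.{max u v w} T).homH0 g hg)) (isFd T).ι
  exact isIso_of_reflects_iso _ (fdToDer.{max u v w} T)

lemma IsReflexive.isIso_homH0 (hT : T.IsReflexive) {s t : T.Obj} {f : (T.Hom s t).X 0}
    {hf : ((T.Hom s t).d 0 1).hom f = 0}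
    (h : ∀ N : (dgFd.{max u v w} T).Obj, QuasiIso (actMap N.1 f hf)) : IsIso (T.homH0 f hf) := by
  have := hT.isEquivalence_coev
  have h₁ := (isIso_derMap_iff _ (d_coevHom.{max u v w} f hf)).2
    fun N => (quasiIso_evalMap_coevHom_iff f hf N).2 (h N)
  have h₂ : IsIso ((isFd _).ι.map ((coevFd.{max u v w} T).map (T.homH0 f hf))) := h₁
  have h₃ := isIso_of_reflects_iso ((coevFd.{max u v w} T).map (T.homH0 f hf))
    (isFd (dgFd.{max u v w} T)).ι
  exact isIso_of_reflects_iso _ (coevFd.{max u v w} T)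

/-- Homologically finite-dimensional dg modules are closed under shifts. -/
lemma isFd_shift {M : DGMod.{x} T} (hM : M.IsFd) (c : ℤ) : (DGMod.shift M c).IsFd := fun t => by
  let e : (DGMod.shift M c).obj t ≅ (M.obj t)⟦c⟧ :=
    HomologicalComplex.Hom.isoOfComponents (fun n => Iso.refl _) fun n n' _ => by
      ext y
      rfl
  let i (n : ℤ) : ((DGMod.shift M c).obj t).homology n ≅ (M.obj t).homology (c + n) :=
    (HomologicalComplex.homologyFunctor _ _ n).mapIso e ≪≫
      (CochainComplex.ShiftSequence.shiftIso (ModuleCat k) c n (c + n) rfl).app (M.obj t)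
  refine ⟨fun n => ?_, ((hM t).2.preimage (f := fun n => c + n)
    (add_right_injective c).injOn).subset fun n hn h => hn (h.of_iso (i n))⟩
  have := (hM t).1 (c + n)
  exact Module.Finite.equiv (i n).toLinearEquiv.symm

lemma exists_isShift_dgFd (n : ℤ) (N : (dgFd.{max u v w} T).Obj) :
    ∃ N', (dgFd.{max u v w} T).IsShift n N N' :=
  ⟨⟨DGMod.shift N.1 n, isFd_shift N.2.1 n,
    relKProj_true_iff.1 ((relKProj_true_iff.2 N.2.2).shift n)⟩, shiftTo N.1 n, shiftFrom N.1 n,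
    d_shiftTo N.1 n, d_shiftFrom N.1 n,
    ⟨0, (map_zero _).trans ((sub_eq_zero.2 (shiftTo_shiftFrom N.1 n)).symm)⟩,
    ⟨0, (map_zero _).trans ((sub_eq_zero.2 (shiftFrom_shiftTo N.1 n)).symm)⟩⟩

end DGCat
end

noncomputable section

section

variable {𝒮 : Type u} [Category.{v} 𝒮] {𝒟 : Type u'} [Category.{v'} 𝒟] {𝒜 : Type w}
  [Category.{x} 𝒜] (E : 𝒮 ⥤ 𝒟) {F : 𝒜 ⥤ 𝒟} {G : 𝒟 ⥤ 𝒜}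

namespace CategoryTheory

lemma Functor.postcomp_bijective_iff_of_isEquivalence [E.IsEquivalence] {b N X : 𝒮} (ε : N ⟶ X)
    {D : 𝒟} (e : D ≅ E.obj b) : (Function.Bijective fun g : b ⟶ N => g ≫ ε) ↔
      Function.Bijective fun g : D ⟶ E.obj N => g ≫ E.map ε := by
  have h : (fun g : D ⟶ E.obj N => g ≫ E.map ε) ∘ (e.homCongr (Iso.refl _)).symm ∘ E.map =
      (e.homCongr (Iso.refl _)).symm ∘ E.map ∘ fun g : b ⟶ N => g ≫ ε := by
    funext g
    simp
  have hE : ∀ X, Function.Bijective (E.map : (b ⟶ X) → _) := fun X =>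
    ⟨E.map_injective, E.map_surjective⟩
  rw [← Function.Bijective.of_comp_iff (fun g : D ⟶ E.obj N => g ≫ E.map ε)
    ((e.homCongr (Iso.refl _)).symm.bijective.comp (hE N)), h, ← Function.comp_assoc,
    Function.Bijective.of_comp_iff' ((e.homCongr (Iso.refl _)).symm.bijective.comp (hE X))]

lemma Functor.precomp_bijective_iff_of_isEquivalence [E.IsEquivalence] {b N X : 𝒮} (η : X ⟶ N)
    {D : 𝒟} (e : D ≅ E.obj b) : (Function.Bijective fun g : N ⟶ b => η ≫ g) ↔
      Function.Bijective fun g : E.obj N ⟶ D => E.map η ≫ g := by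
  have h : (fun g : E.obj N ⟶ D => E.map η ≫ g) ∘ ((Iso.refl _).homCongr e).symm ∘ E.map =
      ((Iso.refl _).homCongr e).symm ∘ E.map ∘ fun g : N ⟶ b => η ≫ g := by
    funext g
    simp
  have hE : ∀ X, Function.Bijective (E.map : (X ⟶ b) → _) := fun X =>
    ⟨E.map_injective, E.map_surjective⟩
  rw [← Function.Bijective.of_comp_iff (fun g : E.obj N ⟶ D => E.map η ≫ g)
    (((Iso.refl _).homCongr e).symm.bijective.comp (hE N)), h, ← Function.comp_assoc,
    Function.Bijective.of_comp_iff' (((Iso.refl _).homCongr e).symm.bijective.comp (hE X))]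

lemma Adjunction.postcomp_bijective_iff (adj : F ⊣ G) {M : 𝒜} {X Y : 𝒟} (f : X ⟶ Y) :
    (Function.Bijective fun g : F.obj M ⟶ X => g ≫ f) ↔
      Function.Bijective fun g : M ⟶ G.obj X => g ≫ G.map f := by
  have h : (fun g : M ⟶ G.obj X => g ≫ G.map f) ∘ adj.homEquiv M X =
      adj.homEquiv M Y ∘ fun g : F.obj M ⟶ X => g ≫ f := by
    funext g
    exact (adj.homEquiv_naturality_right g f).symm
  rw [← Function.Bijective.of_comp_iff (fun g : M ⟶ G.obj X => g ≫ G.map f)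
    (adj.homEquiv M X).bijective, h, Function.Bijective.of_comp_iff' (adj.homEquiv M Y).bijective]

lemma Adjunction.precomp_bijective_iff (adj : G ⊣ F) {M : 𝒜} {X Y : 𝒟} (f : X ⟶ Y) :
    (Function.Bijective fun g : Y ⟶ F.obj M => f ≫ g) ↔
      Function.Bijective fun g : G.obj Y ⟶ M => G.map f ≫ g := by
  have h : (fun g : Y ⟶ F.obj M => f ≫ g) ∘ adj.homEquiv Y M =
      adj.homEquiv X M ∘ fun g : G.obj Y ⟶ M => G.map f ≫ g := by
    funext g
    exact (adj.homEquiv_naturality_left f g).symm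
  rw [← Function.Bijective.of_comp_iff (fun g : Y ⟶ F.obj M => f ≫ g)
    (adj.homEquiv Y M).bijective, h, Function.Bijective.of_comp_iff' (adj.homEquiv X M).bijective]

lemma Adjunction.isIso_map_iff_postcomp (adj : F ⊣ G) [E.IsEquivalence] {N X : 𝒮} (ε : N ⟶ X) :
    IsIso (G.map (E.map ε)) ↔
      ∀ b, F.essImage (E.obj b) → Function.Bijective fun g : b ⟶ N => g ≫ ε := by
  constructor
  · rintro h b ⟨M, ⟨e⟩⟩
    refine (E.postcomp_bijective_iff_of_isEquivalence ε e).2 ((adj.postcomp_bijective_iff _).2 ?_)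
    exact ((asIso (G.map (E.map ε))).homToEquiv (Z := M)).bijective
  · refine fun h => isIso_of_yoneda_map_bijective _ fun M => ?_
    exact (adj.postcomp_bijective_iff _).1 ((E.postcomp_bijective_iff_of_isEquivalence ε
      (E.objObjPreimageIso (F.obj M)).symm).1 (h _ ⟨M, ⟨(E.objObjPreimageIso _).symm⟩⟩))

lemma Adjunction.isIso_map_iff_precomp (adj : G ⊣ F) [E.IsEquivalence] {N X : 𝒮} (η : X ⟶ N) :
    IsIso (G.map (E.map η)) ↔
      ∀ b, F.essImage (E.obj b) → Function.Bijective fun g : N ⟶ b => η ≫ g := by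
  constructor
  · rintro h b ⟨M, ⟨e⟩⟩
    refine (E.precomp_bijective_iff_of_isEquivalence η e).2 ((adj.precomp_bijective_iff _).2 ?_)
    exact ((asIso (G.map (E.map η))).symm.homFromEquiv (Z := M)).bijective
  · refine fun h => isIso_of_coyoneda_map_bijective _ fun M => ?_
    exact (adj.precomp_bijective_iff _).1 ((E.precomp_bijective_iff_of_isEquivalence η
      (E.objObjPreimageIso (F.obj M)).symm).1 (h _ ⟨M, ⟨(E.objObjPreimageIso _).symm⟩⟩))

lemma Adjunction.exists_coreflection (adj : F ⊣ G) [F.Full] [F.Faithful] [E.IsEquivalence] (N : 𝒮) :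
    ∃ (P : 𝒮) (ε : P ⟶ N), F.essImage (E.obj P) ∧ IsIso (G.map (E.map ε)) := by
  let i := E.objObjPreimageIso (F.obj (G.obj (E.obj N)))
  refine ⟨_, E.preimage (i.hom ≫ adj.counit.app (E.obj N)), ⟨_, ⟨i.symm⟩⟩, ?_⟩
  rw [E.map_preimage, G.map_comp]
  infer_instance

lemma Adjunction.exists_reflection (adj : G ⊣ F) [F.Full] [F.Faithful] [E.IsEquivalence] (N : 𝒮) :
    ∃ (P : 𝒮) (η : N ⟶ P), F.essImage (E.obj P) ∧ IsIso (G.map (E.map η)) := by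
  let i := E.objObjPreimageIso (F.obj (G.obj (E.obj N)))
  refine ⟨_, E.preimage (adj.unit.app (E.obj N) ≫ i.inv), ⟨_, ⟨i.symm⟩⟩, ?_⟩
  rw [E.map_preimage, G.map_comp]
  infer_instance

lemma Functor.precomp_bijective_of_isIso_map {t a b : 𝒮} (η : t ⟶ a) [IsIso (E.map η)]
    (h : Function.Bijective (E.map : (t ⟶ b) → _)) (h' : Function.Bijective (E.map : (a ⟶ b) → _)) :
    Function.Bijective fun g : a ⟶ b => η ≫ g := by
  refine (Function.Bijective.of_comp_iff' h _).1 ?_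
  have : E.map ∘ (fun g : a ⟶ b => η ≫ g) =
      (asIso (E.map η)).symm.homFromEquiv (Z := E.obj b) ∘ E.map := by
    funext g
    simp
  rw [this]
  exact (Equiv.bijective _).comp h'

lemma Functor.postcomp_bijective_of_isIso_map {t a b : 𝒮} (ε : a ⟶ t) [IsIso (E.map ε)]
    (h : Function.Bijective (E.map : (b ⟶ t) → _)) (h' : Function.Bijective (E.map : (b ⟶ a) → _)) :
    Function.Bijective fun g : b ⟶ a => g ≫ ε := by
  refine (Function.Bijective.of_comp_iff' h _).1 ?_
  have : E.map ∘ (fun g : b ⟶ a => g ≫ ε) =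
      (asIso (E.map ε)).homToEquiv (Z := E.obj b) ∘ E.map := by
    funext g
    simp
  rw [this]
  exact (Equiv.bijective _).comp h'

end CategoryTheory

end

variable {k : Type w} [Field k]

namespace DGMod

open ModuleComplex DGCat

variable {T : DGCat.{w, v, u} k}

lemma quasiIso_actMap_of_homH0_eq {s t : T.Obj} {f g : (T.Hom s t).X 0}
    {hf : ((T.Hom s t).d 0 1).hom f = 0} {hg : ((T.Hom s t).d 0 1).hom g = 0}
    (e : T.homH0 f hf = T.homH0 g hg) (M : DGMod.{x} T) (h : QuasiIso (actMap M f hf)) :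
    QuasiIso (actMap M g hg) := by
  obtain ⟨b, hb⟩ := (T.homH0_eq_iff hf hg).1 e
  have H : ∀ {m n : ℤ} (hm : m + 1 = n) (z : (M.obj t).X n), ((M.obj t).d n (n + 1)).hom z = 0 →
      ((M.obj s).d m n).hom (n.negOnePow • M.act (show n + -1 = m by omega) z b) =
        M.act (add_zero n) z f - M.act (add_zero n) z g := by
    intro m n hm z hz
    rw [Units.smul_def, map_zsmul, M.d_act _ rfl (neg_add_cancel 1) hm, hz, hb, map_zero,
      LinearMap.zero_apply, zero_add, Units.smul_def, smul_smul, Int.units_coe_mul_self, one_smul,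
      map_sub]
  refine quasiIso_mk _ (fun m y hy => ?_) fun m z hz e he => ?_
  · obtain ⟨z, hz, e, he⟩ := exists_of_quasiIso h rfl rfl y hy
    refine ⟨z, hz, e - (m + 1).negOnePow • M.act (show m + 1 + -1 = m by omega) z b, ?_⟩
    rw [map_sub, H rfl z hz, he, actMap_apply, actMap_apply]
    abel
  · refine exists_of_quasiIso' h rfl rfl z hz
      (e + (m + 1).negOnePow • M.act (show m + 1 + -1 = m by omega) z b) ?_
    rw [map_add, H rfl z hz, he, actMap_apply, actMap_apply]
    abel

lemma actMap_comp {r s t : T.Obj} (f : (T.Hom r s).X 0) (hf : ((T.Hom r s).d 0 1).hom f = 0)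
    (g : (T.Hom s t).X 0) (hg : ((T.Hom s t).d 0 1).hom g = 0) (M : DGMod.{x} T) :
    actMap M (T.comp (add_zero 0) f g) (T.d_comp_of_closed _ _ _ hf hg) =
      actMap M g hg ≫ actMap M f hf := by
  ext n y : 3
  exact (M.act_act _ _ _ _ _ _ _).symm

end DGMod

namespace DGFunctor

open DGMod DGCat

variable {C : DGCat.{w, v, u} k} {T : DGCat.{w, v', u'} k} (φ : DGFunctor C T)

lemma isIso_shriek_map_iff {M N : DGMod.{x} T} (hM : M.IsFd) (hN : N.IsFd)
    (g : (T.dgMod.Hom M N).X 0) (hg : ((T.dgMod.Hom M N).d 0 1).hom g = 0) :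
    IsIso (φ.shriek.map (ObjectProperty.homMk (derMap g hg) : derFd M hM ⟶ derFd N hN)) ↔
      ∀ c, QuasiIso (evalMap g hg (φ.obj c)) := by
  have h₁ : IsIso (derMap (resMap φ g) (d_resMap φ g hg)) ↔
      ∀ c, QuasiIso (evalMap g hg (φ.obj c)) := isIso_derMap_iff _ _
  rw [← h₁, ← isIso_comp_left_iff (φ.resIso M).hom, ← φ.resIso_naturality' g hg,
    isIso_comp_right_iff]
  constructor
  · intro h
    exact inferInstanceAs (IsIso ((isFd.{x} C).ι.map (φ.shriek.map
      (ObjectProperty.homMk (derMap g hg) : derFd M hM ⟶ derFd N hN))))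
  · intro h
    have : IsIso ((isFd.{x} C).ι.map (φ.shriek.map
      (ObjectProperty.homMk (derMap g hg) : derFd M hM ⟶ derFd N hN))) := h
    exact isIso_of_reflects_iso _ (isFd.{x} C).ι

end DGFunctor

namespace DGCat

open ModuleComplex DGMod

variable {T : DGCat.{w, v, u} k} {A : ObjectProperty T.H0}

lemma IsUnitArrow.quasiIso_actMap {t a a' : T.Obj} {η : (T.Hom t a).X 0} {η' : (T.Hom t a').X 0}
    {hη : ((T.Hom t a).d 0 1).hom η = 0} {hη' : ((T.Hom t a').d 0 1).hom η' = 0}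
    (h : IsUnitArrow A ⟨t, a, η, hη⟩) (h' : IsUnitArrow A ⟨t, a', η', hη'⟩) (M : DGMod.{x} T)
    (H : QuasiIso (actMap M η hη)) : QuasiIso (actMap M η' hη') := by
  obtain ⟨u, hu⟩ := (h.2 a' h'.1).2 (T.homH0 η' hη')
  obtain ⟨v, hv⟩ := (h'.2 a h.1).2 (T.homH0 η hη)
  replace hu : T.homH0 η hη ≫ u = T.homH0 η' hη' := hu
  replace hv : T.homH0 η' hη' ≫ v = T.homH0 η hη := hv
  have i : IsIso u := by
    refine ⟨v, (h.2 a h.1).1 ?_, (h'.2 a' h'.1).1 ?_⟩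
    · change T.homH0 η hη ≫ u ≫ v = T.homH0 η hη ≫ 𝟙 _
      rw [← Category.assoc, hu, hv, Category.comp_id]
    · change T.homH0 η' hη' ≫ v ≫ u = T.homH0 η' hη' ≫ 𝟙 _
      rw [← Category.assoc, hv, hu, Category.comp_id]
  obtain ⟨f, hf, rfl⟩ := T.exists_homH0 u
  have := quasiIso_actMap_of_isIso i M
  rw [T.homH0_comp] at hu
  refine quasiIso_actMap_of_homH0_eq hu M ?_
  rw [actMap_comp η hη f hf]
  infer_instance

lemma IsCounitArrow.quasiIso_actMap {t a a' : T.Obj} {ε : (T.Hom a t).X 0} {ε' : (T.Hom a' t).X 0}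
    {hε : ((T.Hom a t).d 0 1).hom ε = 0} {hε' : ((T.Hom a' t).d 0 1).hom ε' = 0}
    (h : IsCounitArrow A ⟨a, t, ε, hε⟩) (h' : IsCounitArrow A ⟨a', t, ε', hε'⟩) (M : DGMod.{x} T)
    (H : QuasiIso (actMap M ε hε)) : QuasiIso (actMap M ε' hε') := by
  obtain ⟨u, hu⟩ := (h.2 a' h'.1).2 (T.homH0 ε' hε')
  obtain ⟨v, hv⟩ := (h'.2 a h.1).2 (T.homH0 ε hε)
  replace hu : u ≫ T.homH0 ε hε = T.homH0 ε' hε' := hu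
  replace hv : v ≫ T.homH0 ε' hε' = T.homH0 ε hε := hv
  have i : IsIso u := by
    refine ⟨v, (h'.2 a' h'.1).1 ?_, (h.2 a h.1).1 ?_⟩
    · change (u ≫ v) ≫ T.homH0 ε' hε' = 𝟙 _ ≫ T.homH0 ε' hε'
      rw [Category.assoc, hv, hu, Category.id_comp]
    · change (v ≫ u) ≫ T.homH0 ε hε = 𝟙 _ ≫ T.homH0 ε hε
      rw [Category.assoc, hu, hv, Category.id_comp]
  obtain ⟨f, hf, rfl⟩ := T.exists_homH0 u
  have := quasiIso_actMap_of_isIso i M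
  rw [T.homH0_comp] at hu
  refine quasiIso_actMap_of_homH0_eq hu M ?_
  rw [actMap_comp f hf ε hε]
  infer_instance

end DGCat
end

noncomputable section

variable {k : Type w} [Field k]

namespace DGCat

open ModuleComplex DGMod

variable {T : DGCat.{w, v, u} k}

/-- The quasi-isomorphism condition at `t` for a closed morphism of degree `0` of `Dᶠᵈ(T)`. -/
def Arrow.QuasiIsoAt (g : (dgFd.{x} T).Arrow) (t : T.Obj) : Prop :=
  QuasiIso (evalMap (M := g.src.1) (N := g.tgt.1) g.hom g.closed t)

lemma isTriangulatedSubcategory_quasiIsoAt (g : (dgFd.{max x u v w} T).Arrow) :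
    IsTriangulatedSubcategory fun t : T.H0 => g.QuasiIsoAt t.as.obj := by
  have h : (fun t : T.H0 => g.QuasiIsoAt t.as.obj) = fun t : T.H0 =>
      ((cone (M := g.src.1) (N := g.tgt.1) g.hom g.closed).obj t.as.obj).Acyclic := by
    funext t
    exact propext (cone_acyclic_iff (M := g.src.1) (N := g.tgt.1) g.hom g.closed _).symm
  rw [h]
  exact isTriangulatedSubcategory_acyclic.{x} _

lemma isTriangulatedSubcategory_quasiIso_actMap {s t : T.Obj} (f : (T.Hom s t).X 0)
    (hf : ((T.Hom s t).d 0 1).hom f = 0) : IsTriangulatedSubcategory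
      fun N : (dgFd.{max u v w} T).H0 => QuasiIso (actMap N.as.obj.1 f hf) := by
  have h : (fun N : (dgFd.{max u v w} T).H0 => QuasiIso (actMap N.as.obj.1 f hf)) = fun N =>
      ((cone (coevHom.{max u v w} f) (d_coevHom.{max u v w} f hf)).obj N.as.obj).Acyclic := by
    funext N
    exact propext ((quasiIso_evalMap_coevHom_iff f hf _).symm.trans
      (cone_acyclic_iff _ (d_coevHom.{max u v w} f hf) N.as.obj).symm)
  rw [h]
  exact isTriangulatedSubcategory_acyclic.{w} _

lemma Arrow.quasiIsoAt_iff_of_actMap (g : (dgFd.{x} T).Arrow) {s t : T.Obj} (f : (T.Hom s t).X 0)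
    (hf : ((T.Hom s t).d 0 1).hom f = 0) (h : QuasiIso (actMap g.src.1 f hf))
    (h' : QuasiIso (actMap g.tgt.1 f hf)) : g.QuasiIsoAt s ↔ g.QuasiIsoAt t :=
  quasiIso_evalMap_of_actMap (M := g.src.1) (N := g.tgt.1) g.hom g.closed f hf h h'

lemma Arrow.quasiIso_actMap_iff_of_at (g : (dgFd.{x} T).Arrow) {s t : T.Obj} (f : (T.Hom s t).X 0)
    (hf : ((T.Hom s t).d 0 1).hom f = 0) (hs : g.QuasiIsoAt s) (ht : g.QuasiIsoAt t) :
    QuasiIso (actMap g.src.1 f hf) ↔ QuasiIso (actMap g.tgt.1 f hf) :=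
  quasiIso_actMap_of_quasiIso (M := g.src.1) (N := g.tgt.1) g.hom g.closed f hf hs ht

lemma isIso_subIncl_shriek_iff (A : ObjectProperty T.H0) {N X : (dgFd.{max u v w} T).H0}
    (ε : N ⟶ X) : IsIso ((T.subIncl A).shriek.map ((fdToDer.{max u v w} T).map ε)) ↔
      ∀ (g : ((dgFd.{max u v w} T).Hom N.as.obj X.as.obj).X 0)
        (hg : (((dgFd.{max u v w} T).Hom N.as.obj X.as.obj).d 0 1).hom g = 0),
        ε = (dgFd.{max u v w} T).homH0 g hg → ∀ a : T.Obj, A (T.toH0 a) →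
          Arrow.QuasiIsoAt ⟨N.as.obj, X.as.obj, g, hg⟩ a := by
  obtain ⟨g, hg, rfl⟩ := (dgFd.{max u v w} T).exists_homH0 (X := N.as.obj) (Y := X.as.obj) ε
  have h (g) (hg) := (T.subIncl A).isIso_shriek_map_iff N.as.obj.2.1 X.as.obj.2.1 g hg
  constructor
  · intro H g' hg' e a ha
    rw [e] at H
    exact (h g' hg').1 H ⟨a, ha⟩
  · exact fun H => (h g hg).2 fun a => H g hg rfl a.1 a.2

section

variable {A : ObjectProperty T.H0}

lemma fdOfLAdm_iff_actMap (N : (dgFd.{max u v w} T).H0) : fdOfLAdm A N ↔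
    ∀ η : {η : T.Arrow // IsUnitArrow A η}, QuasiIso (actMap N.as.obj.1 η.1.hom η.1.closed) :=
  (fdOfLAdm_iff N).trans ⟨fun h η => (inverts_fdToDer_iff N.as.obj _ _).1 (h η.1 η.2),
    fun h η hη => (inverts_fdToDer_iff N.as.obj _ _).2 (h ⟨η, hη⟩)⟩

lemma fdOfRAdm_iff_actMap (N : (dgFd.{max u v w} T).H0) : fdOfRAdm A N ↔
    ∀ ε : {ε : T.Arrow // IsCounitArrow A ε}, QuasiIso (actMap N.as.obj.1 ε.1.hom ε.1.closed) :=
  (fdOfRAdm_iff N).trans ⟨fun h ε => (inverts_fdToDer_iff N.as.obj _ _).1 (h ε.1 ε.2),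
    fun h ε hε => (inverts_fdToDer_iff N.as.obj _ _).2 (h ⟨ε, hε⟩)⟩

lemma isCounitArrow_fdOfLAdm_iff (hT : T.IsPretriangulated) (hA : A ∈ T.LAdm)
    (ε : (dgFd.{max u v w} T).Arrow) : IsCounitArrow (fdOfLAdm A) ε ↔
      fdOfLAdm A ((dgFd.{max u v w} T).toH0 ε.src) ∧ ∀ a, A (T.toH0 a) → ε.QuasiIsoAt a := by
  obtain ⟨F, -, _, _, ⟨adj⟩, h⟩ := exists_piLShriek hT hA
  have := isEquivalence_fdToDer.{w} (T := T)
  have h₁ := (adj.isIso_map_iff_postcomp (fdToDer.{max u v w} T)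
    ((dgFd.{max u v w} T).homH0 ε.hom ε.closed)).symm.trans (isIso_subIncl_shriek_iff A _)
  refine and_congr_right fun _ => ⟨fun H => ?_, fun H b hb => ?_⟩
  · exact h₁.1 (fun b hb => H b.as.obj ((h b).2 hb)) ε.hom ε.closed rfl
  · refine h₁.2 (fun g hg e a ha => ?_) _ ((h _).1 hb)
    have i : IsIso ((T.subIncl A).shriek.map ((fdToDer.{max u v w} T).map
      ((dgFd.{max u v w} T).homH0 ε.hom ε.closed))) :=
      ((T.subIncl A).isIso_shriek_map_iff ε.src.2.1 ε.tgt.2.1 ε.hom ε.closed).2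
        fun a => H a.1 a.2
    exact (isIso_subIncl_shriek_iff A _).1 i g hg e a ha

lemma isUnitArrow_fdOfRAdm_iff (hT : T.IsPretriangulated) (hA : A ∈ T.RAdm)
    (η : (dgFd.{max u v w} T).Arrow) : IsUnitArrow (fdOfRAdm A) η ↔
      fdOfRAdm A ((dgFd.{max u v w} T).toH0 η.tgt) ∧ ∀ a, A (T.toH0 a) → η.QuasiIsoAt a := by
  obtain ⟨F, -, _, _, ⟨adj⟩, h⟩ := exists_piRShriek hT hA
  have := isEquivalence_fdToDer.{w} (T := T)
  have h₁ := (adj.isIso_map_iff_precomp (fdToDer.{max u v w} T)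
    ((dgFd.{max u v w} T).homH0 η.hom η.closed)).symm.trans (isIso_subIncl_shriek_iff A _)
  refine and_congr_right fun _ => ⟨fun H => ?_, fun H b hb => ?_⟩
  · exact h₁.1 (fun b hb => H b.as.obj ((h b).2 hb)) η.hom η.closed rfl
  · refine h₁.2 (fun g hg e a ha => ?_) _ ((h _).1 hb)
    have i : IsIso ((T.subIncl A).shriek.map ((fdToDer.{max u v w} T).map
      ((dgFd.{max u v w} T).homH0 η.hom η.closed))) :=
      ((T.subIncl A).isIso_shriek_map_iff η.src.2.1 η.tgt.2.1 η.hom η.closed).2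
        fun a => H a.1 a.2
    exact (isIso_subIncl_shriek_iff A _).1 i g hg e a ha

lemma fdOfLAdm_mem_RAdm (hT : T.IsPretriangulated) (hA : A ∈ T.LAdm) :
    fdOfLAdm.{max u v w} A ∈ (dgFd.{max u v w} T).RAdm := by
  constructor
  · rw [show fdOfLAdm.{max u v w} A = _ from funext fun N => propext (fdOfLAdm_iff_actMap N)]
    exact IsTriangulatedSubcategory.forall fun η =>
      isTriangulatedSubcategory_quasiIso_actMap _ η.1.closed
  · refine isLeftAdjoint_ι_iff.2 fun N => ?_
    obtain ⟨F, -, _, _, ⟨adj⟩, h⟩ := exists_piLShriek hT hA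
    have := isEquivalence_fdToDer.{w} (T := T)
    obtain ⟨P, ε, hP, hε⟩ := adj.exists_coreflection (fdToDer.{max u v w} T)
      ((dgFd.{max u v w} T).toH0 N)
    obtain ⟨g, hg, rfl⟩ := (dgFd.{max u v w} T).exists_homH0 (X := P.as.obj) (Y := N) ε
    exact ⟨P.as.obj, g, hg, (isCounitArrow_fdOfLAdm_iff hT hA ⟨P.as.obj, N, g, hg⟩).2
      ⟨(h P).2 hP, (isIso_subIncl_shriek_iff A _).1 hε g hg rfl⟩⟩

lemma fdOfRAdm_mem_LAdm (hT : T.IsPretriangulated) (hA : A ∈ T.RAdm) :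
    fdOfRAdm.{max u v w} A ∈ (dgFd.{max u v w} T).LAdm := by
  constructor
  · rw [show fdOfRAdm.{max u v w} A = _ from funext fun N => propext (fdOfRAdm_iff_actMap N)]
    exact IsTriangulatedSubcategory.forall fun ε =>
      isTriangulatedSubcategory_quasiIso_actMap _ ε.1.closed
  · refine isRightAdjoint_ι_iff.2 fun N => ?_
    obtain ⟨F, -, _, _, ⟨adj⟩, h⟩ := exists_piRShriek hT hA
    have := isEquivalence_fdToDer.{w} (T := T)
    obtain ⟨P, η, hP, hη⟩ := adj.exists_reflection (fdToDer.{max u v w} T)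
      ((dgFd.{max u v w} T).toH0 N)
    obtain ⟨g, hg, rfl⟩ := (dgFd.{max u v w} T).exists_homH0 (X := N) (Y := P.as.obj) η
    exact ⟨P.as.obj, g, hg, (isUnitArrow_fdOfRAdm_iff hT hA ⟨N, P.as.obj, g, hg⟩).2
      ⟨(h P).2 hP, (isIso_subIncl_shriek_iff A _).1 hη g hg rfl⟩⟩

end

section

variable (B : ObjectProperty (dgFd.{x} T).H0)

/-- The objects at which all counits for `B` are quasi-isomorphisms. -/
def colocal : ObjectProperty T.H0 := fun t =>
  ∀ ε : {ε : (dgFd.{x} T).Arrow // IsCounitArrow B ε}, ε.1.QuasiIsoAt t.as.obj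

/-- The objects at which all units for `B` are quasi-isomorphisms. -/
def local' : ObjectProperty T.H0 := fun t =>
  ∀ η : {η : (dgFd.{x} T).Arrow // IsUnitArrow B η}, η.1.QuasiIsoAt t.as.obj

end

section

variable {A : ObjectProperty T.H0}

lemma colocal_fdOfLAdm (hT : T.IsReflexive) (hA : A ∈ T.LAdm) :
    colocal (fdOfLAdm.{max u v w} A) = A := by
  have hc : ∀ (ε : (dgFd.{max u v w} T).Arrow), IsCounitArrow (fdOfLAdm A) ε →
      ∀ a, A (T.toH0 a) → ε.QuasiIsoAt a := fun ε hε =>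
    ((isCounitArrow_fdOfLAdm_iff hT.isPretriangulated hA ε).1 hε).2
  funext t
  refine propext ⟨fun h => ?_, fun h ε => hc ε.1 ε.2 _ h⟩
  obtain ⟨a, η, hη, hu⟩ := isRightAdjoint_ι_iff.1 hA.2 t.as.obj
  have i : IsIso (T.homH0 η hη) := hT.isIso_homH0 fun X => by
    obtain ⟨N, ε, hε, hN⟩ := isLeftAdjoint_ι_iff.1 (fdOfLAdm_mem_RAdm hT.isPretriangulated hA).2 X
    exact (Arrow.quasiIso_actMap_iff_of_at ⟨N, X, ε, hε⟩ η hη (h ⟨_, hN⟩) (hc _ hN a hu.1)).1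
      ((fdOfLAdm_iff_actMap _).1 hN.1 ⟨_, hu⟩)
  exact hA.1.isClosedUnderIsomorphisms.of_iso (asIso (T.homH0 η hη)).symm hu.1

lemma local'_fdOfRAdm (hT : T.IsReflexive) (hA : A ∈ T.RAdm) :
    local' (fdOfRAdm.{max u v w} A) = A := by
  have hc : ∀ (η : (dgFd.{max u v w} T).Arrow), IsUnitArrow (fdOfRAdm A) η →
      ∀ a, A (T.toH0 a) → η.QuasiIsoAt a := fun η hη =>
    ((isUnitArrow_fdOfRAdm_iff hT.isPretriangulated hA η).1 hη).2
  funext t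
  refine propext ⟨fun h => ?_, fun h η => hc η.1 η.2 _ h⟩
  obtain ⟨a, ε, hε, hu⟩ := isLeftAdjoint_ι_iff.1 hA.2 t.as.obj
  have i : IsIso (T.homH0 ε hε) := hT.isIso_homH0 fun X => by
    obtain ⟨N, η, hη, hN⟩ := isRightAdjoint_ι_iff.1 (fdOfRAdm_mem_LAdm hT.isPretriangulated hA).2 X
    exact (Arrow.quasiIso_actMap_iff_of_at ⟨X, N, η, hη⟩ ε hε (hc _ hN a hu.1) (h ⟨_, hN⟩)).2
      ((fdOfRAdm_iff_actMap _).1 hN.1 ⟨_, hu⟩)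
  exact hA.1.isClosedUnderIsomorphisms.of_iso (asIso (T.homH0 ε hε)) hu.1

end

lemma isFd_coevObj (t : T.Obj) : (coevObj.{max u v w} T t).IsFd := by
  obtain ⟨M, hM, ⟨e⟩⟩ := ((coevFd.{max u v w} T).obj (T.toH0 t)).property
  exact (isFd_iff_of_iso.{w} (M := M) (N := coevObj.{max u v w} T t) e).1 hM

section

variable {B : ObjectProperty (dgFd.{max u v w} T).H0}

lemma IsCounitArrow.isCounit_subIncl (hB : IsTriangulatedSubcategory B)
    {ε : (dgFd.{max u v w} T).Arrow} (h : IsCounitArrow B ε) :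
    ((dgFd.{max u v w} T).subIncl B).IsCounit (c := ⟨ε.src, h.1⟩) ε.hom ε.closed := fun b =>
  quasiIso_post_of_bijective fun n => by
    obtain ⟨b', hb'⟩ := exists_isShift_dgFd n b.1
    exact ⟨b', hb', h.2 b' (hB.shift n b.1 b' hb' b.2)⟩

lemma IsUnitArrow.isUnit_subIncl (hB : IsTriangulatedSubcategory B)
    {η : (dgFd.{max u v w} T).Arrow} (h : IsUnitArrow B η) :
    ((dgFd.{max u v w} T).subIncl B).IsUnit (c := ⟨η.tgt, h.1⟩) η.hom η.closed := fun b =>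
  quasiIso_pre_of_bijective fun n => by
    obtain ⟨b', hb'⟩ := exists_isShift_dgFd n b.1
    exact ⟨b', hb', h.2 b' (hB.shift n b.1 b' hb' b.2)⟩

lemma RAdm.shriek_map_bijective (hB : B ∈ (dgFd.{max u v w} T).RAdm)
    {E : DerFd.{max w (max u v w + 1)} (dgFd.{max u v w} T)}
    (hE : ∀ ε, IsCounitArrow B ε → Inverts E ε.hom ε.closed)
    (X : DerFd.{max w (max u v w + 1)} (dgFd.{max u v w} T)) :
    Function.Bijective (((dgFd.{max u v w} T).subIncl B).shriek.map : (X ⟶ E) → _) :=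
  DGFunctor.shriek_map_bijective_of_counit.{w} (isQuasiFF_incl _ _) (fun N => by
    obtain ⟨P, ε, hε, h⟩ := isLeftAdjoint_ι_iff.1 hB.2 N
    exact ⟨⟨P, h.1⟩, ε, hε, h.isCounit_subIncl hB.1, hE _ h⟩) X

lemma RAdm.exists_shriek (hB : B ∈ (dgFd.{max u v w} T).RAdm)
    (G : DerFd.{max w (max u v w + 1)} ((dgFd.{max u v w} T).sub B)) :
    ∃ E : DerFd.{max w (max u v w + 1)} (dgFd.{max u v w} T),
      Nonempty (((dgFd.{max u v w} T).subIncl B).shriek.obj E ≅ G) ∧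
      ∀ ε, IsCounitArrow B ε → Inverts E ε.hom ε.closed := by
  obtain ⟨E, i, h⟩ := DGFunctor.exists_shriek_of_counit.{w}
    (φ := (dgFd.{max u v w} T).subIncl B) (isQuasiFF_incl _ _) (fun N => by
      obtain ⟨P, ε, hε, h⟩ := isLeftAdjoint_ι_iff.1 hB.2 N
      exact ⟨⟨P, h.1⟩, ε, hε, h.isCounit_subIncl hB.1⟩) G
  exact ⟨E, i, fun ε hε => h ⟨_, hε.1⟩ _ _ _ (hε.isCounit_subIncl hB.1)⟩

lemma colocal_iff (t : T.H0) : colocal B t ↔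
    ∀ ε, IsCounitArrow B ε → Inverts ((coevFd.{max u v w} T).obj t) ε.hom ε.closed :=
  ⟨fun h ε hε => (inverts_coevFd_iff ε.hom ε.closed t.as.obj).2 (h ⟨ε, hε⟩),
    fun h ε => (inverts_coevFd_iff ε.1.hom ε.1.closed t.as.obj).1 (h ε.1 ε.2)⟩

lemma exists_unit_colocal (hT : T.IsReflexive) (hB : B ∈ (dgFd.{max u v w} T).RAdm) (t : T.Obj) :
    ∃ (a : T.Obj) (η : (T.Hom t a).X 0) (hη : ((T.Hom t a).d 0 1).hom η = 0),
      IsUnitArrow (colocal B) ⟨t, a, η, hη⟩ ∧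
      ∀ N : (dgFd.{max u v w} T).Obj, B ((dgFd.{max u v w} T).toH0 N) →
        QuasiIso (actMap N.1 η hη) := by
  have := hT.isEquivalence_coev
  let Φ := ((dgFd.{max u v w} T).subIncl B).shriek.{max w (max u v w + 1)}
  obtain ⟨E, ⟨i⟩, hE⟩ := RAdm.exists_shriek hB (Φ.obj ((coevFd.{max u v w} T).obj (T.toH0 t)))
  obtain ⟨f, hf⟩ := (RAdm.shriek_map_bijective hB hE _).2 i.inv
  let j := (coevFd.{max u v w} T).objObjPreimageIso E
  let a := (coevFd.{max u v w} T).objPreimage E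
  obtain ⟨η, hη, e⟩ := T.exists_homH0 (X := t) (Y := a.as.obj)
    ((coevFd.{max u v w} T).preimage (f ≫ j.inv))
  have h₁ : (coevFd.{max u v w} T).map (T.homH0 η hη) = f ≫ j.inv := by
    rw [← e, Functor.map_preimage]
  have h₂ : IsIso (Φ.map ((coevFd.{max u v w} T).map (T.homH0 η hη))) := by
    have : IsIso (Φ.map f) := hf ▸ (inferInstance : IsIso i.inv)
    rw [h₁, Φ.map_comp]
    infer_instance
  have ha : colocal B a := (colocal_iff a).2 fun ε hε => (hE ε hε).of_iso j.symm
  have hb (b) (hb : colocal B b) (t) : Function.Bijective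
      ((coevFd.{max u v w} T ⋙ Φ).map : (t ⟶ b) → _) :=
    (RAdm.shriek_map_bijective hB ((colocal_iff b).1 hb) _).comp
      ⟨(coevFd.{max u v w} T).map_injective, (coevFd.{max u v w} T).map_surjective⟩
  refine ⟨a.as.obj, η, hη, ⟨ha, fun b hb' => ?_⟩, fun N hN => ?_⟩
  · have : IsIso ((coevFd.{max u v w} T ⋙ Φ).map (T.homH0 η hη)) := h₂
    exact (coevFd.{max u v w} T ⋙ Φ).precomp_bijective_of_isIso_map _ (hb _ hb' _) (hb _ hb' _)
  · exact (quasiIso_evalMap_coevHom_iff η hη N).1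
      ((DGFunctor.isIso_shriek_map_iff _ (isFd_coevObj _) (isFd_coevObj _) _
        (d_coevHom.{max u v w} η hη)).1 h₂ ⟨N, hN⟩)

lemma colocal_mem_LAdm (hT : T.IsReflexive) (hB : B ∈ (dgFd.{max u v w} T).RAdm) :
    colocal B ∈ T.LAdm :=
  ⟨IsTriangulatedSubcategory.forall fun ε => isTriangulatedSubcategory_quasiIsoAt.{w} ε.1,
    isRightAdjoint_ι_iff.2 fun t => by
      obtain ⟨a, η, hη, h, -⟩ := exists_unit_colocal hT hB t
      exact ⟨a, η, hη, h⟩⟩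

lemma fdOfLAdm_colocal (hT : T.IsReflexive) (hB : B ∈ (dgFd.{max u v w} T).RAdm) :
    fdOfLAdm.{max u v w} (colocal B) = B := by
  have hN (N : (dgFd.{max u v w} T).H0) (h : B N) : fdOfLAdm.{max u v w} (colocal B) N := by
    refine (fdOfLAdm_iff_actMap N).2 fun ⟨⟨t, a', η', hη'⟩, h'⟩ => ?_
    obtain ⟨a, η, hη, hu, H⟩ := exists_unit_colocal hT hB t
    exact hu.quasiIso_actMap h' _ (H N.as.obj h)
  funext N
  refine propext ⟨fun h => ?_, hN N⟩
  obtain ⟨P, ε, hε, hP⟩ := isLeftAdjoint_ι_iff.1 hB.2 N.as.obj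
  have i := isIso_homH0_of_evalMap ε hε fun t => by
    obtain ⟨a, η, hη, hu, H⟩ := exists_unit_colocal hT hB t
    exact (Arrow.quasiIsoAt_iff_of_actMap ⟨P, N.as.obj, ε, hε⟩ η hη (H P hP.1)
      ((fdOfLAdm_iff_actMap N).1 h ⟨_, hu⟩)).2 (hu.1 ⟨_, hP⟩)
  exact hB.1.isClosedUnderIsomorphisms.of_iso (asIso ((dgFd.{max u v w} T).homH0 ε hε)) hP.1

lemma LAdm.shriek_map_bijective (hB : B ∈ (dgFd.{max u v w} T).LAdm)
    {E : DerFd.{max w (max u v w + 1)} (dgFd.{max u v w} T)}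
    (hE : ∀ η, IsUnitArrow B η → Inverts E η.hom η.closed)
    (X : DerFd.{max w (max u v w + 1)} (dgFd.{max u v w} T)) :
    Function.Bijective (((dgFd.{max u v w} T).subIncl B).shriek.map : (E ⟶ X) → _) :=
  DGFunctor.shriek_map_bijective_of_unit.{w} (isQuasiFF_incl _ _) (fun N => by
    obtain ⟨P, η, hη, h⟩ := isRightAdjoint_ι_iff.1 hB.2 N
    exact ⟨⟨P, h.1⟩, η, hη, h.isUnit_subIncl hB.1, hE _ h⟩) X

lemma LAdm.exists_shriek (hB : B ∈ (dgFd.{max u v w} T).LAdm)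
    (G : DerFd.{max w (max u v w + 1)} ((dgFd.{max u v w} T).sub B)) :
    ∃ E : DerFd.{max w (max u v w + 1)} (dgFd.{max u v w} T),
      Nonempty (((dgFd.{max u v w} T).subIncl B).shriek.obj E ≅ G) ∧
      ∀ η, IsUnitArrow B η → Inverts E η.hom η.closed := by
  obtain ⟨E, i, h⟩ := DGFunctor.exists_shriek_of_unit.{w}
    (φ := (dgFd.{max u v w} T).subIncl B) (isQuasiFF_incl _ _) (fun N => by
      obtain ⟨P, η, hη, h⟩ := isRightAdjoint_ι_iff.1 hB.2 N
      exact ⟨⟨P, h.1⟩, η, hη, h.isUnit_subIncl hB.1⟩) G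
  exact ⟨E, i, fun η hη => h ⟨_, hη.1⟩ _ _ _ (hη.isUnit_subIncl hB.1)⟩

lemma local'_iff (t : T.H0) : local' B t ↔
    ∀ η, IsUnitArrow B η → Inverts ((coevFd.{max u v w} T).obj t) η.hom η.closed :=
  ⟨fun h η hη => (inverts_coevFd_iff η.hom η.closed t.as.obj).2 (h ⟨η, hη⟩),
    fun h η => (inverts_coevFd_iff η.1.hom η.1.closed t.as.obj).1 (h η.1 η.2)⟩

lemma exists_counit_local' (hT : T.IsReflexive) (hB : B ∈ (dgFd.{max u v w} T).LAdm) (t : T.Obj) :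
    ∃ (a : T.Obj) (ε : (T.Hom a t).X 0) (hε : ((T.Hom a t).d 0 1).hom ε = 0),
      IsCounitArrow (local' B) ⟨a, t, ε, hε⟩ ∧
      ∀ N : (dgFd.{max u v w} T).Obj, B ((dgFd.{max u v w} T).toH0 N) →
        QuasiIso (actMap N.1 ε hε) := by
  have := hT.isEquivalence_coev
  let Φ := ((dgFd.{max u v w} T).subIncl B).shriek.{max w (max u v w + 1)}
  obtain ⟨E, ⟨i⟩, hE⟩ := LAdm.exists_shriek hB (Φ.obj ((coevFd.{max u v w} T).obj (T.toH0 t)))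
  obtain ⟨f, hf⟩ := (LAdm.shriek_map_bijective hB hE _).2 i.hom
  let j := (coevFd.{max u v w} T).objObjPreimageIso E
  let a := (coevFd.{max u v w} T).objPreimage E
  obtain ⟨ε, hε, e⟩ := T.exists_homH0 (X := a.as.obj) (Y := t)
    ((coevFd.{max u v w} T).preimage (j.hom ≫ f))
  have h₁ : (coevFd.{max u v w} T).map (T.homH0 ε hε) = j.hom ≫ f := by
    rw [← e, Functor.map_preimage]
  have h₂ : IsIso (Φ.map ((coevFd.{max u v w} T).map (T.homH0 ε hε))) := by
    have : IsIso (Φ.map f) := hf ▸ (inferInstance : IsIso i.hom)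
    rw [h₁, Φ.map_comp]
    infer_instance
  have ha : local' B a := (local'_iff a).2 fun η hη => (hE η hη).of_iso j.symm
  have hb (b) (hb : local' B b) (t) : Function.Bijective
      ((coevFd.{max u v w} T ⋙ Φ).map : (b ⟶ t) → _) :=
    (LAdm.shriek_map_bijective hB ((local'_iff b).1 hb) _).comp
      ⟨(coevFd.{max u v w} T).map_injective, (coevFd.{max u v w} T).map_surjective⟩
  refine ⟨a.as.obj, ε, hε, ⟨ha, fun b hb' => ?_⟩, fun N hN => ?_⟩
  · have : IsIso ((coevFd.{max u v w} T ⋙ Φ).map (T.homH0 ε hε)) := h₂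
    exact (coevFd.{max u v w} T ⋙ Φ).postcomp_bijective_of_isIso_map _ (hb _ hb' _) (hb _ hb' _)
  · exact (quasiIso_evalMap_coevHom_iff ε hε N).1
      ((DGFunctor.isIso_shriek_map_iff _ (isFd_coevObj _) (isFd_coevObj _) _
        (d_coevHom.{max u v w} ε hε)).1 h₂ ⟨N, hN⟩)

lemma local'_mem_RAdm (hT : T.IsReflexive) (hB : B ∈ (dgFd.{max u v w} T).LAdm) :
    local' B ∈ T.RAdm :=
  ⟨IsTriangulatedSubcategory.forall fun η => isTriangulatedSubcategory_quasiIsoAt.{w} η.1,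
    isLeftAdjoint_ι_iff.2 fun t => by
      obtain ⟨a, ε, hε, h, -⟩ := exists_counit_local' hT hB t
      exact ⟨a, ε, hε, h⟩⟩

lemma fdOfRAdm_local' (hT : T.IsReflexive) (hB : B ∈ (dgFd.{max u v w} T).LAdm) :
    fdOfRAdm.{max u v w} (local' B) = B := by
  have hN (N : (dgFd.{max u v w} T).H0) (h : B N) : fdOfRAdm.{max u v w} (local' B) N := by
    refine (fdOfRAdm_iff_actMap N).2 fun ⟨⟨a', t, ε', hε'⟩, h'⟩ => ?_
    obtain ⟨a, ε, hε, hu, H⟩ := exists_counit_local' hT hB t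
    exact hu.quasiIso_actMap h' _ (H N.as.obj h)
  funext N
  refine propext ⟨fun h => ?_, hN N⟩
  obtain ⟨P, η, hη, hP⟩ := isRightAdjoint_ι_iff.1 hB.2 N.as.obj
  have i := isIso_homH0_of_evalMap η hη fun t => by
    obtain ⟨a, ε, hε, hu, H⟩ := exists_counit_local' hT hB t
    exact (Arrow.quasiIsoAt_iff_of_actMap ⟨N.as.obj, P, η, hη⟩ ε hε 
      ((fdOfRAdm_iff_actMap N).1 h ⟨_, hu⟩) (H P hP.1)).1 (hu.1 ⟨_, hP⟩)
  exact hB.1.isClosedUnderIsomorphisms.of_iso (asIso ((dgFd.{max u v w} T).homH0 η hη)).symm hP.1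

end

theorem bijOn_fdOfLAdm (hT : T.IsReflexive) :
    Set.BijOn (fun A => fdOfLAdm.{max u v w} A) T.LAdm (dgFd.{max u v w} T).RAdm :=
  Set.InvOn.bijOn (f' := fun B => colocal B)
    ⟨fun _ hA => colocal_fdOfLAdm hT hA, fun _ hB => fdOfLAdm_colocal hT hB⟩
    (fun _ hA => fdOfLAdm_mem_RAdm hT.isPretriangulated hA) fun _ hB => colocal_mem_LAdm hT hB

theorem bijOn_fdOfRAdm (hT : T.IsReflexive) :
    Set.BijOn (fun A => fdOfRAdm.{max u v w} A) T.RAdm (dgFd.{max u v w} T).LAdm :=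
  Set.InvOn.bijOn (f' := fun B => local' B)
    ⟨fun _ hA => local'_fdOfRAdm hT hA, fun _ hB => fdOfRAdm_local' hT hB⟩
    (fun _ hA => fdOfRAdm_mem_LAdm hT.isPretriangulated hA) fun _ hB => local'_mem_RAdm hT hB

end DGCat
end

noncomputable section

variable {k : Type w} [Field k]

namespace DGCat

open ModuleComplex DGMod

section

variable (T : DGCat.{w, v, u} k)

/-- The dg module `M ↦ M(t)^∨` over the dg category of all dg modules. -/
def coevMod (t : T.Obj) : DGMod.{max w (x + 1)} T.dgMod.{x} where
  obj M := dualComplex (M.obj t)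
  act {M N m n p} h := LinearMap.mk₂ k
    (fun (ξ : (N.obj t).X (-m) →ₗ[k] ULift.{x + 1} k) (φ : DGMod.homSubmodule M N n) =>
        (ξ.comp ((φ.1 t).v (-p) (-m) (by omega)).hom : (M.obj t).X (-p) →ₗ[k] ULift.{x + 1} k))
    (fun ξ ξ' φ => LinearMap.add_comp _ _ _) (fun c ξ φ => LinearMap.smul_comp _ _ _)
    (fun ξ φ φ' => LinearMap.comp_add _ _ _) (fun c ξ φ => LinearMap.comp_smul _ _ _)
  act_ident := fun {M m} h (ξ : (M.obj t).X (-m) →ₗ[k] ULift.{x + 1} k) => by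
    refine LinearMap.ext fun (y : (M.obj t).X (-m)) => ?_
    change ξ (((CochainComplex.HomComplex.Cochain.ofHom (𝟙 (M.obj t))).v (-m) (-m)
      (add_zero _)).hom y) = ξ y
    rw [CochainComplex.HomComplex.Cochain.ofHom_v]
    rfl
  act_act := fun {L M N m n l a b p} h₁ h₂ h₃ h₄ (ξ : (N.obj t).X (-m) →ₗ[k] ULift.{x + 1} k)
      (ψ : DGMod.homSubmodule M N n) (φ : DGMod.homSubmodule L M l) => by
    refine LinearMap.ext fun (y : (L.obj t).X (-p)) => ?_
    change ξ (((ψ.1 t).v (-a) (-m) _).hom (((φ.1 t).v (-p) (-a) _).hom y)) =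
      ξ ((((φ.1 t).comp (ψ.1 t) h₃).v (-p) (-m) _).hom y)
    rw [CochainComplex.HomComplex.Cochain.comp_v _ _ h₃ (-p) (-a) (-m) (by omega) (by omega)]
    rfl
  d_act := fun {M N m n p m' n' p'} h hm hn hp (ξ : (N.obj t).X (-m) →ₗ[k] ULift.{x + 1} k)
      (φ : DGMod.homSubmodule M N n) => by
    refine LinearMap.ext fun (y : (M.obj t).X (-p')) => ?_
    change ((p + 1).negOnePow : ℤ) • ξ (((φ.1 t).v (-p) (-m) _).hom
        (((M.obj t).d (-p') (-p)).hom y)) =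
      ((m + 1).negOnePow : ℤ) • ξ (((N.obj t).d (-m') (-m)).hom
        (((φ.1 t).v (-p') (-m') _).hom y)) +
      (m.negOnePow : ℤ) • ξ (((CochainComplex.HomComplex.δ n n' (φ.1 t)).v (-p') (-m) _).hom y)
    rw [CochainComplex.HomComplex.δ_v n n' hn _ (-p') (-m) (by omega) (-m') (-p) (by omega)
      (by omega)]
    simp only [ModuleCat.hom_add, ModuleCat.hom_comp, LinearMap.add_apply, LinearMap.comp_apply,
      map_add, Units.smul_def, map_zsmul, LinearMap.smul_apply, ModuleCat.hom_zsmul, smul_add,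
      smul_smul]
    have h₁ : ((p + 1).negOnePow : ℤ) = (m.negOnePow : ℤ) * (n'.negOnePow : ℤ) := by
      rw [← h, ← hn, add_assoc, Int.negOnePow_add m (n + 1), Units.val_mul]
    rw [h₁, Int.negOnePow_succ m, Units.val_neg, neg_smul, neg_add_cancel_left]

end

variable {T : DGCat.{w, v, u} k}

/-- The transpose of the action of a morphism of degree `0`. -/
def coevModHom {s t : T.Obj} (f : (T.Hom s t).X 0) :
    (T.dgMod.{x}.dgMod.Hom (coevMod.{x} T s) (coevMod.{x} T t)).X 0 :=
  ⟨fun M => CochainComplex.HomComplex.Cochain.mk fun m p hp =>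
    ModuleCat.ofHom (((0 : ℤ).negOnePow : ℤ) • LinearMap.lcomp k (ULift.{x + 1} k)
      ((M.act (show -p + 0 = -m by omega)).flip f)), by
    intro M N m l p m' p' h hm hp (ξ : (N.obj s).X (-m) →ₗ[k] ULift.{x + 1} k)
      (φ : DGMod.homSubmodule M N l)
    refine LinearMap.ext fun (y : (M.obj t).X (-p')) => ?_
    change ((0 : ℤ).negOnePow : ℤ) • ξ (((φ.1 s).v (-p) (-m) _).hom (M.act _ y f)) =
      ((0 : ℤ).negOnePow : ℤ) • ξ (N.act _ (((φ.1 t).v (-p') (-m') _).hom y) f)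
    rw [φ.2 (show -p' + 0 = -p by omega) (show -p' + l = -m' by omega) (by omega)]⟩

lemma d_coevModHom {s t : T.Obj} (f : (T.Hom s t).X 0) (hf : ((T.Hom s t).d 0 1).hom f = 0) :
    ((T.dgMod.{x}.dgMod.Hom (coevMod.{x} T s) (coevMod.{x} T t)).d 0 1).hom (coevModHom f) = 0 := by
  refine Subtype.ext (funext fun M => ?_)
  let g : dualComplex (M.obj s) ⟶ dualComplex (M.obj t) :=
    dualMap (ULift.{x + 1} k) (actMap M f hf)
  have h : (coevModHom.{x} f).1 M = CochainComplex.HomComplex.Cochain.ofHom g := by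
    ext n : 2
    refine (LinearMap.ext fun (ξ : (M.obj s).X (-n) →ₗ[k] ULift.{x + 1} k) =>
      LinearMap.ext fun (y : (M.obj t).X (-n)) => ?_).trans (congrArg ModuleCat.Hom.hom
        (CochainComplex.HomComplex.Cochain.ofHom_v g n).symm)
    change ((0 : ℤ).negOnePow : ℤ) • ξ (M.act (add_zero _) y f) = ξ (M.act (add_zero _) y f)
    rw [Int.negOnePow_zero, Units.val_one, one_smul]
  change CochainComplex.HomComplex.δ 0 1 ((coevModHom.{x} f).1 M) = 0
  rw [h]
  exact CochainComplex.HomComplex.δ_ofHom _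

lemma quasiIso_actMap_coevMod_iff {M N : DGMod.{x} T} (g : (T.dgMod.Hom M N).X 0)
    (hg : ((T.dgMod.Hom M N).d 0 1).hom g = 0) (t : T.Obj) :
    QuasiIso (actMap (coevMod.{x} T t) g hg) ↔ QuasiIso (evalMap g hg t) := by
  have : actMap (coevMod.{x} T t) g hg = dualMap (ULift.{x + 1} k) (evalMap g hg t) := by
    ext n ξ : 3
    exact LinearMap.ext fun y => rfl
  rw [this]
  exact ⟨fun h => quasiIso_of_dualMap h, fun h => quasiIso_dualMap h⟩

section

variable {W : DGCat.{w, v', u'} k} {W' : DGCat.{w, z, y} k}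

/-- The assignment `c` on closed morphisms induces a bijection from the morphisms `a ⟶ b` in `H⁰(T)`
to the morphisms `X ⟶ Y` in the derived category. -/
def HomBij {a b : T.Obj} {X Y : DGMod.{x} W} (c : ∀ f : (T.Hom a b).X 0,
    ((T.Hom a b).d 0 1).hom f = 0 →
      {g : (W.dgMod.Hom X Y).X 0 // ((W.dgMod.Hom X Y).d 0 1).hom g = 0}) : Prop :=
  (∀ g : der X ⟶ der Y, ∃ f hf, g = derMap (c f hf).1 (c f hf).2) ∧
  ∀ f f' hf hf', derMap (c f hf).1 (c f hf).2 = derMap (c f' hf').1 (c f' hf').2 →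
      T.homH0 (X := a) (Y := b) f hf = T.homH0 f' hf'

lemma homBij_resMap_iff (φ : DGFunctor W' W) {a b : T.Obj} {X Y : DGMod.{x} W}
    (c : ∀ f : (T.Hom a b).X 0, ((T.Hom a b).d 0 1).hom f = 0 →
      {g : (W.dgMod.Hom X Y).X 0 // ((W.dgMod.Hom X Y).d 0 1).hom g = 0})
    (h : Function.Bijective (φ.resDer.map : (der X ⟶ der Y) → _)) :
    HomBij (X := φ.resObj X) (Y := φ.resObj Y) (fun f hf => ⟨resMap φ (c f hf).1,
      d_resMap φ _ (c f hf).2⟩) ↔ HomBij c := by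
  have e (f) (hf) : derMap (resMap φ (c f hf).1) (d_resMap φ _ (c f hf).2) =
      (φ.resIso X).inv ≫ φ.resDer.map (derMap (c f hf).1 (c f hf).2) ≫ (φ.resIso Y).hom :=
    (Iso.eq_inv_comp _).2 (φ.resIso_naturality' _ _).symm
  constructor
  · rintro ⟨h₁, h₂⟩
    refine ⟨fun g => ?_, fun f f' hf hf' H => h₂ f f' hf hf' ?_⟩
    · obtain ⟨f, hf, H⟩ := h₁ ((φ.resIso X).inv ≫ φ.resDer.map g ≫ (φ.resIso Y).hom)
      refine ⟨f, hf, h.1 ?_⟩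
      rw [e f hf] at H
      simpa using H
    · rw [e f hf, e f' hf', H]
  · rintro ⟨h₁, h₂⟩
    refine ⟨fun g => ?_, fun f f' hf hf' H => h₂ f f' hf hf' (h.1 ?_)⟩
    · obtain ⟨g', hg⟩ := h.2 ((φ.resIso X).hom ≫ g ≫ (φ.resIso Y).inv)
      obtain ⟨f, hf, rfl⟩ := h₁ g'
      refine ⟨f, hf, ?_⟩
      rw [e f hf, hg]
      simp
    · rw [e f hf, e f' hf'] at H
      simpa using H

/-- The morphisms `a ⟶ b` in `H⁰(T)` are the morphisms of coevaluation modules along `κ`. -/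
def CoevBij (κ : DGFunctor W T.dgMod.{x}) (a b : T.Obj) : Prop :=
  HomBij (a := a) (b := b) (X := κ.resObj (coevMod.{x} T a)) (Y := κ.resObj (coevMod.{x} T b))
    fun f hf => ⟨resMap κ (coevModHom f), d_resMap κ _ (d_coevModHom f hf)⟩

lemma coevBij_comp_iff (φ : DGFunctor W' W) (κ : DGFunctor W T.dgMod.{x}) (a b : T.Obj)
    (h : Function.Bijective (φ.resDer.map : (der (κ.resObj (coevMod.{x} T a)) ⟶
      der (κ.resObj (coevMod.{x} T b))) → _)) : CoevBij (φ.comp κ) a b ↔ CoevBij κ a b :=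
  homBij_resMap_iff φ (a := a) (b := b) (X := κ.resObj (coevMod.{x} T a))
    (Y := κ.resObj (coevMod.{x} T b))
    (fun f hf => ⟨resMap κ (coevModHom f), d_resMap κ _ (d_coevModHom f hf)⟩) h

end

lemma coevBij_incl_iff {a b : T.Obj} : CoevBij (T.dgMod.{x}.incl fun M => M.IsFd ∧ M.IsKProj) a b ↔
    Function.Bijective ((coevFd.{x} T).map : (T.toH0 a ⟶ T.toH0 b) → _) := by
  constructor
  · rintro ⟨h₁, h₂⟩
    refine ⟨fun f f' H => ?_, fun g => ?_⟩
    · obtain ⟨f, hf, rfl⟩ := T.exists_homH0 f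
      obtain ⟨f', hf', rfl⟩ := T.exists_homH0 f'
      exact h₂ f f' hf hf' (congrArg (fun g => g.hom) H)
    · obtain ⟨f, hf, H⟩ := h₁ g.hom
      exact ⟨T.homH0 f hf, ObjectProperty.hom_ext _ H.symm⟩
  · rintro ⟨h₁, h₂⟩
    refine ⟨fun g => ?_, fun f f' hf hf' H => h₁ (ObjectProperty.hom_ext _ H)⟩
    obtain ⟨f, H⟩ := h₂ (ObjectProperty.homMk g)
    obtain ⟨f, hf, rfl⟩ := T.exists_homH0 f
    exact ⟨f, hf, (congrArg (fun g => g.hom) H).symm⟩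

end DGCat
end

noncomputable section

variable {k : Type w} [Field k]

namespace DGCat

open ModuleComplex DGMod

variable {T : DGCat.{w, v, u} k}

lemma isPretriangulated_sub {A : ObjectProperty T.H0} (hT : T.IsPretriangulated)
    (hA : IsTriangulatedSubcategory A) : (T.sub A).IsPretriangulated where
  exists_zero := by
    obtain ⟨X, hX⟩ := hT.exists_zero
    refine ⟨⟨X, hA.zero X hX⟩, fun ⟨⟨Y⟩⟩ => ⟨⟨⟨(T.sub A).homH0 0 (map_zero _)⟩, fun f => ?_⟩⟩,
      fun ⟨⟨Y⟩⟩ => ⟨⟨⟨(T.sub A).homH0 0 (map_zero _)⟩, fun f => ?_⟩⟩⟩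
    · obtain ⟨f, hf, rfl⟩ := (T.sub A).exists_homH0 f
      exact (homH0_eq_iff (T.sub A) hf _).2 ((homH0_eq_iff T (X := X) (Y := Y.1) hf
        (map_zero _)).1 (hX.eq_of_src _ _))
    · obtain ⟨f, hf, rfl⟩ := (T.sub A).exists_homH0 f
      exact (homH0_eq_iff (T.sub A) hf _).2 ((homH0_eq_iff T (X := Y.1) (Y := X) hf
        (map_zero _)).1 (hX.eq_of_tgt _ _))
  exists_shift n X := by
    obtain ⟨Y, hY⟩ := hT.exists_shift n X.1
    exact ⟨⟨Y, hA.shift n _ _ hY X.2⟩, hY⟩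
  exists_cone {X Y} f hf := by
    obtain ⟨Z, hZ⟩ := hT.exists_cone (X := X.1) (Y := Y.1) f hf
    refine ⟨⟨Z, hA.cone f hf Z hZ X.2 Y.2⟩, ?_⟩
    obtain ⟨q, r, hq, hr, h⟩ := hZ
    exact ⟨q, r, hq, hr, fun W => h W.1⟩

variable {Q : T.Obj → Prop}

lemma acyclic_coind_incl (N : DGMod.{max x u v w} (T.full Q)) (a : (T.full Q).Obj)
    (h : (N.obj a).Acyclic) : ((coind.{x} (T.incl Q) N).obj a.1).Acyclic :=
  relKProj_rep.{max x u v w} (T := T.full Q) (A := fun b => b = a) rfl N (by rintro _ rfl; exact h)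

lemma isKProj_res_of_relKProj {P : DGMod.{max x u v w} T} (hP : RelKProj Q P) :
    ((T.incl Q).resObj P).IsKProj := fun N hN => by
  have := quasiIso_coindAdj.{x} (φ := T.incl Q) (I := N) (N := P)
  exact (acyclic_iff_of_quasiIso (coindAdj.{x} (T.incl Q) N P)).1
    (hP _ fun t ht => acyclic_coind_incl.{x} N ⟨t, ht⟩ (hN _))

lemma quasiIso_evalMap_coindCounit_incl (N : DGMod.{max x u v w} (T.full Q)) (a : (T.full Q).Obj) :
    QuasiIso (evalMap (coindCounit.{x} (T.incl Q) N) (d_coindCounit.{x} (T.incl Q) N) a) := by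
  have e : evalMap (coindCounit.{x} (T.incl Q) N) (d_coindCounit.{x} (T.incl Q) N) a ≫
      yoMap.{max x u v w} N a = 𝟙 ((coind.{x} (T.incl Q) N).obj a.1) := by
    ext n χ : 3
    exact yo_ap.{max x u v w} (T := T.full Q) (t := a) (X := N) χ
  have := quasiIso_yoMap.{max x u v w} N a
  have h : QuasiIso (evalMap (coindCounit.{x} (T.incl Q) N) (d_coindCounit.{x} (T.incl Q) N) a ≫
      yoMap.{max x u v w} N a) := by rw [e]; exact quasiIso_of_bijective _ fun _ => Function.bijective_id
  exact (quasiIso_iff_comp_right _ (yoMap.{max x u v w} N a)).1 h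

lemma d_coindLift_zero {C : DGCat.{w, v, u} k} {T : DGCat.{w, v', u'} k} {φ : DGFunctor C T}
    {I : DGMod.{max x u v w u' v'} C} {N : DGMod.{max x u v w u' v'} T}
    (g : (C.dgMod.Hom (φ.resObj N) I).X 0) (hg : ((C.dgMod.Hom (φ.resObj N) I).d 0 1).hom g = 0) :
    ((T.dgMod.Hom N (coind.{x} φ I)).d 0 1).hom (coindLift.{x} g) = 0 := by
  rw [d_coindLift.{x} (zero_add 1), hg, ← coindLift_comp_counit.{x} (φ := φ) (I := I) (N := N) 0]
  exact congrArg coindLift.{x} (LinearMap.map_zero₂ (C.dgMod.comp (add_zero 1)) _).symm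

lemma quasiIso_evalMap_coindLift_incl {I : DGMod.{max x u v w} (T.full Q)}
    {N : DGMod.{max x u v w} T} (g : ((T.full Q).dgMod.Hom ((T.incl Q).resObj N) I).X 0)
    (hg : (((T.full Q).dgMod.Hom ((T.incl Q).resObj N) I).d 0 1).hom g = 0) (a : (T.full Q).Obj)
    (h : QuasiIso (evalMap g hg a)) :
    QuasiIso (evalMap (coindLift.{x} g) (d_coindLift_zero.{x} g hg) a.1) := by
  let p : (coind.{x} (T.incl Q) I).obj a.1 ⟶ I.obj a :=
    evalMap (coindCounit.{x} (T.incl Q) I) (d_coindCounit.{x} (T.incl Q) I) a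
  have hp : QuasiIso p := quasiIso_evalMap_coindCounit_incl.{x} I a
  let q : N.obj a.1 ⟶ I.obj a := evalMap g hg a
  have h₂ : QuasiIso q := h
  have e : evalMap (coindLift.{x} g) (d_coindLift_zero.{x} g hg) a.1 ≫ p = q := by
    ext n y : 3
    refine (ap_comp (add_zero 0) (resMap (T.incl Q) (coindLift.{x} g))
      (coindCounit.{x} (T.incl Q) I) a (add_zero n) (add_zero n) (add_zero n) y).symm.trans ?_
    rw [coindLift_counit.{x} g]
    rfl
  rw [← e, quasiIso_iff_comp_right] at h₂
  exact h₂

lemma quasiIso_evalMap_ident (M : DGMod.{x} T) (t : T.Obj) :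
    QuasiIso (evalMap (T.dgMod.ident M) (T.dgMod.d_ident M) t) := by
  have : evalMap (T.dgMod.ident M) (T.dgMod.d_ident M) t = 𝟙 (M.obj t) :=
    (evalZ0 T t).map_id (⟨M⟩ : T.dgMod.Z0)
  rw [this]
  exact quasiIso_of_bijective _ fun _ => Function.bijective_id

variable (T Q)

/-- A dg module over `T` which is relatively K-projective with respect to `Q` and whose restriction
to `Q` is homologically finite-dimensional. -/
def IsCellFd (P : DGMod.{x} T) : Prop := RelKProj Q P ∧ ((T.incl Q).resObj P).IsFd

/-- The restriction from the cellular dg modules over `T` to the dg modules over `Q`. -/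
def cellRes : DGFunctor (T.dgMod.{max x u v w}.full (IsCellFd T Q))
    (dgFd.{max x u v w} (T.full Q)) :=
  ((T.dgMod.incl (IsCellFd T Q)).comp (T.incl Q).res).liftFull _
    fun P => ⟨P.2.2, isKProj_res_of_relKProj.{x} P.2.1⟩

lemma exists_quasiIso_resMap {P : DGMod.{max x u v w} T} (hP : RelKProj Q P)
    (N : DGMod.{max x u v w} T) :
    ∃ F : T.dgMod.Hom P N ⟶ (T.full Q).dgMod.Hom ((T.incl Q).resObj P) ((T.incl Q).resObj N),
      QuasiIso F ∧ ∀ n f, (F.f n).hom f = resMap (T.incl Q) f := by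
  obtain ⟨g, hg, hq, e⟩ : ∃ (g : (T.dgMod.Hom N (coind.{x} (T.incl Q) ((T.incl Q).resObj N))).X 0)
      (hg : ((T.dgMod.Hom N (coind.{x} (T.incl Q) ((T.incl Q).resObj N))).d 0 1).hom g = 0),
      (∀ t, Q t → QuasiIso (evalMap g hg t)) ∧ (T.full Q).dgMod.comp (add_zero 0)
        (resMap (T.incl Q) g) (coindCounit.{x} (T.incl Q) _) = (T.full Q).dgMod.ident _ :=
    ⟨_, d_coindLift_zero.{x} (φ := T.incl Q) ((T.full Q).dgMod.ident ((T.incl Q).resObj N))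
      ((T.full Q).dgMod.d_ident _), fun t ht => quasiIso_evalMap_coindLift_incl.{x}
        ((T.full Q).dgMod.ident ((T.incl Q).resObj N)) ((T.full Q).dgMod.d_ident _) ⟨t, ht⟩
          (quasiIso_evalMap_ident _ _), coindLift_counit.{x} _⟩
  have h := hP.quasiIso_post g hg hq
  have h' := quasiIso_coindAdj.{x} (φ := T.incl Q) (I := (T.incl Q).resObj N) (N := P)
  refine ⟨T.dgMod.post P g hg ≫ coindAdj.{x} (T.incl Q) ((T.incl Q).resObj N) P,
    quasiIso_comp _ _, fun n f => ?_⟩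
  refine ((T.full Q).dgMod.assoc (add_zero n) (add_zero 0) (add_zero n) (add_zero n)
    (resMap (T.incl Q) f) (resMap (T.incl Q) g) (coindCounit.{x} (T.incl Q) _)).trans ?_
  rw [e]
  exact (T.full Q).dgMod.comp_ident _ _

lemma _root_.DGFunctor.isQuasiFF_of_quasiIso {C : DGCat.{w, v, u} k} {D : DGCat.{w, v, u'} k}
    {φ : DGFunctor C D} (h : ∀ c c', ∃ F : C.Hom c c' ⟶ D.Hom (φ.obj c) (φ.obj c'), QuasiIso F ∧
      ∀ n f, (F.f n).hom f = φ.map n f) : φ.IsQuasiFF := fun c c' m => by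
  obtain ⟨F, hF, e⟩ := h c c'
  refine ⟨fun y hy => ?_, fun z hz b hb => ?_⟩
  · obtain ⟨z, hz, b, hb⟩ := exists_of_quasiIso hF rfl rfl y hy
    exact ⟨z, hz, b, hb.trans (congrArg (· - y) (e _ z))⟩
  · exact exists_of_quasiIso' hF rfl rfl z hz b (hb.trans (e _ z).symm)

lemma isQuasiFF_cellRes : (cellRes.{x} T Q).IsQuasiFF :=
  DGFunctor.isQuasiFF_of_quasiIso fun P P' => exists_quasiIso_resMap.{x} T Q P.2.1 P'.1

variable {T Q}

/-- An isomorphism between dg modules in the derived category, as an isomorphism in `H⁰`. -/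
lemma nonempty_iso_dgFd {M N : (dgFd.{x} T).Obj} (e : der M.1 ≅ der N.1) :
    Nonempty ((dgFd.{x} T).toH0 M ≅ (dgFd.{x} T).toH0 N) :=
  ⟨(fdToDer.{x} T).preimageIso (isoMkFd e)⟩

lemma isEquivalence_cellRes_shriek :
    ((cellRes.{w} T Q).shriek.{max u v w + 1}).IsEquivalence :=
  DGFunctor.isEquivalence_shriek.{w} (isQuasiFF_cellRes.{w} T Q) fun M => by
    obtain ⟨I, g, hg, hI, hq⟩ := exists_isKInj_resolution.{w} M.2.1
    obtain ⟨P, f, hf, hP, hfq⟩ := exists_relKProj_resolution.{w} Q (coind.{w} (T.incl Q) I)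
    have h₁ : IsIso (derMap (resMap (T.incl Q) f) (d_resMap (T.incl Q) f hf)) :=
      (isIso_derMap_iff _ _).2 fun a => hfq a.1 a.2
    have h₂ : IsIso (derMap (coindCounit.{w} (T.incl Q) I) (d_coindCounit.{w} (T.incl Q) I)) :=
      (isIso_derMap_iff _ _).2 fun a => quasiIso_evalMap_coindCounit_incl.{w} I a
    have h₃ : IsIso (derMap g hg) := (isIso_derMap_iff _ _).2 hq
    let e : der ((T.incl Q).resObj P) ≅ der M.1 := asIso (derMap (resMap (T.incl Q) f)
      (d_resMap (T.incl Q) f hf)) ≪≫ asIso (derMap (coindCounit.{w} (T.incl Q) I)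
        (d_coindCounit.{w} (T.incl Q) I)) ≪≫ (asIso (derMap g hg)).symm
    exact ⟨⟨P, hP, (isFd_iff_of_iso.{w} e).2 M.2.1⟩, nonempty_iso_dgFd e⟩

end DGCat
end

noncomputable section

variable {k : Type w} [Field k]

namespace DGCat

open ModuleComplex DGMod

variable {T : DGCat.{w, v, u} k} {Q : T.Obj → Prop}

/-- The restriction of the coevaluation module to the cellular dg modules. -/
abbrev cellCoev (Q : T.Obj → Prop) (a : T.Obj) :
    DGMod.{max w (max u v w + 1)} (T.dgMod.{max u v w}.full (IsCellFd T Q)) :=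
  (T.dgMod.incl (IsCellFd T Q)).resObj (coevMod.{max u v w} T a)

lemma coevBij_cellRes_iff (a b : (T.full Q).Obj) :
    CoevBij ((cellRes.{w} T Q).comp ((T.full Q).dgMod.incl fun M => M.IsFd ∧ M.IsKProj)) a b ↔
      CoevBij (T.dgMod.{max u v w}.incl (IsCellFd T Q)) a.1 b.1 := by
  refine and_congr Iff.rfl (forall₄_congr fun f f' hf hf' => imp_congr Iff.rfl ?_)
  exact (homH0_eq_iff (T.full Q) hf hf').trans
    (homH0_eq_iff T (X := a.1) (Y := b.1) hf hf').symm

theorem isEquivalence_coevFd_full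
    (h₁ : ∀ a b, Q a → Q b → CoevBij (T.dgMod.{max u v w}.incl (IsCellFd T Q)) a b)
    (h₂ : ∀ Y : DerFd.{max w (max u v w + 1)} (T.dgMod.{max u v w}.full (IsCellFd T Q)),
      ∃ a, Q a ∧ Nonempty (der (cellCoev Q a) ≅ Y.obj)) :
    (coevFd.{max u v w} (T.full Q)).IsEquivalence := by
  have hE := isEquivalence_cellRes_shriek (T := T) (Q := Q)
  have hb (a b : (T.full Q).Obj) : Function.Bijective ((coevFd.{max u v w} (T.full Q)).map :
      ((T.full Q).toH0 a ⟶ (T.full Q).toH0 b) → _) := by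
    refine coevBij_incl_iff.1 ((coevBij_comp_iff (cellRes.{w} T Q) _ a b ?_).1
      ((coevBij_cellRes_iff a b).2 (h₁ _ _ a.2 b.2)))
    exact ((cellRes.{w} T Q).shriek_map_bijective_iff ((coevFd.{max u v w} (T.full Q)).obj
      ((T.full Q).toH0 a)) ((coevFd.{max u v w} (T.full Q)).obj ((T.full Q).toH0 b))).1
        ⟨Functor.map_injective _, Functor.map_surjective _⟩
  exact
    { faithful := ⟨fun {a b} => (hb a.as.obj b.as.obj).1⟩
      full := ⟨fun {a b} => (hb a.as.obj b.as.obj).2⟩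
      essSurj := ⟨fun X => by
        obtain ⟨a, ha, ⟨e⟩⟩ := h₂ ((cellRes.{w} T Q).shriek.obj X)
        exact ⟨(T.full Q).toH0 ⟨a, ha⟩, ⟨(cellRes.{w} T Q).shriek.preimageIso
          (isoMkFd (((cellRes.{w} T Q).resIso (coevObj (T.full Q) ⟨a, ha⟩)).trans e))⟩⟩⟩ }

end DGCat
end

noncomputable section

variable {k : Type w} [Field k]

lemma ModuleComplex.hFinite_dualComplex {K : CochainComplex (ModuleCat.{x} k) ℤ}
    (hK : ModuleComplex.HFinite K) : ModuleComplex.HFinite (dualComplex K) := by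
  refine ⟨fun n => ?_, (hK.2.preimage (f := fun n : ℤ => -n) neg_injective.injOn).subset
    fun n hn hn' => ?_⟩
  · obtain ⟨φ, hφ⟩ := dualComplex_homology K n
    have := hK.1 (-n)
    exact Module.Finite.of_injective φ hφ
  · obtain ⟨φ, hφ⟩ := dualComplex_homology K n
    have h₁ : Subsingleton (K.homology (-n)) := ModuleCat.subsingleton_of_isZero hn'
    have h₂ : Subsingleton ((dualComplex K).homology n) := hφ.subsingleton
    exact hn (@ModuleCat.isZero_of_subsingleton _ _ _ h₂)

namespace DGCat

open ModuleComplex DGMod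

section

variable {T : DGCat.{w, v, u} k} {Q R : DGMod.{max u v w} T → Prop}

/-- The inclusion of full dg subcategories of dg modules. -/
def fullIncl (h : ∀ P, Q P → R P) :
    DGFunctor (T.dgMod.{max u v w}.full Q) (T.dgMod.{max u v w}.full R) :=
  (T.dgMod.incl Q).liftFull R fun P => h P.1 P.2

lemma isQuasiFF_fullIncl (h : ∀ P, Q P → R P) : (fullIncl h).IsQuasiFF :=
  fun _ _ _ => ⟨fun y hy => ⟨y, hy, 0, (map_zero _).trans (sub_self y).symm⟩,
    fun _ _ e he => ⟨e, he⟩⟩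

/-- The restriction of the coevaluation module to a full dg subcategory of dg modules. -/
abbrev resCoev (R : DGMod.{max u v w} T → Prop) (a : T.Obj) :
    DGMod.{max w (max u v w + 1)} (T.dgMod.{max u v w}.full R) :=
  (T.dgMod.incl R).resObj (coevMod.{max u v w} T a)

lemma isFd_resCoev {a : T.Obj} (h : ∀ P, R P → HFinite (P.obj a)) : (resCoev R a).IsFd :=
  fun P => hFinite_dualComplex (h P.1 P.2)

lemma inverts_resCoev {a : T.Obj} (h : ∀ P, R P → HFinite (P.obj a))
    {M N : (T.dgMod.{max u v w}.full R).Obj} (g : ((T.dgMod.{max u v w}.full R).Hom M N).X 0)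
    (hg : (((T.dgMod.{max u v w}.full R).Hom M N).d 0 1).hom g = 0)
    (H : QuasiIso (evalMap (M := M.1) (N := N.1) g hg a)) :
    Inverts (derFd (resCoev R a) (isFd_resCoev h)) g hg :=
  (inverts_derFd_iff.{w} (isFd_resCoev h) g hg).2 ((quasiIso_actMap_coevMod_iff _ _ _).2 H)

lemma coevBij_fullIncl_iff (h : ∀ P, Q P → R P) {a b : T.Obj}
    (ha : ∀ P, R P → HFinite (P.obj a)) (hb : ∀ P, R P → HFinite (P.obj b))
    (H : Function.Bijective ((fullIncl h).shriek.map : (derFd (resCoev R a) (isFd_resCoev ha) ⟶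
      derFd (resCoev R b) (isFd_resCoev hb)) → _)) :
    CoevBij (T.dgMod.{max u v w}.incl Q) a b ↔ CoevBij (T.dgMod.{max u v w}.incl R) a b :=
  coevBij_comp_iff (fullIncl h) (T.dgMod.incl R) a b
    (((fullIncl h).shriek_map_bijective_iff _ _).1 H)

end

variable {T : DGCat.{w, v, u} k} {Q : T.Obj → Prop} {R : DGMod.{max u v w} T → Prop}

lemma exists_isCounit_cell (h : ∀ P, IsCellFd T Q P → R P)
    (hR : ∀ P, R P → ((T.incl Q).resObj P).IsFd) (X : (T.dgMod.{max u v w}.full R).Obj) :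
    ∃ (P : (T.dgMod.{max u v w}.full (IsCellFd T Q)).Obj)
      (ε : ((T.dgMod.{max u v w}.full R).Hom ((fullIncl h).obj P) X).X 0)
      (hε : (((T.dgMod.{max u v w}.full R).Hom ((fullIncl h).obj P) X).d 0 1).hom ε = 0),
      (fullIncl h).IsCounit ε hε ∧ ∀ t, Q t → QuasiIso (evalMap (M := P.1) (N := X.1) ε hε t) := by
  obtain ⟨P, f, hf, hP, hq⟩ := exists_relKProj_resolution.{w} Q X.1
  have : ((T.incl Q).resObj P).IsFd := (isFd_of_quasiIso (resMap (T.incl Q) f)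
    (d_resMap (T.incl Q) f hf) fun t => hq t.1 t.2).2 (hR X.1 X.2)
  exact ⟨⟨P, hP, this⟩, f, hf, fun P' => P'.2.1.quasiIso_post f hf hq, hq⟩

lemma coevBij_cell_iff (h : ∀ P, IsCellFd T Q P → R P)
    (hR : ∀ P, R P → ((T.incl Q).resObj P).IsFd) {a b : T.Obj} (ha : Q a) (hb : Q b) :
    CoevBij (T.dgMod.{max u v w}.incl (IsCellFd T Q)) a b ↔
      CoevBij (T.dgMod.{max u v w}.incl R) a b :=
  coevBij_fullIncl_iff h (fun P hP => hR P hP ⟨a, ha⟩) (fun P hP => hR P hP ⟨b, hb⟩)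
    (DGFunctor.shriek_map_bijective_of_counit.{w} (isQuasiFF_fullIncl h) (fun X => by
      obtain ⟨P, ε, hε, h₁, h₂⟩ := exists_isCounit_cell h hR X
      exact ⟨P, ε, hε, h₁, inverts_resCoev (fun P hP => hR P hP ⟨b, hb⟩) ε hε (h₂ b hb)⟩) _)

end DGCat
end

noncomputable section

variable {k : Type w} [Field k]

namespace DGCat

open ModuleComplex DGMod

variable {T : DGCat.{w, v, u} k} {A : ObjectProperty T.H0}

lemma IsReflexive.coevBij (hT : T.IsReflexive) (a b : T.Obj) :
    CoevBij (T.dgMod.{max u v w}.incl fun M => M.IsFd ∧ M.IsKProj) a b := by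
  have := hT.isEquivalence_coev
  exact coevBij_incl_iff.2 ⟨Functor.map_injective _, Functor.map_surjective _⟩

lemma RelKProj.quasiIso_actMap_of_isUnitArrow (hT : T.IsPretriangulated)
    (hA : IsTriangulatedSubcategory A) {P : DGMod.{max x u v w} T}
    (hP : RelKProj (fun t => A (T.toH0 t)) P) {η : T.Arrow} (hη : IsUnitArrow A η) :
    QuasiIso (actMap P η.hom η.closed) :=
  hP.quasiIso_actMap.{x} η.hom η.closed fun _ ha => hη.quasiIso_pre hT hA ha

lemma isFd_of_isCellFd (hT : T.IsPretriangulated) (hA : A ∈ T.LAdm) {P : DGMod.{max u v w} T}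
    (hP : IsCellFd T (fun t => A (T.toH0 t)) P) : P.IsFd := fun t => by
  obtain ⟨a, η, hη, h⟩ := isRightAdjoint_ι_iff.1 hA.2 t
  exact (hFinite_iff (RelKProj.quasiIso_actMap_of_isUnitArrow.{w} hT hA.1 hP.1 h)).1
    (hP.2 ⟨a, h.1⟩)

theorem isReflexive_of_mem_LAdm (hT : T.IsReflexive) (hA : A ∈ T.LAdm) :
    (T.sub A).IsReflexive := by
  have h (P : DGMod.{max u v w} T) (hP : IsCellFd T (fun t => A (T.toH0 t)) P) :
      P.IsFd ∧ P.IsKProj := ⟨isFd_of_isCellFd hT.isPretriangulated hA hP, hP.1.isKProj⟩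
  have hR (P : DGMod.{max u v w} T) (hP : P.IsFd ∧ P.IsKProj) :
      ((T.incl fun t => A (T.toH0 t)).resObj P).IsFd := fun a => hP.1 a.1
  refine ⟨isPretriangulated_sub hT.isPretriangulated hA.1, isEquivalence_coevFd_full
    (fun a b ha hb => (coevBij_cell_iff h hR ha hb).2 (hT.coevBij a b)) fun Y => ?_⟩
  obtain ⟨E, ⟨e⟩, hE⟩ := DGFunctor.exists_shriek_of_counit.{w} (isQuasiFF_fullIncl h) (fun X => by
    obtain ⟨P, ε, hε, h₁, -⟩ := exists_isCounit_cell h hR X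
    exact ⟨P, ε, hε, h₁⟩) Y
  have := hT.isEquivalence_coev
  obtain ⟨t, ⟨j⟩⟩ : ∃ t, Nonempty ((coevFd.{max u v w} T).obj t ≅ E) :=
    ⟨_, ⟨(coevFd.{max u v w} T).objObjPreimageIso E⟩⟩
  refine ⟨t.as.obj, ?_, ⟨?_⟩⟩
  · change A t
    rw [← colocal_fdOfLAdm hT hA, colocal_iff]
    intro ε hε
    obtain ⟨P, ε', hε', h₁, h₂⟩ := exists_isCounit_cell h hR ε.tgt
    have hP : IsCounitArrow (fdOfLAdm.{max u v w} A) ⟨(fullIncl h).obj P, ε.tgt, ε', hε'⟩ :=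
      (isCounitArrow_fdOfLAdm_iff hT.isPretriangulated hA _).2 ⟨(fdOfLAdm_iff_actMap _).2
        fun η => RelKProj.quasiIso_actMap_of_isUnitArrow.{w} hT.isPretriangulated hA.1 P.2.1 η.2, h₂⟩
    exact (inverts_coevFd_iff ε.hom ε.closed t.as.obj).2 ((quasiIso_actMap_coevObj_iff _ _ _).1
      (hP.quasiIso_actMap hε _ ((quasiIso_actMap_coevObj_iff _ _ _).2
        ((inverts_coevFd_iff ε' hε' t.as.obj).1 ((hE _ _ _ _ h₁).of_iso j.symm)))))
  · exact (((fullIncl h).resIso (coevObj.{max u v w} T t.as.obj)).symm.trans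
      (isoFd ((fullIncl h).shriek.mapIso j))).trans (isoFd e)

end DGCat
end

noncomputable section

variable {k : Type w} [Field k]

namespace DGMod

open ModuleComplex DGCat

lemma isIso_resDer_map_iff {C : DGCat.{w, v, u} k} {T : DGCat.{w, v', u'} k} (φ : DGFunctor C T)
    {M N : DGMod.{x} T} (g : (T.dgMod.Hom M N).X 0) (hg : ((T.dgMod.Hom M N).d 0 1).hom g = 0) :
    IsIso (φ.resDer.map (derMap g hg)) ↔ ∀ c, QuasiIso (evalMap g hg (φ.obj c)) := by
  have h₁ : IsIso (derMap (resMap φ g) (d_resMap φ g hg)) ↔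
      ∀ c, QuasiIso (evalMap g hg (φ.obj c)) := isIso_derMap_iff _ _
  rw [← h₁, ← isIso_comp_left_iff (φ.resIso M).hom, ← φ.resIso_naturality' g hg,
    isIso_comp_right_iff]

variable {T : DGCat.{w, v, u} k} {Q : T.Obj → Prop}

lemma quasiIso_pre_coind_incl {I : DGMod.{max x u v w} (T.full Q)} (hI : I.IsKInj)
    {M N : DGMod.{max x u v w} T} (η : (T.dgMod.Hom M N).X 0)
    (hη : ((T.dgMod.Hom M N).d 0 1).hom η = 0) (h : ∀ t, Q t → QuasiIso (evalMap η hη t)) :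
    QuasiIso (T.dgMod.pre η hη (coind.{x} (T.incl Q) I)) := by
  have := quasiIso_coindAdj.{x} (φ := T.incl Q) (I := I) (N := cone η hη)
  exact (cone_hom_acyclic_iff η hη _).1 ((acyclic_iff_of_quasiIso
    (coindAdj.{x} (T.incl Q) I (cone η hη))).2
      (hI _ fun a => (cone_acyclic_iff η hη a.1).2 (h a.1 a.2)))

lemma quasiIso_pre_iff {M N L L' : DGMod.{x} T} (hM : M.IsKProj) (hN : N.IsKProj)
    (η : (T.dgMod.Hom M N).X 0) (hη : ((T.dgMod.Hom M N).d 0 1).hom η = 0)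
    (q : (T.dgMod.Hom L L').X 0) (hq : ((T.dgMod.Hom L L').d 0 1).hom q = 0)
    (h : ∀ t, QuasiIso (evalMap q hq t)) :
    QuasiIso (T.dgMod.pre η hη L) ↔ QuasiIso (T.dgMod.pre η hη L') := by
  have h₁ : QuasiIso (T.dgMod.post M q hq) :=
    (relKProj_true_iff.2 hM).quasiIso_post q hq fun t _ => h t
  have h₂ : QuasiIso (T.dgMod.post N q hq) :=
    (relKProj_true_iff.2 hN).quasiIso_post q hq fun t _ => h t
  have e : T.dgMod.pre η hη L ≫ T.dgMod.post M q hq =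
      T.dgMod.post N q hq ≫ T.dgMod.pre η hη L' := by
    ext n f : 3
    exact T.dgMod.assoc (zero_add n) (add_zero n) (add_zero n) (zero_add n) η f q
  rw [← quasiIso_iff_comp_right (T.dgMod.pre η hη L) (T.dgMod.post M q hq), e,
    quasiIso_iff_comp_left]

end DGMod

namespace DGCat

open ModuleComplex DGMod

variable {T : DGCat.{w, v, u} k} {A : ObjectProperty T.H0}

lemma quasiIso_pre_of_fdOfRAdm (hT : T.IsPretriangulated) (hA : A ∈ T.RAdm)
    {X N : DGMod.{max u v w} T} (hX : X.IsKProj) (hN : N.IsKProj) (η : (T.dgMod.Hom X N).X 0)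
    (hη : ((T.dgMod.Hom X N).d 0 1).hom η = 0)
    (h : ∀ a, A (T.toH0 a) → QuasiIso (evalMap η hη a)) {L : (dgFd.{max u v w} T).Obj}
    (hL : fdOfRAdm A ((dgFd.{max u v w} T).toH0 L)) : QuasiIso (T.dgMod.pre η hη L.1) := by
  obtain ⟨I, g, hg, q, hq, hI, -, -, hqi⟩ := DGFunctor.exists_coind_unit.{w}
    (T.isQuasiFF_incl fun t => A (T.toH0 t)) L.2.1
  refine (quasiIso_pre_iff hX hN η hη q hq fun t => ?_).2 (quasiIso_pre_coind_incl.{w} hI η hη h)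
  obtain ⟨a, ε, hε, hc⟩ := isLeftAdjoint_ι_iff.1 hA.2 t
  exact (quasiIso_evalMap_of_actMap q hq ε hε ((fdOfRAdm_iff_actMap _).1 hL ⟨_, hc⟩)
    (quasiIso_actMap_coind.{w} hI ε hε fun b => hc.quasiIso_post hT hA.1 b.2)).1 (hqi ⟨a, hc.1⟩)

lemma exists_unit_fdOfRAdm (hT : T.IsPretriangulated) (hA : A ∈ T.RAdm)
    {X : DGMod.{max u v w} T} (hX : X.IsKProj) (hX' : ((T.subIncl A).resObj X).IsFd) :
    ∃ (N : (dgFd.{max u v w} T).Obj) (η : (T.dgMod.Hom X N.1).X 0)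
      (hη : ((T.dgMod.Hom X N.1).d 0 1).hom η = 0), fdOfRAdm A ((dgFd.{max u v w} T).toH0 N) ∧
      ∀ a, A (T.toH0 a) → QuasiIso (evalMap η hη a) := by
  obtain ⟨I, g, hg, hI, hq⟩ := exists_isKInj_resolution.{w} hX'
  obtain ⟨N, f, hf, hN, hfq⟩ := exists_isKProj_resolution.{w} (coind.{w} (T.subIncl A) I)
  have := (isIso_derMap_iff f hf).2 hfq
  obtain ⟨η, hη, e⟩ := exists_derMap_of_isKProj hX
    (derMap (coindLift.{w} g) (d_coindLift_zero.{w} g hg) ≫ inv (derMap f hf))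
  have hηA (a) (ha : A (T.toH0 a)) : QuasiIso (evalMap η hη a) := by
    refine (isIso_resDer_map_iff (T.subIncl A) η hη).1 ?_ ⟨a, ha⟩
    have := (isIso_resDer_map_iff (T.subIncl A) _ (d_coindLift_zero.{w} g hg)).2
      fun a => quasiIso_evalMap_coindLift_incl.{w} g hg a (hq a)
    rw [← e, Functor.map_comp]
    infer_instance
  have hNε {ε : T.Arrow} (hε : IsCounitArrow A ε) : QuasiIso (actMap N ε.hom ε.closed) :=
    (quasiIso_actMap_of_quasiIso f hf ε.hom ε.closed (hfq _) (hfq _)).2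
      (quasiIso_actMap_coind.{w} hI ε.hom ε.closed fun b => hε.quasiIso_post hT hA.1 b.2)
  have hNf : N.IsFd := fun t => by
    obtain ⟨a, ε, hε, hc⟩ := isLeftAdjoint_ι_iff.1 hA.2 t
    exact (hFinite_iff (hNε hc)).2 ((hFinite_iff (hηA a hc.1)).1 (hX' ⟨a, hc.1⟩))
  exact ⟨⟨N, hNf, hN⟩, η, hη, (fdOfRAdm_iff_actMap _).2 fun ε => hNε ε.2, hηA⟩

end DGCat
end

noncomputable section

variable {k : Type w} [Field k]

namespace DGCat

open ModuleComplex DGMod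

variable {T : DGCat.{w, v, u} k} {A : ObjectProperty T.H0}

lemma Inverts.of_comp {X : DerFd.{max x u v w} T} {r s t : T.Obj} {f : (T.Hom r s).X 0}
    {hf : ((T.Hom r s).d 0 1).hom f = 0} {g : (T.Hom s t).X 0}
    {hg : ((T.Hom s t).d 0 1).hom g = 0} (h : Inverts X f hf)
    (h' : Inverts X (T.comp (add_zero 0) f g) (T.d_comp_of_closed _ _ _ hf hg)) :
    Inverts X g hg := by
  obtain ⟨M, hM, ⟨e⟩⟩ := exists_derFd_iso X
  have i : der M ≅ X.obj := isoFd e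
  rw [inverts_iff.{x} i] at h h' ⊢
  rwa [actMap_comp f hf g hg M, quasiIso_iff_comp_right] at h'

lemma quasiIso_evalMap_comp {L M N : DGMod.{x} T} {f : (T.dgMod.Hom L M).X 0}
    {hf : ((T.dgMod.Hom L M).d 0 1).hom f = 0} {g : (T.dgMod.Hom M N).X 0}
    {hg : ((T.dgMod.Hom M N).d 0 1).hom g = 0} {t : T.Obj} (h : QuasiIso (evalMap f hf t))
    (h' : QuasiIso (evalMap g hg t)) : QuasiIso (evalMap (T.dgMod.comp (add_zero 0) f g)
      (T.dgMod.d_comp_of_closed _ _ _ hf hg) t) := by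
  have e : evalMap (T.dgMod.comp (add_zero 0) f g) (T.dgMod.d_comp_of_closed _ _ _ hf hg) t =
      evalMap f hf t ≫ evalMap g hg t :=
    (evalZ0 T t).map_comp (X := ⟨L⟩) (Y := ⟨M⟩) (Z := ⟨N⟩) ⟨f, hf⟩ ⟨g, hg⟩
  rw [e]
  exact quasiIso_comp _ _

variable (A)

/-- A K-projective dg module over `T` whose restriction to `A` is homologically finite-dimensional. -/
def IsFdOn (X : DGMod.{max u v w} T) : Prop := X.IsKProj ∧ ((T.subIncl A).resObj X).IsFd

lemma isFdOn_of_isCellFd (P : DGMod.{max u v w} T) (hP : IsCellFd T (fun t => A (T.toH0 t)) P) :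
    IsFdOn A P := ⟨hP.1.isKProj, hP.2⟩

lemma isFdOn_of_isFd (P : DGMod.{max u v w} T) (hP : P.IsFd ∧ P.IsKProj) : IsFdOn A P :=
  ⟨hP.2, fun a => hP.1 a.1⟩

/-- The inclusion of `Dᶠᵈ(A)`, embedded in `Dᶠᵈ(T)` by `π_R^!`, into the dg category of dg modules
which are homologically finite-dimensional on `A`. -/
def fdOfRAdmIncl : DGFunctor ((dgFd.{max u v w} T).sub (fdOfRAdm A))
    (T.dgMod.{max u v w}.full (IsFdOn A)) :=
  ((dgFd.{max u v w} T).subIncl (fdOfRAdm A)).comp (fullIncl (isFdOn_of_isFd A))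

lemma isQuasiFF_fdOfRAdmIncl : (fdOfRAdmIncl A).IsQuasiFF :=
  fun _ _ _ => ⟨fun y hy => ⟨y, hy, 0, (map_zero _).trans (sub_self y).symm⟩,
    fun _ _ e he => ⟨e, he⟩⟩

variable {A}

lemma exists_isUnit_fdOfRAdmIncl (hT : T.IsPretriangulated) (hA : A ∈ T.RAdm)
    (X : (T.dgMod.{max u v w}.full (IsFdOn A)).Obj) :
    ∃ (N : ((dgFd.{max u v w} T).sub (fdOfRAdm A)).Obj)
      (η : ((T.dgMod.{max u v w}.full (IsFdOn A)).Hom X ((fdOfRAdmIncl A).obj N)).X 0)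
      (hη : (((T.dgMod.{max u v w}.full (IsFdOn A)).Hom X ((fdOfRAdmIncl A).obj N)).d 0 1).hom η =
        0), (fdOfRAdmIncl A).IsUnit η hη ∧
      ∀ a, A (T.toH0 a) → QuasiIso (evalMap (M := X.1) (N := N.1.1) η hη a) := by
  obtain ⟨N, η, hη, hN, h⟩ := exists_unit_fdOfRAdm hT hA X.2.1 X.2.2
  exact ⟨⟨N, hN⟩, η, hη, fun L => quasiIso_pre_of_fdOfRAdm hT hA X.2.1 N.2.2 η hη h L.2, h⟩

lemma finite_of_isFdOn {a : T.Obj} (ha : A (T.toH0 a)) (P : DGMod.{max u v w} T)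
    (hP : IsFdOn A P) : HFinite (P.obj a) := hP.2 ⟨a, ha⟩

lemma fdOfRAdmIncl_map_bijective (hT : T.IsPretriangulated) (hA : A ∈ T.RAdm) {a : T.Obj}
    (ha : A (T.toH0 a)) (Y : DerFd.{max w (max u v w + 1)} (T.dgMod.{max u v w}.full (IsFdOn A))) :
    Function.Bijective ((fdOfRAdmIncl A).shriek.map :
      (derFd (resCoev (IsFdOn A) a) (isFd_resCoev (finite_of_isFdOn ha)) ⟶ Y) → _) :=
  DGFunctor.shriek_map_bijective_of_unit.{w} (isQuasiFF_fdOfRAdmIncl A) (fun X => by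
    obtain ⟨N, η, hη, h, h'⟩ := exists_isUnit_fdOfRAdmIncl hT hA X
    exact ⟨N, η, hη, h, inverts_resCoev (finite_of_isFdOn ha) η hη (h' a ha)⟩) Y

lemma coevBij_isFdOn (hT : T.IsReflexive) (hA : A ∈ T.RAdm) {a b : T.Obj} (ha : A (T.toH0 a))
    (hb : A (T.toH0 b)) : CoevBij (T.dgMod.{max u v w}.incl (IsFdOn A)) a b := by
  refine (coevBij_comp_iff (fdOfRAdmIncl A) _ a b
    (((fdOfRAdmIncl A).shriek_map_bijective_iff _ _).1 (fdOfRAdmIncl_map_bijective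
      hT.isPretriangulated hA ha (derFd (resCoev (IsFdOn A) b)
        (isFd_resCoev (finite_of_isFdOn hb)))))).1 ?_
  have h (c : T.Obj) (P : DGMod.{max u v w} T) (hP : P.IsFd ∧ P.IsKProj) : HFinite (P.obj c) :=
    hP.1 c
  exact (coevBij_comp_iff ((dgFd.{max u v w} T).subIncl (fdOfRAdm A)) _ a b
    (((DGFunctor.shriek_map_bijective_iff _ _ _).1 (LAdm.shriek_map_bijective
      (fdOfRAdm_mem_LAdm hT.isPretriangulated hA) (E := derFd (resCoev _ a) (isFd_resCoev (h a)))
        (fun η hη => inverts_resCoev (h a) η.hom η.closed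
          (((isUnitArrow_fdOfRAdm_iff hT.isPretriangulated hA η).1 hη).2 a ha))
            (derFd (resCoev _ b) (isFd_resCoev (h b))))))).2 (hT.coevBij a b)

theorem isReflexive_of_mem_RAdm (hT : T.IsReflexive) (hA : A ∈ T.RAdm) :
    (T.sub A).IsReflexive := by
  have hT' := hT.isPretriangulated
  have hR (P : DGMod.{max u v w} T) (hP : IsFdOn A P) :
      ((T.incl fun t => A (T.toH0 t)).resObj P).IsFd := hP.2
  refine ⟨isPretriangulated_sub hT' hA.1, isEquivalence_coevFd_full (fun a b ha hb =>
    (coevBij_cell_iff (isFdOn_of_isCellFd A) hR ha hb).2 (coevBij_isFdOn hT hA ha hb)) fun Y => ?_⟩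
  obtain ⟨E, ⟨e⟩, hE⟩ := DGFunctor.exists_shriek_of_counit.{w}
    (isQuasiFF_fullIncl (isFdOn_of_isCellFd A)) (fun X => by
      obtain ⟨P, ε, hε, h₁, -⟩ := exists_isCounit_cell (isFdOn_of_isCellFd A) hR X
      exact ⟨P, ε, hε, h₁⟩) Y
  obtain ⟨E', ⟨e'⟩, hE'⟩ := LAdm.exists_shriek (fdOfRAdm_mem_LAdm hT' hA)
    ((fdOfRAdmIncl A).shriek.obj E)
  have := hT.isEquivalence_coev
  obtain ⟨t, ⟨j⟩⟩ : ∃ t, Nonempty ((coevFd.{max u v w} T).obj t ≅ E') :=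
    ⟨_, ⟨(coevFd.{max u v w} T).objObjPreimageIso E'⟩⟩
  have ht : A (T.toH0 t.as.obj) := by
    change A t
    rw [← local'_fdOfRAdm hT hA, local'_iff]
    exact fun η hη => (hE' η hη).of_iso j.symm
  have hEη (Z : DerFd.{max w (max u v w + 1)} (T.dgMod.{max u v w}.full (IsFdOn A))) :
      Function.Bijective ((fdOfRAdmIncl A).shriek.map : (E ⟶ Z) → _) :=
    DGFunctor.shriek_map_bijective_of_unit.{w} (isQuasiFF_fdOfRAdmIncl A) (fun X => by
      obtain ⟨N, η, hη, h, h'⟩ := exists_isUnit_fdOfRAdmIncl hT' hA X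
      obtain ⟨P, ε, hε, h₁, h₂⟩ := exists_isCounit_cell (isFdOn_of_isCellFd A) hR X
      refine ⟨N, η, hη, h, Inverts.of_comp.{w} (hE _ _ _ hε h₁) (hE P _ _ _ fun P' => ?_)⟩
      exact P'.2.1.quasiIso_post _ _ fun t ht => quasiIso_evalMap_comp (h₂ t ht) (h' t ht)) Z
  let i : (fdOfRAdmIncl A).shriek.obj (derFd (resCoev (IsFdOn A) t.as.obj)
      (isFd_resCoev (finite_of_isFdOn ht))) ≅ (fdOfRAdmIncl A).shriek.obj E :=
    isoMkFd (((fdOfRAdmIncl A).resIso _).trans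
      ((((dgFd.{max u v w} T).subIncl (fdOfRAdm A)).resIso
        (coevObj.{max u v w} T t.as.obj)).symm.trans
          (isoFd ((((dgFd.{max u v w} T).subIncl (fdOfRAdm A)).shriek.mapIso j).trans e'))))
  obtain ⟨l⟩ := (fdOfRAdmIncl A).shriek.nonempty_iso_of_map_bijective_left
    (fdOfRAdmIncl_map_bijective hT' hA ht) hEη i
  exact ⟨t.as.obj, ht, ⟨((fullIncl (isFdOn_of_isCellFd A)).resIso
    (resCoev (IsFdOn A) t.as.obj)).symm.trans (isoFd (((fullIncl
      (isFdOn_of_isCellFd A)).shriek.mapIso l).trans e))⟩⟩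

end DGCat
end

theorem mainTheorem2 {k : Type w} [Field k] (T : DGCat.{w, v, u} k) (hT : T.IsReflexive) :
    Set.BijOn (fun A => DGCat.fdOfLAdm.{max u v w} A) T.LAdm (DGCat.dgFd.{max u v w} T).RAdm ∧
    Set.BijOn (fun A => DGCat.fdOfRAdm.{max u v w} A) T.RAdm (DGCat.dgFd.{max u v w} T).LAdm ∧
    (∀ A ∈ T.LAdm, ∃ F : DGCat.DerFd.{max u v w} (T.sub A) ⥤ DGCat.DerFd.{max u v w} T,
      DGCat.IsPiLShriek A F ∧ F.Full ∧ F.Faithful ∧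
      Nonempty (F ⊣ DGFunctor.shriek.{max u v w} (T.subIncl A)) ∧
      ∀ N, DGCat.fdOfLAdm A N ↔ F.essImage ((DGCat.fdToDer.{max u v w} T).obj N)) ∧
    (∀ A ∈ T.RAdm, ∃ F : DGCat.DerFd.{max u v w} (T.sub A) ⥤ DGCat.DerFd.{max u v w} T,
      DGCat.IsPiRShriek A F ∧ F.Full ∧ F.Faithful ∧
      Nonempty (DGFunctor.shriek.{max u v w} (T.subIncl A) ⊣ F) ∧
      ∀ N, DGCat.fdOfRAdm A N ↔ F.essImage ((DGCat.fdToDer.{max u v w} T).obj N)) ∧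
    (∀ A, A ∈ T.LAdm ∨ A ∈ T.RAdm → (T.sub A).IsReflexive) := by
  exact ⟨DGCat.bijOn_fdOfLAdm hT, DGCat.bijOn_fdOfRAdm hT,
    fun _ hA => DGCat.exists_piLShriek hT.isPretriangulated hA,
    fun _ hA => DGCat.exists_piRShriek hT.isPretriangulated hA,
    fun _ hA => hA.elim (DGCat.isReflexive_of_mem_LAdm hT) (DGCat.isReflexive_of_mem_RAdm hT)⟩
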